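/- Let $a>0$ and $\Omega=(-a,a)\times(-1,1)$, with points $(x,v)$; all $L^1$ spaces are complex and $\|\cdot\|$ denotes their norms and the corresponding operator norms. For $i=1,2$ let $\alpha_i,\beta_i\ge 0$, $\alpha_i+\beta_i=1$, with $\beta_1+\beta_2>0$. Let $K_1:L^1((-1,0);dv)\to L^1((0,1);dv)$ and $K_2:L^1((0,1);dv)\to L^1((-1,0);dv)$ be stochastic (positive, and norm preserving on the positive cone) and weakly compact, let $R_i\varphi(v)=\varphi(-v)$, and put $$O_1=\alpha_1R_1+\beta_1K_1:L^1(-1,0)\to L^1(0,1),\qquad O_2=\alpha_2R_2+\beta_2K_2:L^1(0,1)\to L^1(-1,0).$$ Let $T_Of=-v\,\partial_xf$ on $D(T_O)$, the set of all $f\in L^1(\Omega)$ with $v\,\partial_xf\in L^1(\Omega)$ (in the sense of distributions) whose traces satisfy $h_{-a}^+=O_1h_{-a}^-$ and $h_a^-=O_2h_a^+$, where $h_{\pm a}^{+}$ and $h_{\pm a}^{-}$ are the restrictions of $v\mapsto|v|f(\pm a,v)$ to $(0,1)$ and to $(-1,0)$. For real $s$ define on $L^1((0,1);dv)$ $$G_{is}=O_1\,e^{-2isa/|v|}\,O_2\,e^{-2isa/|v|}.$$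 Let $k\in\mathbb N$ (including $k=0$) and suppose that the operators $$|v|^{-(k+1)}O_1O_2,\qquad |v|^{-(k+1)}O_1|v|^{k+1},\qquad |v|^{-(k+1-p)}O_2|v|^{k+1-p}\quad(0\le p\le k)$$ are bounded (between the respective $L^1(dv)$ spaces; $|v|^n$ stands for the multiplication operator). Then $1-G_{is}$ is invertible for every real $s\ne 0$, every $\lambda$ with $\operatorname{Re}\lambda>0$ belongs to the resolvent set of $T_O$, and there is a constant $C>0$ such that the following holds for every $g\in L^1(\Omega)$ with $\|g\|_Z:=\int_\Omega|g(x,v)|\,|v|^{-(k+1)}\,dx\,dv<\infty$. The map $\lambda\mapsto(\lambda-T_O)^{-1}g\in L^1(\Omega)$ extends continuously from $\{\operatorname{Re}\lambda>0\}$ to $\{\operatorname{Re}\lambda\ge0,\ \lambda\neq0\}$, its boundary values $F_g(s)$ at $\lambda=is$ define a $C^k$ function $F_g:\mathbb R\setminus\{0\}\to L^1(\Omega)$, and $$\Big\|\frac{d^j}{ds^j}F_g(s)\Big\|\le C\Big(\sum_{l=0}^{j+1}\|(1-G_{is})^{-1}\|^l\Big)\|g\|_Z\qquad(0\le j\le k,\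 s\in\mathbb R\setminus\{0\}).$$ -/

import Mathlib

open MeasureTheory Set Filter Topology
open scoped ContDiff ENNReal

noncomputable section

namespace SlabTransport

/-- `L¹(I; dv)`, complex valued, for a set `I` of directions. -/
abbrev L1 (I : Set ℝ) : Type := Lp ℂ 1 (volume.restrict I)

/-- `L¹((0,1); dv)`. -/
abbrev L1Pos : Type := L1 (Ioo (0 : ℝ) 1)

/-- `L¹((-1,0); dv)`. -/
abbrev L1Neg : Type := L1 (Ioo (-1 : ℝ) 0)

/-- The phase space `Ω = (-a,a) × (-1,1)`, with points `(x, v)`. -/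
def slab (a : ℝ) : Set (ℝ × ℝ) := Ioo (-a) a ×ˢ Ioo (-1 : ℝ) 1

/-- `L¹(Ω)`, complex valued. -/
abbrev L1Slab (a : ℝ) : Type := Lp ℂ 1 (volume.restrict (slab a))

/-! ### Stochastic and weakly compact operators -/

/-- Membership of the positive cone of `L¹(I)`. -/
def IsNonneg {I : Set ℝ} (f : L1 I) : Prop :=
  ∀ᵐ v ∂(volume.restrict I), 0 ≤ (f v).re ∧ (f v).im = 0

/-- Stochastic operators: positive, and norm preserving on the positive cone. -/
def IsStochastic {I J : Set ℝ} (K : L1 I →L[ℂ] L1 J) : Prop :=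
  ∀ f : L1 I, IsNonneg f → IsNonneg (K f) ∧ ‖K f‖ = ‖f‖

/-- Weakly compact operators: a neighbourhood of `0` (equivalently the unit ball) is mapped into a
weakly compact set. -/
def IsWeaklyCompact {I J : Set ℝ} (K : L1 I →L[ℂ] L1 J) : Prop :=
  IsCompactOperator (fun f : L1 I => toWeakSpace ℂ (L1 J) (K f))

/-! ### Boundary operators -/

theorem measurePreserving_neg_pos :
    MeasurePreserving (fun v : ℝ => -v) (volume.restrict (Ioo (0 : ℝ) 1))
      (volume.restrict (Ioo (-1 : ℝ) 0)) := by
  have h := (Measure.measurePreserving_neg (volume : Measure ℝ)).restrict_preimage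
    (measurableSet_Ioo (a := (-1 : ℝ)) (b := 0))
  have e : (Neg.neg ⁻¹' Ioo (-1 : ℝ) 0) = Ioo (0 : ℝ) 1 := by
    ext v; simp only [mem_preimage, mem_Ioo]
    constructor <;> rintro ⟨h1, h2⟩ <;> constructor <;> linarith
  rw [e] at h
  exact h

theorem measurePreserving_neg_neg :
    MeasurePreserving (fun v : ℝ => -v) (volume.restrict (Ioo (-1 : ℝ) 0))
      (volume.restrict (Ioo (0 : ℝ) 1)) := by
  have h := (Measure.measurePreserving_neg (volume : Measure ℝ)).restrict_preimage
    (measurableSet_Ioo (a := (0 : ℝ)) (b := 1))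
  have e : (Neg.neg ⁻¹' Ioo (0 : ℝ) 1) = Ioo (-1 : ℝ) 0 := by
    ext v; simp only [mem_preimage, mem_Ioo]
    constructor <;> rintro ⟨h1, h2⟩ <;> constructor <;> linarith
  rw [e] at h
  exact h

/-- Specular reflection `(R₁ φ)(v) = φ(-v)`, from `L¹(-1,0)` to `L¹(0,1)`. -/
def reflNegPos : L1Neg →L[ℂ] L1Pos :=
  (Lp.compMeasurePreservingₗᵢ ℂ (fun v : ℝ => -v)
    measurePreserving_neg_pos).toContinuousLinearMap

/-- Specular reflection `(R₂ φ)(v) = φ(-v)`, from `L¹(0,1)` to `L¹(-1,0)`. -/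
def reflPosNeg : L1Pos →L[ℂ] L1Neg :=
  (Lp.compMeasurePreservingₗᵢ ℂ (fun v : ℝ => -v)
    measurePreserving_neg_neg).toContinuousLinearMap

/-- `O₁ = α₁ R₁ + β₁ K₁`. -/
def leftBoundaryOp (α β : ℝ) (K : L1Neg →L[ℂ] L1Pos) : L1Neg →L[ℂ] L1Pos :=
  (α : ℂ) • reflNegPos + (β : ℂ) • K

/-- `O₂ = α₂ R₂ + β₂ K₂`. -/
def rightBoundaryOp (α β : ℝ) (K : L1Pos →L[ℂ] L1Neg) : L1Pos →L[ℂ] L1Neg :=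
  (α : ℂ) • reflPosNeg + (β : ℂ) • K

/-! ### The operators `G_{is}` -/

/-- The function `v ↦ e^{-2isa/|v|}`. -/
def phase (a s : ℝ) (v : ℝ) : ℂ := Complex.exp (-(2 * s * a / |v| : ℝ) * Complex.I)

theorem norm_phase (a s v : ℝ) : ‖phase a s v‖ = 1 := by
  unfold phase
  have h := Complex.norm_exp_ofReal_mul_I (-(2 * s * a / |v|))
  push_cast at h ⊢
  exact h

theorem measurable_phase (a s : ℝ) : Measurable (phase a s) := by
  unfold phase
  have h : Measurable fun v : ℝ => |v| := measurable_norm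
  fun_prop

theorem memLp_phase (a s : ℝ) (μ : Measure ℝ) : MemLp (phase a s) ∞ μ :=
  memLp_top_of_bound (measurable_phase a s).aestronglyMeasurable 1
    (Eventually.of_forall fun v => (norm_phase a s v).le)

/-- Multiplication by `e^{-2isa/|v|}` on `L¹(I)`. -/
def phaseMul (a s : ℝ) (I : Set ℝ) : L1 I →L[ℂ] L1 I :=
  (ContinuousLinearMap.mul ℂ ℂ).holderL (volume.restrict I) ∞ 1 1
    ((memLp_phase a s (volume.restrict I)).toLp (phase a s))

/-- `G_{is} = O₁ e^{-2isa/|v|} O₂ e^{-2isa/|v|}` on `L¹(0,1)`. -/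
def G (a : ℝ) (O₁ : L1Neg →L[ℂ] L1Pos) (O₂ : L1Pos →L[ℂ] L1Neg) (s : ℝ) :
    L1Pos →L[ℂ] L1Pos :=
  O₁ ∘L phaseMul a s (Ioo (-1) 0) ∘L O₂ ∘L phaseMul a s (Ioo 0 1)

/-! ### Multiplication by powers of `|v|` -/

/-- `u = |v|^n f` (so `f` belongs to the domain in `L¹(I)` of the multiplication by `|v|^n`, and
`u` is its image). -/
def IsPowMul {I : Set ℝ} (n : ℤ) (f u : L1 I) : Prop :=
  ∀ᵐ v ∂(volume.restrict I), u v = ((|v| ^ n : ℝ) : ℂ) * f v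

/-- `|v|^{-n} A` is a bounded operator from `L¹(I)` to `L¹(J)`. -/
def WeightBounded {I J : Set ℝ} (n : ℕ) (A : L1 I →L[ℂ] L1 J) : Prop :=
  ∃ C : ℝ, ∀ f : L1 I, ∃ u : L1 J, IsPowMul (-(n : ℤ)) (A f) u ∧ ‖u‖ ≤ C * ‖f‖

/-- `|v|^{-n} A |v|^n` is a bounded operator from `L¹(I)` to `L¹(J)`. -/
def ConjBounded {I J : Set ℝ} (n : ℕ) (A : L1 I →L[ℂ] L1 J) : Prop :=
  ∃ C : ℝ, ∀ f f' : L1 I, IsPowMul (n : ℤ) f f' →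
    ∃ u : L1 J, IsPowMul (-(n : ℤ)) (A f') u ∧ ‖u‖ ≤ C * ‖f‖

/-! ### The transport operator -/

/-- `w = v ∂f/∂x` in the sense of distributions on `Ω`. -/
def IsStreamDeriv (a : ℝ) (f w : L1Slab a) : Prop :=
  ∀ φ : ℝ × ℝ → ℝ, ContDiff ℝ ∞ φ → HasCompactSupport φ → tsupport φ ⊆ slab a →
    ∫ z in slab a, (z.2 * fderiv ℝ φ z (1, 0)) • f z = - ∫ z in slab a, φ z • w z

/-- `u` is the flux `v ↦ |v| f(b, v)`, `v ∈ I`, of `f` through the face `x = b` of the slab: for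
almost every `v ∈ I` the function `f(·, v)` has a representative which is continuous on `[-a, a]`,
and `f(b, v)` is the value at `b` of this representative. -/
def IsFlux (a : ℝ) (f : L1Slab a) (b : ℝ) (I : Set ℝ) (u : L1 I) : Prop :=
  ∀ᵐ v ∂(volume.restrict I), ∃ F : ℝ → ℂ, ContinuousOn F (Icc (-a) a) ∧
    (∀ᵐ x ∂(volume.restrict (Ioo (-a) a)), F x = f (x, v)) ∧ u v = |v| • F b

/-- The graph of `v ∂/∂x` with the boundary conditions `h_{-a}^+ = O₁ h_{-a}^-` and
`h_a^- = O₂ h_a^+`: `f` belongs to `W₁(Ω)`, satisfies these conditions, and `w = v ∂f/∂x`. -/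
def IsTransportPair (a : ℝ) (O₁ : L1Neg →L[ℂ] L1Pos) (O₂ : L1Pos →L[ℂ] L1Neg)
    (f w : L1Slab a) : Prop :=
  IsStreamDeriv a f w ∧ ∃ (hl : L1Neg) (hr : L1Pos),
    IsFlux a f (-a) (Ioo (-1) 0) hl ∧ IsFlux a f (-a) (Ioo 0 1) (O₁ hl) ∧
    IsFlux a f a (Ioo 0 1) hr ∧ IsFlux a f a (Ioo (-1) 0) (O₂ hr)

theorem measurableSet_slab (a : ℝ) : MeasurableSet (slab a) :=
  measurableSet_Ioo.prod measurableSet_Ioo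

theorem isOpen_slab (a : ℝ) : IsOpen (slab a) := isOpen_Ioo.prod isOpen_Ioo

theorem integrable_smul_of_compactSupport {a : ℝ} (f : L1Slab a) {ψ : ℝ × ℝ → ℝ}
    (hc : Continuous ψ) (hs : HasCompactSupport ψ) :
    Integrable (fun z => ψ z • f z) (volume.restrict (slab a)) := by
  obtain ⟨C, hC⟩ := hc.bounded_above_of_compact_support hs
  exact (L1.integrable_coeFn f).bdd_smul C hc.aestronglyMeasurable (Eventually.of_forall hC)

theorem integrable_test {a : ℝ} (f : L1Slab a) {φ : ℝ × ℝ → ℝ}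
    (h : ContDiff ℝ ∞ φ) (hs : HasCompactSupport φ) :
    Integrable (fun z => φ z • f z) (volume.restrict (slab a)) :=
  integrable_smul_of_compactSupport f h.continuous hs

theorem integrable_testDeriv {a : ℝ} (f : L1Slab a) {φ : ℝ × ℝ → ℝ}
    (h : ContDiff ℝ ∞ φ) (hs : HasCompactSupport φ) :
    Integrable (fun z : ℝ × ℝ => (z.2 * fderiv ℝ φ z (1, 0)) • f z)
      (volume.restrict (slab a)) := by
  have hc : Continuous fun z : ℝ × ℝ => fderiv ℝ φ z (1, 0) :=
    (h.continuous_fderiv (by simp)).clm_apply continuous_const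
  refine integrable_smul_of_compactSupport f (continuous_snd.mul hc) ?_
  exact HasCompactSupport.mul_left (hs.fderiv_apply ℝ (1, 0))

theorem IsStreamDeriv.add {a : ℝ} {f w f' w' : L1Slab a} (h : IsStreamDeriv a f w)
    (h' : IsStreamDeriv a f' w') : IsStreamDeriv a (f + f') (w + w') := by
  intro φ h1 h2 h3
  have e1 : ∫ z in slab a, (z.2 * fderiv ℝ φ z (1, 0)) • (f + f' : L1Slab a) z
      = ∫ z in slab a, ((z.2 * fderiv ℝ φ z (1, 0)) • f z
          + (z.2 * fderiv ℝ φ z (1, 0)) • f' z) := by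
    refine integral_congr_ae ?_
    filter_upwards [Lp.coeFn_add f f'] with z hz
    rw [hz, Pi.add_apply, smul_add]
  have e2 : ∫ z in slab a, φ z • (w + w' : L1Slab a) z
      = ∫ z in slab a, (φ z • w z + φ z • w' z) := by
    refine integral_congr_ae ?_
    filter_upwards [Lp.coeFn_add w w'] with z hz
    rw [hz, Pi.add_apply, smul_add]
  rw [e1, e2, integral_add (integrable_testDeriv f h1 h2) (integrable_testDeriv f' h1 h2),
    integral_add (integrable_test w h1 h2) (integrable_test w' h1 h2), h φ h1 h2 h3,
    h' φ h1 h2 h3, neg_add]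

theorem IsStreamDeriv.smul {a : ℝ} {f w : L1Slab a} (c : ℂ) (h : IsStreamDeriv a f w) :
    IsStreamDeriv a (c • f) (c • w) := by
  intro φ h1 h2 h3
  have e1 : ∫ z in slab a, (z.2 * fderiv ℝ φ z (1, 0)) • (c • f : L1Slab a) z
      = ∫ z in slab a, c • ((z.2 * fderiv ℝ φ z (1, 0)) • f z) := by
    refine integral_congr_ae ?_
    filter_upwards [Lp.coeFn_smul c f] with z hz
    rw [hz, Pi.smul_apply, smul_comm]
  have e2 : ∫ z in slab a, φ z • (c • w : L1Slab a) z
      = ∫ z in slab a, c • (φ z • w z) := by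
    refine integral_congr_ae ?_
    filter_upwards [Lp.coeFn_smul c w] with z hz
    rw [hz, Pi.smul_apply, smul_comm]
  rw [e1, e2, integral_smul, integral_smul, h φ h1 h2 h3, smul_neg]

theorem IsStreamDeriv.unique {a : ℝ} {f w w' : L1Slab a} (h : IsStreamDeriv a f w)
    (h' : IsStreamDeriv a f w') : w = w' := by
  have key : ∀ᵐ z ∂(volume.restrict (slab a)), z ∈ slab a → w z - w' z = 0 := by
    refine (isOpen_slab a).ae_eq_zero_of_integral_contDiff_smul_eq_zero
      (f := fun z => w z - w' z) ?_ ?_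
    · exact ((L1.integrable_coeFn w).sub
        (L1.integrable_coeFn w')).locallyIntegrable.locallyIntegrableOn _
    · intro φ h1 h2 h3
      have e : ∀ z, φ z • (w z - w' z) = φ z • w z - φ z • w' z := fun z => smul_sub _ _ _
      simp_rw [e]
      rw [integral_sub (integrable_test w h1 h2) (integrable_test w' h1 h2), sub_eq_zero]
      exact neg_injective ((h φ h1 h2 h3).symm.trans (h' φ h1 h2 h3))
  refine Lp.ext ?_
  filter_upwards [key, ae_restrict_mem (measurableSet_slab a)] with z hz hm
  exact sub_eq_zero.1 (hz hm)

theorem ae_slices {a : ℝ} {P : ℝ × ℝ → Prop} (h : ∀ᵐ z ∂(volume.restrict (slab a)), P z)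
    {I : Set ℝ} (hI : I ⊆ Ioo (-1 : ℝ) 1) :
    ∀ᵐ v ∂(volume.restrict I), ∀ᵐ x ∂(volume.restrict (Ioo (-a) a)), P (x, v) := by
  refine ae_restrict_of_ae_restrict_of_subset hI ?_
  rw [slab, Measure.volume_eq_prod, ← Measure.prod_restrict] at h
  rw [← Measure.prod_swap] at h
  exact Measure.ae_ae_of_ae_prod (ae_of_ae_map measurable_swap.aemeasurable h)

theorem IsFlux.add {a b : ℝ} {f f' : L1Slab a} {I : Set ℝ} {u u' : L1 I}
    (hI : I ⊆ Ioo (-1 : ℝ) 1) (h : IsFlux a f b I u) (h' : IsFlux a f' b I u') :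
    IsFlux a (f + f') b I (u + u') := by
  unfold IsFlux at h h' ⊢
  filter_upwards [h, h', ae_slices (Lp.coeFn_add f f') hI, Lp.coeFn_add u u'] with v hv hv' hs hu
  obtain ⟨F, hF, hFf, hFu⟩ := hv
  obtain ⟨F', hF', hFf', hFu'⟩ := hv'
  refine ⟨fun x => F x + F' x, hF.add hF', ?_, ?_⟩
  · filter_upwards [hFf, hFf', hs] with x h1 h2 h3
    rw [h3, Pi.add_apply, h1, h2]
  · rw [hu, Pi.add_apply, hFu, hFu', smul_add]

theorem IsFlux.smul {a b : ℝ} {f : L1Slab a} {I : Set ℝ} {u : L1 I}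
    (hI : I ⊆ Ioo (-1 : ℝ) 1) (c : ℂ) (h : IsFlux a f b I u) :
    IsFlux a (c • f) b I (c • u) := by
  unfold IsFlux at h ⊢
  filter_upwards [h, ae_slices (Lp.coeFn_smul c f) hI, Lp.coeFn_smul c u] with v hv hs hu
  obtain ⟨F, hF, hFf, hFu⟩ := hv
  refine ⟨fun x => c • F x, hF.const_smul c, ?_, ?_⟩
  · filter_upwards [hFf, hs] with x h1 h3
    rw [h3, Pi.smul_apply, h1]
  · rw [hu, Pi.smul_apply, hFu, smul_comm]

theorem neg_subset : Ioo (-1 : ℝ) 0 ⊆ Ioo (-1 : ℝ) 1 := Ioo_subset_Ioo le_rfl zero_le_one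

theorem pos_subset : Ioo (0 : ℝ) 1 ⊆ Ioo (-1 : ℝ) 1 := Ioo_subset_Ioo (by norm_num) le_rfl

theorem IsTransportPair.add {a : ℝ} {O₁ : L1Neg →L[ℂ] L1Pos} {O₂ : L1Pos →L[ℂ] L1Neg}
    {f w f' w' : L1Slab a} (h : IsTransportPair a O₁ O₂ f w)
    (h' : IsTransportPair a O₁ O₂ f' w') : IsTransportPair a O₁ O₂ (f + f') (w + w') := by
  obtain ⟨hd, hl, hr, h1, h2, h3, h4⟩ := h
  obtain ⟨hd', hl', hr', h1', h2', h3', h4'⟩ := h'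
  refine ⟨hd.add hd', hl + hl', hr + hr', h1.add neg_subset h1', ?_, h3.add pos_subset h3', ?_⟩
  · rw [map_add]; exact h2.add pos_subset h2'
  · rw [map_add]; exact h4.add neg_subset h4'

theorem IsTransportPair.smul {a : ℝ} {O₁ : L1Neg →L[ℂ] L1Pos} {O₂ : L1Pos →L[ℂ] L1Neg}
    {f w : L1Slab a} (c : ℂ) (h : IsTransportPair a O₁ O₂ f w) :
    IsTransportPair a O₁ O₂ (c • f) (c • w) := by
  obtain ⟨hd, hl, hr, h1, h2, h3, h4⟩ := h
  refine ⟨hd.smul c, c • hl, c • hr, h1.smul neg_subset c, ?_, h3.smul pos_subset c, ?_⟩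
  · rw [map_smul]; exact h2.smul pos_subset c
  · rw [map_smul]; exact h4.smul neg_subset c

theorem IsTransportPair.zero (a : ℝ) (O₁ : L1Neg →L[ℂ] L1Pos) (O₂ : L1Pos →L[ℂ] L1Neg) :
    IsTransportPair a O₁ O₂ 0 0 := by
  have h0 : ∀ (b : ℝ) (I : Set ℝ), I ⊆ Ioo (-1 : ℝ) 1 → IsFlux a 0 b I 0 := by
    intro b I hI
    unfold IsFlux
    filter_upwards [ae_slices (Lp.coeFn_zero ℂ 1 (volume.restrict (slab a))) hI,
      Lp.coeFn_zero ℂ 1 (volume.restrict I)] with v hs hu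
    refine ⟨fun _ => 0, continuousOn_const, ?_, ?_⟩
    · filter_upwards [hs] with x hx
      rw [hx, Pi.zero_apply]
    · rw [hu, Pi.zero_apply, smul_zero]
  refine ⟨?_, 0, 0, h0 _ _ neg_subset, ?_, h0 _ _ pos_subset, ?_⟩
  · intro φ _ _ _
    have e1 : ∫ z in slab a, (z.2 * fderiv ℝ φ z (1, 0)) • (0 : L1Slab a) z = 0 := by
      refine integral_eq_zero_of_ae ?_
      filter_upwards [Lp.coeFn_zero ℂ 1 (volume.restrict (slab a))] with z hz
      rw [hz, Pi.zero_apply, smul_zero]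
    have e2 : ∫ z in slab a, φ z • (0 : L1Slab a) z = 0 := by
      refine integral_eq_zero_of_ae ?_
      filter_upwards [Lp.coeFn_zero ℂ 1 (volume.restrict (slab a))] with z hz
      rw [hz, Pi.zero_apply, smul_zero]
    rw [e1, e2, neg_zero]
  · rw [map_zero]; exact h0 _ _ pos_subset
  · rw [map_zero]; exact h0 _ _ neg_subset

/-- The transport operator `T_O f = - v ∂f/∂x` in `L¹(Ω)`, with domain
`D(T_O) = {f ∈ W₁(Ω) ; h_{-a}^+ = O₁ h_{-a}^-, h_a^- = O₂ h_a^+}`. -/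
def transportOp (a : ℝ) (O₁ : L1Neg →L[ℂ] L1Pos) (O₂ : L1Pos →L[ℂ] L1Neg) :
    L1Slab a →ₗ.[ℂ] L1Slab a where
  domain :=
    { carrier := {f | ∃ w, IsTransportPair a O₁ O₂ f w}
      add_mem' := fun ⟨w, h⟩ ⟨w', h'⟩ => ⟨w + w', h.add h'⟩
      zero_mem' := ⟨0, IsTransportPair.zero a O₁ O₂⟩
      smul_mem' := fun c _ ⟨w, h⟩ => ⟨c • w, h.smul c⟩ }
  toFun :=
    { toFun := fun f => -(Classical.choose f.2)
      map_add' := fun f g => by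
        rw [← neg_add]
        exact congrArg Neg.neg ((Classical.choose_spec (f + g).2).1.unique
          ((Classical.choose_spec f.2).1.add (Classical.choose_spec g.2).1))
      map_smul' := fun c f => by
        rw [RingHom.id_apply, smul_neg]
        exact congrArg Neg.neg ((Classical.choose_spec (c • f).2).1.unique
          ((Classical.choose_spec f.2).1.smul c)) }

/-- `R = (μ - T)⁻¹`: the bounded operator `R` is a two-sided inverse of `μ - T : D(T) → X`. -/
def IsResolventAt {X : Type*} [NormedAddCommGroup X] [NormedSpace ℂ X] (T : X →ₗ.[ℂ] X) (μ : ℂ)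
    (R : X →L[ℂ] X) : Prop :=
  (∀ g : X, ∃ h : R g ∈ T.domain, μ • R g - T ⟨R g, h⟩ = g) ∧
  ∀ f : T.domain, R (μ • (f : X) - T f) = f

end SlabTransport

end

noncomputable section
namespace SlabTransport

/-! ### Bounded operators between `L¹` spaces -/

section General

variable {α β γ : Type*} [MeasurableSpace α] [MeasurableSpace β] [MeasurableSpace γ]
  {μ : Measure α} {ν : Measure β}

/-! There are two separate difficulties: inverting `1 - G` on the punctured imaginary axis, and the
factor `1/|v|` that each derivative in `s` produces.

Invertibility. `G` is a contraction, so it suffices that `1` is not an approximate eigenvalue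
(`isUnit_one_sub_of_le_norm_sub`). Let `ψ` be a unit vector almost fixed by `A e B e`, where `e =
e^{-2isa/|v|}` and `B` contains a weakly compact part. Then `B` almost preserves the norm of `u = e
ψ`, so there is hardly any cancellation: the part of `|u|` with phase `p` is carried to the set
where `B u` has phase near `p`. Weak compactness gives uniform integrability
(`IsWeaklyCompact.smallSetBound`): a positive function cannot be sent almost entirely to a set of
measure less than `δ`. Each phase that matters thus occupies measure at least `δ`, and there are
boundedly many of them (`IsStochastic.phase_concentration`). The same applies to `A` acting on `e B
u`; if `A` is a reflection, the equation itself transports the phases of `u` to those of `e² B u`.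
So `B u` and `e B u` (or `e² B u`) both live near finitely many rays, and `e` (or `e²`) is near
finitely many values on most of the mass of `B u`. For `s ≠ 0` the level sets of the phase are
countable, so this happens on a set of small measure only, which contradicts uniform integrability
(`exists_le_norm_sub`).

Resolvent. On each line `v = const` the equation is solved explicitly: `|v| f` is the flow of the
incoming flux `p` plus the flow of the source, and the boundary conditions read `p = O (E_λ p +
outflow)`, where `O` exchanges the two signs of `v` through `O₁`, `O₂` and `E_λ` is multiplication
by `e^{-2λa/|v|}`. Every ingredient except `(1 - O E_λ)⁻¹` extends at once to `Re λ = 0`;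
elimination of one sign of `v` reduces this inverse to that of `1 - G`. Uniqueness holds because a
homogeneous solution is exponential on almost every line and its incoming flux is fixed by `O E_λ`.

Smoothness. Write `g = |v|^{k+1} u` and use the conjugates `O_n = |v|^{-n} O |v|^n`, which exist for
`n ≤ k + 1` by interpolation over dyadic shells of `|v|` (`exists_intermediate_lift`). A derivative
costs one level of this scale. With `Q = O E_λ` one has `(1 - Q)⁻¹ = 1 + Q + Q² + Q³ (1 - Q)⁻¹`, and
the bound on `|v|^{-(k+1)} O₁ O₂` makes `Q³` gain `k + 1` powers of `|v|`; hence the inverses at all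
levels are controlled linearly by the one at level `0`. The same gain yields local boundedness of
the inverses in `λ`, although `E_λ` is only strongly continuous. Differentiating an inverse creates
one more inverse, so the derivative of order `j` costs `j + 1` of them (`scaleDiff_resolvent`). -/

theorem norm_eq_integral (f : Lp ℂ 1 μ) : ‖f‖ = ∫ x, ‖f x‖ ∂μ := L1.norm_eq_integral_norm f

theorem integrable_Lp (f : Lp ℂ 1 μ) : Integrable (f : α → ℂ) μ := L1.integrable_coeFn f

theorem norm_le_of_ae_le {f : Lp ℂ 1 μ} {g : Lp ℂ 1 ν} {C : ℝ}
    (h : ∫ x, ‖f x‖ ∂μ ≤ C * ∫ x, ‖g x‖ ∂ν) : ‖f‖ ≤ C * ‖g‖ := by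
  rwa [norm_eq_integral, norm_eq_integral]

theorem norm_mono_ae {f g : Lp ℂ 1 μ} (h : ∀ᵐ x ∂μ, ‖f x‖ ≤ ‖g x‖) : ‖f‖ ≤ ‖g‖ := by
  rw [norm_eq_integral, norm_eq_integral]
  exact integral_mono_ae (integrable_Lp f).norm (integrable_Lp g).norm h

/-- A map on functions which induces a bounded linear operator between `L¹` spaces. -/
structure IsL1Map (μ : Measure α) (ν : Measure β) (Φ : (α → ℂ) → β → ℂ) (C : ℝ) : Prop where
  nonneg : 0 ≤ C
  congr : ∀ f g, f =ᵐ[μ] g → Φ f =ᵐ[ν] Φ g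
  add : ∀ f g, Integrable f μ → Integrable g μ → Φ (f + g) =ᵐ[ν] Φ f + Φ g
  smul : ∀ (c : ℂ) f, Integrable f μ → Φ (c • f) =ᵐ[ν] c • Φ f
  integrable : ∀ f, Integrable f μ → Integrable (Φ f) ν
  bound : ∀ f, Integrable f μ → ∫ x, ‖Φ f x‖ ∂ν ≤ C * ∫ x, ‖f x‖ ∂μ

/-- The operator induced by a map on functions. -/
def IsL1Map.clm {Φ : (α → ℂ) → β → ℂ} {C : ℝ} (h : IsL1Map μ ν Φ C) :
    Lp ℂ 1 μ →L[ℂ] Lp ℂ 1 ν :=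
  LinearMap.mkContinuous
    { toFun := fun f => (h.integrable f (integrable_Lp f)).toL1 _
      map_add' := fun f g => by
        refine Lp.ext ?_
        filter_upwards [(h.integrable _ (integrable_Lp (f + g))).coeFn_toL1,
          (h.integrable _ (integrable_Lp f)).coeFn_toL1,
          (h.integrable _ (integrable_Lp g)).coeFn_toL1, h.congr _ _ (Lp.coeFn_add f g),
          h.add _ _ (integrable_Lp f) (integrable_Lp g),
          Lp.coeFn_add ((h.integrable _ (integrable_Lp f)).toL1 _)
            ((h.integrable _ (integrable_Lp g)).toL1 _)] with x h1 h2 h3 h4 h5 h6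
        rw [h1, h6, h4, h5, Pi.add_apply, Pi.add_apply, h2, h3]
      map_smul' := fun c f => by
        refine Lp.ext ?_
        filter_upwards [(h.integrable _ (integrable_Lp (c • f))).coeFn_toL1,
          (h.integrable _ (integrable_Lp f)).coeFn_toL1, h.congr _ _ (Lp.coeFn_smul c f),
          h.smul c _ (integrable_Lp f),
          Lp.coeFn_smul c ((h.integrable _ (integrable_Lp f)).toL1 _)] with x h1 h2 h4 h5 h6
        rw [h1, RingHom.id_apply, h6, h4, h5, Pi.smul_apply, Pi.smul_apply, h2] }
    C (fun f => by
      refine norm_le_of_ae_le (le_trans (le_of_eq ?_) (h.bound _ (integrable_Lp f)))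
      refine integral_congr_ae ?_
      filter_upwards [(h.integrable _ (integrable_Lp f)).coeFn_toL1] with x hx
      exact congrArg norm hx)

theorem IsL1Map.coe_clm {Φ : (α → ℂ) → β → ℂ} {C : ℝ} (h : IsL1Map μ ν Φ C) (f : Lp ℂ 1 μ) :
    h.clm f =ᵐ[ν] Φ f := (h.integrable _ (integrable_Lp f)).coeFn_toL1

theorem IsL1Map.norm_clm_le {Φ : (α → ℂ) → β → ℂ} {C : ℝ} (h : IsL1Map μ ν Φ C) :
    ‖h.clm‖ ≤ C := LinearMap.mkContinuous_norm_le _ h.nonneg _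

open Classical in
/-- Multiplication by a bounded function `m` on `L¹(μ)`. -/
def mulL (μ : Measure α) (m : α → ℂ) : Lp ℂ 1 μ →L[ℂ] Lp ℂ 1 μ :=
  if h : MemLp m ∞ μ then (ContinuousLinearMap.mul ℂ ℂ).holderL μ ∞ 1 1 (h.toLp m) else 0

theorem coe_mulL {m : α → ℂ} (h : MemLp m ∞ μ) (f : Lp ℂ 1 μ) :
    mulL μ m f =ᵐ[μ] fun x => m x * f x := by
  rw [mulL, dif_pos h]
  filter_upwards [(ContinuousLinearMap.mul ℂ ℂ).coeFn_holder (r := 1) (h.toLp m) f,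
    h.coeFn_toLp] with x h1 h2
  rw [ContinuousLinearMap.holderL_apply_apply, h1, h2, ContinuousLinearMap.mul_apply']

theorem norm_mulL_apply_le {m : α → ℂ} (h : MemLp m ∞ μ) {C : ℝ} 
    (hC : ∀ᵐ x ∂μ, ‖m x‖ ≤ C) (f : Lp ℂ 1 μ) : ‖mulL μ m f‖ ≤ C * ‖f‖ := by
  refine norm_le_of_ae_le ?_
  rw [← integral_const_mul]
  refine integral_mono_ae (integrable_Lp _).norm ((integrable_Lp f).norm.const_mul C) ?_
  filter_upwards [coe_mulL h f, hC] with x h1 h2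
  rw [h1, norm_mul]
  exact mul_le_mul_of_nonneg_right h2 (norm_nonneg _)

theorem norm_mulL_le {m : α → ℂ} (h : MemLp m ∞ μ) {C : ℝ} (h0 : 0 ≤ C)
    (hC : ∀ᵐ x ∂μ, ‖m x‖ ≤ C) : ‖mulL μ m‖ ≤ C :=
  ContinuousLinearMap.opNorm_le_bound _ h0 (norm_mulL_apply_le h hC)

theorem memLp_top_of_norm_le {m : α → ℂ} (hm : Measurable m) {C : ℝ} (hC : ∀ x, ‖m x‖ ≤ C) :
    MemLp m ∞ μ := memLp_top_of_bound hm.aestronglyMeasurable C (Eventually.of_forall hC)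

theorem mulL_mulL {m m' : α → ℂ} (h : MemLp m ∞ μ) (h' : MemLp m' ∞ μ)
    (f : Lp ℂ 1 μ) : mulL μ m (mulL μ m' f) = mulL μ (fun x => m x * m' x) f := by
  have h2 : MemLp (fun x => m x * m' x) ∞ μ := h'.mul h
  refine Lp.ext ?_
  filter_upwards [coe_mulL h (mulL μ m' f), coe_mulL h' f, coe_mulL h2 f] with x h1 h2 h3
  rw [h1, h2, h3, mul_assoc]

theorem mulL_comm {m m' : α → ℂ} (h : MemLp m ∞ μ) (h' : MemLp m' ∞ μ)
    (f : Lp ℂ 1 μ) : mulL μ m (mulL μ m' f) = mulL μ m' (mulL μ m f) := by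
  rw [mulL_mulL h h', mulL_mulL h' h]
  simp_rw [mul_comm]

theorem mulL_injective {m : α → ℂ} (h : MemLp m ∞ μ) (h0 : ∀ᵐ x ∂μ, m x ≠ 0) :
    Function.Injective (mulL μ m) := by
  refine (injective_iff_map_eq_zero _).2 fun f hf => Lp.ext ?_
  have := coe_mulL h f
  rw [hf] at this
  filter_upwards [this, Lp.coeFn_zero ℂ 1 μ, h0] with x h1 h2 h3
  rw [h2] at h1 ⊢
  exact (mul_eq_zero.1 h1.symm).resolve_left h3

/-- Convergence in `L¹` by domination. -/
theorem tendsto_L1_of_dominated {ι : Type*} {l : Filter ι} [l.IsCountablyGenerated]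
    {F : ι → Lp ℂ 1 μ} {f : Lp ℂ 1 μ} (bound : α → ℝ) (hb : Integrable bound μ)
    (hF : ∀ᶠ i in l, ∀ᵐ x ∂μ, ‖F i x - f x‖ ≤ bound x)
    (G : ι → α → ℂ) (hG : ∀ i, F i =ᵐ[μ] G i)
    (hl : ∀ᵐ x ∂μ, Tendsto (fun i => G i x) l (𝓝 (f x))) : Tendsto F l (𝓝 f) := by
  rw [tendsto_iff_norm_sub_tendsto_zero]
  have e : ∀ i, ‖F i - f‖ = ∫ x, ‖G i x - f x‖ ∂μ := fun i => by
    rw [norm_eq_integral]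
    refine integral_congr_ae ?_
    filter_upwards [Lp.coeFn_sub (F i) f, hG i] with x h1 h2
    rw [h1, Pi.sub_apply, h2]
  simp_rw [e]
  have := tendsto_integral_filter_of_dominated_convergence (l := l) (μ := μ)
    (F := fun i x => ‖G i x - f x‖) (f := fun _ => (0 : ℝ)) bound
    (Eventually.of_forall fun i => ((((Lp.aestronglyMeasurable (F i)).congr (hG i)).sub
      (Lp.aestronglyMeasurable f)).norm)) ?_ hb ?_
  · simpa using this
  · filter_upwards [hF] with i hi
    filter_upwards [hi, hG i] with x h1 h2
    rw [norm_norm, ← h2]; exact h1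
  · filter_upwards [hl] with x hx
    exact tendsto_iff_norm_sub_tendsto_zero.1 hx

/-- Strong convergence of multiplication operators with bounded pointwise convergent symbols. -/
theorem tendsto_mulL {ι : Type*} {l : Filter ι} [l.IsCountablyGenerated] {m : ι → α → ℂ}
    {m' : α → ℂ} (h : ∀ i, MemLp (m i) ∞ μ) (h' : MemLp m' ∞ μ) {C : ℝ}
    (hC : ∀ᶠ i in l, ∀ᵐ x ∂μ, ‖m i x - m' x‖ ≤ C)
    (hl : ∀ᵐ x ∂μ, Tendsto (fun i => m i x) l (𝓝 (m' x))) (f : Lp ℂ 1 μ) :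
    Tendsto (fun i => mulL μ (m i) f) l (𝓝 (mulL μ m' f)) := by
  refine tendsto_L1_of_dominated (fun x => C * ‖f x‖) ((integrable_Lp f).norm.const_mul C) ?_
    (fun i x => m i x * f x) (fun i => coe_mulL (h i) f) ?_
  · filter_upwards [hC] with i hi
    filter_upwards [hi, coe_mulL (h i) f, coe_mulL h' f] with x h1 h2 h3
    rw [h2, h3, ← sub_mul, norm_mul]
    exact mul_le_mul_of_nonneg_right h1 (norm_nonneg _)
  · filter_upwards [hl, coe_mulL h' f] with x h1 h2
    rw [h2]
    exact h1.mul_const _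

end General

/-! ### Stochastic operators -/

section Stochastic

variable {I J : Set ℝ}

/-- The real part of an element of `L¹`. -/
def reL (f : L1 I) : L1 I := (integrable_Lp f).re.ofReal.toL1 (fun v => (((f v).re : ℝ) : ℂ))

theorem coe_reL (f : L1 I) : reL f =ᵐ[volume.restrict I] fun v => (((f v).re : ℝ) : ℂ) :=
  (integrable_Lp f).re.ofReal.coeFn_toL1

/-- The modulus of an element of `L¹`. -/
def absL (f : L1 I) : L1 I := (integrable_Lp f).norm.ofReal.toL1 (fun v => ((‖f v‖ : ℝ) : ℂ))

theorem coe_absL (f : L1 I) : absL f =ᵐ[volume.restrict I] fun v => ((‖f v‖ : ℝ) : ℂ) :=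
  (integrable_Lp f).norm.ofReal.coeFn_toL1

theorem isNonneg_absL (f : L1 I) : IsNonneg (absL f) := by
  filter_upwards [coe_absL f] with v hv
  rw [hv]
  simp

theorem norm_absL (f : L1 I) : ‖absL f‖ = ‖f‖ := by
  rw [norm_eq_integral, norm_eq_integral]
  refine integral_congr_ae ?_
  filter_upwards [coe_absL f] with v hv
  rw [hv]
  simp

theorem IsNonneg.add {f g : L1 I} (hf : IsNonneg f) (hg : IsNonneg g) : IsNonneg (f + g) := by
  filter_upwards [hf, hg, Lp.coeFn_add f g] with v h1 h2 h3
  rw [h3, Pi.add_apply, Complex.add_re, Complex.add_im, h1.2, h2.2]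
  exact ⟨add_nonneg h1.1 h2.1, add_zero _⟩

theorem IsNonneg.smul {f : L1 I} (hf : IsNonneg f) {c : ℝ} (hc : 0 ≤ c) :
    IsNonneg ((c : ℂ) • f) := by
  filter_upwards [hf, Lp.coeFn_smul (c : ℂ) f] with v h1 h3
  rw [h3, Pi.smul_apply, smul_eq_mul, Complex.re_ofReal_mul, Complex.im_ofReal_mul, h1.2]
  exact ⟨mul_nonneg hc h1.1, mul_zero _⟩

theorem IsNonneg.norm_eq {f : L1 I} (hf : IsNonneg f) :
    ∀ᵐ v ∂(volume.restrict I), ‖f v‖ = (f v).re := by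
  filter_upwards [hf] with v h
  have e : f v = ((f v).re : ℂ) := Complex.ext rfl (by rw [h.2, Complex.ofReal_im])
  rw [e, Complex.norm_real, Real.norm_of_nonneg h.1, Complex.ofReal_re]

theorem IsNonneg.norm_add {f g : L1 I} (hf : IsNonneg f) (hg : IsNonneg g) :
    ‖f + g‖ = ‖f‖ + ‖g‖ := by
  rw [norm_eq_integral, norm_eq_integral, norm_eq_integral,
    ← integral_add (integrable_Lp f).norm (integrable_Lp g).norm]
  refine integral_congr_ae ?_
  filter_upwards [hf.norm_eq, hg.norm_eq, (hf.add hg).norm_eq, Lp.coeFn_add f g] with v h1 h2 h3 h4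
  rw [h3, h1, h2, h4, Pi.add_apply, Complex.add_re]

/-- A positive operator maps real functions to real functions. -/
theorem IsStochastic.im_apply_reL {O : L1 I →L[ℂ] L1 J} (hO : IsStochastic O) (f : L1 I) :
    ∀ᵐ w ∂(volume.restrict J), (O (reL f) w).im = 0 := by
  have h1 : IsNonneg (reL f + absL f) := by
    filter_upwards [coe_reL f, coe_absL f, Lp.coeFn_add (reL f) (absL f)] with v h1 h2 h3
    rw [h3, Pi.add_apply, h1, h2, ← Complex.ofReal_add]
    exact ⟨by rw [Complex.ofReal_re]; linarith [neg_abs_le (f v).re, Complex.abs_re_le_norm (f v)],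
      Complex.ofReal_im _⟩
  have e : O (reL f) = O (reL f + absL f) - O (absL f) := by
    rw [map_add, add_sub_cancel_right]
  filter_upwards [(hO _ h1).1, (hO _ (isNonneg_absL f)).1,
    Lp.coeFn_sub (O (reL f + absL f)) (O (absL f))] with w h2 h3 h4
  rw [e, h4, Pi.sub_apply, Complex.sub_im, h2.2, h3.2, sub_zero]

/-- Since real functions have real images, the term `i O (Im f)` is purely imaginary. -/
theorem IsStochastic.re_apply {O : L1 I →L[ℂ] L1 J} (hO : IsStochastic O) (f : L1 I) :
    ∀ᵐ w ∂(volume.restrict J), (O f w).re = (O (reL f) w).re := by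
  -- The imaginary part is obtained as the real part of `-i f`.
  have e : f = reL f + Complex.I • reL ((-Complex.I) • f) := by
    refine Lp.ext ?_
    filter_upwards [coe_reL f, coe_reL ((-Complex.I) • f), Lp.coeFn_smul (-Complex.I) f,
      Lp.coeFn_smul Complex.I (reL ((-Complex.I) • f)),
      Lp.coeFn_add (reL f) (Complex.I • reL ((-Complex.I) • f))] with v h1 h2 h3 h4 h5
    rw [h5, Pi.add_apply, h4, Pi.smul_apply, h1, h2, h3, Pi.smul_apply]
    simp [Complex.ext_iff]
  have e2 : O f = O (reL f) + Complex.I • O (reL ((-Complex.I) • f)) := by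
    conv_lhs => rw [e]
    rw [map_add, map_smul]
  filter_upwards [hO.im_apply_reL ((-Complex.I) • f),
    Lp.coeFn_smul Complex.I (O (reL ((-Complex.I) • f))),
    Lp.coeFn_add (O (reL f)) (Complex.I • O (reL ((-Complex.I) • f)))] with w h1 h2 h3
  rw [e2, h3, Pi.add_apply, h2, Pi.smul_apply, smul_eq_mul, Complex.add_re, Complex.I_mul_re, h1,
    neg_zero, add_zero]

/-- The modulus is the maximum of `Re (e^{iθ} z)` over `θ`, and by continuity rational `θ` suffice.
Countability matters: each rotation will come with its own null set. -/
theorem norm_le_of_forall_re_exp_le {z : ℂ} {t : ℝ}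
    (h : ∀ q : ℚ, (Complex.exp ((q : ℝ) * Complex.I) * z).re ≤ t) : ‖z‖ ≤ t := by
  have hc : IsClosed {x : ℝ | (Complex.exp (x * Complex.I) * z).re ≤ t} :=
    isClosed_le (by fun_prop) continuous_const
  have hu : {x : ℝ | (Complex.exp (x * Complex.I) * z).re ≤ t} = univ := by
    refine eq_univ_of_univ_subset ?_
    rw [← (Rat.denseRange_cast (𝕜 := ℝ)).closure_range]
    exact closure_minimal (by rintro _ ⟨q, rfl⟩; exact h q) hc
  have h1 : -z.arg ∈ {x : ℝ | (Complex.exp (x * Complex.I) * z).re ≤ t} := hu ▸ mem_univ _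
  have h2 : Complex.exp ((-z.arg : ℝ) * Complex.I) * z = (‖z‖ : ℂ) := by
    conv_lhs => rw [← Complex.norm_mul_exp_arg_mul_I z]
    rw [mul_left_comm, ← Complex.exp_add]
    simp
  rw [mem_ofPred_eq, h2, Complex.ofReal_re] at h1
  exact h1

/-- A stochastic operator preserves domination. -/
theorem IsStochastic.domination {O : L1 I →L[ℂ] L1 J} (hO : IsStochastic O) {f g : L1 I}
    (hg : IsNonneg g) (h : ∀ᵐ v ∂(volume.restrict I), ‖f v‖ ≤ (g v).re) :
    ∀ᵐ w ∂(volume.restrict J), ‖O f w‖ ≤ (O g w).re := by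
  -- For a fixed unimodular `c` the function `g - Re (c f)` is nonnegative, so positivity of `O`
  -- gives the bound off a null set depending on `c`.
  have key : ∀ c : ℂ, ‖c‖ = 1 → ∀ᵐ w ∂(volume.restrict J), (c * O f w).re ≤ (O g w).re := by
    intro c hc
    have h1 : IsNonneg (g - reL (c • f)) := by
      filter_upwards [hg, h, coe_reL (c • f), Lp.coeFn_smul c f,
        Lp.coeFn_sub g (reL (c • f))] with v h1 h2 h3 h4 h5
      rw [h5, Pi.sub_apply, h3, Complex.sub_re, Complex.sub_im, Complex.ofReal_re,
        Complex.ofReal_im, h1.2, sub_zero, h4, Pi.smul_apply, sub_nonneg]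
      refine ⟨le_trans (Complex.re_le_norm _) ?_, rfl⟩
      rw [norm_smul, hc, one_mul]
      exact h2
    filter_upwards [(hO _ h1).1, hO.re_apply (c • f), Lp.coeFn_sub (O g) (O (reL (c • f))),
      Lp.coeFn_smul c (O f)] with w h2 h3 h4 h5
    rw [map_sub, h4, Pi.sub_apply, Complex.sub_re, ← h3, map_smul, h5, Pi.smul_apply] at h2
    exact sub_nonneg.1 h2.1
  have := ae_all_iff.2 fun q : ℚ =>
    key (Complex.exp ((q : ℝ) * Complex.I)) (Complex.norm_exp_ofReal_mul_I _)
  filter_upwards [this] with w hw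
  exact norm_le_of_forall_re_exp_le hw

/-- `|O f| ≤ O |f|` by domination, and `O` preserves the norm of `|f|`. -/
theorem IsStochastic.norm_apply_le {O : L1 I →L[ℂ] L1 J} (hO : IsStochastic O) (f : L1 I) :
    ‖O f‖ ≤ ‖f‖ := by
  rw [← norm_absL f, ← (hO _ (isNonneg_absL f)).2]
  refine norm_mono_ae ?_
  have h : ∀ᵐ v ∂(volume.restrict I), ‖f v‖ ≤ (absL f v).re := by
    filter_upwards [coe_absL f] with v hv
    rw [hv, Complex.ofReal_re]
  filter_upwards [hO.domination (isNonneg_absL f) h] with w hw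
  exact hw.trans (Complex.re_le_norm _)

theorem IsStochastic.norm_le {O : L1 I →L[ℂ] L1 J} (hO : IsStochastic O) : ‖O‖ ≤ 1 :=
  ContinuousLinearMap.opNorm_le_bound _ zero_le_one fun f => by
    rw [one_mul]; exact hO.norm_apply_le f

/-- The `L¹` norm is additive on the positive cone, so the two norms add up to `(α + β) ‖f‖`. -/
theorem IsStochastic.convex {A B : L1 I →L[ℂ] L1 J} (hA : IsStochastic A) (hB : IsStochastic B)
    {α β : ℝ} (hα : 0 ≤ α) (hβ : 0 ≤ β) (h : α + β = 1) :
    IsStochastic ((α : ℂ) • A + (β : ℂ) • B) := by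
  intro f hf
  have h1 := (hA f hf).1.smul hα
  have h2 := (hB f hf).1.smul hβ
  refine ⟨h1.add h2, ?_⟩
  change ‖(α : ℂ) • A f + (β : ℂ) • B f‖ = ‖f‖
  rw [h1.norm_add h2, norm_smul, norm_smul, (hA f hf).2, (hB f hf).2, Complex.norm_real,
    Complex.norm_real, Real.norm_of_nonneg hα, Real.norm_of_nonneg hβ, ← add_mul, h, one_mul]

/-- An operator which is, up to an isometric factor, composition with the reflection. -/
def IsReflection (O : L1 I →L[ℂ] L1 J) : Prop :=
  ∀ f : L1 I, O f =ᵐ[volume.restrict J] fun w => f (-w)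

theorem isReflection_reflNegPos : IsReflection reflNegPos := fun f =>
  Lp.coeFn_compMeasurePreserving f measurePreserving_neg_pos

theorem isReflection_reflPosNeg : IsReflection reflPosNeg := fun f =>
  Lp.coeFn_compMeasurePreserving f measurePreserving_neg_neg

theorem isStochastic_reflNegPos : IsStochastic reflNegPos := fun f hf => by
  refine ⟨?_, LinearIsometry.norm_map _ f⟩
  filter_upwards [isReflection_reflNegPos f,
    measurePreserving_neg_pos.quasiMeasurePreserving.ae hf] with v h1 h2
  rw [h1]; exact h2

theorem isStochastic_reflPosNeg : IsStochastic reflPosNeg := fun f hf => by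
  refine ⟨?_, LinearIsometry.norm_map _ f⟩
  filter_upwards [isReflection_reflPosNeg f,
    measurePreserving_neg_neg.quasiMeasurePreserving.ae hf] with v h1 h2
  rw [h1]; exact h2

/-- The part of the mass which an operator can carry to sets of measure less than `δ` is at most
the proportion `q`. -/
def SmallSetBound (δ q : ℝ) (O : L1 I →L[ℂ] L1 J) : Prop :=
  ∀ S : Set ℝ, MeasurableSet S → volume.restrict J S < ENNReal.ofReal δ → ∀ f : L1 I, IsNonneg f →
    ∫ w in S, ‖O f w‖ ∂(volume.restrict J) ≤ q * ‖f‖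

theorem continuous_dual_symm {E : Type*} [NormedAddCommGroup E] [NormedSpace ℂ E]
    (l : E →L[ℂ] ℂ) : Continuous fun x : WeakSpace ℂ E => l ((toWeakSpace ℂ E).symm x) :=
  WeakBilin.eval_continuous (topDualPairing ℂ E).flip l

/-- The functional `f ↦ ∫_S f`. -/
def setIntegralL (μ : Measure ℝ) (S : Set ℝ) : Lp ℂ 1 μ →L[ℂ] ℂ :=
  L1.integralCLM' ℂ ∘L mulL μ (S.indicator fun _ => 1)

theorem memLp_indicator_one {α : Type*} [MeasurableSpace α] {μ : Measure α} {S : Set α}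
    (hS : MeasurableSet S) : MemLp (S.indicator fun _ => (1 : ℂ)) ∞ μ :=
  memLp_top_of_norm_le (measurable_const.indicator hS) (C := 1) fun x => by
    by_cases h : x ∈ S <;> simp [h]

theorem setIntegralL_apply {μ : Measure ℝ} {S : Set ℝ} (hS : MeasurableSet S) (f : Lp ℂ 1 μ) :
    setIntegralL μ S f = ∫ x in S, f x ∂μ := by
  have h : setIntegralL μ S f = L1.integral (mulL μ (S.indicator fun _ => 1) f) :=
    (L1.integral_eq' ℂ _).symm
  rw [h, L1.integral_eq_integral, ← integral_indicator hS]
  refine integral_congr_ae ?_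
  filter_upwards [coe_mulL (memLp_indicator_one hS) f] with x hx
  rw [hx]
  by_cases h : x ∈ S <;> simp [h]

/-- Sets of small measure carry little mass of the members of a weakly compact set, along any
sequence of elements with nonnegative real part. -/
theorem exists_setIntegral_lt_of_isCompact_weak {μ : Measure ℝ} {Z : Set (WeakSpace ℂ (Lp ℂ 1 μ))}
    (hZ : IsCompact Z) {k : ℕ → Lp ℂ 1 μ} (hk : ∀ n, toWeakSpace ℂ (Lp ℂ 1 μ) (k n) ∈ Z)
    {U : ℕ → Set ℝ} (hUm : ∀ n, MeasurableSet (U n)) (hUa : Antitone U) (hU0 : μ (⋂ n, U n) = 0)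
    {c : ℝ} (hc : 0 < c) : ∃ n m, n ≤ m ∧ ∫ x in U n, (k m x).re ∂μ < c := by
  by_contra! hcon
  -- Take a weak cluster point of the sequence. Integration over a fixed `U n` is weakly continuous,
  -- so the lower bound `c` passes to the cluster point, whose own integrals over the shrinking sets
  -- tend to `0`.
  obtain ⟨z, -, hz⟩ := hZ (f := map (fun n => toWeakSpace ℂ (Lp ℂ 1 μ) (k n)) atTop)
    (le_principal_iff.2 (mem_map.2 (Eventually.of_forall hk)))
  have hre : ∀ (n : ℕ) (f : Lp ℂ 1 μ),
      (setIntegralL μ (U n) f).re = ∫ x in U n, (f x).re ∂μ := by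
    intro n f
    rw [setIntegralL_apply (hUm n)]
    exact (integral_re (𝕜 := ℂ) ((integrable_Lp f).integrableOn (s := U n))).symm
  obtain ⟨g, rfl⟩ := (toWeakSpace ℂ (Lp ℂ 1 μ)).surjective z
  have hzn : ∀ n, c ≤ ∫ x in U n, (g x).re ∂μ := by
    intro n
    have hcl : IsClosed {y : WeakSpace ℂ (Lp ℂ 1 μ) | c ≤ (setIntegralL μ (U n)
      ((toWeakSpace ℂ (Lp ℂ 1 μ)).symm y)).re} :=
      isClosed_le continuous_const (Complex.continuous_re.comp (continuous_dual_symm _))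
    have := isClosed_iff_clusterPt.1 hcl _ (hz.mono (le_principal_iff.2 (mem_map.2 ?_)))
    · rw [mem_ofPred_eq, LinearEquiv.symm_apply_apply, hre] at this
      exact this
    · filter_upwards [eventually_ge_atTop n] with m hm
      rw [mem_preimage, mem_ofPred_eq, LinearEquiv.symm_apply_apply, hre]
      exact hcon n m hm
  have hlim := tendsto_setIntegral_of_antitone (μ := μ) (f := fun x => (g x).re) hUm hUa
    ⟨0, (integrable_Lp g).re.integrableOn⟩
  rw [setIntegral_measure_zero _ hU0] at hlim
  exact absurd (ge_of_tendsto' hlim hzn) (not_le.2 hc)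

theorem setIntegral_norm_le_norm (f : L1 J) (S : Set ℝ) :
    ∫ w in S, ‖f w‖ ∂(volume.restrict J) ≤ ‖f‖ := by
  rw [norm_eq_integral]
  exact setIntegral_le_integral (integrable_Lp _).norm (Eventually.of_forall fun _ => norm_nonneg _)

theorem setIntegral_norm_smul (c : ℂ) (f : L1 J) (S : Set ℝ) :
    ∫ w in S, ‖(c • f : L1 J) w‖ ∂(volume.restrict J)
      = ‖c‖ * ∫ w in S, ‖f w‖ ∂(volume.restrict J) := by
  rw [← integral_const_mul]
  refine integral_congr_ae (ae_restrict_of_ae ?_)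
  filter_upwards [Lp.coeFn_smul c f] with w hw
  rw [hw, Pi.smul_apply, norm_smul]

theorem IsWeaklyCompact.exists_ball {K : L1 I →L[ℂ] L1 J} (hw : IsWeaklyCompact K) :
    ∃ r > 0, ∃ Z : Set (WeakSpace ℂ (L1 J)), IsCompact Z ∧
      ∀ f ∈ Metric.ball (0 : L1 I) r, toWeakSpace ℂ (L1 J) (K f) ∈ Z := by
  obtain ⟨Z, hZ, hZn⟩ := hw
  obtain ⟨r, hr, hrZ⟩ := Metric.mem_nhds_iff.1 hZn
  exact ⟨r, hr, Z, hZ, fun f hf => hrZ hf⟩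

/-- Uniform integrability of the image of the unit ball under a weakly compact operator, on the
positive cone. -/
theorem IsWeaklyCompact.smallSetBound {K : L1 I →L[ℂ] L1 J} (hK : IsStochastic K)
    (hw : IsWeaklyCompact K) : ∃ δ, 0 < δ ∧ SmallSetBound δ (1 / 2) K := by
  by_contra hcon
  -- The thresholds `2^{-n}` are summable, which allows Borel–Cantelli below.
  have hneg : ∀ n : ℕ, ∃ S : Set ℝ, MeasurableSet S ∧
      volume.restrict J S < ENNReal.ofReal ((1 / 2) ^ n) ∧ ∃ f : L1 I, IsNonneg f ∧
      1 / 2 * ‖f‖ < ∫ w in S, ‖K f w‖ ∂(volume.restrict J) := by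
    intro n
    by_contra h
    push Not at h
    exact hcon ⟨(1 / 2) ^ n, by positivity, fun S h1 h2 f h3 => h S h1 h2 f h3⟩
  choose S hSm hS f hf hfS using hneg
  obtain ⟨r, hr, Z, hZ, hrZ⟩ := hw.exists_ball
  have hfpos : ∀ n, 0 < ‖f n‖ := by
    intro n
    refine norm_pos_iff.2 fun h0 => ?_
    have h1 := hfS n
    have h2 := setIntegral_norm_le_norm (K (f n)) (S n)
    rw [h0, map_zero, norm_zero] at h2
    rw [h0, norm_zero, mul_zero, map_zero] at h1
    linarith
  -- Rescaling to norm `r / 2` places every `f n` inside the ball that `K` maps into the compact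
  -- set.
  obtain ⟨c, hc⟩ : ∃ c : ℕ → ℝ, ∀ n, c n = r / (2 * ‖f n‖) := ⟨_, fun _ => rfl⟩
  have hc0 : ∀ n, 0 ≤ c n := fun n => by have := hfpos n; rw [hc]; positivity
  have hcf : ∀ n, c n * ‖f n‖ = r / 2 := fun n => by
    have := (hfpos n).ne'
    rw [hc]; field_simp
  have hball : ∀ n, toWeakSpace ℂ (L1 J) (K ((c n : ℂ) • f n)) ∈ Z := by
    intro n
    refine hrZ _ ?_
    rw [mem_ball_zero_iff, norm_smul, Complex.norm_real, Real.norm_of_nonneg (hc0 n), hcf]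
    linarith
  -- The tail unions form a decreasing sequence containing the sets `S m`; their intersection is the
  -- null set `limsup S`.
  have hUm : ∀ n, MeasurableSet (⋃ m, ⋃ (_ : n ≤ m), S m) := fun n =>
    MeasurableSet.iUnion fun m => MeasurableSet.iUnion fun _ => hSm m
  have hzero : (volume.restrict J) (⋂ n, ⋃ m, ⋃ (_ : n ≤ m), S m) = 0 := by
    have := measure_limsup_atTop_eq_zero (μ := volume.restrict J) (s := S) (ne_of_lt ?_)
    · rw [limsup_eq_iInf_iSup_of_nat] at this
      simpa only [iSup_eq_iUnion, iInf_eq_iInter] using this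
    · refine lt_of_le_of_lt (ENNReal.tsum_le_tsum fun n => (hS n).le) ?_
      rw [← ENNReal.ofReal_tsum_of_nonneg (fun n => by positivity)
        (summable_geometric_of_lt_one (by norm_num) (by norm_num))]
      exact ENNReal.ofReal_lt_top
  -- `r / 4` is half of the norm `r / 2`: by construction more than that amount of `K (c m • f m)`
  -- sits on `S m`, which is part of the tail union.
  obtain ⟨n, m, hnm, hlt⟩ := exists_setIntegral_lt_of_isCompact_weak hZ hball hUm
    (fun n m hnm => iUnion_mono fun i => iUnion_mono' fun hi => ⟨hnm.trans hi, Subset.rfl⟩) hzero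
    (c := r / 4) (by positivity)
  have h1 := (hK _ ((hf m).smul (hc0 m))).1
  have h2 : ∫ w in ⋃ m, ⋃ (_ : n ≤ m), S m, (K ((c m : ℂ) • f m) w).re ∂(volume.restrict J)
      = ∫ w in ⋃ m, ⋃ (_ : n ≤ m), S m, ‖K ((c m : ℂ) • f m) w‖ ∂(volume.restrict J) :=
    integral_congr_ae (ae_restrict_of_ae (h1.norm_eq.mono fun w hw => hw.symm))
  have h3 : ∫ w in S m, ‖K ((c m : ℂ) • f m) w‖ ∂(volume.restrict J)
      ≤ ∫ w in ⋃ m, ⋃ (_ : n ≤ m), S m, ‖K ((c m : ℂ) • f m) w‖ ∂(volume.restrict J) :=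
    setIntegral_mono_set (integrable_Lp _).norm.integrableOn
      (Eventually.of_forall fun _ => norm_nonneg _)
      (LE.le.eventuallyLE (subset_iUnion₂_of_subset m hnm Subset.rfl))
  rw [map_smul, setIntegral_norm_smul, Complex.norm_real, Real.norm_of_nonneg (hc0 m)] at h3
  have h5 := mul_le_mul_of_nonneg_left (hfS m).le (hc0 m)
  rw [map_smul] at h2 hlt
  have h6 := hcf m
  nlinarith

/-- At worst the `A` part goes entirely to the small set, at the cost `α`. For `α + β = 1`, `β > 0`
and `q < 1` the new proportion is still below `1`. -/
theorem SmallSetBound.convex {A B : L1 I →L[ℂ] L1 J} (hA : IsStochastic A) {δ q α β : ℝ}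
    (hB : SmallSetBound δ q B) (hα : 0 ≤ α) (hβ : 0 ≤ β) :
    SmallSetBound δ (α + β * q) ((α : ℂ) • A + (β : ℂ) • B) := by
  intro S hS hδ f hf
  have h1 : ∫ w in S, ‖A f w‖ ∂(volume.restrict J) ≤ ‖f‖ := by
    rw [← (hA f hf).2]
    exact setIntegral_norm_le_norm _ _
  have h2 := hB S hS hδ f hf
  have h3 : ∫ w in S, ‖((α : ℂ) • A + (β : ℂ) • B) f w‖ ∂(volume.restrict J)
      ≤ ∫ w in S, (α * ‖A f w‖ + β * ‖B f w‖) ∂(volume.restrict J) := by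
    refine integral_mono_ae (integrable_Lp _).norm.integrableOn
      (((integrable_Lp _).norm.const_mul _).add ((integrable_Lp _).norm.const_mul _)).integrableOn
      (ae_restrict_of_ae ?_)
    change ∀ᵐ w ∂(volume.restrict J), ‖((α : ℂ) • A f + (β : ℂ) • B f : L1 J) w‖ ≤ _
    filter_upwards [Lp.coeFn_add ((α : ℂ) • A f) ((β : ℂ) • B f), Lp.coeFn_smul (α : ℂ) (A f),
      Lp.coeFn_smul (β : ℂ) (B f)] with w h1 h2 h3
    rw [h1, Pi.add_apply, h2, h3, Pi.smul_apply, Pi.smul_apply]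
    refine (norm_add_le _ _).trans (le_of_eq ?_)
    rw [norm_smul, norm_smul, Complex.norm_real,
      Complex.norm_real, Real.norm_of_nonneg hα, Real.norm_of_nonneg hβ]
  rw [integral_add ((integrable_Lp _).norm.const_mul _).integrableOn
    ((integrable_Lp _).norm.const_mul _).integrableOn, integral_const_mul,
    integral_const_mul] at h3
  nlinarith [mul_le_mul_of_nonneg_left h1 hα, mul_le_mul_of_nonneg_left h2 hβ]

end Stochastic

/-! ### Concentration of the phase -/

/-- The distance of `z` to the union of the rays spanned by the elements of `T`. -/
def rayDist (T : Finset ℂ) (hT : T.Nonempty) (z : ℂ) : ℝ := T.inf' hT fun c => ‖z - c * ‖z‖‖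

theorem rayDist_le {T : Finset ℂ} (hT : T.Nonempty) {c : ℂ} (hc : c ∈ T) (z : ℂ) :
    rayDist T hT z ≤ ‖z - c * ‖z‖‖ := Finset.inf'_le _ hc

theorem exists_rayDist_eq {T : Finset ℂ} (hT : T.Nonempty) (z : ℂ) :
    ∃ c ∈ T, rayDist T hT z = ‖z - c * ‖z‖‖ := Finset.exists_mem_eq_inf' hT _

theorem rayDist_nonneg {T : Finset ℂ} (hT : T.Nonempty) (z : ℂ) : 0 ≤ rayDist T hT z := by
  obtain ⟨c, -, h⟩ := exists_rayDist_eq hT z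
  rw [h]; exact norm_nonneg _

theorem continuous_rayDist {T : Finset ℂ} (hT : T.Nonempty) : Continuous (rayDist T hT) :=
  Continuous.finset_inf'_apply hT fun c _ => by fun_prop

/-- For a fixed unimodular `c` both `z` and `c ‖z‖` move by at most `‖z - z'‖`, whence the factor
`2`. -/
theorem rayDist_le_add {T : Finset ℂ} (hT : T.Nonempty) (hT1 : ∀ c ∈ T, ‖c‖ = 1) (z z' : ℂ) :
    rayDist T hT z ≤ rayDist T hT z' + 2 * ‖z - z'‖ := by
  obtain ⟨c, hc, h⟩ := exists_rayDist_eq hT z'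
  refine (rayDist_le hT hc z).trans ?_
  rw [h]
  have e : z - c * ‖z‖ = (z' - c * ‖z'‖) + (z - z') + c * ((‖z'‖ - ‖z‖ : ℝ) : ℂ) := by
    push_cast; ring
  rw [e]
  refine (norm_add₃_le).trans ?_
  rw [norm_mul, hT1 c hc, one_mul, Complex.norm_real, Real.norm_eq_abs]
  have := abs_norm_sub_norm_le z' z
  rw [norm_sub_rev z' z] at this
  linarith

theorem rayDist_le_two_mul {T : Finset ℂ} (hT : T.Nonempty) (hT1 : ∀ c ∈ T, ‖c‖ = 1) (z : ℂ) :
    rayDist T hT z ≤ 2 * ‖z‖ := by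
  obtain ⟨c, hc⟩ := hT
  have h0 := rayDist_le ⟨c, hc⟩ hc 0
  have h1 := rayDist_le_add ⟨c, hc⟩ hT1 z 0
  simp at h0
  rw [sub_zero] at h1
  linarith

theorem integrable_rayDist {α : Type*} [MeasurableSpace α] {μ : Measure α} {T : Finset ℂ}
    (hT : T.Nonempty) (hT1 : ∀ c ∈ T, ‖c‖ = 1) {f : α → ℂ} (hf : Integrable f μ) :
    Integrable (fun x => rayDist T hT (f x)) μ := by
  refine Integrable.mono' (hf.norm.const_mul 2)
    ((continuous_rayDist hT).comp_aestronglyMeasurable hf.aestronglyMeasurable)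
    (Eventually.of_forall fun x => ?_)
  rw [Real.norm_of_nonneg (rayDist_nonneg hT _)]
  exact rayDist_le_two_mul hT hT1 _

/-- A measurable approximation, with finitely many values, of the phase of a complex number. -/
theorem exists_phase_approx {r : ℝ} (hr : 0 < r) : ∃ (N : Finset ℂ) (c : ℂ → ℂ), Measurable c ∧
    (∀ z, c z ∈ N) ∧ (∀ p ∈ N, ‖p‖ = 1) ∧ ∀ z, ‖z - c z * ‖z‖‖ ≤ r * ‖z‖ := by
  obtain ⟨m, hm⟩ := exists_nat_gt (1 / r)
  have hm0 : (0 : ℝ) < m := lt_trans (by positivity) hm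
  -- Arguments are rounded down to multiples of `1 / m < r`. As `|arg z| ≤ π < 4`, only the indices
  -- `|j| ≤ 4 m` occur.
  set e : ℤ → ℂ := fun j => Complex.exp ((j / m : ℝ) * Complex.I) with he
  refine ⟨(Finset.Icc (-(4 * m : ℤ)) (4 * m)).image e, fun z => e ⌊m * z.arg⌋, ?_, ?_, ?_, ?_⟩
  · exact (measurable_from_top (f := e)).comp
      (Int.measurable_floor.comp (Complex.measurable_arg.const_mul _))
  · intro z
    have h1 := Complex.neg_pi_lt_arg z
    have h2 := Complex.arg_le_pi z
    have h3 := Real.pi_lt_four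
    refine Finset.mem_image_of_mem e (Finset.mem_Icc.2 ⟨?_, ?_⟩)
    · refine Int.le_floor.2 ?_
      push_cast; nlinarith
    · have : ((⌊m * z.arg⌋ : ℤ) : ℝ) ≤ ((4 * m : ℤ) : ℝ) :=
        (Int.floor_le _).trans (by push_cast; nlinarith)
      exact_mod_cast this
  · intro p hp
    obtain ⟨j, -, rfl⟩ := Finset.mem_image.1 hp
    exact Complex.norm_exp_ofReal_mul_I _
  · intro z
    have e1 : z - e ⌊m * z.arg⌋ * ‖z‖ = (‖z‖ * e ⌊m * z.arg⌋) *
        (Complex.exp (Complex.I * ((z.arg - ⌊m * z.arg⌋ / m : ℝ) : ℂ)) - 1) := by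
      have e2 : ((⌊m * z.arg⌋ / m : ℝ) : ℂ) * Complex.I
          + Complex.I * ((z.arg - ⌊m * z.arg⌋ / m : ℝ) : ℂ) = z.arg * Complex.I := by
        push_cast; ring
      rw [mul_sub, mul_assoc, he]
      simp only
      rw [← Complex.exp_add, e2, Complex.norm_mul_exp_arg_mul_I]
      ring
    rw [e1, norm_mul, norm_mul, Complex.norm_real, norm_norm, he]
    simp only
    rw [Complex.norm_exp_ofReal_mul_I, mul_one, mul_comm]
    refine mul_le_mul_of_nonneg_right ?_ (norm_nonneg _)
    refine (Real.norm_exp_I_mul_ofReal_sub_one_le).trans ?_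
    have h1 := Int.floor_le (m * z.arg)
    have h2 := Int.lt_floor_add_one (m * z.arg)
    have h3 : z.arg - ⌊m * z.arg⌋ / m = (m * z.arg - ⌊m * z.arg⌋) / m := by field_simp
    rw [h3, Real.norm_of_nonneg (div_nonneg (by linarith) hm0.le), div_le_iff₀ hm0]
    rw [div_lt_iff₀ hr] at hm
    nlinarith

/-- A separated subset of maximal cardinality is a net: a point far from all of it could be added.
-/
theorem exists_separated_net (H : Finset ℂ) {ρ : ℝ} (hρ : 0 < ρ) : ∃ T ⊆ H,
    (∀ x ∈ T, ∀ y ∈ T, x ≠ y → ρ ≤ ‖x - y‖) ∧ ∀ p ∈ H, ∃ t ∈ T, ‖p - t‖ < ρ := by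
  classical
  obtain ⟨T, hT, hmax⟩ := Finset.exists_max_image
    (H.powerset.filter fun T => ∀ x ∈ T, ∀ y ∈ T, x ≠ y → ρ ≤ ‖x - y‖) Finset.card
    ⟨∅, by simp⟩
  rw [Finset.mem_filter, Finset.mem_powerset] at hT
  refine ⟨T, hT.1, hT.2, fun p hp => ?_⟩
  by_contra! h
  have hpT : p ∉ T := fun hpT => by
    have := h p hpT
    simp at this
    linarith
  have := hmax (insert p T) ?_
  · rw [Finset.card_insert_of_notMem hpT] at this
    omega
  · rw [Finset.mem_filter, Finset.mem_powerset]
    refine ⟨Finset.insert_subset hp hT.1, fun x hx y hy hxy => ?_⟩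
    rcases Finset.mem_insert.1 hx with rfl | hx'
    · rcases Finset.mem_insert.1 hy with rfl | hy
      · exact absurd rfl hxy
      · exact h y hy
    · rcases Finset.mem_insert.1 hy with rfl | hy
      · rw [norm_sub_rev]; exact h x hx'
      · exact hT.2 x hx' y hy hxy

theorem norm_sign_le_one (Y : ℂ) : ‖Y / ‖Y‖‖ ≤ 1 := by
  rw [norm_div, Complex.norm_real, norm_norm]
  exact div_self_le_one _

/-- If a sum of terms on rays has almost maximal modulus, then these rays are close to the sum. -/
theorem sum_mul_sq_le {N : Finset ℂ} (hN : ∀ p ∈ N, ‖p‖ = 1) {x : ℂ → ℝ} (hx : ∀ p ∈ N, 0 ≤ x p)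
    {Y : ℂ} {b : ℝ} (hY : ‖Y - ∑ p ∈ N, p * x p‖ ≤ b) :
    ∑ p ∈ N, x p * ‖Y / ‖Y‖ - p‖ ^ 2 ≤ 2 * (b + ∑ p ∈ N, x p - ‖Y‖) := by
  set η : ℂ := Y / ‖Y‖ with hη
  have hη1 : ‖η‖ ≤ 1 := norm_sign_le_one Y
  have h1 : ‖Y‖ = (star η * Y).re := by
    rw [hη, star_div₀]
    by_cases h : ‖Y‖ = 0
    · simp [h]
    · have : star Y / star (‖Y‖ : ℂ) * Y = (‖Y‖ : ℂ) := by
        have h2 : (‖Y‖ : ℂ) ≠ 0 := by exact_mod_cast h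
        have h3 : star Y * Y = (‖Y‖ : ℂ) ^ 2 := Complex.conj_mul' Y
        have h4 : star (‖Y‖ : ℂ) = (‖Y‖ : ℂ) := Complex.conj_ofReal _
        rw [h4, div_mul_eq_mul_div, h3]
        field_simp
      rw [this, Complex.ofReal_re]
  have h2 : (star η * (Y - ∑ p ∈ N, p * x p)).re ≤ b := by
    refine (Complex.re_le_norm _).trans ?_
    rw [norm_mul, norm_star]
    nlinarith [norm_nonneg (Y - ∑ p ∈ N, p * (x p : ℂ))]
  have h3 : (star η * ∑ p ∈ N, p * x p).re = ∑ p ∈ N, x p * (star η * p).re := by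
    rw [Finset.mul_sum, Complex.re_sum]
    refine Finset.sum_congr rfl fun p _ => ?_
    rw [← mul_assoc, mul_comm, Complex.re_ofReal_mul]
  rw [mul_sub, Complex.sub_re, ← h1, h3] at h2
  -- Expanding the square with `‖η‖ ≤ 1 = ‖p‖` gives `‖η - p‖² ≤ 2 - 2 Re (η̄ p)`. The case `Y = 0`,
  -- where `η = 0`, needs no exception.
  have h4 : ∀ p ∈ N, x p * ‖η - p‖ ^ 2 ≤ 2 * x p - 2 * (x p * (star η * p).re) := by
    intro p hp
    have h5 : ‖η - p‖ ^ 2 = ‖η‖ ^ 2 - 2 * (star η * p).re + ‖p‖ ^ 2 := by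
      rw [← Complex.normSq_eq_norm_sq, ← Complex.normSq_eq_norm_sq, ← Complex.normSq_eq_norm_sq,
        Complex.normSq_sub]
      have : (η * (starRingEnd ℂ) p).re = (star η * p).re := by
        simp [Complex.mul_re]
      rw [this]; ring
    rw [h5, hN p hp]
    nlinarith [hx p hp, norm_nonneg η, mul_nonneg (hx p hp) (sub_nonneg.2 hη1),
      mul_nonneg (mul_nonneg (hx p hp) (sub_nonneg.2 hη1)) (norm_nonneg η)]
  refine (Finset.sum_le_sum h4).trans ?_
  rw [Finset.sum_sub_distrib, ← Finset.mul_sum, ← Finset.mul_sum]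
  linarith

/-- For every `p` the ray distance of `Y` is at most `‖Y‖ (‖η - p‖ + ‖p - t p‖)`, where `η` is the
phase of `Y`; this is averaged with the weights `x p`, whose total is at least `‖Y‖`. Only squares
of `‖η - p‖` are controlled later, hence the replacement of `d` by `ρ + d² / ρ`. -/
theorem rayDist_le_sum {T : Finset ℂ} (hT : T.Nonempty) {N : Finset ℂ} {x : ℂ → ℝ}
    (hx : ∀ p ∈ N, 0 ≤ x p) {Y : ℂ} (hY : ‖Y‖ ≤ ∑ p ∈ N, x p) {t : ℂ → ℂ}
    (ht : ∀ p ∈ N, t p ∈ T) {ρ : ℝ} (hρ : 0 < ρ) :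
    rayDist T hT Y ≤ ∑ p ∈ N, x p * (ρ + ‖Y / ‖Y‖ - p‖ ^ 2 / ρ + ‖p - t p‖) := by
  have hnn : ∀ p ∈ N, 0 ≤ x p * (ρ + ‖Y / ‖Y‖ - p‖ ^ 2 / ρ + ‖p - t p‖) := fun p hp => by
    have := hx p hp; positivity
  by_cases h0 : Y = 0
  · refine le_trans ?_ (Finset.sum_nonneg hnn)
    obtain ⟨c, hc⟩ := hT
    refine (rayDist_le _ hc Y).trans ?_
    simp [h0]
  have hYpos : 0 < ‖Y‖ := norm_pos_iff.2 h0
  have key : ∀ p ∈ N, rayDist T hT Y ≤ ‖Y‖ * (ρ + ‖Y / ‖Y‖ - p‖ ^ 2 / ρ + ‖p - t p‖) := by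
    intro p hp
    refine (rayDist_le hT (ht p hp) Y).trans ?_
    have e : Y - t p * ‖Y‖ = ‖Y‖ * ((Y / ‖Y‖ - p) + (p - t p)) := by
      have : (‖Y‖ : ℂ) ≠ 0 := by exact_mod_cast hYpos.ne'
      field_simp; ring
    rw [e, norm_mul, Complex.norm_real, norm_norm]
    refine mul_le_mul_of_nonneg_left ((norm_add_le _ _).trans ?_) hYpos.le
    have : ‖Y / ‖Y‖ - p‖ ≤ ρ + ‖Y / ‖Y‖ - p‖ ^ 2 / ρ := by
      rw [← sub_le_iff_le_add', le_div_iff₀ hρ]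
      nlinarith [sq_nonneg (‖Y / ‖Y‖ - p‖ - ρ), norm_nonneg (Y / ‖Y‖ - p), sq_nonneg ρ]
    linarith
  refine le_of_mul_le_mul_left ?_ hYpos
  calc ‖Y‖ * rayDist T hT Y ≤ (∑ p ∈ N, x p) * rayDist T hT Y :=
        mul_le_mul_of_nonneg_right hY (rayDist_nonneg _ _)
    _ = ∑ p ∈ N, x p * rayDist T hT Y := Finset.sum_mul _ _ _
    _ ≤ ∑ p ∈ N, x p * (‖Y‖ * (ρ + ‖Y / ‖Y‖ - p‖ ^ 2 / ρ + ‖p - t p‖)) :=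
        Finset.sum_le_sum fun p hp => mul_le_mul_of_nonneg_left (key p hp) (hx p hp)
    _ = _ := by
        rw [Finset.mul_sum]
        exact Finset.sum_congr rfl fun p _ => by ring

/-! ### The phase decomposition of a function and of its image under a stochastic operator -/

section Concentration

variable {I J : Set ℝ}

theorem coeFn_sum {ι α : Type*} [MeasurableSpace α] {μ : Measure α} (s : Finset ι)
    (f : ι → Lp ℂ 1 μ) : ⇑(∑ i ∈ s, f i) =ᵐ[μ] fun x => ∑ i ∈ s, f i x := by
  classical
  induction s using Finset.induction_on with
  | empty =>
    simp only [Finset.sum_empty]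
    exact Lp.coeFn_zero ℂ 1 μ
  | insert a s ha ih =>
    rw [Finset.sum_insert ha]
    filter_upwards [Lp.coeFn_add (f a) (∑ i ∈ s, f i), ih] with x h1 h2
    rw [h1, Pi.add_apply, h2, Finset.sum_insert ha]

/-- The part of the modulus of `u` which is carried by the set where the approximate phase of `u`
is `p`. -/
def phasePart (c : ℂ → ℂ) (u : L1 I) (p : ℂ) : L1 I :=
  mulL _ (((fun v => c (u v)) ⁻¹' {p}).indicator fun _ => 1) (absL u)

theorem coe_phasePart {c : ℂ → ℂ} (hc : Measurable c) (u : L1 I) (p : ℂ) :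
    ∀ᵐ v ∂(volume.restrict I), phasePart c u p v = if c (u v) = p then (‖u v‖ : ℂ) else 0 := by
  have hm : MeasurableSet ((fun v => c (u v)) ⁻¹' {p}) :=
    (hc.comp (Lp.stronglyMeasurable u).measurable) (measurableSet_singleton p)
  filter_upwards [coe_mulL (memLp_indicator_one (μ := volume.restrict I) hm) (absL u),
    coe_absL u] with v h1 h2
  rw [phasePart, h1, h2]
  by_cases h : c (u v) = p <;> simp [indicator, h]

theorem isNonneg_phasePart {c : ℂ → ℂ} (hc : Measurable c) (u : L1 I) (p : ℂ) :
    IsNonneg (phasePart c u p) := by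
  filter_upwards [coe_phasePart hc u p] with v hv
  rw [hv]
  by_cases h : c (u v) = p <;> simp [h]

theorem sum_phasePart {c : ℂ → ℂ} (hc : Measurable c) {N : Finset ℂ} (hN : ∀ z, c z ∈ N)
    (u : L1 I) : ∑ p ∈ N, phasePart c u p = absL u := by
  refine Lp.ext ?_
  have h := (ae_ball_iff N.countable_toSet).2 fun p (_ : p ∈ (N : Set ℂ)) => coe_phasePart hc u p
  filter_upwards [coeFn_sum N (phasePart c u), h, coe_absL u] with v h1 h2 h3
  rw [h1, h3, Finset.sum_congr rfl h2, Finset.sum_ite_eq, if_pos (hN _)]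

theorem coe_sum_smul_phasePart {c : ℂ → ℂ} (hc : Measurable c) {N : Finset ℂ} (hN : ∀ z, c z ∈ N)
    (u : L1 I) : ∀ᵐ v ∂(volume.restrict I),
      (∑ p ∈ N, p • phasePart c u p : L1 I) v = c (u v) * ‖u v‖ := by
  have h := (ae_ball_iff N.countable_toSet).2 fun p (_ : p ∈ (N : Set ℂ)) => coe_phasePart hc u p
  have h' := (ae_ball_iff N.countable_toSet).2 fun p (_ : p ∈ (N : Set ℂ)) =>
    Lp.coeFn_smul p (phasePart c u p)
  filter_upwards [coeFn_sum N (fun p => p • phasePart c u p), h, h'] with v h1 h2 h3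
  rw [h1, Finset.sum_congr rfl fun p hp => (h3 p hp).trans (by rw [Pi.smul_apply, h2 p hp])]
  simp [hN]

theorem IsStochastic.sum_norm_phasePart {O : L1 I →L[ℂ] L1 J} (hO : IsStochastic O) {c : ℂ → ℂ}
    (hc : Measurable c) {N : Finset ℂ} (hN : ∀ z, c z ∈ N) (u : L1 I) :
    ∀ᵐ w ∂(volume.restrict J), (O (absL u) w).re = ∑ p ∈ N, ‖O (phasePart c u p) w‖ := by
  have h := (ae_ball_iff N.countable_toSet).2 fun p (_ : p ∈ (N : Set ℂ)) =>
    (hO _ (isNonneg_phasePart hc u p)).1.norm_eq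
  rw [← sum_phasePart hc hN u, map_sum]
  filter_upwards [coeFn_sum N (fun p => O (phasePart c u p)), h] with w h1 h2
  rw [h1, Complex.re_sum]
  exact (Finset.sum_congr rfl h2).symm

theorem sum_norm_phasePart_eq {c : ℂ → ℂ} (hc : Measurable c) {N : Finset ℂ} (hN : ∀ z, c z ∈ N)
    (u : L1 I) : ∑ p ∈ N, ‖phasePart c u p‖ = ‖u‖ := by
  simp_rw [norm_eq_integral]
  rw [← integral_finsetSum _ fun p _ => (integrable_Lp _).norm]
  refine integral_congr_ae ?_
  have h := (ae_ball_iff N.countable_toSet).2 fun p (_ : p ∈ (N : Set ℂ)) => coe_phasePart hc u p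
  filter_upwards [h] with v h2
  rw [Finset.sum_congr rfl fun p hp => congrArg norm (h2 p hp)]
  have : ∀ p ∈ N, ‖(if c (u v) = p then (‖u v‖ : ℂ) else 0)‖ = if c (u v) = p then ‖u v‖ else 0 := by
    intro p _
    by_cases hp : c (u v) = p <;> simp [hp]
  rw [Finset.sum_congr rfl this, Finset.sum_ite_eq, if_pos (hN _)]

/-- The pointwise form of the phase decomposition of `O u`. -/
theorem IsStochastic.norm_sub_sum_le {O : L1 I →L[ℂ] L1 J} (hO : IsStochastic O) {c : ℂ → ℂ}
    (hc : Measurable c) {N : Finset ℂ} (hN : ∀ z, c z ∈ N) {r : ℝ} (hr : 0 ≤ r)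
    (hcr : ∀ z, ‖z - c z * ‖z‖‖ ≤ r * ‖z‖) (u : L1 I) :
    ∀ᵐ w ∂(volume.restrict J), ‖O u w - ∑ p ∈ N, p * (‖O (phasePart c u p) w‖ : ℂ)‖
      ≤ r * ∑ p ∈ N, ‖O (phasePart c u p) w‖ := by
  have hdom : ∀ᵐ v ∂(volume.restrict I), ‖(u - ∑ p ∈ N, p • phasePart c u p : L1 I) v‖
      ≤ (((r : ℂ) • absL u : L1 I) v).re := by
    filter_upwards [coe_sum_smul_phasePart hc hN u, coe_absL u,
      Lp.coeFn_sub u (∑ p ∈ N, p • phasePart c u p), Lp.coeFn_smul (r : ℂ) (absL u)]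
      with v h1 h2 h3 h4
    rw [h3, Pi.sub_apply, h1, h4, Pi.smul_apply, h2, smul_eq_mul, ← Complex.ofReal_mul,
      Complex.ofReal_re]
    exact hcr _
  have h := (ae_ball_iff N.countable_toSet).2 fun p (_ : p ∈ (N : Set ℂ)) =>
    ((hO _ (isNonneg_phasePart hc u p)).1.norm_eq.and (hO _ (isNonneg_phasePart hc u p)).1)
  have h' := (ae_ball_iff N.countable_toSet).2 fun p (_ : p ∈ (N : Set ℂ)) =>
    Lp.coeFn_smul p (O (phasePart c u p))
  have e : O (u - ∑ p ∈ N, p • phasePart c u p) = O u - ∑ p ∈ N, p • O (phasePart c u p) := by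
    rw [map_sub, map_sum]
    simp_rw [map_smul]
  have hd := hO.domination ((isNonneg_absL u).smul hr) hdom
  rw [e, map_smul] at hd
  filter_upwards [hd, h, h', hO.sum_norm_phasePart hc hN u,
    Lp.coeFn_sub (O u) (∑ p ∈ N, p • O (phasePart c u p)), Lp.coeFn_smul (r : ℂ) (O (absL u)),
    coeFn_sum N (fun p => p • O (phasePart c u p))] with w h1 h2 h3 h4 h5 h6 h7
  rw [h5, Pi.sub_apply, h6, Pi.smul_apply, smul_eq_mul, Complex.re_ofReal_mul, h4, h7,
    Finset.sum_congr rfl fun p hp => h3 p hp] at h1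
  refine le_trans (le_of_eq ?_) h1
  congr 2
  refine Finset.sum_congr rfl fun p hp => ?_
  rw [Pi.smul_apply, smul_eq_mul]
  congr 1
  exact Complex.ext (by rw [Complex.ofReal_re, (h2 p hp).1])
    (by rw [Complex.ofReal_im, (h2 p hp).2.2])

/-- The phase of a function. -/
def sign (f : ℝ → ℂ) (w : ℝ) : ℂ := f w / ‖f w‖

theorem integrable_norm_mul_sign (f g : L1 J) (p : ℂ) :
    Integrable (fun w => ‖f w‖ * ‖sign g w - p‖ ^ 2) (volume.restrict J) := by
  have hm : Measurable (sign g) := (Lp.stronglyMeasurable g).measurable.div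
    (Complex.measurable_ofReal.comp (Lp.stronglyMeasurable g).measurable.norm)
  refine Integrable.mono' ((integrable_Lp f).norm.mul_const ((1 + ‖p‖) ^ 2))
    ((integrable_Lp f).norm.aestronglyMeasurable.mul
      ((hm.sub_const p).norm.pow_const 2).aestronglyMeasurable)
    (Eventually.of_forall fun w => ?_)
  rw [Real.norm_of_nonneg (by positivity)]
  refine mul_le_mul_of_nonneg_left (pow_le_pow_left₀ (norm_nonneg _) ?_ 2) (norm_nonneg _)
  exact (norm_sub_le _ _).trans (add_le_add_left (norm_sign_le_one _) _)

theorem measurableSet_sign_near (g : L1 J) (p : ℂ) (ρ : ℝ) :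
    MeasurableSet {w | ‖sign g w - p‖ < ρ} := by
  have hm : Measurable (sign g) := (Lp.stronglyMeasurable g).measurable.div
    (Complex.measurable_ofReal.comp (Lp.stronglyMeasurable g).measurable.norm)
  exact measurableSet_lt (hm.sub_const p).norm measurable_const

/-- Integrate `sum_mul_sq_le` with the weights `|O u_p|`, where `u_p` is the piece of `|u|` with
phase `p`. These weights have total integral `‖u‖`, because `O` preserves the norms of the
nonnegative pieces. If `O` loses little norm on `u`, each piece must therefore land where `O u` has
nearly its own phase. -/
theorem IsStochastic.energy_le {O : L1 I →L[ℂ] L1 J} (hO : IsStochastic O) {c : ℂ → ℂ}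
    (hc : Measurable c) {N : Finset ℂ} (hN : ∀ z, c z ∈ N) (hN1 : ∀ p ∈ N, ‖p‖ = 1) {r : ℝ}
    (hr : 0 ≤ r) (hcr : ∀ z, ‖z - c z * ‖z‖‖ ≤ r * ‖z‖) (u : L1 I) :
    ∑ p ∈ N, ∫ w, ‖O (phasePart c u p) w‖ * ‖sign (O u) w - p‖ ^ 2 ∂(volume.restrict J)
      ≤ 2 * ((1 + r) * ‖u‖ - ‖O u‖) := by
  rw [← integral_finsetSum _ fun p _ => integrable_norm_mul_sign _ _ _]
  have hi : Integrable (fun w => ∑ p ∈ N, ‖O (phasePart c u p) w‖) (volume.restrict J) :=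
    integrable_finsetSum _ fun p _ => (integrable_Lp _).norm
  have e : 2 * ((1 + r) * ‖u‖ - ‖O u‖) = ∫ w, 2 * ((1 + r) * ∑ p ∈ N, ‖O (phasePart c u p) w‖
      - ‖O u w‖) ∂(volume.restrict J) := by
    rw [integral_const_mul, integral_sub (hi.const_mul _) (integrable_Lp _).norm,
      integral_const_mul, integral_finsetSum _ fun p _ => (integrable_Lp _).norm,
      ← norm_eq_integral, ← sum_norm_phasePart_eq hc hN u]
    simp_rw [← norm_eq_integral]
    rw [Finset.sum_congr rfl fun p _ => (hO _ (isNonneg_phasePart hc u p)).2]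
  rw [e]
  refine integral_mono_ae (integrable_finsetSum _ fun p _ => integrable_norm_mul_sign _ _ _)
    (((hi.const_mul _).sub (integrable_Lp _).norm).const_mul _) ?_
  filter_upwards [hO.norm_sub_sum_le hc hN hr hcr u] with w hw
  refine (sum_mul_sq_le hN1 (x := fun p => ‖O (phasePart c u p) w‖)
    (fun p _ => norm_nonneg _) hw).trans (le_of_eq ?_)
  ring

theorem IsStochastic.norm_apply_le_sum {O : L1 I →L[ℂ] L1 J} (hO : IsStochastic O) {c : ℂ → ℂ}
    (hc : Measurable c) {N : Finset ℂ} (hN : ∀ z, c z ∈ N) (u : L1 I) :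
    ∀ᵐ w ∂(volume.restrict J), ‖O u w‖ ≤ ∑ p ∈ N, ‖O (phasePart c u p) w‖ := by
  have h : ∀ᵐ v ∂(volume.restrict I), ‖u v‖ ≤ (absL u v).re := by
    filter_upwards [coe_absL u] with v hv
    rw [hv, Complex.ofReal_re]
  filter_upwards [hO.domination (isNonneg_absL u) h, hO.sum_norm_phasePart hc hN u] with w h1 h2
  rwa [h2] at h1

/-- On the set where the approximate phase is `p`, the function is within `r |u|` of the ray of `p`,
and that ray is moved to the ray of `t p ∈ T`. -/
theorem integral_rayDist_le {c : ℂ → ℂ}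
    (hc : Measurable c) {N : Finset ℂ} (hN : ∀ z, c z ∈ N) {r : ℝ}
    (hcr : ∀ z, ‖z - c z * ‖z‖‖ ≤ r * ‖z‖) (u : L1 I) {T : Finset ℂ} (hT : T.Nonempty)
    (hT1 : ∀ c ∈ T, ‖c‖ = 1) {t : ℂ → ℂ} (ht : ∀ p ∈ N, t p ∈ T) :
    ∫ v, rayDist T hT (u v) ∂(volume.restrict I)
      ≤ r * ‖u‖ + ∑ p ∈ N, ‖p - t p‖ * ‖phasePart c u p‖ := by
  have e : r * ‖u‖ + ∑ p ∈ N, ‖p - t p‖ * ‖phasePart c u p‖ =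
      ∫ v, (r * ‖u v‖ + ∑ p ∈ N, ‖p - t p‖ * ‖phasePart c u p v‖) ∂(volume.restrict I) := by
    rw [integral_add ((integrable_Lp _).norm.const_mul _)
      (integrable_finsetSum _ fun p _ => (integrable_Lp _).norm.const_mul _), integral_const_mul,
      integral_finsetSum _ fun p _ => (integrable_Lp _).norm.const_mul _, ← norm_eq_integral]
    simp_rw [integral_const_mul, ← norm_eq_integral]
  rw [e]
  refine integral_mono_ae (integrable_rayDist hT hT1 (integrable_Lp u))
    (((integrable_Lp _).norm.const_mul _).add
      (integrable_finsetSum _ fun p _ => (integrable_Lp _).norm.const_mul _)) ?_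
  have h := (ae_ball_iff N.countable_toSet).2 fun p (_ : p ∈ (N : Set ℂ)) => coe_phasePart hc u p
  filter_upwards [h] with v h2
  have h3 : ∑ p ∈ N, ‖p - t p‖ * ‖phasePart c u p v‖ = ‖c (u v) - t (c (u v))‖ * ‖u v‖ := by
    have : ∀ p ∈ N, ‖p - t p‖ * ‖phasePart c u p v‖
        = if c (u v) = p then ‖p - t p‖ * ‖u v‖ else 0 := by
      intro p hp
      rw [h2 p hp]
      by_cases hp : c (u v) = p <;> simp [hp]
    rw [Finset.sum_congr rfl this, Finset.sum_ite_eq, if_pos (hN _)]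
  simp only [h3]
  refine (rayDist_le hT (ht _ (hN (u v))) _).trans ?_
  have e2 : u v - t (c (u v)) * ‖u v‖
      = (u v - c (u v) * ‖u v‖) + (c (u v) - t (c (u v))) * ‖u v‖ := by ring
  rw [e2]
  refine (norm_add_le _ _).trans (add_le_add (hcr _) (le_of_eq ?_))
  rw [norm_mul, Complex.norm_real, norm_norm]

/-- This integrates the pointwise estimate `rayDist_le_sum` for `Y = O u`; the quadratic terms are
bounded by `energy_le`. -/
theorem IsStochastic.integral_rayDist_apply_le {O : L1 I →L[ℂ] L1 J} (hO : IsStochastic O)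
    {c : ℂ → ℂ} (hc : Measurable c) {N : Finset ℂ} (hN : ∀ z, c z ∈ N) (hN1 : ∀ p ∈ N, ‖p‖ = 1)
    {r : ℝ} (hr : 0 ≤ r) (hcr : ∀ z, ‖z - c z * ‖z‖‖ ≤ r * ‖z‖) (u : L1 I) {T : Finset ℂ}
    (hT : T.Nonempty) (hT1 : ∀ c ∈ T, ‖c‖ = 1) {t : ℂ → ℂ} (ht : ∀ p ∈ N, t p ∈ T) {ρ : ℝ}
    (hρ : 0 < ρ) :
    ∫ w, rayDist T hT (O u w) ∂(volume.restrict J)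
      ≤ ρ * ‖u‖ + 2 * ((1 + r) * ‖u‖ - ‖O u‖) / ρ
        + ∑ p ∈ N, ‖p - t p‖ * ‖phasePart c u p‖ := by
  have hi : ∀ p, Integrable (fun w => ‖O (phasePart c u p) w‖ *
      (ρ + ‖sign (O u) w - p‖ ^ 2 / ρ + ‖p - t p‖)) (volume.restrict J) := by
    intro p
    have := (((integrable_Lp (O (phasePart c u p))).norm.const_mul ρ).add
      ((integrable_norm_mul_sign (O (phasePart c u p)) (O u) p).div_const ρ)).add
      ((integrable_Lp (O (phasePart c u p))).norm.const_mul ‖p - t p‖)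
    refine this.congr (Eventually.of_forall fun w => ?_)
    simp only [Pi.add_apply]
    ring
  have h1 : ∫ w, rayDist T hT (O u w) ∂(volume.restrict J) ≤ ∑ p ∈ N, ∫ w,
      ‖O (phasePart c u p) w‖ * (ρ + ‖sign (O u) w - p‖ ^ 2 / ρ + ‖p - t p‖)
        ∂(volume.restrict J) := by
    rw [← integral_finsetSum _ fun p _ => hi p]
    refine integral_mono_ae (integrable_rayDist hT hT1 (integrable_Lp _))
      (integrable_finsetSum _ fun p _ => hi p) ?_
    filter_upwards [hO.norm_apply_le_sum hc hN u] with w hw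
    exact rayDist_le_sum hT (x := fun p => ‖O (phasePart c u p) w‖) (fun p _ => norm_nonneg _) hw
      ht hρ
  refine h1.trans ?_
  have h2 : ∀ p ∈ N, ∫ w, ‖O (phasePart c u p) w‖ * (ρ + ‖sign (O u) w - p‖ ^ 2 / ρ + ‖p - t p‖)
        ∂(volume.restrict J) = ρ * ‖phasePart c u p‖ +
      (∫ w, ‖O (phasePart c u p) w‖ * ‖sign (O u) w - p‖ ^ 2 ∂(volume.restrict J)) / ρ
      + ‖p - t p‖ * ‖phasePart c u p‖ := by
    intro p _
    have hn : ∫ w, ‖O (phasePart c u p) w‖ ∂(volume.restrict J) = ‖phasePart c u p‖ := by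
      rw [← norm_eq_integral, (hO _ (isNonneg_phasePart hc u p)).2]
    have hA : Integrable (fun w => ρ * ‖O (phasePart c u p) w‖ +
        ‖O (phasePart c u p) w‖ * ‖sign (O u) w - p‖ ^ 2 / ρ) (volume.restrict J) :=
      ((integrable_Lp _).norm.const_mul _).add ((integrable_norm_mul_sign _ _ _).div_const _)
    rw [← hn, ← integral_const_mul, ← integral_const_mul, ← integral_div, ← integral_add
      ((integrable_Lp _).norm.const_mul _) ((integrable_norm_mul_sign _ _ _).div_const _),
      ← integral_add hA ((integrable_Lp _).norm.const_mul _)]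
    refine integral_congr_ae (Eventually.of_forall fun w => ?_)
    simp only
    ring
  rw [Finset.sum_congr rfl h2, Finset.sum_add_distrib, Finset.sum_add_distrib, ← Finset.mul_sum,
    ← Finset.sum_div, sum_norm_phasePart_eq hc hN]
  have h3 := hO.energy_le hc hN hN1 hr hcr u
  gcongr

/-- The pieces whose phase is taken by `O u` on a small set only have little mass. -/
theorem IsStochastic.light_mass_le {O : L1 I →L[ℂ] L1 J} (hO : IsStochastic O) {δ q : ℝ}
    (hS : SmallSetBound δ q O) {c : ℂ → ℂ} (hc : Measurable c) (u : L1 I) (p : ℂ) {ρ : ℝ}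
    (hρ : 0 < ρ) (hp : volume.restrict J {w | ‖sign (O u) w - p‖ < ρ} < ENNReal.ofReal δ) :
    (1 - q) * ‖phasePart c u p‖ ≤
      (∫ w, ‖O (phasePart c u p) w‖ * ‖sign (O u) w - p‖ ^ 2 ∂(volume.restrict J)) / ρ ^ 2 := by
  have hm := measurableSet_sign_near (O u) p ρ
  have h1 := hS _ hm hp _ (isNonneg_phasePart hc u p)
  -- Chebyshev: off the small set the phase of `O u` is at distance at least `ρ` from `p`. On the
  -- small set at most the proportion `q` of the piece can be found.
  have h2 : ∫ w in {w | ‖sign (O u) w - p‖ < ρ}ᶜ, ‖O (phasePart c u p) w‖ ∂(volume.restrict J) ≤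
      (∫ w, ‖O (phasePart c u p) w‖ * ‖sign (O u) w - p‖ ^ 2 ∂(volume.restrict J)) / ρ ^ 2 := by
    rw [← integral_div]
    refine le_trans (setIntegral_mono_on (integrable_Lp _).norm.integrableOn
      ((integrable_norm_mul_sign _ _ _).div_const _).integrableOn hm.compl fun w hw => ?_)
      (setIntegral_le_integral ((integrable_norm_mul_sign _ _ _).div_const _)
        (Eventually.of_forall fun w => by positivity))
    rw [le_div_iff₀ (by positivity)]
    refine mul_le_mul_of_nonneg_left (pow_le_pow_left₀ hρ.le ?_ 2) (norm_nonneg _)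
    rw [mem_compl_iff, mem_ofPred_eq, not_lt] at hw
    exact hw
  have h3 := integral_add_compl hm (integrable_Lp (O (phasePart c u p))).norm
  rw [← norm_eq_integral, (hO _ (isNonneg_phasePart hc u p)).2] at h3
  linarith

/-- The phases are `2 ρ`-separated, so the sets where the phase of `g` is `ρ`-close to one of them
are disjoint; each has measure at least `δ` inside a set of measure at most `1`. -/
theorem card_mul_le_of_separated {T : Finset ℂ} {g : L1 J} {ρ δ : ℝ} (hδ : 0 < δ)
    (hJ : volume J ≤ 1) (hsep : ∀ x ∈ T, ∀ y ∈ T, x ≠ y → 2 * ρ ≤ ‖x - y‖)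
    (hT : ∀ p ∈ T, ENNReal.ofReal δ ≤ volume.restrict J {w | ‖sign g w - p‖ < ρ}) :
    (T.card : ℝ) * δ ≤ 1 := by
  have h1 : ∑ p ∈ T, volume.restrict J {w | ‖sign g w - p‖ < ρ}
      = volume.restrict J (⋃ p ∈ T, {w | ‖sign g w - p‖ < ρ}) := by
    refine (measure_biUnion_finset (fun x hx y hy hxy => ?_)
      fun p _ => measurableSet_sign_near g p ρ).symm
    refine Set.disjoint_left.2 fun w hwx hwy => ?_
    rw [mem_ofPred_eq] at hwx hwy
    have h2 := hsep x hx y hy hxy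
    have h3 : ‖x - y‖ ≤ ‖sign g w - x‖ + ‖sign g w - y‖ := by
      have e : x - y = (sign g w - y) - (sign g w - x) := by ring
      rw [e, add_comm]
      exact norm_sub_le _ _
    linarith
  have h2 : (T.card : ENNReal) * ENNReal.ofReal δ ≤ 1 := by
    calc (T.card : ENNReal) * ENNReal.ofReal δ = ∑ p ∈ T, ENNReal.ofReal δ := by
          rw [Finset.sum_const, nsmul_eq_mul]
      _ ≤ ∑ p ∈ T, volume.restrict J {w | ‖sign g w - p‖ < ρ} := Finset.sum_le_sum hT
      _ ≤ volume.restrict J univ := by rw [h1]; exact measure_mono (subset_univ _)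
      _ ≤ 1 := by rwa [Measure.restrict_apply_univ]
  have h3 := ENNReal.toReal_mono ENNReal.one_ne_top h2
  rwa [ENNReal.toReal_mul, ENNReal.toReal_natCast, ENNReal.toReal_ofReal hδ.le,
    ENNReal.toReal_one] at h3

/-- If `O` almost preserves the norm of `u`, then the phases of `u` and of `O u` concentrate at a
number of points which is bounded in terms of `O` only. -/
theorem IsStochastic.phase_concentration {O : L1 I →L[ℂ] L1 J} (hO : IsStochastic O) {δ q : ℝ}
    (hδ : 0 < δ) (hq : q < 1) (hS : SmallSetBound δ q O) (hJ : volume J ≤ 1) {κ : ℝ}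
    (hκ : 0 < κ) : ∃ τ > 0, ∀ u : L1 I, ‖u‖ ≤ 1 → ‖u‖ - τ ≤ ‖O u‖ →
      ∃ (T : Finset ℂ) (hT : T.Nonempty), (∀ c ∈ T, ‖c‖ = 1) ∧ (T.card : ℝ) ≤ 1 / δ + 1 ∧
        ∫ v, rayDist T hT (u v) ∂(volume.restrict I) ≤ κ ∧
        ∫ w, rayDist T hT (O u w) ∂(volume.restrict J) ≤ κ := by
  classical
  -- The final error is at most `3 ρ + 4 σ / ρ + 8 σ / ((1 - q) ρ²)`. The choice of `ρ` bounds the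
  -- first term by `3 κ / 10`; `σ`, which serves both as norm defect and as phase resolution, makes
  -- the others at most `κ / 2`.
  obtain ⟨ρ, hρ⟩ : ∃ ρ, ρ = κ / 10 := ⟨_, rfl⟩
  have hρ0 : 0 < ρ := by rw [hρ]; positivity
  have hq' : 0 < 1 - q := by linarith
  obtain ⟨D, hD⟩ : ∃ D, D = 1 + 4 / ρ + 8 / ((1 - q) * ρ ^ 2) := ⟨_, rfl⟩
  have hD0 : 0 < D := by rw [hD]; positivity
  obtain ⟨σ, hσ⟩ : ∃ σ, σ = κ / 2 / D := ⟨_, rfl⟩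
  have hσ0 : 0 < σ := by rw [hσ]; positivity
  have hσD : σ + 4 * σ / ρ + 8 * σ / ((1 - q) * ρ ^ 2) = κ / 2 := by
    have : σ * D = κ / 2 := by rw [hσ]; field_simp
    rw [← this, hD]; ring
  refine ⟨σ, hσ0, fun u hu1 hu2 => ?_⟩
  obtain ⟨N, c, hc, hN, hN1, hcr⟩ := exists_phase_approx hσ0
  -- The heavy phases: those which `O u` takes approximately on a set of measure at least `δ`. A
  -- separated net among them has at most `1 / δ` elements.
  set H := N.filter fun p =>
    ENNReal.ofReal δ ≤ volume.restrict J {w | ‖sign (O u) w - p‖ < ρ} with hH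
  obtain ⟨T₀, hT₀H, hsep, hnet⟩ := exists_separated_net H (ρ := 2 * ρ) (by positivity)
  have hcard := card_mul_le_of_separated (J := J) (g := O u) hδ hJ hsep
    fun p hp => (Finset.mem_filter.1 (hT₀H hp)).2
  choose! t₀ ht₀ ht₀' using hnet
  -- Heavy phases move to the net, light ones to the arbitrary value `1`. Adjoining `1` accounts for
  -- the extra unit in the cardinality bound and keeps the set nonempty.
  set t : ℂ → ℂ := fun p => if p ∈ H then t₀ p else 1 with ht
  have hT1 : ∀ c ∈ insert 1 T₀, ‖c‖ = 1 := by
    intro c hc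
    rcases Finset.mem_insert.1 hc with rfl | hc
    · exact norm_one
    · exact hN1 c (Finset.mem_filter.1 (hT₀H hc)).1
  have htT : ∀ p ∈ N, t p ∈ insert 1 T₀ := by
    intro p _
    rw [ht]
    by_cases hp : p ∈ H
    · simp only [hp, if_true]
      exact Finset.mem_insert_of_mem (ht₀ p hp)
    · simp only [hp, if_false]
      exact Finset.mem_insert_self _ _
  set en : ℂ → ℝ := fun p =>
    ∫ w, ‖O (phasePart c u p) w‖ * ‖sign (O u) w - p‖ ^ 2 ∂(volume.restrict J) with hen
  have hen0 : ∀ p, 0 ≤ en p := fun p => integral_nonneg fun w => by positivity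
  have hE : ∑ p ∈ N, en p ≤ 4 * σ := by
    refine (hO.energy_le hc hN hN1 hσ0.le hcr u).trans ?_
    nlinarith
  -- Heavy pieces move by at most `2 ρ`. Light pieces may move by `2`, but their mass is bounded by
  -- their energy divided by `(1 - q) ρ²`.
  have hΛ : ∑ p ∈ N, ‖p - t p‖ * ‖phasePart c u p‖ ≤ 2 * ρ + 8 * σ / ((1 - q) * ρ ^ 2) := by
    have h1 : ∀ p ∈ N, ‖p - t p‖ * ‖phasePart c u p‖
        ≤ 2 * ρ * ‖phasePart c u p‖ + 2 * (en p / ρ ^ 2 / (1 - q)) := by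
      intro p hp
      have h0 : 0 ≤ en p / ρ ^ 2 / (1 - q) := by have := hen0 p; positivity
      by_cases hpH : p ∈ H
      · have : ‖p - t p‖ ≤ 2 * ρ := by
          rw [ht]; simp only [hpH, if_true]
          exact (ht₀' p hpH).le
        nlinarith [mul_le_mul_of_nonneg_right this (norm_nonneg (phasePart c u p))]
      · have h2 : ‖p - t p‖ ≤ 2 := by
          refine (norm_sub_le _ _).trans ?_
          rw [hN1 p hp, hT1 _ (htT p hp)]
          norm_num
        have h3 := hO.light_mass_le hS hc u p hρ0 (not_le.1 fun h => hpH
          (Finset.mem_filter.2 ⟨hp, h⟩))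
        have h4 : ‖phasePart c u p‖ ≤ en p / ρ ^ 2 / (1 - q) := by
          rw [le_div_iff₀ hq', mul_comm]
          exact h3
        have h5 : 0 ≤ 2 * ρ * ‖phasePart c u p‖ := by positivity
        nlinarith [mul_le_mul_of_nonneg_right h2 (norm_nonneg (phasePart c u p))]
    refine (Finset.sum_le_sum h1).trans ?_
    rw [Finset.sum_add_distrib, ← Finset.mul_sum, ← Finset.mul_sum, sum_norm_phasePart_eq hc hN,
      ← Finset.sum_div, ← Finset.sum_div]
    have h2 : (∑ p ∈ N, en p) / ρ ^ 2 / (1 - q) ≤ 4 * σ / ρ ^ 2 / (1 - q) := by gcongr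
    have h3 : 8 * σ / ((1 - q) * ρ ^ 2) = 2 * (4 * σ / ρ ^ 2 / (1 - q)) := by field_simp; ring
    rw [h3]
    nlinarith
  have h4σ : 0 ≤ 4 * σ / ρ := by positivity
  refine ⟨insert 1 T₀, Finset.insert_nonempty _ _, hT1, ?_, ?_, ?_⟩
  · have h1 : ((insert 1 T₀).card : ℝ) ≤ T₀.card + 1 := by exact_mod_cast Finset.card_insert_le _ _
    have h2 : (T₀.card : ℝ) ≤ 1 / δ := by rwa [le_div_iff₀ hδ]
    linarith
  · refine (integral_rayDist_le hc hN hcr u _ hT1 htT).trans ?_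
    have : σ * ‖u‖ ≤ σ := mul_le_of_le_one_right hσ0.le hu1
    linarith
  · refine (hO.integral_rayDist_apply_le hc hN hN1 hσ0.le hcr u _ hT1 htT hρ0).trans ?_
    have h1 : ρ * ‖u‖ ≤ ρ := mul_le_of_le_one_right hρ0.le hu1
    have h2 : 2 * ((1 + σ) * ‖u‖ - ‖O u‖) / ρ ≤ 4 * σ / ρ := by
      refine div_le_div_of_nonneg_right ?_ hρ0.le
      nlinarith
    linarith

end Concentration

/-! ### The level sets of the phase -/

/-- The phase determines `2sa / |v|` modulo `2π`, hence `|v|` up to countably many values. -/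
theorem countable_phase_eq {a s : ℝ} (ha : 0 < a) (hs : s ≠ 0) (p : ℂ) :
    {v : ℝ | phase a s v = p}.Countable := by
  have hc : 2 * s * a ≠ 0 := by positivity
  by_cases h : ∃ v₀, phase a s v₀ = p
  swap
  · have : {v : ℝ | phase a s v = p} = ∅ := by
      ext v
      simp only [mem_ofPred_eq, mem_empty_iff_false, iff_false]
      exact fun hv => h ⟨v, hv⟩
    rw [this]; exact countable_empty
  obtain ⟨v₀, hv₀⟩ := h
  refine (((countable_range fun n : ℤ => 2 * s * a / (2 * s * a / |v₀| - n * (2 * Real.pi))).union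
    (countable_range fun n : ℤ => -(2 * s * a / (2 * s * a / |v₀| - n * (2 * Real.pi))))).union
    (countable_singleton 0)).mono ?_
  intro v hv
  rw [mem_ofPred_eq, ← hv₀, phase, phase, Complex.exp_eq_exp_iff_exists_int] at hv
  obtain ⟨n, hn⟩ := hv
  have hn2 : 2 * s * a / |v| = 2 * s * a / |v₀| - n * (2 * Real.pi) := by
    have h2 := congrArg Complex.im hn
    simp at h2
    linarith
  by_cases hv0 : v = 0
  · exact Or.inr hv0
  have hv1 : |v| ≠ 0 := abs_ne_zero.2 hv0
  have h3 : |v| = 2 * s * a / (2 * s * a / |v₀| - n * (2 * Real.pi)) := by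
    rw [← hn2]; field_simp
  left
  rcases abs_choice v with h | h
  · left; exact ⟨n, by simp only; rw [← h3, h]⟩
  · right; exact ⟨n, by simp only; rw [← h3, h, neg_neg]⟩

/-- The point is uniformity in `p`. If no `ρ` worked, bad centres for `ρ → 0` would accumulate at
some `p₀`, and by continuity of the measure from above the level set of `p₀` would have measure at
least `δ`; but it is countable. -/
theorem exists_measure_phase_near_lt {a s : ℝ} (ha : 0 < a) (hs : s ≠ 0) {δ : ℝ} (hδ : 0 < δ) :
    ∃ ρ > 0, ∀ p : ℂ,
      volume.restrict (Ioo (-1 : ℝ) 1) {v | ‖phase a s v - p‖ < ρ} < ENNReal.ofReal δ := by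
  by_contra! hcon
  have h1 : ∀ n : ℕ, ∃ p : ℂ, ENNReal.ofReal δ ≤
      volume.restrict (Ioo (-1 : ℝ) 1) {v | ‖phase a s v - p‖ < 1 / ((n : ℝ) + 1)} :=
    fun n => hcon _ (by positivity)
  choose p hp using h1
  -- A bad centre is within distance `1` of some value of the phase, so the centres stay in a
  -- compact ball.
  have hpb : ∀ n, p n ∈ Metric.closedBall (0 : ℂ) 2 := by
    intro n
    rw [mem_closedBall_zero_iff]
    have hne : {v | ‖phase a s v - p n‖ < 1 / ((n : ℝ) + 1)}.Nonempty := by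
      by_contra hemp
      have := hp n
      rw [not_nonempty_iff_eq_empty.1 hemp, measure_empty, nonpos_iff_eq_zero,
        ENNReal.ofReal_eq_zero] at this
      linarith
    obtain ⟨v, hv⟩ := hne
    have h2 : p n = phase a s v - (phase a s v - p n) := by ring
    have h3 : 1 / ((n : ℝ) + 1) ≤ 1 := by
      rw [div_le_one (by positivity)]
      have : (0 : ℝ) ≤ n := Nat.cast_nonneg n
      linarith
    rw [h2]
    refine (norm_sub_le _ _).trans ?_
    rw [norm_phase]
    rw [mem_ofPred_eq] at hv
    linarith
  obtain ⟨p₀, -, φ, hφ, hlim⟩ := (isCompact_closedBall (0 : ℂ) 2).tendsto_subseq hpb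
  have hm : Measurable fun v => ‖phase a s v - p₀‖ := ((measurable_phase a s).sub_const p₀).norm
  have hB : ∀ n : ℕ, ENNReal.ofReal δ ≤ volume.restrict (Ioo (-1 : ℝ) 1)
      {v | ‖phase a s v - p₀‖ ≤ 1 / ((n : ℝ) + 1)} := by
    intro n
    have hpos : (0 : ℝ) < 1 / ((n : ℝ) + 1) / 2 := by positivity
    have h2 : ∀ᶠ m in atTop, ‖p (φ m) - p₀‖ < 1 / ((n : ℝ) + 1) / 2 := by
      have := (tendsto_iff_norm_sub_tendsto_zero.1 hlim).eventually (gt_mem_nhds hpos)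
      exact this
    have h3 : ∀ᶠ m in atTop, 1 / (((φ m : ℕ) : ℝ) + 1) < 1 / ((n : ℝ) + 1) / 2 :=
      (tendsto_one_div_add_atTop_nhds_zero_nat.comp hφ.tendsto_atTop).eventually
        (gt_mem_nhds hpos)
    obtain ⟨m, hm2, hm3⟩ := (h2.and h3).exists
    refine (hp (φ m)).trans (measure_mono fun v hv => ?_)
    rw [mem_ofPred_eq] at hv ⊢
    have e : phase a s v - p₀ = (phase a s v - p (φ m)) + (p (φ m) - p₀) := by ring
    rw [e]
    refine (norm_add_le _ _).trans ?_
    linarith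
  have hlim2 := tendsto_measure_iInter_atTop (μ := volume.restrict (Ioo (-1 : ℝ) 1))
    (s := fun n : ℕ => {v | ‖phase a s v - p₀‖ ≤ 1 / ((n : ℝ) + 1)})
    (fun n => (measurableSet_le hm measurable_const).nullMeasurableSet)
    (fun n m hnm v hv => le_trans (show ‖phase a s v - p₀‖ ≤ 1 / ((m : ℝ) + 1) from hv)
      (one_div_le_one_div_of_le (by positivity) (by gcongr)))
    ⟨0, measure_ne_top _ _⟩
  have h4 := ge_of_tendsto' hlim2 hB
  have h5 : (⋂ n : ℕ, {v | ‖phase a s v - p₀‖ ≤ 1 / ((n : ℝ) + 1)}) ⊆ {v | phase a s v = p₀} := by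
    intro v hv
    have h6 : ∀ n : ℕ, ‖phase a s v - p₀‖ ≤ 1 / ((n : ℝ) + 1) := fun n => mem_iInter.1 hv n
    have h7 := ge_of_tendsto' tendsto_one_div_add_atTop_nhds_zero_nat h6
    exact sub_eq_zero.1 (norm_le_zero_iff.1 h7)
  have h8 : volume.restrict (Ioo (-1 : ℝ) 1) {v | phase a s v = p₀} = 0 :=
    (countable_phase_eq ha hs p₀).measure_zero _
  have h9 := h4.trans ((measure_mono h5).trans h8.le)
  rw [nonpos_iff_eq_zero, ENNReal.ofReal_eq_zero] at h9
  linarith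

/-- A union bound. Giving each point the share `δ / (n + 1)` rather than `δ / n` makes the total
strictly smaller than `δ` and covers `n = 0`. -/
theorem exists_measure_phase_near_finset_lt {a s : ℝ} (ha : 0 < a) (hs : s ≠ 0) {δ : ℝ}
    (hδ : 0 < δ) {n : ℝ} (hn : 0 ≤ n) : ∃ ρ > 0, ∀ P : Finset ℂ, (P.card : ℝ) ≤ n →
      volume.restrict (Ioo (-1 : ℝ) 1) {v | ∃ p ∈ P, ‖phase a s v - p‖ < ρ} < ENNReal.ofReal δ := by
  obtain ⟨ρ, hρ, h⟩ := exists_measure_phase_near_lt ha hs (δ := δ / (n + 1)) (by positivity)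
  refine ⟨ρ, hρ, fun P hP => ?_⟩
  have e : {v | ∃ p ∈ P, ‖phase a s v - p‖ < ρ} = ⋃ p ∈ P, {v | ‖phase a s v - p‖ < ρ} := by
    ext v; simp
  rw [e]
  refine (measure_biUnion_finset_le _ _).trans_lt ?_
  refine (Finset.sum_le_sum fun p _ => (h p).le).trans_lt ?_
  rw [Finset.sum_const, nsmul_eq_mul, ← ENNReal.ofReal_natCast, ← ENNReal.ofReal_mul (by positivity)]
  refine (ENNReal.ofReal_lt_ofReal_iff hδ).2 ?_
  rw [mul_div_assoc', div_lt_iff₀ (by positivity)]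
  nlinarith

/-! ### Exclusion of the approximate eigenvalue `1` -/

section Eigen

variable {I J : Set ℝ}

theorem phaseMul_eq_mulL (a s : ℝ) (I : Set ℝ) :
    phaseMul a s I = mulL (volume.restrict I) (phase a s) := by
  rw [mulL, dif_pos (memLp_phase a s _)]
  rfl

theorem coe_phaseMul (a s : ℝ) (f : L1 I) :
    phaseMul a s I f =ᵐ[volume.restrict I] fun v => phase a s v * f v := by
  rw [phaseMul_eq_mulL]
  exact coe_mulL (memLp_phase a s _) f

theorem norm_phaseMul (a s : ℝ) (f : L1 I) : ‖phaseMul a s I f‖ = ‖f‖ := by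
  rw [norm_eq_integral, norm_eq_integral]
  refine integral_congr_ae ?_
  filter_upwards [coe_phaseMul a s f] with v hv
  rw [hv, norm_mul, norm_phase, one_mul]

/-- If `z` is close to `c₁ ‖z‖` and `e z` to `c₂ ‖z‖`, then `e ‖z‖` is close to `c₂ c̄₁ ‖z‖`. So
concentration of both `z` and `e z` confines `e` to the finitely many quotients. -/
theorem norm_mul_sub_le_rayDist {T₁ T₂ : Finset ℂ} (h₁ : T₁.Nonempty) (h₂ : T₂.Nonempty)
    (hT₁ : ∀ c ∈ T₁, ‖c‖ = 1) {e z : ℂ} (he : ‖e‖ = 1) :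
    ∃ c₁ ∈ T₁, ∃ c₂ ∈ T₂, ‖z‖ * ‖e - c₂ * star c₁‖ ≤ rayDist T₁ h₁ z + rayDist T₂ h₂ (e * z) := by
  obtain ⟨c₁, hc₁, h3⟩ := exists_rayDist_eq h₁ z
  obtain ⟨c₂, hc₂, h4⟩ := exists_rayDist_eq h₂ (e * z)
  refine ⟨c₁, hc₁, c₂, hc₂, ?_⟩
  have h5 : star c₁ * c₁ = 1 := by
    have := Complex.conj_mul' c₁
    rw [hT₁ c₁ hc₁] at this
    simpa using this
  have h6 : ‖z‖ * ‖e - c₂ * star c₁‖ = ‖star c₁ * ((e * z - c₂ * ‖e * z‖) -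
      e * (z - c₁ * ‖z‖))‖ := by
    rw [norm_mul e z, he, one_mul]
    have : star c₁ * ((e * z - c₂ * ‖z‖) - e * (z - c₁ * ‖z‖))
        = ‖z‖ * (e * (star c₁ * c₁) - c₂ * star c₁) := by ring
    rw [this, h5, mul_one, norm_mul, Complex.norm_real, norm_norm]
  rw [h6, norm_mul, norm_star, hT₁ c₁ hc₁, one_mul, h3, h4]
  refine (norm_sub_le _ _).trans ?_
  rw [norm_mul e (_ - _), he, one_mul, add_comm]

/-- If the phases of `φ = B u` and of `e φ` are concentrated at finitely many points, then `φ`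
has most of its mass on a small set, which is impossible when `‖φ‖` is close to `1`. -/
theorem norm_apply_le_of_rayDist {B : L1 I →L[ℂ] L1 J} (hB : IsStochastic B) {δ q : ℝ}
    (hS : SmallSetBound δ q B) (hJ : J ⊆ Ioo (-1 : ℝ) 1) {a s : ℝ} {u : L1 I}
    {T₁ T₂ : Finset ℂ} (h₁ : T₁.Nonempty) (h₂ : T₂.Nonempty) (hT₁ : ∀ c ∈ T₁, ‖c‖ = 1)
    (hT₂ : ∀ c ∈ T₂, ‖c‖ = 1) {n ρ κ κ' : ℝ} (hρ0 : 0 < ρ)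
    (hn : (T₂.card : ℝ) * T₁.card ≤ n)
    (hρ : ∀ P : Finset ℂ, (P.card : ℝ) ≤ n → volume.restrict (Ioo (-1 : ℝ) 1)
      {v | ∃ p ∈ P, ‖phase a s v - p‖ < ρ} < ENNReal.ofReal δ)
    (hκ : ∫ w, rayDist T₁ h₁ (B u w) ∂(volume.restrict J) ≤ κ)
    (hκ' : ∫ w, rayDist T₂ h₂ (phase a s w * B u w) ∂(volume.restrict J) ≤ κ') :
    ‖B u‖ ≤ q * ‖u‖ + (κ + κ') / ρ := by
  classical
  -- All possible quotients of phases. Where `e` stays `ρ` away from `P`, the modulus of `B u` is at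
  -- most the sum of the two ray distances divided by `ρ`; the remaining set `S` is small and
  -- receives at most the proportion `q`.
  set P : Finset ℂ := Finset.image₂ (fun c₂ c₁ => c₂ * star c₁) T₂ T₁ with hP
  have hPn : (P.card : ℝ) ≤ n := by
    refine le_trans ?_ hn
    exact_mod_cast Finset.card_image₂_le _ _ _
  set S : Set ℝ := {v | ∃ p ∈ P, ‖phase a s v - p‖ < ρ} with hSdef
  have hSm : MeasurableSet S := by
    have e : S = ⋃ p ∈ P, {v | ‖phase a s v - p‖ < ρ} := by
      ext v; simp [hSdef]
    rw [e]
    exact Finset.measurableSet_biUnion _ fun p _ =>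
      measurableSet_lt ((measurable_phase a s).sub_const p).norm measurable_const
  have hSδ : volume.restrict J S < ENNReal.ofReal δ :=
    (Measure.restrict_mono hJ le_rfl S).trans_lt (hρ P hPn)
  have h1 : ∫ w in S, ‖B u w‖ ∂(volume.restrict J) ≤ q * ‖u‖ := by
    rw [← norm_absL u]
    refine le_trans ?_ (hS S hSm hSδ _ (isNonneg_absL u))
    refine integral_mono_ae (integrable_Lp _).norm.integrableOn
      (integrable_Lp _).norm.integrableOn (ae_restrict_of_ae ?_)
    have h : ∀ᵐ v ∂(volume.restrict I), ‖u v‖ ≤ (absL u v).re := by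
      filter_upwards [coe_absL u] with v hv
      rw [hv, Complex.ofReal_re]
    filter_upwards [hB.domination (isNonneg_absL u) h] with w hw
    exact hw.trans (Complex.re_le_norm _)
  have hi : Integrable (fun w => phase a s w * B u w) (volume.restrict J) :=
    (integrable_Lp (phaseMul a s J (B u))).congr (coe_phaseMul a s (B u))
  have hi2 := (integrable_rayDist h₁ hT₁ (integrable_Lp (B u))).add (integrable_rayDist h₂ hT₂ hi)
  have h2 : ∫ w in Sᶜ, ‖B u w‖ ∂(volume.restrict J) ≤ (κ + κ') / ρ := by
    have h3 : ∫ w in Sᶜ, ‖B u w‖ ∂(volume.restrict J) ≤ ∫ w in Sᶜ,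
        (rayDist T₁ h₁ (B u w) + rayDist T₂ h₂ (phase a s w * B u w)) / ρ
          ∂(volume.restrict J) := by
      refine setIntegral_mono_on (integrable_Lp _).norm.integrableOn
        (hi2.div_const ρ).integrableOn hSm.compl fun w hw => ?_
      obtain ⟨c₁, hc₁, c₂, hc₂, hle⟩ :=
        norm_mul_sub_le_rayDist h₁ h₂ hT₁ (z := B u w) (norm_phase a s w)
      have hfar : ρ ≤ ‖phase a s w - c₂ * star c₁‖ := by
        by_contra hlt
        exact hw ⟨_, Finset.mem_image₂_of_mem hc₂ hc₁, not_le.1 hlt⟩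
      rw [le_div_iff₀ hρ0]
      exact (mul_le_mul_of_nonneg_left hfar (norm_nonneg _)).trans hle
    refine h3.trans ((setIntegral_le_integral (hi2.div_const ρ) (Eventually.of_forall fun w =>
      div_nonneg (add_nonneg (rayDist_nonneg _ _) (rayDist_nonneg _ _)) hρ0.le)).trans ?_)
    have h4 := integral_add (integrable_rayDist h₁ hT₁ (integrable_Lp (B u)))
      (integrable_rayDist h₂ hT₂ hi)
    rw [integral_div]
    refine div_le_div_of_nonneg_right ?_ hρ0.le
    simp only [Pi.add_apply] at h4 ⊢
    rw [h4]
    exact add_le_add hκ hκ'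
  have h3 := integral_add_compl hSm (integrable_Lp (B u)).norm
  rw [← norm_eq_integral] at h3
  linarith

theorem phase_mul_self (a s v : ℝ) : phase a s v * phase a s v = phase a (2 * s) v := by
  rw [phase, phase, ← Complex.exp_add]
  congr 1
  push_cast
  ring

theorem phase_neg (a s v : ℝ) : phase a s (-v) = phase a s v := by
  rw [phase, phase, abs_neg]

theorem integral_rayDist_le_add {T : Finset ℂ} (hT : T.Nonempty) (hT1 : ∀ c ∈ T, ‖c‖ = 1)
    (f g : L1 I) : ∫ v, rayDist T hT (f v) ∂(volume.restrict I)
      ≤ ∫ v, rayDist T hT (g v) ∂(volume.restrict I) + 2 * ‖f - g‖ := by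
  rw [norm_eq_integral, ← integral_const_mul, ← integral_add
    (integrable_rayDist hT hT1 (integrable_Lp g)) ((integrable_Lp (f - g)).norm.const_mul 2)]
  refine integral_mono_ae (integrable_rayDist hT hT1 (integrable_Lp f))
    ((integrable_rayDist hT hT1 (integrable_Lp g)).add ((integrable_Lp (f - g)).norm.const_mul 2))
    ?_
  filter_upwards [Lp.coeFn_sub f g] with v hv
  rw [hv]
  exact rayDist_le_add hT hT1 _ _

/-- The operator `A e B e` has no approximate eigenvectors for the eigenvalue `1`. -/
theorem exists_le_norm_sub {A : L1 J →L[ℂ] L1 I} {B : L1 I →L[ℂ] L1 J} (hA : IsStochastic A)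
    (hB : IsStochastic B) (hI : volume I ≤ 1) (hJ : volume J ≤ 1) (hJ1 : J ⊆ Ioo (-1 : ℝ) 1)
    (hIJ : MeasurePreserving (fun v : ℝ => -v) (volume.restrict I) (volume.restrict J))
    {δ q : ℝ} (hδ : 0 < δ) (hq : q < 1) (hBS : SmallSetBound δ q B)
    (hAS : (∃ δ' q', 0 < δ' ∧ q' < 1 ∧ SmallSetBound δ' q' A) ∨ IsReflection A)
    {a s : ℝ} (ha : 0 < a) (hs : s ≠ 0) :
    ∃ τ > 0, ∀ ψ : L1 I, ‖ψ‖ = 1 →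
      τ ≤ ‖ψ - A (phaseMul a s J (B (phaseMul a s I ψ)))‖ := by
  have hq' : 0 < 1 - q := by linarith
  rcases hAS with ⟨δ', q', hδ', hq'1, hAS⟩ | hAR
  -- Both operators are spread out, so phase concentration applies to `B` on `u` and to `A` on `e B
  -- u`. The second application localizes the phases of its argument `e B u`.
  · obtain ⟨ρ, hρ0, hρ⟩ := exists_measure_phase_near_finset_lt ha hs hδ
      (n := (1 / δ' + 1) * (1 / δ + 1)) (by positivity)
    -- With this `κ` the error `2 κ / ρ` equals `(1 - q) / 4`. The resulting bound `q + (1 - q) / 4`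
    -- for `‖B u‖` is incompatible with `‖B u‖ > 1 - (1 - q) / 4`.
    obtain ⟨κ, hκ⟩ : ∃ κ, κ = (1 - q) * ρ / 8 := ⟨_, rfl⟩
    have hκ0 : 0 < κ := by rw [hκ]; positivity
    obtain ⟨τ₁, hτ₁, h1⟩ := hB.phase_concentration hδ hq hBS hJ hκ0
    obtain ⟨τ₂, hτ₂, h2⟩ := hA.phase_concentration hδ' hq'1 hAS hI hκ0
    refine ⟨min (min τ₁ τ₂) ((1 - q) / 4), by positivity, fun ψ hψ => ?_⟩
    by_contra! hlt
    have hlt1 := hlt.trans_le ((min_le_left _ _).trans (min_le_left _ _))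
    have hlt2 := hlt.trans_le ((min_le_left _ _).trans (min_le_right _ _))
    have hlt3 := hlt.trans_le (min_le_right _ _)
    set u := phaseMul a s I ψ with hu
    have hu1 : ‖u‖ = 1 := by rw [hu, norm_phaseMul, hψ]
    have hG := norm_sub_norm_le ψ (A (phaseMul a s J (B u)))
    have hAn := hA.norm_apply_le (phaseMul a s J (B u))
    have hBn := hB.norm_apply_le u
    rw [norm_phaseMul] at hAn
    obtain ⟨T₁, hT₁, hT₁1, hc₁, -, hr₁⟩ := h1 u hu1.le (by linarith)
    obtain ⟨T₂, hT₂, hT₂1, hc₂, hr₂, -⟩ := h2 (phaseMul a s J (B u))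
      (by rw [norm_phaseMul]; linarith) (by rw [norm_phaseMul]; linarith)
    have hr₂' : ∫ w, rayDist T₂ hT₂ (phase a s w * B u w) ∂(volume.restrict J) ≤ κ := by
      refine le_trans (le_of_eq (integral_congr_ae ?_)) hr₂
      filter_upwards [coe_phaseMul a s (B u)] with w hw
      rw [hw]
    have hfin := norm_apply_le_of_rayDist hB hBS hJ1 hT₁ hT₂ hT₁1 hT₂1 hρ0
      (n := (1 / δ' + 1) * (1 / δ + 1))
      (mul_le_mul hc₂ hc₁ (Nat.cast_nonneg _) (by positivity)) hρ hr₁ hr₂'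
    have : (κ + κ) / ρ = (1 - q) / 4 := by rw [hκ]; field_simp; ring
    rw [this, hu1] at hfin
    linarith
  -- `A` is a reflection. The even factor `e` commutes with it, so `u ≈ e A e B u` is the reflection
  -- of `e² B u`, and `e²` is the phase for `2 s`. One set of rays now serves for both functions.
  · obtain ⟨ρ, hρ0, hρ⟩ := exists_measure_phase_near_finset_lt ha (s := 2 * s) (by positivity) hδ
      (n := (1 / δ + 1) * (1 / δ + 1)) (by positivity)
    obtain ⟨κ, hκ⟩ : ∃ κ, κ = (1 - q) * ρ / 8 := ⟨_, rfl⟩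
    have hκ0 : 0 < κ := by rw [hκ]; positivity
    obtain ⟨τ₁, hτ₁, h1⟩ := hB.phase_concentration hδ hq hBS hJ hκ0
    refine ⟨min (min τ₁ κ) ((1 - q) / 4), by positivity, fun ψ hψ => ?_⟩
    by_contra! hlt
    have hlt1 := hlt.trans_le ((min_le_left _ _).trans (min_le_left _ _))
    have hlt2 := hlt.trans_le ((min_le_left _ _).trans (min_le_right _ _))
    have hlt3 := hlt.trans_le (min_le_right _ _)
    set u := phaseMul a s I ψ with hu
    have hu1 : ‖u‖ = 1 := by rw [hu, norm_phaseMul, hψ]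
    set g := A (phaseMul a s J (B u)) with hg
    have hG := norm_sub_norm_le ψ g
    have hAn := hA.norm_apply_le (phaseMul a s J (B u))
    have hBn := hB.norm_apply_le u
    rw [norm_phaseMul] at hAn
    obtain ⟨T₁, hT₁, hT₁1, hc₁, hr₀, hr₁⟩ := h1 u hu1.le (by linarith)
    have hr₂ := integral_rayDist_le_add hT₁ hT₁1 (phaseMul a s I g) u
    have hn : ‖phaseMul a s I g - u‖ ≤ κ := by
      rw [hu, ← map_sub, norm_phaseMul, norm_sub_rev]
      exact hlt2.le
    -- Ray distances are invariant under the change of variables `v ↦ -v`, which moves the integral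
    -- from one half of the velocities to the other.
    have hr₃ : ∫ w, rayDist T₁ hT₁ (phase a (2 * s) w * B u w) ∂(volume.restrict J)
        = ∫ v, rayDist T₁ hT₁ (phaseMul a s I g v) ∂(volume.restrict I) := by
      rw [← hIJ.integral_comp (MeasurableEquiv.neg ℝ).measurableEmbedding]
      refine integral_congr_ae ?_
      filter_upwards [coe_phaseMul a s g, hAR (phaseMul a s J (B u)),
        hIJ.quasiMeasurePreserving.ae (coe_phaseMul a s (B u))] with v h3 h4 h5
      rw [h3, hg, h4, h5, phase_neg, phase_neg, ← mul_assoc, phase_mul_self]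
    have hfin := norm_apply_le_of_rayDist hB hBS hJ1 hT₁ hT₁ hT₁1 hT₁1 hρ0
      (n := (1 / δ + 1) * (1 / δ + 1))
      (mul_le_mul hc₁ hc₁ (Nat.cast_nonneg _) (by positivity)) hρ hr₁ (hr₃.le.trans
        (hr₂.trans (add_le_add hr₀ (mul_le_mul_of_nonneg_left hn zero_le_two))))
    have : (κ + (κ + 2 * κ)) / ρ = (1 - q) / 2 := by rw [hκ]; field_simp; ring
    rw [this, hu1] at hfin
    linarith

/-- A contraction for which `1` is not an approximate eigenvalue does not have `1` in its
spectrum. -/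
theorem isUnit_one_sub_of_le_norm_sub {X : Type*} [NormedAddCommGroup X] [NormedSpace ℂ X]
    [CompleteSpace X] {T : X →L[ℂ] X} (hT : ‖T‖ ≤ 1) {τ : ℝ} (hτ : 0 < τ)
    (h : ∀ x : X, ‖x‖ = 1 → τ ≤ ‖x - T x‖) : IsUnit (1 - T) := by
  have h' : ∀ x : X, τ * ‖x‖ ≤ ‖x - T x‖ := by
    intro x
    by_cases hx : x = 0
    · simp [hx]
    have hx0 : ‖x‖ ≠ 0 := norm_ne_zero_iff.2 hx
    have h1 := h ((‖x‖⁻¹ : ℂ) • x) (by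
      rw [norm_smul, norm_inv, Complex.norm_real, norm_norm, inv_mul_cancel₀ hx0])
    rw [map_smul, ← smul_sub, norm_smul, norm_inv, Complex.norm_real, norm_norm,
      inv_mul_eq_div, le_div_iff₀ (by positivity)] at h1
    exact h1
  -- The operator `1 - r T` is invertible by a Neumann series. For `1 - r < τ / 2` it inherits the
  -- lower bound `τ / 2`, so its inverse is bounded by `2 / τ` and the remaining perturbation `(1 -
  -- r) T` is small enough for a second Neumann series.
  obtain ⟨r, hr0, hr1, hr⟩ : ∃ r : ℝ, 0 < r ∧ r < 1 ∧ 1 - r < τ / 2 := by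
    refine ⟨1 - min (τ / 4) (1 / 2), ?_, ?_, ?_⟩
    · have := min_le_right (τ / 4) (1 / 2 : ℝ); linarith
    · have : 0 < min (τ / 4) (1 / 2) := by positivity
      linarith
    · have := min_le_left (τ / 4) (1 / 2 : ℝ); linarith
  have hrT : ‖(r : ℂ) • T‖ < 1 := by
    rw [norm_smul, Complex.norm_real, Real.norm_of_nonneg hr0.le]
    nlinarith [norm_nonneg T]
  obtain ⟨w, hw⟩ := isUnit_one_sub_of_norm_lt_one hrT
  have hcomp : ∀ x, (w : X →L[ℂ] X) ((↑w⁻¹ : X →L[ℂ] X) x) = x := fun x => by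
    rw [← mul_apply_eq_comp, Units.mul_inv, one_apply_eq_self]
  have hinv : ‖(↑w⁻¹ : X →L[ℂ] X)‖ ≤ 2 / τ := by
    refine ContinuousLinearMap.opNorm_le_bound _ (by positivity) fun x => ?_
    set y := (↑w⁻¹ : X →L[ℂ] X) x with hy
    have h1 : x = y - (r : ℂ) • T y := by
      rw [← hcomp x, hw, ← hy]; rfl
    have h2 : y - T y = x - ((1 - r : ℝ) : ℂ) • T y := by
      rw [h1]; push_cast; module
    have h3 := h' y
    have h4 : ‖x - ((1 - r : ℝ) : ℂ) • T y‖ ≤ ‖x‖ + τ / 2 * ‖y‖ := by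
      refine (norm_sub_le _ _).trans (add_le_add le_rfl ?_)
      rw [norm_smul, Complex.norm_real, Real.norm_of_nonneg (by linarith)]
      refine mul_le_mul hr.le ?_ (norm_nonneg _) (by positivity)
      exact (T.le_opNorm y).trans (mul_le_of_le_one_left (norm_nonneg _) hT)
    rw [h2] at h3
    rw [div_mul_eq_mul_div, le_div_iff₀ hτ]
    linarith
  have e : 1 - T = ↑w * (1 - (↑w⁻¹ : X →L[ℂ] X) * (((1 - r : ℝ) : ℂ) • T)) := by
    rw [mul_sub, ← mul_assoc, Units.mul_inv, one_mul, mul_one, hw]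
    push_cast; module
  rw [e]
  refine w.isUnit.mul (isUnit_one_sub_of_norm_lt_one ?_)
  refine (norm_mul_le _ _).trans_lt ?_
  have h5 : ‖((1 - r : ℝ) : ℂ) • T‖ ≤ 1 - r := by
    rw [norm_smul, Complex.norm_real, Real.norm_of_nonneg (by linarith)]
    exact mul_le_of_le_one_right (by linarith) hT
  calc ‖(↑w⁻¹ : X →L[ℂ] X)‖ * ‖((1 - r : ℝ) : ℂ) • T‖ ≤ 2 / τ * (1 - r) :=
        mul_le_mul hinv h5 (norm_nonneg _) (by positivity)
    _ < 2 / τ * (τ / 2) := mul_lt_mul_of_pos_left hr (by positivity)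
    _ = 1 := by field_simp

/-- The inverse is `1 + A (1 - B A)⁻¹ B`. This permits starting the cycle of two reflections at
either face. -/
theorem isUnit_one_sub_comp_comm {X Y : Type*} [NormedAddCommGroup X] [NormedSpace ℂ X]
    [NormedAddCommGroup Y] [NormedSpace ℂ Y] {A : Y →L[ℂ] X} {B : X →L[ℂ] Y}
    (h : IsUnit (1 - B ∘L A)) : IsUnit (1 - A ∘L B) := by
  obtain ⟨w, hw⟩ := h
  have h1 : (1 - B ∘L A) ∘L (↑w⁻¹ : Y →L[ℂ] Y) = 1 := by rw [← hw]; exact Units.mul_inv w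
  have h2 : (↑w⁻¹ : Y →L[ℂ] Y) ∘L (1 - B ∘L A) = 1 := by rw [← hw]; exact Units.inv_mul w
  have h1' : ∀ y, (↑w⁻¹ : Y →L[ℂ] Y) y - B (A ((↑w⁻¹ : Y →L[ℂ] Y) y)) = y := fun y =>
    DFunLike.congr_fun h1 y
  have h2' : ∀ y, (↑w⁻¹ : Y →L[ℂ] Y) y - (↑w⁻¹ : Y →L[ℂ] Y) (B (A y)) = y := fun y => by
    rw [← map_sub]; exact DFunLike.congr_fun h2 y
  refine ⟨⟨1 - A ∘L B, 1 + A ∘L (↑w⁻¹ : Y →L[ℂ] Y) ∘L B, ?_, ?_⟩, rfl⟩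
  · ext x
    change (x + A ((↑w⁻¹ : Y →L[ℂ] Y) (B x))) - A (B (x + A ((↑w⁻¹ : Y →L[ℂ] Y) (B x)))) = x
    have := congrArg A (h1' (B x))
    rw [map_sub] at this
    rw [map_add B, map_add A (B x), ← this]
    abel
  · ext x
    change (x - A (B x)) + A ((↑w⁻¹ : Y →L[ℂ] Y) (B (x - A (B x)))) = x
    have := congrArg A (h2' (B x))
    rw [map_sub] at this
    rw [map_sub B, map_sub _ (B x), map_sub A, this]
    abel

end Eigen

/-! ### Invertibility of `1 - G_{is}` -/

theorem volume_pos_le : volume (Ioo (0 : ℝ) 1) ≤ 1 := by simp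
theorem volume_neg_le : volume (Ioo (-1 : ℝ) 0) ≤ 1 := by simp

theorem isStochastic_leftBoundaryOp {α β : ℝ} (hα : 0 ≤ α) (hβ : 0 ≤ β) (h : α + β = 1)
    {K : L1Neg →L[ℂ] L1Pos} (hK : IsStochastic K) : IsStochastic (leftBoundaryOp α β K) :=
  isStochastic_reflNegPos.convex hK hα hβ h

theorem isStochastic_rightBoundaryOp {α β : ℝ} (hα : 0 ≤ α) (hβ : 0 ≤ β) (h : α + β = 1)
    {K : L1Pos →L[ℂ] L1Neg} (hK : IsStochastic K) : IsStochastic (rightBoundaryOp α β K) :=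
  isStochastic_reflPosNeg.convex hK hα hβ h

theorem norm_phaseMul_comp_le {I J : Set ℝ} {A : L1 J →L[ℂ] L1 I} {B : L1 I →L[ℂ] L1 J}
    (hA : IsStochastic A) (hB : IsStochastic B) (a s : ℝ) :
    ‖A ∘L phaseMul a s J ∘L B ∘L phaseMul a s I‖ ≤ 1 := by
  refine ContinuousLinearMap.opNorm_le_bound _ zero_le_one fun ψ => ?_
  rw [one_mul]
  change ‖A (phaseMul a s J (B (phaseMul a s I ψ)))‖ ≤ ‖ψ‖
  refine (hA.norm_apply_le _).trans ?_
  rw [norm_phaseMul]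
  refine (hB.norm_apply_le _).trans ?_
  rw [norm_phaseMul]

/-- `1 - G_{is}` is invertible for `s ≠ 0`. -/
theorem isUnit_one_sub_G {a : ℝ} (ha : 0 < a) {α₁ β₁ α₂ β₂ : ℝ}
    (hα₁ : 0 ≤ α₁) (hβ₁ : 0 ≤ β₁) (h₁ : α₁ + β₁ = 1)
    (hα₂ : 0 ≤ α₂) (hβ₂ : 0 ≤ β₂) (h₂ : α₂ + β₂ = 1) (hβ : 0 < β₁ + β₂)
    {K₁ : L1Neg →L[ℂ] L1Pos} {K₂ : L1Pos →L[ℂ] L1Neg}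
    (hK₁ : IsStochastic K₁) (hK₁' : IsWeaklyCompact K₁)
    (hK₂ : IsStochastic K₂) (hK₂' : IsWeaklyCompact K₂) {s : ℝ} (hs : s ≠ 0) :
    IsUnit (1 - G a (leftBoundaryOp α₁ β₁ K₁) (rightBoundaryOp α₂ β₂ K₂) s) := by
  have hO₁ := isStochastic_leftBoundaryOp hα₁ hβ₁ h₁ hK₁
  have hO₂ := isStochastic_rightBoundaryOp hα₂ hβ₂ h₂ hK₂
  obtain ⟨δ₁, hδ₁, hS₁⟩ := hK₁'.smallSetBound hK₁
  obtain ⟨δ₂, hδ₂, hS₂⟩ := hK₂'.smallSetBound hK₂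
  have hS₁' : SmallSetBound δ₁ (α₁ + β₁ * (1 / 2)) (leftBoundaryOp α₁ β₁ K₁) :=
    hS₁.convex isStochastic_reflNegPos hα₁ hβ₁
  have hS₂' : SmallSetBound δ₂ (α₂ + β₂ * (1 / 2)) (rightBoundaryOp α₂ β₂ K₂) :=
    hS₂.convex isStochastic_reflPosNeg hα₂ hβ₂
  have hA₁ : (∃ δ' q', 0 < δ' ∧ q' < 1 ∧ SmallSetBound δ' q' (leftBoundaryOp α₁ β₁ K₁)) ∨
      IsReflection (leftBoundaryOp α₁ β₁ K₁) := by
    rcases hβ₁.eq_or_lt with h0 | h0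
    · right
      have e : leftBoundaryOp α₁ β₁ K₁ = reflNegPos := by
        have : α₁ = 1 := by linarith
        rw [leftBoundaryOp, ← h0, this]; simp
      rw [e]; exact isReflection_reflNegPos
    · exact Or.inl ⟨_, _, hδ₁, by linarith, hS₁'⟩
  have hA₂ : (∃ δ' q', 0 < δ' ∧ q' < 1 ∧ SmallSetBound δ' q' (rightBoundaryOp α₂ β₂ K₂)) ∨
      IsReflection (rightBoundaryOp α₂ β₂ K₂) := by
    rcases hβ₂.eq_or_lt with h0 | h0
    · right
      have e : rightBoundaryOp α₂ β₂ K₂ = reflPosNeg := by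
        have : α₂ = 1 := by linarith
        rw [rightBoundaryOp, ← h0, this]; simp
      rw [e]; exact isReflection_reflPosNeg
    · exact Or.inl ⟨_, _, hδ₂, by linarith, hS₂'⟩
  -- The role of `B` requires a weakly compact part. If `β₂ = 0` then `β₁ > 0`, and the cyclically
  -- permuted product, which begins with `O₁`, is treated instead.
  rcases hβ₂.eq_or_lt with h0 | h0
  · obtain ⟨τ, hτ, h⟩ := exists_le_norm_sub hO₂ hO₁ volume_neg_le volume_pos_le pos_subset
      measurePreserving_neg_neg hδ₁ (by linarith) hS₁' hA₂ ha hs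
    have h3 := isUnit_one_sub_of_le_norm_sub (norm_phaseMul_comp_le hO₂ hO₁ a s) hτ h
    exact isUnit_one_sub_comp_comm (A := leftBoundaryOp α₁ β₁ K₁ ∘L phaseMul a s (Ioo (-1) 0))
      (B := rightBoundaryOp α₂ β₂ K₂ ∘L phaseMul a s (Ioo 0 1)) h3
  · obtain ⟨τ, hτ, h⟩ := exists_le_norm_sub hO₁ hO₂ volume_pos_le volume_neg_le neg_subset
      measurePreserving_neg_pos hδ₂ (by linarith) hS₂' hA₁ ha hs
    exact isUnit_one_sub_of_le_norm_sub (norm_phaseMul_comp_le hO₁ hO₂ a s) hτ h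

/-! ### Smoothness in a scale of weighted spaces -/

set_option linter.unusedSectionVars false

section Scale

variable {X Y : Type*} [NormedAddCommGroup X] [NormedSpace ℂ X] [NormedSpace ℝ X]
  [IsScalarTower ℝ ℂ X] [NormedAddCommGroup Y] [NormedSpace ℂ Y] [NormedSpace ℝ Y]
  [IsScalarTower ℝ ℂ Y]

/-- `ScaleDiff M κ m e C f`: the function `M ^ m ∘ f` on `ℝ \ {0}` is `m` times differentiable, its
derivatives lose one power of `M` at a time, and the derivative of order `j` of `M ^ j ∘ f` is
bounded by `C κ ^ (e + j)`. -/
def ScaleDiff (M : X →L[ℂ] X) (κ : ℝ → ℝ) : ℕ → ℕ → ℝ → (ℝ → X) → Prop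
  | 0, e, C, f => ContinuousOn f {0}ᶜ ∧ ∀ s, s ≠ 0 → ‖f s‖ ≤ C * κ s ^ e
  | m + 1, e, C, f => (ContinuousOn f {0}ᶜ ∧ ∀ s, s ≠ 0 → ‖f s‖ ≤ C * κ s ^ e) ∧
      ∃ f' : ℝ → X, (∀ s, s ≠ 0 → HasDerivAt (fun t => M (f t)) (f' s) s) ∧
        ScaleDiff M κ m (e + 1) C f'

variable {M : X →L[ℂ] X} {M' : Y →L[ℂ] Y} {κ : ℝ → ℝ}

theorem ScaleDiff.mono (hκ : ∀ s, 1 ≤ κ s) : ∀ {m e e' : ℕ} {C C' : ℝ} {f : ℝ → X}, 0 ≤ C →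
    e ≤ e' → C ≤ C' → ScaleDiff M κ m e C f → ScaleDiff M κ m e' C' f := by
  have key : ∀ {e e' : ℕ} {C C' : ℝ}, 0 ≤ C → e ≤ e' → C ≤ C' → ∀ s,
      C * κ s ^ e ≤ C' * κ s ^ e' := fun hC he hC' s =>
    mul_le_mul hC' (pow_le_pow_right₀ (hκ s) he) (pow_nonneg (zero_le_one.trans (hκ s)) _)
      (hC.trans hC')
  intro m
  induction m with
  | zero => exact fun hC he hC' h => ⟨h.1, fun s hs => (h.2 s hs).trans (key hC he hC' s)⟩
  | succ m ih =>
    intro e e' C C' f hC he hC' h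
    obtain ⟨⟨h1, h2⟩, f', h3, h4⟩ := h
    exact ⟨⟨h1, fun s hs => (h2 s hs).trans (key hC he hC' s)⟩, f', h3,
      ih hC (Nat.succ_le_succ he) hC' h4⟩

theorem ScaleDiff.of_succ : ∀ {m e : ℕ} {C : ℝ} {f : ℝ → X}, ScaleDiff M κ (m + 1) e C f →
    ScaleDiff M κ m e C f
  | 0, _, _, _, h => h.1
  | _ + 1, _, _, _, h => ⟨h.1, h.2.choose, h.2.choose_spec.1, h.2.choose_spec.2.of_succ⟩

theorem ScaleDiff.add : ∀ {m e : ℕ} {C C' : ℝ} {f g : ℝ → X}, ScaleDiff M κ m e C f →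
    ScaleDiff M κ m e C' g → ScaleDiff M κ m e (C + C') (fun s => f s + g s) := by
  have key : ∀ {e : ℕ} {C C' : ℝ} {f g : ℝ → X}, (∀ s, s ≠ 0 → ‖f s‖ ≤ C * κ s ^ e) →
      (∀ s, s ≠ 0 → ‖g s‖ ≤ C' * κ s ^ e) → ∀ s, s ≠ 0 → ‖f s + g s‖ ≤ (C + C') * κ s ^ e :=
    fun hf hg s hs => (norm_add_le _ _).trans (by
      rw [add_mul]; exact add_le_add (hf s hs) (hg s hs))
  intro m
  induction m with
  | zero => exact fun h h' => ⟨h.1.add h'.1, key h.2 h'.2⟩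
  | succ m ih =>
    intro e C C' f g h h'
    obtain ⟨⟨h1, h2⟩, f', h3, h4⟩ := h
    obtain ⟨⟨k1, k2⟩, g', k3, k4⟩ := h'
    refine ⟨⟨h1.add k1, key h2 k2⟩, fun s => f' s + g' s, fun s hs => ?_, ih h4 k4⟩
    simp_rw [map_add]
    exact (h3 s hs).add (k3 s hs)

theorem hasDerivAt_clm_comp (T : X →L[ℂ] Y) {f : ℝ → X} {f' : X} {s : ℝ} (h : HasDerivAt f f' s) :
    HasDerivAt (fun t => T (f t)) (T f') s :=
  (T.restrictScalars ℝ).hasFDerivAt.comp_hasDerivAt s h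

/-- `M' T_{m+1} f = T_m (M f)` has derivative `T_m f'`: the index of the operator drops along with
the number of derivatives left. This is how a boundary operator acts through its conjugates on
successive levels. -/
theorem ScaleDiff.map : ∀ {m e : ℕ} {C c : ℝ} {f : ℝ → X} {T : ℕ → X →L[ℂ] Y},
    (∀ n, n < m → ∀ x, M' (T (n + 1) x) = T n (M x)) → (∀ n, n ≤ m → ‖T n‖ ≤ c) →
    ScaleDiff M κ m e C f → ScaleDiff M' κ m e (c * C) (fun s => T m (f s)) := by
  have key : ∀ {e : ℕ} {C c : ℝ} {f : ℝ → X} {T : X →L[ℂ] Y}, ‖T‖ ≤ c →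
      (∀ s, s ≠ 0 → ‖f s‖ ≤ C * κ s ^ e) → ∀ s, s ≠ 0 → ‖T (f s)‖ ≤ c * C * κ s ^ e :=
    fun hc hf s hs => (ContinuousLinearMap.le_opNorm _ _).trans (by
      rw [mul_assoc]
      exact mul_le_mul hc (hf s hs) (norm_nonneg _) ((norm_nonneg _).trans hc))
  intro m
  induction m with
  | zero =>
    exact fun _ hc h => ⟨(ContinuousLinearMap.continuous _).comp_continuousOn h.1,
      key (hc 0 le_rfl) h.2⟩
  | succ m ih =>
    intro e C c f T hT hc h
    obtain ⟨⟨h1, h2⟩, f', h3, h4⟩ := h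
    refine ⟨⟨(ContinuousLinearMap.continuous _).comp_continuousOn h1, key (hc _ le_rfl) h2⟩,
      fun s => T m (f' s), fun s hs => ?_,
      ih (fun n hn => hT n (hn.trans m.lt_succ_self)) (fun n hn => hc n (hn.trans m.le_succ)) h4⟩
    simp_rw [hT m m.lt_succ_self]
    exact hasDerivAt_clm_comp _ (h3 s hs)

theorem ScaleDiff.map_const {m e : ℕ} {C c : ℝ} {f : ℝ → X} {T : X →L[ℂ] Y}
    (hT : ∀ x, M' (T x) = T (M x)) (hc : ‖T‖ ≤ c) (h : ScaleDiff M κ m e C f) :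
    ScaleDiff M' κ m e (c * C) (fun s => T (f s)) :=
  ScaleDiff.map (T := fun _ => T) (fun _ _ => hT) (fun _ _ => hc) h

theorem ScaleDiff.const (hκ : ∀ s, 1 ≤ κ s) : ∀ {m e : ℕ} {C : ℝ} {x : X}, ‖x‖ ≤ C →
    ScaleDiff M κ m e C fun _ => x := by
  have key : ∀ {e : ℕ} {C : ℝ} {x : X}, ‖x‖ ≤ C → ∀ s, s ≠ 0 → ‖x‖ ≤ C * κ s ^ e :=
    fun hx s _ => hx.trans (le_mul_of_one_le_right ((norm_nonneg _).trans hx)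
      (one_le_pow₀ (hκ s)))
  intro m
  induction m with
  | zero => exact fun hx => ⟨continuousOn_const, key hx⟩
  | succ m ih =>
    intro e C x hx
    exact ⟨⟨continuousOn_const, key hx⟩, fun _ => 0, fun s _ => hasDerivAt_const _ _,
      ih (by rw [norm_zero]; exact (norm_nonneg _).trans hx)⟩

/-- Strong convergence is compatible with convergence of the arguments. -/
theorem tendsto_clm_apply_of_strong {ι : Type*} {l : Filter ι} {A : ι → X →L[ℂ] Y}
    {A₀ : X →L[ℂ] Y} {z : ι → X} {z₀ : X} {K : ℝ} (hK : ∀ᶠ i in l, ‖A i‖ ≤ K)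
    (hA : ∀ x, Tendsto (fun i => A i x) l (𝓝 (A₀ x))) (hz : Tendsto z l (𝓝 z₀)) :
    Tendsto (fun i => A i (z i)) l (𝓝 (A₀ z₀)) := by
  have h1 : Tendsto (fun i => A i (z i - z₀)) l (𝓝 0) := by
    refine squeeze_zero_norm' (a := fun i => K * ‖z i - z₀‖) ?_ ?_
    · filter_upwards [hK] with i hi
      exact (ContinuousLinearMap.le_opNorm _ _).trans (mul_le_mul_of_nonneg_right hi
        (norm_nonneg _))
    · have := (tendsto_iff_norm_sub_tendsto_zero.1 hz).const_mul K
      rwa [mul_zero] at this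
  have h2 := h1.add (hA z₀)
  rw [zero_add] at h2
  refine h2.congr fun i => ?_
  rw [← map_add, sub_add_cancel]

/-- The difference quotient is `A t` applied to the difference quotient of `z`. No differentiability
of `A` is needed, because the argument vanishes at `s`. -/
theorem hasDerivAt_strong {A : ℝ → X →L[ℂ] Y} {z : ℝ → X} {z' : X} {s K : ℝ}
    (hK : ∀ᶠ t in 𝓝 s, ‖A t‖ ≤ K) (hA : ∀ x, ContinuousAt (fun t => A t x) s)
    (hz : HasDerivAt z z' s) : HasDerivAt (fun t => A t (z t - z s)) (A s z') s := by
  rw [hasDerivAt_iff_tendsto_slope] at hz ⊢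
  have h := tendsto_clm_apply_of_strong (A := A) (l := 𝓝[≠] s)
    (hK.filter_mono nhdsWithin_le_nhds) (fun x => (hA x).mono_left nhdsWithin_le_nhds) hz
  refine h.congr fun t => ?_
  rw [slope_def_module, slope_def_module, sub_self, map_zero, sub_zero]
  exact map_smul ((A t).restrictScalars ℝ) _ _

/-- A strongly continuous family of contractions, differentiable on the range of `M`. -/
structure IsPhaseFamily (M : X →L[ℂ] X) (E : ℝ → X →L[ℂ] X) (D : X →L[ℂ] X) : Prop where
  norm_le : ∀ s, ‖E s‖ ≤ 1
  continuous : ∀ x, Continuous fun s => E s x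
  comm : ∀ s x, M (E s x) = E s (M x)
  comm_D : ∀ x, M (D x) = D (M x)
  hasDerivAt : ∀ s x, HasDerivAt (fun t => E t (M x)) (D (E s x)) s

theorem IsPhaseFamily.continuousAt_apply {E : ℝ → X →L[ℂ] X} {D : X →L[ℂ] X}
    (hE : IsPhaseFamily M E D) {f : ℝ → X} {s : ℝ} (hf : ContinuousAt f s) :
    ContinuousAt (fun t => E t (f t)) s :=
  tendsto_clm_apply_of_strong (Eventually.of_forall hE.norm_le)
    (fun x => (hE.continuous x).continuousAt) hf

/-- The product rule: the derivative of `M E f` is `E f' + D E f`, where `f'` is the derivative of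
`M f`. The two summands cost the factor `1 + d` for each order. -/
theorem IsPhaseFamily.scaleDiff {E : ℝ → X →L[ℂ] X} {D : X →L[ℂ] X} (hE : IsPhaseFamily M E D)
    (hκ : ∀ s, 1 ≤ κ s) {d : ℝ} (hd : ‖D‖ ≤ d) : ∀ {m e : ℕ} {C : ℝ} {f : ℝ → X}, 0 ≤ C →
    ScaleDiff M κ m e C f → ScaleDiff M κ m e ((1 + d) ^ m * C) (fun s => E s (f s)) := by
  have hd0 : 0 ≤ d := (norm_nonneg _).trans hd
  have key : ∀ {e : ℕ} {C : ℝ} (m : ℕ) {f : ℝ → X}, 0 ≤ C → ContinuousOn f {0}ᶜ →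
      (∀ s, s ≠ 0 → ‖f s‖ ≤ C * κ s ^ e) → ContinuousOn (fun s => E s (f s)) {0}ᶜ ∧
      ∀ s, s ≠ 0 → ‖E s (f s)‖ ≤ (1 + d) ^ m * C * κ s ^ e := by
    intro e C m f hC hc hf
    refine ⟨fun s hs => (hE.continuousAt_apply (hc.continuousAt
      (isOpen_compl_singleton.mem_nhds hs))).continuousWithinAt, fun s hs => ?_⟩
    have h1 : ‖E s (f s)‖ ≤ C * κ s ^ e := ((E s).le_opNorm _).trans
      ((mul_le_of_le_one_left (norm_nonneg _) (hE.norm_le s)).trans (hf s hs))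
    refine h1.trans (mul_le_mul_of_nonneg_right (le_mul_of_one_le_left hC
      (one_le_pow₀ (by linarith))) (pow_nonneg (zero_le_one.trans (hκ s)) _))
  intro m
  induction m with
  | zero =>
    intro e C f hC h
    exact key 0 hC h.1 h.2
  | succ m ih =>
    intro e C f hC h
    have hm := h.of_succ
    obtain ⟨⟨h1, h2⟩, f', h3, h4⟩ := h
    refine ⟨key (m + 1) hC h1 h2, fun s => E s (f' s) + D (E s (f s)), fun s hs => ?_, ?_⟩
    · have h5 := hasDerivAt_strong (A := E) (Eventually.of_forall hE.norm_le)
        (fun x => (hE.continuous x).continuousAt) (h3 s hs)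
      refine (h5.add (hE.hasDerivAt s (f s))).congr_of_eventuallyEq
        (Eventually.of_forall fun t => ?_)
      simp only [Pi.add_apply]
      rw [hE.comm, map_sub, sub_add_cancel]
    · have h5 := ih hC h4
      have h6 := (ih hC (hm.mono hκ hC e.le_succ le_rfl)).map_const hE.comm_D hd
      refine (h5.add h6).mono hκ (by positivity) le_rfl (le_of_eq (by ring))

/-- Inversion in the scale. -/
theorem scaleDiff_resolvent {E : ℝ → X →L[ℂ] X} {D : X →L[ℂ] X} (hE : IsPhaseFamily M E D)
    (hκ : ∀ s, 1 ≤ κ s) {L : ℕ} {O : ℕ → X →L[ℂ] X} {N : ℕ → ℝ → X →L[ℂ] X} {c : ℝ}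
    (hc : ∀ n, n ≤ L → ‖O n‖ ≤ c) (hO : ∀ n, n < L → ∀ x, M (O (n + 1) x) = O n (M x))
    (hN1 : ∀ n, n ≤ L → ∀ s, s ≠ 0 → ∀ x, N n s (x - O n (E s x)) = x)
    (hN2 : ∀ n, n ≤ L → ∀ s, s ≠ 0 → ∀ x, N n s x - O n (E s (N n s x)) = x)
    (hNκ : ∀ n, n ≤ L → ∀ s, s ≠ 0 → ‖N n s‖ ≤ c * κ s)
    (hNb : ∀ n, n ≤ L → ∀ s, s ≠ 0 → ∃ K, ∀ᶠ t in 𝓝 s, ‖N n t‖ ≤ K)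
    (hNc : ∀ n, n ≤ L → ∀ s, s ≠ 0 → ∀ x, ContinuousAt (fun t => N n t x) s) (m : ℕ) :
    ∃ cm, 0 ≤ cm ∧ ∀ b, b + m ≤ L → ∀ {e : ℕ} {C : ℝ} {h : ℝ → X}, 0 ≤ C →
      ScaleDiff M κ m e C h → ScaleDiff M κ m (e + 1) (cm * C) (fun s => N (b + m) s (h s)) := by
  have hc0 : 0 ≤ c := (norm_nonneg _).trans (hc 0 (Nat.zero_le _))
  have key : ∀ n, n ≤ L → ∀ {e : ℕ} {C : ℝ} {h : ℝ → X}, ContinuousOn h {0}ᶜ →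
      (∀ s, s ≠ 0 → ‖h s‖ ≤ C * κ s ^ e) → ContinuousOn (fun s => N n s (h s)) {0}ᶜ ∧
      ∀ s, s ≠ 0 → ‖N n s (h s)‖ ≤ c * C * κ s ^ (e + 1) := by
    intro n hn e C h h1 h2
    refine ⟨fun s hs => ContinuousAt.continuousWithinAt ?_, fun s hs => ?_⟩
    · obtain ⟨K, hK⟩ := hNb n hn s hs
      exact tendsto_clm_apply_of_strong hK (fun x => hNc n hn s hs x)
        (h1.continuousAt (isOpen_compl_singleton.mem_nhds hs))
    · calc ‖N n s (h s)‖ ≤ ‖N n s‖ * ‖h s‖ := (N n s).le_opNorm _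
        _ ≤ (c * κ s) * (C * κ s ^ e) := mul_le_mul (hNκ n hn s hs) (h2 s hs) (norm_nonneg _)
            (mul_nonneg hc0 (zero_le_one.trans (hκ s)))
        _ = c * C * κ s ^ (e + 1) := by ring
  have hd : ‖D‖ ≤ ‖D‖ := le_rfl
  induction m with
  | zero => exact ⟨c, hc0, fun b hb e C h _ hh => key b hb hh.1 hh.2⟩
  | succ m ih =>
    obtain ⟨cm, hcm, ih⟩ := ih
    refine ⟨c + cm * (1 + c * ‖D‖ * (1 + ‖D‖) ^ m * cm), by positivity,
      fun b hb e C h hC hh => ?_⟩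
    have hbm : b + m < L := by omega
    have hhm := hh.of_succ
    -- The same function, viewed as level `b + 1` plus `m`, has order `m` by induction. That is
    -- enough regularity for the term `D E ψ` in the derivative, to which the induction hypothesis
    -- at `b` is then applied.
    have hψ := ih (b + 1) (by omega) hC hhm
    rw [show b + 1 + m = b + (m + 1) by ring] at hψ
    obtain ⟨⟨h1, h2⟩, h', h3, h4⟩ := hh
    obtain ⟨k1, k2⟩ := key (b + (m + 1)) hb h1 h2
    set n := b + m with hn
    obtain ⟨ψ, hψe⟩ : ∃ ψ : ℝ → X, ∀ s, N (b + (m + 1)) s (h s) = ψ s := ⟨_, fun _ => rfl⟩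
    have hψ2 : ∀ s, ψ s = N (n + 1) s (h s) := fun s => (hψe s).symm
    simp only [hψe] at hψ k1 k2 ⊢
    have hE1 := hE.scaleDiff hκ hd (by positivity) hψ
    have hE2 := hE1.map_const hE.comm_D hd
    have hE3 := ScaleDiff.map (M' := M) (T := fun i => O (b + i)) (c := c)
      (fun i hi x => hO (b + i) (by omega) x) (fun i hi => hc _ (by omega)) hE2
    have hE4 := h4.add hE3
    have hE5 := ih b (by omega) (by positivity) hE4
    -- `M` intertwines `1 - O_{n+1} E` with `1 - O_n E`, hence also their inverses.
    have hMψ : ∀ s, s ≠ 0 → M (ψ s) = N n s (M (h s)) := by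
      intro s hs
      conv_lhs => rw [← hN1 n hbm.le s hs (M (ψ s))]
      congr 1
      conv_rhs => rw [← hN2 (n + 1) hbm s hs (h s), ← hψ2]
      rw [map_sub, hO n hbm, hE.comm]
    refine ⟨⟨k1, fun s hs => (k2 s hs).trans ?_⟩, _, fun s hs => ?_, hE5.mono hκ (by positivity)
      le_rfl ?_⟩
    · refine mul_le_mul_of_nonneg_right (mul_le_mul_of_nonneg_right ?_ hC)
        (pow_nonneg (zero_le_one.trans (hκ s)) _)
      exact le_add_of_nonneg_right (by positivity)
    -- The resolvent identity: `M ψ(t) - M ψ(s)` is `N_n(t)` applied to the increment from `s` to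
    -- `t` of `M h + O_n E M ψ(s)`, with `ψ(s)` frozen. Hence the derivative is `N_n (h' + O_n D E
    -- ψ)`, with one additional inverse.
    · have hk : HasDerivAt (fun t => M (h t) + O n (E t (M (ψ s))))
          (h' s + O n (D (E s (ψ s)))) s :=
        (h3 s hs).add (hasDerivAt_clm_comp (O n) (hE.hasDerivAt s (ψ s)))
      obtain ⟨K, hK⟩ := hNb n hbm.le s hs
      have h5 := (hasDerivAt_strong hK (fun x => hNc n hbm.le s hs x) hk).add_const (M (ψ s))
      refine h5.congr_of_eventuallyEq ?_
      filter_upwards [isOpen_compl_singleton.mem_nhds hs] with t ht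
      rw [← sub_eq_iff_eq_add, hMψ t ht, hMψ s hs]
      conv_lhs => rw [← hN1 n hbm.le t ht (N n s (M (h s)))]
      rw [← map_sub]
      congr 1
      have h6 : M (h s) + O n (E s (N n s (M (h s)))) = N n s (M (h s)) :=
        (sub_eq_iff_eq_add.1 (hN2 n hbm.le s hs (M (h s)))).symm
      rw [h6]
      abel
    · have h7 : 0 ≤ c * C := by positivity
      have h8 : cm * (C + c * (‖D‖ * ((1 + ‖D‖) ^ m * (cm * C))))
          = cm * (1 + c * ‖D‖ * (1 + ‖D‖) ^ m * cm) * C := by ring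
      rw [h8, add_mul]
      linarith

/-- Each derivative uses up one factor of `M ^ m`; the `m - j` factors left over after `j`
derivatives are contractions. -/
theorem ScaleDiff.contDiffOn (hM : ‖M‖ ≤ 1) : ∀ {m e : ℕ} {C : ℝ} {f : ℝ → X},
    ScaleDiff M κ m e C f → ContDiffOn ℝ m (fun s => (M ^ m) (f s)) {0}ᶜ ∧
      ∀ j, j ≤ m → ∀ s, s ≠ 0 → ‖iteratedDeriv j (fun s => (M ^ m) (f s)) s‖ ≤ C * κ s ^ (e + j) := by
  have hMp : ∀ (m : ℕ) (x : X), ‖(M ^ m) x‖ ≤ ‖x‖ := by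
    intro m x
    induction m with
    | zero => simp
    | succ m ih =>
      rw [pow_succ', mul_apply_eq_comp]
      exact ((M.le_opNorm _).trans (mul_le_of_le_one_left (norm_nonneg _) hM)).trans ih
  intro m
  induction m with
  | zero =>
    intro e C f h
    refine ⟨?_, fun j hj s hs => ?_⟩
    · simpa using h.1
    · obtain rfl : j = 0 := by omega
      simpa using h.2 s hs
  | succ m ih =>
    intro e C f h
    obtain ⟨⟨h1, h2⟩, f', h3, h4⟩ := h
    obtain ⟨i1, i2⟩ := ih h4
    have hder : ∀ s, s ≠ 0 → HasDerivAt (fun s => (M ^ (m + 1)) (f s)) ((M ^ m) (f' s)) s := by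
      intro s hs
      simp_rw [pow_succ, mul_apply_eq_comp]
      exact hasDerivAt_clm_comp _ (h3 s hs)
    have hder' : ∀ s, s ≠ 0 → deriv (fun s => (M ^ (m + 1)) (f s)) s = (M ^ m) (f' s) :=
      fun s hs => (hder s hs).deriv
    refine ⟨?_, fun j hj s hs => ?_⟩
    · have := (contDiffOn_succ_iff_deriv_of_isOpen (n := (m : WithTop ℕ∞)) (𝕜 := ℝ)
        (f := fun s => (M ^ (m + 1)) (f s)) (s := {0}ᶜ) isOpen_compl_singleton).2
        ⟨fun s hs => (hder s hs).differentiableAt.differentiableWithinAt, by simp,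
          i1.congr hder'⟩
      simpa using this
    · rcases j with _ | j
      · simp only [iteratedDeriv_zero, add_zero]
        exact (hMp _ _).trans (h2 s hs)
      · rw [iteratedDeriv_succ']
        have hev : deriv (fun s => (M ^ (m + 1)) (f s)) =ᶠ[𝓝 s] fun s => (M ^ m) (f' s) := by
          filter_upwards [isOpen_compl_singleton.mem_nhds hs] with t ht
          exact hder' t ht
        rw [hev.iteratedDeriv_eq]
        have := i2 j (by omega) s hs
        rwa [show e + 1 + j = e + (j + 1) by ring] at this

end Scale

/-! ### Exponential multiplication operators -/

section Exponential

variable {α : Type*} [MeasurableSpace α] {μ : Measure α} {w τ : α → ℝ} {T : ℝ}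

/-- `w` is a weight with values in `(0, 1]` and `τ` is a function with values in `[0, T]`. -/
structure IsTimeWeight (μ : Measure α) (w τ : α → ℝ) (T : ℝ) : Prop where
  measurable_w : Measurable w
  measurable_τ : Measurable τ
  ae : ∀ᵐ z ∂μ, 0 < w z ∧ w z ≤ 1 ∧ 0 ≤ τ z ∧ τ z ≤ T
  nonneg : 0 ≤ T

/-- The projection of the complex plane onto the closed right half plane. -/
def projRe (l : ℂ) : ℂ := ⟨max l.re 0, l.im⟩

theorem projRe_of_nonneg {l : ℂ} (h : 0 ≤ l.re) : projRe l = l :=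
  Complex.ext (max_eq_left h) rfl

theorem projRe_re_nonneg (l : ℂ) : 0 ≤ (projRe l).re := le_max_right _ _

theorem norm_projRe_sub_le (l l' : ℂ) : ‖projRe l - projRe l'‖ ≤ ‖l - l'‖ := by
  rw [← abs_of_nonneg (norm_nonneg (projRe l - projRe l')), ← abs_of_nonneg (norm_nonneg (l - l')),
    ← sq_le_sq, ← Complex.normSq_eq_norm_sq, ← Complex.normSq_eq_norm_sq, Complex.normSq_apply,
    Complex.normSq_apply]
  have h1 : (projRe l - projRe l').im = (l - l').im := rfl
  have h2 : |(projRe l - projRe l').re| ≤ |(l - l').re| := abs_max_sub_max_le_abs _ _ _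
  rw [h1]
  nlinarith [abs_mul_abs_self (projRe l - projRe l').re, abs_mul_abs_self (l - l').re,
    mul_self_le_mul_self (abs_nonneg _) h2]

theorem continuous_projRe : Continuous projRe := by
  refine Metric.continuous_iff.2 fun l ε hε => ⟨ε, hε, fun l' h => ?_⟩
  rw [dist_eq_norm] at h ⊢
  exact (norm_projRe_sub_le _ _).trans_lt h

/-- The function `e^{-λ τ / w}` for `Re λ ≥ 0`; it depends on the projection of `λ` to the right
half plane only. -/
def expSym (w τ : α → ℝ) (l : ℂ) (z : α) : ℂ := Complex.exp (-(projRe l * ((τ z / w z : ℝ) : ℂ)))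

theorem measurable_expSym (hw : Measurable w) (hτ : Measurable τ) (l : ℂ) :
    Measurable (expSym w τ l) :=
  Complex.measurable_exp.comp ((Complex.measurable_ofReal.comp (hτ.div hw)).const_mul _).neg

theorem norm_exp_neg_mul_le {p : ℂ} (hp : 0 ≤ p.re) {t : ℝ} (ht : 0 ≤ t) :
    ‖Complex.exp (-(p * (t : ℂ)))‖ ≤ 1 := by
  rw [Complex.norm_exp, Complex.neg_re, Complex.re_mul_ofReal]
  exact Real.exp_le_one_iff.2 (by nlinarith)

/-- The mean value inequality on the convex half plane, where the derivative of `e^{-z}` has modulus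
at most `1`. -/
theorem norm_exp_neg_sub_exp_neg_le {z z' : ℂ} (hz : 0 ≤ z.re) (hz' : 0 ≤ z'.re) :
    ‖Complex.exp (-z) - Complex.exp (-z')‖ ≤ ‖z - z'‖ := by
  have hconv : Convex ℝ {z : ℂ | 0 ≤ z.re} := convex_halfSpace_re_ge 0
  have := hconv.norm_image_sub_le_of_norm_hasDerivWithin_le (𝕜 := ℂ)
    (f := fun z => Complex.exp (-z)) (f' := fun z => Complex.exp (-z) * (-1)) (C := 1)
    (fun x _ => ((hasDerivAt_neg x).cexp).hasDerivWithinAt)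
    (fun x hx => by
      rw [mul_neg_one, norm_neg, Complex.norm_exp, Complex.neg_re]
      exact Real.exp_le_one_iff.2 (neg_nonpos.2 hx)) hz' hz
  simpa using this

theorem IsTimeWeight.norm_expSym_le (h : IsTimeWeight μ w τ T) (l : ℂ) :
    ∀ᵐ z ∂μ, ‖expSym w τ l z‖ ≤ 1 := by
  filter_upwards [h.ae] with z hz
  exact norm_exp_neg_mul_le (projRe_re_nonneg l) (div_nonneg hz.2.2.1 hz.1.le)

theorem IsTimeWeight.memLp_expSym (h : IsTimeWeight μ w τ T) (l : ℂ) :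
    MemLp (expSym w τ l) ∞ μ :=
  memLp_top_of_bound (measurable_expSym h.measurable_w h.measurable_τ l).aestronglyMeasurable 1
    (h.norm_expSym_le l)

theorem IsTimeWeight.memLp_weight (h : IsTimeWeight μ w τ T) : MemLp (fun z => (w z : ℂ)) ∞ μ :=
  memLp_top_of_bound (Complex.measurable_ofReal.comp h.measurable_w).aestronglyMeasurable 1 (by
    filter_upwards [h.ae] with z hz
    rw [Complex.norm_real, Real.norm_of_nonneg hz.1.le]
    exact hz.2.1)

/-- Multiplication by the weight. -/
def weightL (μ : Measure α) (w : α → ℝ) : Lp ℂ 1 μ →L[ℂ] Lp ℂ 1 μ := mulL μ fun z => (w z : ℂ)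

/-- Multiplication by `e^{-λ τ / w}`. -/
def expL (μ : Measure α) (w τ : α → ℝ) (l : ℂ) : Lp ℂ 1 μ →L[ℂ] Lp ℂ 1 μ :=
  mulL μ (expSym w τ l)

/-- Multiplication by `-i τ`. -/
def timeL (μ : Measure α) (τ : α → ℝ) : Lp ℂ 1 μ →L[ℂ] Lp ℂ 1 μ :=
  mulL μ fun z => -(Complex.I * (τ z : ℂ))

theorem IsTimeWeight.norm_weightL_le (h : IsTimeWeight μ w τ T) : ‖weightL μ w‖ ≤ 1 :=
  norm_mulL_le h.memLp_weight zero_le_one (by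
    filter_upwards [h.ae] with z hz
    rw [Complex.norm_real, Real.norm_of_nonneg hz.1.le]
    exact hz.2.1)

theorem IsTimeWeight.weightL_injective (h : IsTimeWeight μ w τ T) :
    Function.Injective (weightL μ w) :=
  mulL_injective h.memLp_weight (by
    filter_upwards [h.ae] with z hz
    exact_mod_cast hz.1.ne')

theorem IsTimeWeight.norm_expL_le (h : IsTimeWeight μ w τ T) (l : ℂ) : ‖expL μ w τ l‖ ≤ 1 :=
  norm_mulL_le (h.memLp_expSym l) zero_le_one (h.norm_expSym_le l)

theorem IsTimeWeight.memLp_time (h : IsTimeWeight μ w τ T) :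
    MemLp (fun z => -(Complex.I * (τ z : ℂ))) ∞ μ :=
  memLp_top_of_bound ((Complex.measurable_ofReal.comp h.measurable_τ).const_mul
    _).neg.aestronglyMeasurable T (by
    filter_upwards [h.ae] with z hz
    rw [norm_neg, norm_mul, Complex.norm_I, one_mul, Complex.norm_real,
      Real.norm_of_nonneg hz.2.2.1]
    exact hz.2.2.2)

theorem IsTimeWeight.norm_timeL_le (h : IsTimeWeight μ w τ T) : ‖timeL μ τ‖ ≤ T :=
  norm_mulL_le h.memLp_time h.nonneg (by
    filter_upwards [h.ae] with z hz
    rw [norm_neg, norm_mul, Complex.norm_I, one_mul, Complex.norm_real,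
      Real.norm_of_nonneg hz.2.2.1]
    exact hz.2.2.2)

theorem continuous_expSym (z : α) : Continuous fun l => expSym w τ l z := by
  unfold expSym
  have := continuous_projRe
  fun_prop

/-- The family `e^{-λ τ / w}` is strongly continuous. -/
theorem IsTimeWeight.continuous_expL (h : IsTimeWeight μ w τ T) (f : Lp ℂ 1 μ) :
    Continuous fun l => expL μ w τ l f := by
  refine continuous_iff_continuousAt.2 fun l => ?_
  refine tendsto_mulL (C := 2) (fun l => h.memLp_expSym l) (h.memLp_expSym l)
    (Eventually.of_forall fun l' => ?_)
    (Eventually.of_forall fun z => (continuous_expSym z).tendsto l) f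
  filter_upwards [h.norm_expSym_le l, h.norm_expSym_le l'] with z h1 h2
  exact (norm_sub_le _ _).trans (by linarith)

/-- On the range of the weight the family `e^{-λ τ / w}` is Lipschitz continuous in norm. -/
theorem IsTimeWeight.norm_expL_sub_le (h : IsTimeWeight μ w τ T) (l l' : ℂ) (f : Lp ℂ 1 μ) :
    ‖expL μ w τ l (weightL μ w f) - expL μ w τ l' (weightL μ w f)‖ ≤ T * ‖l - l'‖ * ‖f‖ := by
  refine norm_le_of_ae_le ?_
  rw [← integral_const_mul]
  refine integral_mono_ae (integrable_Lp _).norm ((integrable_Lp f).norm.const_mul _) ?_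
  filter_upwards [h.ae, coe_mulL (h.memLp_expSym l) (weightL μ w f),
    coe_mulL (h.memLp_expSym l') (weightL μ w f), coe_mulL h.memLp_weight f,
    Lp.coeFn_sub (expL μ w τ l (weightL μ w f)) (expL μ w τ l' (weightL μ w f))]
    with z hz h1 h2 h3 h4
  have h0 : 0 ≤ τ z / w z := div_nonneg hz.2.2.1 hz.1.le
  have hre : ∀ p : ℂ, 0 ≤ p.re → 0 ≤ (p * ((τ z / w z : ℝ) : ℂ)).re := fun p hp => by
    rw [Complex.re_mul_ofReal]; positivity
  have h5 := norm_exp_neg_sub_exp_neg_le (hre _ (projRe_re_nonneg l)) (hre _ (projRe_re_nonneg l'))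
  rw [← sub_mul, norm_mul, Complex.norm_real, Real.norm_of_nonneg h0] at h5
  -- The weight supplied by `weightL` cancels the denominator of the exponent and leaves `τ ≤ T`.
  have h6 : ‖expSym w τ l z - expSym w τ l' z‖ * w z ≤ T * ‖l - l'‖ := by
    calc ‖expSym w τ l z - expSym w τ l' z‖ * w z
        ≤ ‖projRe l - projRe l'‖ * (τ z / w z) * w z := mul_le_mul_of_nonneg_right h5 hz.1.le
      _ = ‖projRe l - projRe l'‖ * τ z := by have := hz.1.ne'; field_simp
      _ ≤ ‖l - l'‖ * T := mul_le_mul (norm_projRe_sub_le _ _) hz.2.2.2 hz.2.2.1 (norm_nonneg _)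
      _ = T * ‖l - l'‖ := mul_comm _ _
  have h7 : (expL μ w τ l (weightL μ w f) - expL μ w τ l' (weightL μ w f) : Lp ℂ 1 μ) z
      = (expSym w τ l z - expSym w τ l' z) * (w z * f z) := by
    rw [h4, Pi.sub_apply, expL, expL, h1, h2, weightL, h3, sub_mul]
  rw [h7, norm_mul, norm_mul, Complex.norm_real, Real.norm_of_nonneg hz.1.le, ← mul_assoc]
  exact mul_le_mul_of_nonneg_right h6 (norm_nonneg _)

theorem IsTimeWeight.weightL_expL (h : IsTimeWeight μ w τ T) (l : ℂ) (f : Lp ℂ 1 μ) :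
    weightL μ w (expL μ w τ l f) = expL μ w τ l (weightL μ w f) :=
  mulL_comm h.memLp_weight (h.memLp_expSym l) f

theorem expSym_mul_I (s : ℝ) (z : α) :
    expSym w τ (s * Complex.I) z = Complex.exp (-(s * Complex.I * ((τ z / w z : ℝ) : ℂ))) := by
  rw [expSym, projRe_of_nonneg (by simp)]

/-- The unitary family `e^{-i s τ / w}`. -/
theorem IsTimeWeight.isPhaseFamily (h : IsTimeWeight μ w τ T) :
    IsPhaseFamily (weightL μ w) (fun s => expL μ w τ (s * Complex.I)) (timeL μ τ) where
  norm_le s := h.norm_expL_le _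
  continuous f := (h.continuous_expL f).comp (by fun_prop)
  comm s f := h.weightL_expL _ f
  comm_D f := mulL_comm h.memLp_weight h.memLp_time f
  hasDerivAt s f := by
    rw [hasDerivAt_iff_tendsto_slope]
    have hbase : ∀ t : ℝ, ∀ᵐ z ∂μ, slope (fun t : ℝ => expL μ w τ (t * Complex.I) (weightL μ w f))
        s t z = slope (fun t : ℝ => expSym w τ (t * Complex.I) z * (w z * f z)) s t := by
      intro t
      rw [slope_def_module]
      filter_upwards [Lp.coeFn_smul (t - s)⁻¹ (expL μ w τ (t * Complex.I) (weightL μ w f)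
          - expL μ w τ (s * Complex.I) (weightL μ w f)),
        Lp.coeFn_sub (expL μ w τ (t * Complex.I) (weightL μ w f))
          (expL μ w τ (s * Complex.I) (weightL μ w f)),
        coe_mulL (h.memLp_expSym (t * Complex.I)) (weightL μ w f),
        coe_mulL (h.memLp_expSym (s * Complex.I)) (weightL μ w f),
        coe_mulL h.memLp_weight f] with z h1 h2 h3 h4 h5
      rw [h1, Pi.smul_apply, h2, Pi.sub_apply, expL, expL, h3, h4, weightL, h5, slope_def_module]
    have hlim : ∀ᵐ z ∂μ, timeL μ τ (expL μ w τ (s * Complex.I) f) z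
        = -(Complex.I * τ z) * (expSym w τ (s * Complex.I) z * f z) := by
      filter_upwards [coe_mulL h.memLp_time (expL μ w τ (s * Complex.I) f),
        coe_mulL (h.memLp_expSym (s * Complex.I)) f] with z h1 h2
      rw [timeL, h1, expL, h2]
    have hder : ∀ᵐ z ∂μ, HasDerivAt (fun t : ℝ => expSym w τ (t * Complex.I) z * (w z * f z))
        (-(Complex.I * τ z) * (expSym w τ (s * Complex.I) z * f z)) s := by
      filter_upwards [h.ae] with z hz
      have h1 : HasDerivAt (fun t : ℝ => -((t : ℂ) * Complex.I * ((τ z / w z : ℝ) : ℂ)))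
          (-(1 * Complex.I * ((τ z / w z : ℝ) : ℂ))) s :=
        ((Complex.ofRealCLM.hasDerivAt.mul_const _).mul_const _).neg
      have h2 := (h1.cexp).mul_const (w z * f z)
      simp_rw [← expSym_mul_I] at h2
      refine h2.congr_deriv ?_
      have : (w z : ℂ) ≠ 0 := by exact_mod_cast hz.1.ne'
      push_cast
      field_simp
    -- The difference quotients and their limit are each bounded by `T |f|`, again because `w`
    -- cancels `1 / w`.
    refine tendsto_L1_of_dominated (fun z => 2 * T * ‖f z‖)
      ((integrable_Lp f).norm.const_mul _) ?_ _ hbase ?_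
    · filter_upwards [self_mem_nhdsWithin] with t ht
      filter_upwards [h.ae, hbase t, hlim, h.norm_expSym_le (s * Complex.I)] with z hz h1 h2 h3
      rw [h1, h2, slope_def_module, ← sub_mul]
      have h0 : 0 ≤ τ z / w z := div_nonneg hz.2.2.1 hz.1.le
      have hre : ∀ p : ℂ, 0 ≤ p.re → 0 ≤ (p * ((τ z / w z : ℝ) : ℂ)).re := fun p hp => by
        rw [Complex.re_mul_ofReal]; positivity
      have h5 := norm_exp_neg_sub_exp_neg_le (hre _ (projRe_re_nonneg (t * Complex.I)))
        (hre _ (projRe_re_nonneg (s * Complex.I)))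
      rw [← sub_mul, norm_mul, Complex.norm_real, Real.norm_of_nonneg h0] at h5
      have h6 : ‖projRe (t * Complex.I) - projRe (s * Complex.I)‖ = |t - s| := by
        rw [projRe_of_nonneg (by simp), projRe_of_nonneg (by simp), ← sub_mul, norm_mul,
          Complex.norm_I, mul_one, ← Complex.ofReal_sub, Complex.norm_real, Real.norm_eq_abs]
      rw [h6] at h5
      have hts : 0 < |t - s| := abs_pos.2 (sub_ne_zero.2 ht)
      have h7 : ‖(t - s)⁻¹ • ((expSym w τ (t * Complex.I) z - expSym w τ (s * Complex.I) z)
          * (w z * f z))‖ ≤ T * ‖f z‖ := by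
        rw [norm_smul, norm_mul, norm_mul, Complex.norm_real, Real.norm_of_nonneg hz.1.le, norm_inv,
          Real.norm_eq_abs]
        calc |t - s|⁻¹ * (‖expSym w τ (t * Complex.I) z - expSym w τ (s * Complex.I) z‖
              * (w z * ‖f z‖)) ≤ |t - s|⁻¹ * (|t - s| * (τ z / w z) * (w z * ‖f z‖)) := by
              have := hz.1
              gcongr
              exact h5
          _ = τ z * ‖f z‖ := by have := hz.1.ne'; field_simp
          _ ≤ T * ‖f z‖ := mul_le_mul_of_nonneg_right hz.2.2.2 (norm_nonneg _)
      have h8 : ‖-(Complex.I * τ z) * (expSym w τ (s * Complex.I) z * f z)‖ ≤ T * ‖f z‖ := by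
        rw [norm_mul, norm_neg, norm_mul, Complex.norm_I, one_mul, Complex.norm_real,
          Real.norm_of_nonneg hz.2.2.1, norm_mul]
        refine mul_le_mul hz.2.2.2 (mul_le_of_le_one_left (norm_nonneg _) h3) (by positivity)
          h.nonneg
      refine (norm_sub_le _ _).trans ?_
      linarith
    · filter_upwards [hder, hlim] with z h1 h2
      rw [h2]
      exact hasDerivAt_iff_tendsto_slope.1 h1

end Exponential

/-! ### Resolvents in a scale of weighted spaces -/

section ScaleResolvent

variable {X : Type*} [NormedAddCommGroup X] [NormedSpace ℂ X]

theorem pow_comm_apply {M : X →L[ℂ] X} {E : X →L[ℂ] X} (h : ∀ x, M (E x) = E (M x)) (n : ℕ)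
    (x : X) : (M ^ n) (E x) = E ((M ^ n) x) := by
  induction n generalizing x with
  | zero => rfl
  | succ n ih => rw [pow_succ, mul_apply_eq_comp, h, ih, mul_apply_eq_comp]

theorem pow_chain_apply {M : X →L[ℂ] X} {O : ℕ → X →L[ℂ] X} {L : ℕ}
    (hO : ∀ n, n < L → ∀ x, M (O (n + 1) x) = O n (M x)) {n : ℕ} (hn : n ≤ L) (x : X) :
    (M ^ n) (O n x) = O 0 ((M ^ n) x) := by
  induction n generalizing x with
  | zero => rfl
  | succ n ih =>
    rw [pow_succ, mul_apply_eq_comp, hO n hn, ih (n.le_succ.trans hn), mul_apply_eq_comp]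

theorem norm_pow_apply_le {M : X →L[ℂ] X} (hM : ‖M‖ ≤ 1) (m : ℕ) (x : X) : ‖(M ^ m) x‖ ≤ ‖x‖ := by
  induction m with
  | zero => simp
  | succ m ih =>
    rw [pow_succ', mul_apply_eq_comp]
    exact ((M.le_opNorm _).trans (mul_le_of_le_one_left (norm_nonneg _) hM)).trans ih

theorem pow_injective {M : X →L[ℂ] X} (hM : Function.Injective M) (n : ℕ) :
    Function.Injective (M ^ n : X →L[ℂ] X) := by
  induction n with
  | zero => exact fun x y h => h
  | succ n ih =>
    intro x y h
    rw [pow_succ, mul_apply_eq_comp, mul_apply_eq_comp] at h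
    exact hM (ih h)

/-- A family of operators `1 - O₀ E_λ` in a scale of spaces, together with the inverse `N₀` at the
level `0` and with the smoothing property of `(O₀ E_λ)³`. -/
structure IsScaleFamily (M : X →L[ℂ] X) (E : ℂ → X →L[ℂ] X) (O : ℕ → X →L[ℂ] X) (L : ℕ)
    (U : Set ℂ) (N₀ Γ : ℂ → X →L[ℂ] X) (c : ℝ) : Prop where
  injective : Function.Injective M
  norm_M : ‖M‖ ≤ 1
  norm_E : ∀ l, ‖E l‖ ≤ 1
  continuous_E : ∀ x, Continuous fun l => E l x
  comm : ∀ l x, M (E l x) = E l (M x)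
  lipschitz : ∀ l l' x, ‖E l (M x) - E l' (M x)‖ ≤ c * ‖l - l'‖ * ‖x‖
  norm_O : ∀ n, n ≤ L → ‖O n‖ ≤ c
  chain : ∀ n, n < L → ∀ x, M (O (n + 1) x) = O n (M x)
  left_inv : ∀ l ∈ U, ∀ x, N₀ l (x - O 0 (E l x)) = x
  right_inv : ∀ l ∈ U, ∀ x, N₀ l x - O 0 (E l (N₀ l x)) = x
  norm_Γ : ∀ l ∈ U, ‖Γ l‖ ≤ c
  smoothing : ∀ l ∈ U, ∀ x, (M ^ L) (Γ l x) = O 0 (E l (O 0 (E l (O 0 (E l x)))))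

/-- The inverse of `1 - O_n E_λ`. -/
def scaleInv (M : X →L[ℂ] X) (E : ℂ → X →L[ℂ] X) (O : ℕ → X →L[ℂ] X) (L : ℕ)
    (N₀ Γ : ℂ → X →L[ℂ] X) (n : ℕ) (l : ℂ) : X →L[ℂ] X :=
  1 + O n ∘L E l + O n ∘L E l ∘L O n ∘L E l +
    (M ^ (L - n) : X →L[ℂ] X) ∘L Γ l ∘L N₀ l ∘L (M ^ n : X →L[ℂ] X)

variable {M : X →L[ℂ] X} {E : ℂ → X →L[ℂ] X} {O : ℕ → X →L[ℂ] X} {L : ℕ} {U : Set ℂ}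
  {N₀ Γ : ℂ → X →L[ℂ] X} {c : ℝ}

/-- At level `0` the four terms of `scaleInv` become `1 + Q + Q² + Q³ N₀`, that is `N₀`. In the last
term the factor `M ^ L` hidden in `Q³` supplies the missing power `M ^ (L - n)`, so that inverting
at level `0` is enough. -/
theorem IsScaleFamily.pow_scaleInv (h : IsScaleFamily M E O L U N₀ Γ c) {n : ℕ} (hn : n ≤ L)
    {l : ℂ} (hl : l ∈ U) (x : X) :
    (M ^ n) (scaleInv M E O L N₀ Γ n l x) = N₀ l ((M ^ n) x) := by
  have hQ : ∀ x, (M ^ n) (O n (E l x)) = O 0 (E l ((M ^ n) x)) := fun x => by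
    rw [pow_chain_apply h.chain hn, pow_comm_apply (h.comm l)]
  have h1 : (M ^ n) ((M ^ (L - n)) (Γ l (N₀ l ((M ^ n) x))))
      = O 0 (E l (O 0 (E l (O 0 (E l (N₀ l ((M ^ n) x))))))) := by
    rw [← mul_apply_eq_comp, ← pow_add, Nat.add_sub_cancel' hn, h.smoothing l hl]
  change (M ^ n) (x + O n (E l x) + O n (E l (O n (E l x)))
    + (M ^ (L - n)) (Γ l (N₀ l ((M ^ n) x)))) = _
  rw [map_add, map_add, map_add, h1, hQ, hQ, hQ]
  have h2 := sub_eq_iff_eq_add.1 (h.right_inv l hl ((M ^ n) x))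
  have h3 := congrArg (fun z => O 0 (E l z)) h2
  have h4 := congrArg (fun z => O 0 (E l z)) h3
  simp only [map_add] at h3 h4
  exact Eq.trans (by abel) (h2.trans (congrArg _ (h3.trans (congrArg _ h4)))).symm

theorem IsScaleFamily.pow_sub (h : IsScaleFamily M E O L U N₀ Γ c) {n : ℕ} (hn : n ≤ L)
    (l : ℂ) (x : X) : (M ^ n) (x - O n (E l x)) = (M ^ n) x - O 0 (E l ((M ^ n) x)) := by
  rw [map_sub, pow_chain_apply h.chain hn, pow_comm_apply (h.comm l)]

theorem IsScaleFamily.scaleInv_left (h : IsScaleFamily M E O L U N₀ Γ c) {n : ℕ} (hn : n ≤ L)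
    {l : ℂ} (hl : l ∈ U) (x : X) : scaleInv M E O L N₀ Γ n l (x - O n (E l x)) = x := by
  apply pow_injective h.injective n
  rw [h.pow_scaleInv hn hl, h.pow_sub hn, h.left_inv l hl]

theorem IsScaleFamily.scaleInv_right (h : IsScaleFamily M E O L U N₀ Γ c) {n : ℕ} (hn : n ≤ L)
    {l : ℂ} (hl : l ∈ U) (x : X) :
    scaleInv M E O L N₀ Γ n l x - O n (E l (scaleInv M E O L N₀ Γ n l x)) = x := by
  apply pow_injective h.injective n
  rw [h.pow_sub hn, h.pow_scaleInv hn hl, h.right_inv l hl]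

theorem IsScaleFamily.nonneg (h : IsScaleFamily M E O L U N₀ Γ c) : 0 ≤ c :=
  (norm_nonneg _).trans (h.norm_O 0 (Nat.zero_le _))

theorem IsScaleFamily.norm_OE_le (h : IsScaleFamily M E O L U N₀ Γ c) {n : ℕ} (hn : n ≤ L)
    (l : ℂ) (x : X) : ‖O n (E l x)‖ ≤ c * ‖x‖ :=
  ((O n).le_opNorm _).trans (mul_le_mul (h.norm_O n hn) (((E l).le_opNorm _).trans
    (mul_le_of_le_one_left (norm_nonneg _) (h.norm_E l))) (norm_nonneg _) h.nonneg)

/-- The bound is linear in `‖N₀ l‖`. This linearity is what yields one power of the inverse, and no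
more, for each inversion. -/
theorem IsScaleFamily.norm_scaleInv_le (h : IsScaleFamily M E O L U N₀ Γ c) {n : ℕ} (hn : n ≤ L)
    {l : ℂ} (hl : l ∈ U) : ‖scaleInv M E O L N₀ Γ n l‖ ≤ 1 + c + c ^ 2 + c * ‖N₀ l‖ := by
  have hc := h.nonneg
  refine ContinuousLinearMap.opNorm_le_bound _ (by positivity) fun x => ?_
  have h1 := h.norm_OE_le hn l x
  have h2 := (h.norm_OE_le hn l (O n (E l x))).trans (mul_le_mul_of_nonneg_left h1 hc)
  have h3 : ‖(M ^ (L - n)) (Γ l (N₀ l ((M ^ n) x)))‖ ≤ c * (‖N₀ l‖ * ‖x‖) := by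
    refine (norm_pow_apply_le h.norm_M _ _).trans (((Γ l).le_opNorm _).trans
      (mul_le_mul (h.norm_Γ l hl) ?_ (norm_nonneg _) hc))
    exact ((N₀ l).le_opNorm _).trans (mul_le_mul_of_nonneg_left
      (norm_pow_apply_le h.norm_M _ _) (norm_nonneg _))
  change ‖x + O n (E l x) + O n (E l (O n (E l x)))
    + (M ^ (L - n)) (Γ l (N₀ l ((M ^ n) x)))‖ ≤ _
  refine (norm_add_le _ _).trans ((add_le_add ((norm_add_le _ _).trans (add_le_add
    ((norm_add_le _ _).trans (add_le_add le_rfl h1)) h2)) h3).trans (le_of_eq ?_))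
  ring

/-- The inverses of `1 - O₀ E_λ` are locally bounded. -/
theorem IsScaleFamily.eventually_norm_le (h : IsScaleFamily M E O L U N₀ Γ c) (hL : 1 ≤ L)
    {s : ℂ} (hs : s ∈ U) : ∃ K, ∀ᶠ t in 𝓝[U] s, ‖N₀ t‖ ≤ K := by
  have hc := h.nonneg
  -- `P` bounds the approximate inverse constructed below, and `‖s - t‖ B` bounds its error. `B`
  -- uses the inverse at the top level `L`, at the fixed point `s`.
  obtain ⟨P, hP⟩ : ∃ P, P = 1 + c + c ^ 2 + ‖N₀ s‖ * c ^ 3 := ⟨_, rfl⟩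
  obtain ⟨B, hB⟩ : ∃ B, B = c * (c * (‖scaleInv M E O L N₀ Γ L s‖ * c)) := ⟨_, rfl⟩
  have hB0 : 0 ≤ B := by rw [hB]; positivity
  have hP0 : 0 ≤ P := by rw [hP]; positivity
  refine ⟨2 * P, ?_⟩
  have hev : ∀ᶠ t in 𝓝[U] s, ‖s - t‖ * B < 1 / 2 := by
    have h1 : Tendsto (fun t : ℂ => ‖s - t‖ * B) (𝓝 s) (𝓝 (‖s - s‖ * B)) :=
      Continuous.tendsto (by fun_prop) s
    rw [sub_self, norm_zero, zero_mul] at h1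
    exact nhdsWithin_le_nhds (h1.eventually (gt_mem_nhds (by norm_num)))
  filter_upwards [hev, self_mem_nhdsWithin] with t ht htU
  have h1 : ∀ x, ‖N₀ t x‖ ≤ (P + ‖N₀ t‖ * (1 / 2)) * ‖x‖ := by
    intro x
    -- The expansion `x + Q x + Q² x + N₀ Q³ x` at `t`, except that the last inverse is frozen at
    -- `s`. Its defect `r` is the difference of `O 0 E` at `s` and at `t`, applied to `z`.
    obtain ⟨y, hy⟩ : ∃ y, y = O 0 (E t (O 0 (E t (O 0 (E t x))))) := ⟨_, rfl⟩
    obtain ⟨z, hz⟩ : ∃ z, z = N₀ s y := ⟨_, rfl⟩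
    obtain ⟨p, hp⟩ : ∃ p, p = x + O 0 (E t x) + O 0 (E t (O 0 (E t x))) + z := ⟨_, rfl⟩
    obtain ⟨r, hr⟩ : ∃ r, r = O 0 (E s z) - O 0 (E t z) := ⟨_, rfl⟩
    have e1 : z - O 0 (E s z) = y := by rw [hz]; exact h.right_inv s hs y
    have e2 : p - O 0 (E t p) = x + r := by
      rw [hp, hr]
      simp only [map_add]
      rw [← hy, ← e1]
      abel
    have e3 : N₀ t x = p - N₀ t r := by
      have := h.left_inv t htU p
      rw [e2, map_add] at this
      exact eq_sub_of_add_eq this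
    have n1 := h.norm_OE_le (Nat.zero_le L) t x
    have n2 := (h.norm_OE_le (Nat.zero_le L) t (O 0 (E t x))).trans
      (mul_le_mul_of_nonneg_left n1 hc)
    have n3 := (h.norm_OE_le (Nat.zero_le L) t (O 0 (E t (O 0 (E t x))))).trans
      (mul_le_mul_of_nonneg_left n2 hc)
    rw [← hy] at n3
    have n4 : ‖z‖ ≤ ‖N₀ s‖ * (c * (c * (c * ‖x‖))) := by
      rw [hz]
      exact ((N₀ s).le_opNorm _).trans (mul_le_mul_of_nonneg_left n3 (norm_nonneg _))
    have n5 : ‖p‖ ≤ P * ‖x‖ := by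
      rw [hp]
      refine (norm_add_le _ _).trans ((add_le_add ((norm_add_le _ _).trans (add_le_add
        ((norm_add_le _ _).trans (add_le_add le_rfl n1)) n2)) n4).trans (le_of_eq ?_))
      rw [hP]; ring
    -- By smoothing `y` lies in the range of `M ^ L`, and the inverse at level `L` keeps `z` there.
    -- As `L ≥ 1`, `z` lies in the range of `M`, where `E` is Lipschitz in norm.
    have n6 : ‖r‖ ≤ 1 / 2 * ‖x‖ := by
      obtain ⟨u, hu⟩ : ∃ u, u = scaleInv M E O L N₀ Γ L s (Γ t x) := ⟨_, rfl⟩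
      have e4 : z = M ((M ^ (L - 1)) u) := by
        rw [hz, hy, ← h.smoothing t htU, ← h.pow_scaleInv le_rfl hs, ← hu, ← mul_apply_eq_comp,
          ← pow_succ', Nat.sub_add_cancel hL]
      have n7 : ‖u‖ ≤ ‖scaleInv M E O L N₀ Γ L s‖ * (c * ‖x‖) := by
        rw [hu]
        exact (ContinuousLinearMap.le_opNorm _ _).trans (mul_le_mul_of_nonneg_left
          (((Γ t).le_opNorm _).trans (mul_le_mul_of_nonneg_right (h.norm_Γ t htU)
            (norm_nonneg _))) (norm_nonneg _))
      rw [hr, ← map_sub, e4]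
      refine ((O 0).le_opNorm _).trans ((mul_le_mul (h.norm_O 0 (Nat.zero_le _)) (h.lipschitz _ _ _)
        (norm_nonneg _) hc).trans ?_)
      have n8 := (norm_pow_apply_le h.norm_M (L - 1) u).trans n7
      calc c * (c * ‖s - t‖ * ‖(M ^ (L - 1)) u‖)
          ≤ c * (c * ‖s - t‖ * (‖scaleInv M E O L N₀ Γ L s‖ * (c * ‖x‖))) := by gcongr
        _ = ‖s - t‖ * B * ‖x‖ := by rw [hB]; ring
        _ ≤ 1 / 2 * ‖x‖ := mul_le_mul_of_nonneg_right ht.le (norm_nonneg _)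
    rw [e3]
    refine (norm_sub_le _ _).trans ?_
    have := ((N₀ t).le_opNorm r).trans (mul_le_mul_of_nonneg_left n6 (norm_nonneg _))
    linarith
  -- This gives `‖N₀ t‖ ≤ P + ‖N₀ t‖ / 2`. The norm on the right is finite for each `t`, so it can
  -- be absorbed.
  have h2 := ContinuousLinearMap.opNorm_le_bound _ (by positivity) h1
  linarith

theorem IsScaleFamily.eventually_norm_scaleInv_le (h : IsScaleFamily M E O L U N₀ Γ c)
    (hL : 1 ≤ L) {n : ℕ} (hn : n ≤ L) {s : ℂ} (hs : s ∈ U) :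
    ∃ K, ∀ᶠ t in 𝓝[U] s, ‖scaleInv M E O L N₀ Γ n t‖ ≤ K := by
  obtain ⟨K, hK⟩ := h.eventually_norm_le hL hs
  refine ⟨1 + c + c ^ 2 + c * K, ?_⟩
  filter_upwards [hK, self_mem_nhdsWithin] with t ht htU
  exact (h.norm_scaleInv_le hn htU).trans (by
    have := mul_le_mul_of_nonneg_left ht h.nonneg
    linarith)

/-- The resolvent identity turns the increment of the inverse into the locally bounded inverse at
`t`, applied to the increment of `O_n E` on the fixed vector `y`. -/
theorem IsScaleFamily.continuousOn_scaleInv (h : IsScaleFamily M E O L U N₀ Γ c)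
    (hL : 1 ≤ L) {n : ℕ} (hn : n ≤ L) (x : X) :
    ContinuousOn (fun l => scaleInv M E O L N₀ Γ n l x) U := by
  intro s hs
  obtain ⟨K, hK⟩ := h.eventually_norm_scaleInv_le hL hn hs
  obtain ⟨y, hy⟩ : ∃ y, y = scaleInv M E O L N₀ Γ n s x := ⟨_, rfl⟩
  have e1 := h.scaleInv_right hn hs x
  rw [← hy] at e1
  have h1 : Tendsto (fun t => ‖scaleInv M E O L N₀ Γ n t x - y‖) (𝓝[U] s) (𝓝 0) := by
    have h2 : Tendsto (fun t => K * ‖O n (E t y) - O n (E s y)‖) (𝓝[U] s) (𝓝 0) := by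
      have : Tendsto (fun t => K * ‖O n (E t y) - O n (E s y)‖) (𝓝 s)
          (𝓝 (K * ‖O n (E s y) - O n (E s y)‖)) := by
        have := h.continuous_E y
        exact Continuous.tendsto (by fun_prop) s
      rw [sub_self, norm_zero, mul_zero] at this
      exact this.mono_left nhdsWithin_le_nhds
    refine squeeze_zero' (Eventually.of_forall fun _ => norm_nonneg _) ?_ h2
    filter_upwards [hK, self_mem_nhdsWithin] with t ht htU
    have e2 : scaleInv M E O L N₀ Γ n t x - y
        = scaleInv M E O L N₀ Γ n t (O n (E t y) - O n (E s y)) := by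
      conv_lhs => rw [← h.scaleInv_left hn htU y, ← map_sub, ← e1]
      congr 1
      abel
    rw [e2]
    exact (ContinuousLinearMap.le_opNorm _ _).trans (mul_le_mul_of_nonneg_right ht (norm_nonneg _))
  rw [ContinuousWithinAt, tendsto_iff_norm_sub_tendsto_zero, ← hy]
  exact h1

/-- The function `λ ↦ (1 - O_n E_λ)⁻¹ h(λ)` is continuous for continuous `h`. -/
theorem IsScaleFamily.continuousOn_scaleInv_apply (h : IsScaleFamily M E O L U N₀ Γ c)
    (hL : 1 ≤ L) {n : ℕ} (hn : n ≤ L) {f : ℂ → X} (hf : ContinuousOn f U) :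
    ContinuousOn (fun l => scaleInv M E O L N₀ Γ n l (f l)) U := by
  intro s hs
  obtain ⟨K, hK⟩ := h.eventually_norm_scaleInv_le hL hn hs
  exact tendsto_clm_apply_of_strong hK (fun x => h.continuousOn_scaleInv hL hn x s hs) (hf s hs)

end ScaleResolvent

/-! ### Powers of the velocity -/

/-- A bounded operator which factors pointwise through an injective one factors through it. -/
theorem exists_lift {X Y Z : Type*} [NormedAddCommGroup X] [NormedSpace ℂ X]
    [NormedAddCommGroup Y] [NormedSpace ℂ Y] [NormedAddCommGroup Z] [NormedSpace ℂ Z]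
    {P : Y →L[ℂ] Z} (hP : Function.Injective P) {T : X →L[ℂ] Z} {C : ℝ}
    (h : ∀ x, ∃ y, P y = T x ∧ ‖y‖ ≤ C * ‖x‖) :
    ∃ S : X →L[ℂ] Y, (∀ x, P (S x) = T x) ∧ ∀ x, ‖S x‖ ≤ C * ‖x‖ := by
  choose S hS hSC using h
  exact ⟨LinearMap.mkContinuous
    { toFun := S
      map_add' := fun x y => hP (by rw [map_add, hS, hS, hS, map_add])
      map_smul' := fun c x => hP (by rw [map_smul, hS, hS, map_smul, RingHom.id_apply]) } C hSC,
    hS, hSC⟩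

section Weights

variable {α : Type*} [MeasurableSpace α] {μ : Measure α} {w τ : α → ℝ} {T : ℝ}

theorem IsTimeWeight.coe_weightL (h : IsTimeWeight μ w τ T) (f : Lp ℂ 1 μ) :
    weightL μ w f =ᵐ[μ] fun z => (w z : ℂ) * f z := coe_mulL h.memLp_weight f

theorem IsTimeWeight.coe_expL (h : IsTimeWeight μ w τ T) (l : ℂ) (f : Lp ℂ 1 μ) :
    expL μ w τ l f =ᵐ[μ] fun z => expSym w τ l z * f z := coe_mulL (h.memLp_expSym l) f

theorem IsTimeWeight.coe_weightL_pow (h : IsTimeWeight μ w τ T) (n : ℕ) (f : Lp ℂ 1 μ) :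
    (weightL μ w ^ n) f =ᵐ[μ] fun z => (w z : ℂ) ^ n * f z := by
  induction n with
  | zero => exact Eventually.of_forall fun z => by simp
  | succ n ih =>
    rw [pow_succ', mul_apply_eq_comp]
    filter_upwards [h.coe_weightL ((weightL μ w ^ n) f), ih] with z h1 h2
    rw [h1, h2, pow_succ', mul_assoc]

/-- A function dominated by an element of the range of a power of the weight belongs to it. -/
theorem IsTimeWeight.exists_of_norm_le (h : IsTimeWeight μ w τ T) (n : ℕ) {g y : Lp ℂ 1 μ}
    (hg : ∀ᵐ z ∂μ, ‖g z‖ ≤ ‖(weightL μ w ^ n) y z‖) :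
    ∃ u, (weightL μ w ^ n) u = g ∧ ‖u‖ ≤ ‖y‖ := by
  have hle : ∀ᵐ z ∂μ, ‖((w z : ℂ) ^ n)⁻¹ * g z‖ ≤ ‖y z‖ := by
    filter_upwards [hg, h.coe_weightL_pow n y, h.ae] with z h1 h2 h3
    have h4 : 0 < ‖(w z : ℂ) ^ n‖ := norm_pos_iff.2 (pow_ne_zero _ (by exact_mod_cast h3.1.ne'))
    rw [h2, norm_mul] at h1
    rw [norm_mul, norm_inv, inv_mul_le_iff₀ h4]
    exact h1
  have hm : AEStronglyMeasurable (fun z => ((w z : ℂ) ^ n)⁻¹ * g z) μ :=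
    (((Complex.measurable_ofReal.comp h.measurable_w).pow_const n).inv.aestronglyMeasurable).mul
      (Lp.aestronglyMeasurable g)
  have hi : Integrable (fun z => ((w z : ℂ) ^ n)⁻¹ * g z) μ := (integrable_Lp y).mono hm hle
  refine ⟨hi.toL1 _, Lp.ext ?_, norm_mono_ae ?_⟩
  · filter_upwards [h.coe_weightL_pow n (hi.toL1 _), hi.coeFn_toL1, h.ae] with z h1 h2 h3
    have h4 : (w z : ℂ) ≠ 0 := by exact_mod_cast h3.1.ne'
    rw [h1, h2, mul_inv_cancel_left₀ (pow_ne_zero _ h4)]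
  · filter_upwards [hle, hi.coeFn_toL1] with z h1 h2
    rw [h2]; exact h1

/-- The dyadic shell `2^{-(i+1)} < w ≤ 2^{-i}`. -/
def shell (w : α → ℝ) (i : ℕ) : Set α := {z | (1 / 2) ^ (i + 1) < w z ∧ w z ≤ (1 / 2) ^ i}

theorem measurableSet_shell (hw : Measurable w) (i : ℕ) : MeasurableSet (shell w i) :=
  (measurableSet_lt measurable_const hw).inter (measurableSet_le hw measurable_const)

/-- Restriction to a dyadic shell. -/
def shellL (μ : Measure α) (w : α → ℝ) (i : ℕ) : Lp ℂ 1 μ →L[ℂ] Lp ℂ 1 μ :=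
  mulL μ ((shell w i).indicator fun _ => 1)

theorem IsTimeWeight.coe_shellL (h : IsTimeWeight μ w τ T) (i : ℕ) (f : Lp ℂ 1 μ) :
    shellL μ w i f =ᵐ[μ] (shell w i).indicator f := by
  filter_upwards [coe_mulL (memLp_indicator_one (measurableSet_shell h.measurable_w i)) f] with z hz
  rw [shellL, hz]
  by_cases hm : z ∈ shell w i <;> simp [hm]

theorem sum_indicator_shell {E : Type*} [AddCommMonoid E] (g : α → E) {z : α} (hz : w z ≤ 1)
    (N : ℕ) : ∑ i ∈ Finset.range N, (shell w i).indicator g z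
      = {z | (1 / 2) ^ N < w z}.indicator g z := by
  induction N with
  | zero => simp [indicator, hz]
  | succ N ih =>
    rw [Finset.sum_range_succ, ih]
    have hle : ((1 : ℝ) / 2) ^ (N + 1) ≤ (1 / 2) ^ N :=
      pow_le_pow_of_le_one (by norm_num) (by norm_num) N.le_succ
    by_cases h1 : (1 / 2) ^ N < w z
    · rw [indicator_of_mem (s := {z | (1 / 2) ^ N < w z}) h1,
        indicator_of_notMem (s := shell w N) (fun h => h.2.not_gt h1),
        indicator_of_mem (s := {z | (1 / 2) ^ (N + 1) < w z}) (hle.trans_lt h1), add_zero]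
    · rw [indicator_of_notMem (s := {z | (1 / 2) ^ N < w z}) h1, zero_add]
      by_cases h2 : (1 / 2) ^ (N + 1) < w z
      · rw [indicator_of_mem (s := shell w N) ⟨h2, not_lt.1 h1⟩,
          indicator_of_mem (s := {z | (1 / 2) ^ (N + 1) < w z}) h2]
      · rw [indicator_of_notMem (s := shell w N) (fun h => h2 h.1),
          indicator_of_notMem (s := {z | (1 / 2) ^ (N + 1) < w z}) h2]

theorem IsTimeWeight.coe_sum_shellL (h : IsTimeWeight μ w τ T) (f : Lp ℂ 1 μ) (N : ℕ) :
    (∑ i ∈ Finset.range N, shellL μ w i f : Lp ℂ 1 μ) =ᵐ[μ]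
      {z | (1 / 2) ^ N < w z}.indicator f := by
  have h1 := ae_all_iff.2 fun i => h.coe_shellL i f
  filter_upwards [coeFn_sum (Finset.range N) (fun i => shellL μ w i f), h1, h.ae] with z h2 h3 h4
  rw [h2, ← sum_indicator_shell f h4.2.1 N]
  exact Finset.sum_congr rfl fun i _ => h3 i

theorem IsTimeWeight.sum_norm_shellL_le (h : IsTimeWeight μ w τ T) (f : Lp ℂ 1 μ) (N : ℕ) :
    ∑ i ∈ Finset.range N, ‖shellL μ w i f‖ ≤ ‖f‖ := by
  have h1 := ae_all_iff.2 fun i => h.coe_shellL i f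
  simp_rw [norm_eq_integral]
  rw [← integral_finsetSum _ fun i _ => (integrable_Lp (shellL μ w i f)).norm]
  refine integral_mono_ae (integrable_finsetSum _ fun i _ => (integrable_Lp (shellL μ w i f)).norm)
    (integrable_Lp f).norm ?_
  filter_upwards [h1, h.ae] with z h2 h3
  have h4 : ∀ i, ‖shellL μ w i f z‖ = (shell w i).indicator (fun z => ‖f z‖) z := fun i => by
    rw [h2 i, norm_indicator_eq_indicator_norm]
  simp_rw [h4]
  rw [sum_indicator_shell (fun z => ‖f z‖) h3.2.1]
  exact indicator_le_self' (fun _ _ => norm_nonneg _) z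

theorem IsTimeWeight.hasSum_shellL (h : IsTimeWeight μ w τ T) (f : Lp ℂ 1 μ) :
    Summable (fun i => ‖shellL μ w i f‖) ∧ HasSum (fun i => shellL μ w i f) f := by
  have hs : Summable fun i => ‖shellL μ w i f‖ :=
    summable_of_sum_range_le (fun _ => norm_nonneg _) (h.sum_norm_shellL_le f)
  refine ⟨hs, (hasSum_iff_tendsto_nat_of_summable_norm hs).2 ?_⟩
  refine tendsto_L1_of_dominated (fun z => ‖f z‖) (integrable_Lp f).norm
    (Eventually.of_forall fun N => ?_) _ (h.coe_sum_shellL f) ?_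
  · filter_upwards [h.coe_sum_shellL f N] with z hz
    rw [hz]
    by_cases hm : z ∈ {z | (1 / 2) ^ N < w z}
    · rw [indicator_of_mem hm, sub_self, norm_zero]; exact norm_nonneg _
    · rw [indicator_of_notMem hm, zero_sub, norm_neg]
  · filter_upwards [h.ae] with z hz
    refine tendsto_const_nhds.congr' ?_
    have h1 : Tendsto (fun N : ℕ => ((1 : ℝ) / 2) ^ N) atTop (𝓝 0) :=
      tendsto_pow_atTop_nhds_zero_of_lt_one (by norm_num) (by norm_num)
    filter_upwards [h1.eventually (gt_mem_nhds hz.1)] with N hN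
    exact (indicator_of_mem (s := {z | (1 / 2) ^ N < w z}) hN f).symm

end Weights

/-! ### Interpolation between weighted `L¹` spaces -/

section Interpolation

variable {α β : Type*} [MeasurableSpace α] [MeasurableSpace β] {μ : Measure α} {ν : Measure β}
  {w τ : α → ℝ} {w' τ' : β → ℝ} {T T' : ℝ}

/-- The part of an operator bounded on a weighted space which acts on a dyadic shell. -/
theorem exists_shell_lift (h : IsTimeWeight μ w τ T) (h' : IsTimeWeight ν w' τ' T')
    {O S : Lp ℂ 1 μ →L[ℂ] Lp ℂ 1 ν} {n p : ℕ}
    (hS : ∀ f, (weightL ν w' ^ (n + p)) (S f) = O ((weightL μ w ^ (n + p)) f)) (i : ℕ)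
    (f : Lp ℂ 1 μ) :
    ∃ u, (weightL ν w' ^ n) u = O ((weightL μ w ^ n) (shellL μ w i f)) ∧
      ‖u‖ ≤ (‖S‖ * 2 ^ p + ‖O‖) * ‖shellL μ w i f‖ := by
  set r : ℝ := (1 / 2) ^ i with hr
  have hr0 : 0 < r := by positivity
  have hsym : MemLp ((shell w i).indicator fun z => ((w z : ℂ) ^ p)⁻¹) ∞ μ := by
    refine memLp_top_of_norm_le (C := ((r / 2) ^ p)⁻¹) (Measurable.indicator
      ((Complex.measurable_ofReal.comp h.measurable_w).pow_const p).inv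
      (measurableSet_shell h.measurable_w i)) fun z => ?_
    by_cases hz : z ∈ shell w i
    · have hz1 : r / 2 < w z := by
        have := hz.1; rw [pow_succ] at this; rw [hr]; linarith
      rw [indicator_of_mem hz, norm_inv, norm_pow, Complex.norm_real,
        Real.norm_of_nonneg ((half_pos hr0).trans hz1).le]
      gcongr
    · rw [indicator_of_notMem hz, norm_zero]; positivity
  -- On the shell `w` is comparable with `r`, so division by `w ^ p` is bounded there and raises the
  -- weight from `n` to `n + p`.
  set f' := mulL μ ((shell w i).indicator fun z => ((w z : ℂ) ^ p)⁻¹) f with hf'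
  have e1 : (weightL μ w ^ (n + p)) f' = (weightL μ w ^ n) (shellL μ w i f) := by
    rw [pow_add, mul_apply_eq_comp]
    congr 1
    refine Lp.ext ?_
    filter_upwards [h.coe_weightL_pow p f', coe_mulL hsym f, h.coe_shellL i f, h.ae]
      with z h1 h2 h3 h4
    rw [h1, h2, h3]
    have h5 : (w z : ℂ) ≠ 0 := by exact_mod_cast h4.1.ne'
    by_cases hz : z ∈ shell w i
    · rw [indicator_of_mem hz, indicator_of_mem hz, mul_inv_cancel_left₀ (pow_ne_zero _ h5)]
    · rw [indicator_of_notMem hz, indicator_of_notMem hz, zero_mul, mul_zero]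
  have e2 : (weightL ν w' ^ n) ((weightL ν w' ^ p) (S f'))
      = O ((weightL μ w ^ n) (shellL μ w i f)) := by
    rw [← mul_apply_eq_comp, ← pow_add, hS, e1]
  have n1 : ‖f'‖ ≤ ((r / 2) ^ p)⁻¹ * ‖shellL μ w i f‖ := by
    refine norm_le_of_ae_le ?_
    rw [← integral_const_mul]
    refine integral_mono_ae (integrable_Lp f').norm ((integrable_Lp _).norm.const_mul _) ?_
    filter_upwards [coe_mulL hsym f, h.coe_shellL i f] with z h2 h3
    rw [h2, h3]
    by_cases hz : z ∈ shell w i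
    · have hz1 : r / 2 < w z := by
        have := hz.1; rw [pow_succ] at this; rw [hr]; linarith
      rw [indicator_of_mem hz, indicator_of_mem hz, norm_mul, norm_inv, norm_pow,
        Complex.norm_real, Real.norm_of_nonneg ((half_pos hr0).trans hz1).le]
      gcongr
    · rw [indicator_of_notMem hz, indicator_of_notMem hz, zero_mul, norm_zero, mul_zero]
  have n2 : ‖(weightL μ w ^ n) (shellL μ w i f)‖ ≤ r ^ n * ‖shellL μ w i f‖ := by
    refine norm_le_of_ae_le ?_
    rw [← integral_const_mul]
    refine integral_mono_ae (integrable_Lp _).norm ((integrable_Lp _).norm.const_mul _) ?_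
    filter_upwards [h.coe_weightL_pow n (shellL μ w i f), h.coe_shellL i f, h.ae] with z h2 h3 h4
    rw [h2, h3, norm_mul, norm_pow, Complex.norm_real, Real.norm_of_nonneg h4.1.le]
    by_cases hz : z ∈ shell w i
    · exact mul_le_mul_of_nonneg_right (pow_le_pow_left₀ h4.1.le hz.2 n) (norm_nonneg _)
    · rw [indicator_of_notMem hz, norm_zero, mul_zero, mul_zero]
  refine ⟨_, e2, ?_⟩
  set u := (weightL ν w' ^ p) (S f') with hu
  -- The output is split at `w' = r`: the part with small weight is estimated through the weighted
  -- bound for `S`, the other through the unweighted bound for `O`. All powers of `r` cancel against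
  -- those of the input, which makes the constant independent of the shell.
  have n3 : ‖u‖ ≤ r ^ p * ‖S f'‖ + (r ^ n)⁻¹ * ‖(weightL ν w' ^ n) u‖ := by
    rw [norm_eq_integral, norm_eq_integral, norm_eq_integral, ← integral_const_mul,
      ← integral_const_mul, ← integral_add ((integrable_Lp _).norm.const_mul _)
        ((integrable_Lp _).norm.const_mul _)]
    refine integral_mono_ae (integrable_Lp _).norm (((integrable_Lp _).norm.const_mul _).add
        ((integrable_Lp _).norm.const_mul _)) ?_
    filter_upwards [h'.coe_weightL_pow p (S f'), h'.coe_weightL_pow n u, h'.ae] with z h1 h2 h3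
    by_cases hz : w' z ≤ r
    · refine le_add_of_le_of_nonneg ?_ (by positivity)
      rw [h1, norm_mul, norm_pow, Complex.norm_real, Real.norm_of_nonneg h3.1.le]
      exact mul_le_mul_of_nonneg_right (pow_le_pow_left₀ h3.1.le hz p) (norm_nonneg _)
    · refine le_add_of_nonneg_of_le (by positivity) ?_
      rw [h2, norm_mul, norm_pow, Complex.norm_real, Real.norm_of_nonneg h3.1.le, ← mul_assoc]
      refine le_mul_of_one_le_left (norm_nonneg _) ?_
      rw [inv_mul_eq_div, one_le_div (by positivity)]
      exact pow_le_pow_left₀ hr0.le (not_le.1 hz).le n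
  have n4 : ‖S f'‖ ≤ ‖S‖ * (((r / 2) ^ p)⁻¹ * ‖shellL μ w i f‖) :=
    (S.le_opNorm _).trans (mul_le_mul_of_nonneg_left n1 (norm_nonneg _))
  have n5 : ‖(weightL ν w' ^ n) u‖ ≤ ‖O‖ * (r ^ n * ‖shellL μ w i f‖) := by
    rw [e2]
    exact (O.le_opNorm _).trans (mul_le_mul_of_nonneg_left n2 (norm_nonneg _))
  refine n3.trans ((add_le_add (mul_le_mul_of_nonneg_left n4 (by positivity))
    (mul_le_mul_of_nonneg_left n5 (by positivity))).trans (le_of_eq ?_))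
  rw [div_pow]
  field_simp

/-- Interpolation: an operator which is bounded on `L¹` and on a weighted space is bounded on the
intermediate weighted spaces. -/
theorem exists_intermediate_lift (h : IsTimeWeight μ w τ T) (h' : IsTimeWeight ν w' τ' T')
    {O S : Lp ℂ 1 μ →L[ℂ] Lp ℂ 1 ν} {m : ℕ}
    (hS : ∀ f, (weightL ν w' ^ m) (S f) = O ((weightL μ w ^ m) f)) {n : ℕ} (hn : n ≤ m) :
    ∃ S' : Lp ℂ 1 μ →L[ℂ] Lp ℂ 1 ν,
      ∀ f, (weightL ν w' ^ n) (S' f) = O ((weightL μ w ^ n) f) := by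
  obtain ⟨p, rfl⟩ := Nat.exists_eq_add_of_le hn
  have key : ∀ f, ∃ u, (weightL ν w' ^ n : Lp ℂ 1 ν →L[ℂ] Lp ℂ 1 ν) u
      = (O ∘L (weightL μ w ^ n : Lp ℂ 1 μ →L[ℂ] Lp ℂ 1 μ)) f ∧
      ‖u‖ ≤ (‖S‖ * 2 ^ p + ‖O‖) * ‖f‖ := by
    intro f
    -- The lifts of the shells are summed. The series converges absolutely, because the constant is
    -- uniform and the norms of the shells add up to at most `‖f‖`.
    choose u hu hun using fun i => exists_shell_lift h h' hS i f
    obtain ⟨hs, hsum⟩ := h.hasSum_shellL f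
    have hsu : Summable fun i => ‖u i‖ :=
      Summable.of_nonneg_of_le (fun _ => norm_nonneg _) hun (hs.mul_left _)
    have hsu' : Summable u := hsu.of_norm
    refine ⟨∑' i, u i, ?_, ?_⟩
    · rw [ContinuousLinearMap.map_tsum _ hsu']
      simp_rw [hu]
      exact (hsum.mapL (O ∘L (weightL μ w ^ n : Lp ℂ 1 μ →L[ℂ] Lp ℂ 1 μ))).tsum_eq
    · refine (norm_tsum_le_tsum_norm hsu).trans ((hsu.tsum_le_tsum hun (hs.mul_left _)).trans ?_)
      rw [tsum_mul_left]
      exact mul_le_mul_of_nonneg_left (hs.tsum_le_of_sum_range_le (h.sum_norm_shellL_le f))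
        (by positivity)
  obtain ⟨S', hS', -⟩ := exists_lift (pow_injective h'.weightL_injective n) key
  exact ⟨S', hS'⟩

end Interpolation

/-! ### The boundary operators as a single operator in a scale of spaces -/

section Lifts

variable {α β : Type*} [MeasurableSpace α] [MeasurableSpace β] {μ : Measure α} {ν : Measure β}
  {w τ : α → ℝ} {w' τ' : β → ℝ} {T T' : ℝ}

/-- The operators `w'^{-n} O w^n` for all `n ≤ m`, each obtained by interpolation. The relation
between neighbours follows on cancelling `w' ^ n`, which is injective. -/
theorem exists_chain (h : IsTimeWeight μ w τ T) (h' : IsTimeWeight ν w' τ' T')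
    {O S : Lp ℂ 1 μ →L[ℂ] Lp ℂ 1 ν} {m : ℕ}
    (hS : ∀ f, (weightL ν w' ^ m) (S f) = O ((weightL μ w ^ m) f)) :
    ∃ Q : ℕ → Lp ℂ 1 μ →L[ℂ] Lp ℂ 1 ν, Q 0 = O ∧
      ∀ n, n < m → ∀ f, weightL ν w' (Q (n + 1) f) = Q n (weightL μ w f) := by
  have key : ∀ n, ∃ S' : Lp ℂ 1 μ →L[ℂ] Lp ℂ 1 ν, n ≤ m →
      ∀ f, (weightL ν w' ^ n) (S' f) = O ((weightL μ w ^ n) f) := by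
    intro n
    by_cases hn : n ≤ m
    · obtain ⟨S', hS'⟩ := exists_intermediate_lift h h' hS hn
      exact ⟨S', fun _ => hS'⟩
    · exact ⟨0, fun h => absurd h hn⟩
  choose Q hQ using key
  refine ⟨Q, ContinuousLinearMap.ext fun f => hQ 0 (Nat.zero_le _) f, fun n hn f => ?_⟩
  apply pow_injective h'.weightL_injective n
  rw [← mul_apply_eq_comp, ← pow_succ, hQ _ hn, hQ _ hn.le, pow_succ, mul_apply_eq_comp]

end Lifts

/-! ### Multiplication by the speed and lifts of weighted bounds -/

variable {I J : Set ℝ}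

theorem isTimeWeight_abs (hI : MeasurableSet I) (hI1 : I ⊆ Ioo (-1 : ℝ) 1) {a : ℝ} (ha : 0 < a) :
    IsTimeWeight (volume.restrict I) (fun v : ℝ => |v|) (fun _ => 2 * a) (2 * a) where
  measurable_w := measurable_norm
  measurable_τ := measurable_const
  nonneg := by positivity
  ae := by
    have h0 : ∀ᵐ v ∂(volume.restrict I), v ≠ 0 := ae_restrict_of_ae (by simp [ae_iff])
    filter_upwards [h0, ae_restrict_mem hI] with v h1 h2
    exact ⟨abs_pos.2 h1, (abs_lt.2 (hI1 h2)).le, by positivity, le_rfl⟩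

/-- Multiplication by `|v|`. -/
abbrev velL (I : Set ℝ) : L1 I →L[ℂ] L1 I := weightL (volume.restrict I) fun v => |v|

/-- Multiplication by `e^{-2λa/|v|}`. -/
abbrev crossL (a : ℝ) (I : Set ℝ) (l : ℂ) : L1 I →L[ℂ] L1 I :=
  expL (volume.restrict I) (fun v => |v|) (fun _ => 2 * a) l

theorem phaseMul_eq_crossL (a s : ℝ) (I : Set ℝ) :
    phaseMul a s I = crossL a I (s * Complex.I) := by
  rw [phaseMul_eq_mulL, crossL, expL]
  congr 1
  funext v
  rw [expSym_mul_I, phase]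
  congr 1
  push_cast
  ring

theorem pow_velL_of_isPowMul (hI : MeasurableSet I) (hI1 : I ⊆ Ioo (-1 : ℝ) 1) {n : ℕ}
    {f u : L1 I} (h : IsPowMul (-(n : ℤ)) f u) : (velL I ^ n) u = f := by
  have hw := isTimeWeight_abs hI hI1 one_pos
  refine Lp.ext ?_
  filter_upwards [hw.coe_weightL_pow n u, h, hw.ae] with v h1 h2 h3
  have h4 : ((|v| : ℝ) : ℂ) ≠ 0 := by exact_mod_cast h3.1.ne'
  rw [h1, h2, zpow_neg, zpow_natCast]
  push_cast
  rw [mul_inv_cancel_left₀ (pow_ne_zero _ h4)]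

theorem isPowMul_pow_velL (hI : MeasurableSet I) (hI1 : I ⊆ Ioo (-1 : ℝ) 1) (n : ℕ)
    (f : L1 I) : IsPowMul (n : ℤ) f ((velL I ^ n) f) := by
  filter_upwards [(isTimeWeight_abs hI hI1 one_pos).coe_weightL_pow n f] with v h1
  rw [h1, zpow_natCast]
  push_cast
  rfl

theorem WeightBounded.exists_lift (hJ : MeasurableSet J) (hJ1 : J ⊆ Ioo (-1 : ℝ) 1) {n : ℕ}
    {A : L1 I →L[ℂ] L1 J} (h : WeightBounded n A) :
    ∃ S : L1 I →L[ℂ] L1 J, ∀ f, (velL J ^ n) (S f) = A f := by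
  obtain ⟨C, hC⟩ := h
  obtain ⟨S, hS, -⟩ := SlabTransport.exists_lift (pow_injective
    (isTimeWeight_abs hJ hJ1 one_pos).weightL_injective n) (T := A) (C := C) fun f => by
      obtain ⟨u, hu, hn⟩ := hC f
      exact ⟨u, pow_velL_of_isPowMul hJ hJ1 hu, hn⟩
  exact ⟨S, hS⟩

theorem ConjBounded.exists_lift (hI : MeasurableSet I) (hI1 : I ⊆ Ioo (-1 : ℝ) 1)
    (hJ : MeasurableSet J) (hJ1 : J ⊆ Ioo (-1 : ℝ) 1) {n : ℕ}
    {A : L1 I →L[ℂ] L1 J} (h : ConjBounded n A) :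
    ∃ S : L1 I →L[ℂ] L1 J, ∀ f, (velL J ^ n) (S f) = A ((velL I ^ n) f) := by
  obtain ⟨C, hC⟩ := h
  obtain ⟨S, hS, -⟩ := SlabTransport.exists_lift (pow_injective
    (isTimeWeight_abs hJ hJ1 one_pos).weightL_injective n)
    (T := A ∘L (velL I ^ n : L1 I →L[ℂ] L1 I)) (C := C) fun f => by
      obtain ⟨u, hu, hn⟩ := hC f _ (isPowMul_pow_velL hI hI1 n f)
      exact ⟨u, pow_velL_of_isPowMul hJ hJ1 hu, hn⟩
  exact ⟨S, hS⟩

/-! ### Restriction and extension by zero -/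

theorem isL1Map_restr (h : I ⊆ J) :
    IsL1Map (volume.restrict J) (volume.restrict I) (fun f => f) 1 where
  nonneg := zero_le_one
  congr _ _ hfg := ae_restrict_of_ae_restrict_of_subset h hfg
  add _ _ _ _ := EventuallyEq.rfl
  smul _ _ _ := EventuallyEq.rfl
  integrable _ hf := IntegrableOn.mono_set hf h
  bound f hf := by
    rw [one_mul]
    exact setIntegral_mono_set hf.norm (Eventually.of_forall fun _ => norm_nonneg _)
      h.eventuallyLE

theorem isL1Map_ext (hI : MeasurableSet I) (h : I ⊆ J) :
    IsL1Map (volume.restrict I) (volume.restrict J) (fun f => I.indicator f) 1 where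
  nonneg := zero_le_one
  congr f g hfg := by
    refine ae_restrict_of_ae ?_
    rw [EventuallyEq, ae_restrict_iff' hI] at hfg
    filter_upwards [hfg] with v hv
    by_cases hvI : v ∈ I
    · rw [indicator_of_mem hvI, indicator_of_mem hvI, hv hvI]
    · rw [indicator_of_notMem hvI, indicator_of_notMem hvI]
  add f g _ _ := by rw [indicator_add']
  smul c f _ := Eventually.of_forall fun v => by
    by_cases hvI : v ∈ I
    · rw [indicator_of_mem hvI, Pi.smul_apply, Pi.smul_apply, indicator_of_mem hvI]
    · rw [indicator_of_notMem hvI, Pi.smul_apply, indicator_of_notMem hvI, smul_zero]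
  integrable f hf := ((integrable_indicator_iff hI).2 hf).mono_measure Measure.restrict_le_self
  bound f hf := by
    rw [one_mul]
    simp_rw [norm_indicator_eq_indicator_norm]
    rw [setIntegral_indicator hI, inter_eq_right.2 h]

/-- Restriction of functions. -/
def restrL (h : I ⊆ J) : L1 J →L[ℂ] L1 I := (isL1Map_restr h).clm

/-- Extension of functions by `0`. -/
def extL (hI : MeasurableSet I) (h : I ⊆ J) : L1 I →L[ℂ] L1 J := (isL1Map_ext hI h).clm

theorem coe_restrL (h : I ⊆ J) (f : L1 J) : restrL h f =ᵐ[volume.restrict I] f :=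
  (isL1Map_restr h).coe_clm f

theorem coe_extL (hI : MeasurableSet I) (h : I ⊆ J) (f : L1 I) :
    extL hI h f =ᵐ[volume.restrict J] I.indicator f := (isL1Map_ext hI h).coe_clm f

theorem norm_restrL_le (h : I ⊆ J) : ‖restrL h‖ ≤ 1 := (isL1Map_restr h).norm_clm_le

theorem norm_extL_le (hI : MeasurableSet I) (h : I ⊆ J) : ‖extL hI h‖ ≤ 1 :=
  (isL1Map_ext hI h).norm_clm_le

theorem restrL_mulL (h : I ⊆ J) {m : ℝ → ℂ} (hm : MemLp m ∞ (volume.restrict J)) (f : L1 J) :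
    restrL h (mulL _ m f) = mulL _ m (restrL h f) := by
  have hm' : MemLp m ∞ (volume.restrict I) := hm.mono_measure (Measure.restrict_mono h le_rfl)
  refine Lp.ext ?_
  filter_upwards [coe_restrL h (mulL _ m f), coe_mulL hm' (restrL h f), coe_restrL h f,
    ae_restrict_of_ae_restrict_of_subset h (coe_mulL hm f)] with v h1 h2 h3 h4
  rw [h1, h2, h3, h4]

/-- `L¹((-1,1); dv)`. -/
abbrev L1V : Type := L1 (Ioo (-1 : ℝ) 1)

/-- Restriction to positive velocities. -/
def posL : L1V →L[ℂ] L1Pos := restrL pos_subset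

/-- Restriction to negative velocities. -/
def negL : L1V →L[ℂ] L1Neg := restrL neg_subset

/-- Extension from positive velocities. -/
def extPos : L1Pos →L[ℂ] L1V := extL measurableSet_Ioo pos_subset

/-- Extension from negative velocities. -/
def extNeg : L1Neg →L[ℂ] L1V := extL measurableSet_Ioo neg_subset

theorem norm_posL_apply_le (f : L1V) : ‖posL f‖ ≤ ‖f‖ :=
  (posL.le_opNorm f).trans (mul_le_of_le_one_left (norm_nonneg _) (norm_restrL_le _))

theorem norm_negL_apply_le (f : L1V) : ‖negL f‖ ≤ ‖f‖ :=
  (negL.le_opNorm f).trans (mul_le_of_le_one_left (norm_nonneg _) (norm_restrL_le _))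

theorem norm_extPos_apply_le (f : L1Pos) : ‖extPos f‖ ≤ ‖f‖ :=
  (extPos.le_opNorm f).trans (mul_le_of_le_one_left (norm_nonneg _) (norm_extL_le _ _))

theorem norm_extNeg_apply_le (f : L1Neg) : ‖extNeg f‖ ≤ ‖f‖ :=
  (extNeg.le_opNorm f).trans (mul_le_of_le_one_left (norm_nonneg _) (norm_extL_le _ _))

theorem posL_extPos (f : L1Pos) : posL (extPos f) = f := by
  refine Lp.ext ?_
  filter_upwards [coe_restrL pos_subset (extPos f), ae_restrict_of_ae_restrict_of_subset pos_subset
    (coe_extL measurableSet_Ioo pos_subset f), ae_restrict_mem measurableSet_Ioo] with v h1 h2 h3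
  rw [posL, h1, extPos, h2, indicator_of_mem h3]

theorem negL_extNeg (f : L1Neg) : negL (extNeg f) = f := by
  refine Lp.ext ?_
  filter_upwards [coe_restrL neg_subset (extNeg f), ae_restrict_of_ae_restrict_of_subset neg_subset
    (coe_extL measurableSet_Ioo neg_subset f), ae_restrict_mem measurableSet_Ioo] with v h1 h2 h3
  rw [negL, h1, extNeg, h2, indicator_of_mem h3]

theorem posL_extNeg (f : L1Neg) : posL (extNeg f) = 0 := by
  refine Lp.ext ?_
  filter_upwards [coe_restrL pos_subset (extNeg f), ae_restrict_of_ae_restrict_of_subset pos_subset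
    (coe_extL measurableSet_Ioo neg_subset f), ae_restrict_mem measurableSet_Ioo,
    Lp.coeFn_zero ℂ 1 (volume.restrict (Ioo (0 : ℝ) 1))] with v h1 h2 h3 h4
  rw [posL, h1, extNeg, h2, indicator_of_notMem (fun h => h.2.not_gt h3.1), h4, Pi.zero_apply]

theorem negL_extPos (f : L1Pos) : negL (extPos f) = 0 := by
  refine Lp.ext ?_
  filter_upwards [coe_restrL neg_subset (extPos f), ae_restrict_of_ae_restrict_of_subset neg_subset
    (coe_extL measurableSet_Ioo pos_subset f), ae_restrict_mem measurableSet_Ioo,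
    Lp.coeFn_zero ℂ 1 (volume.restrict (Ioo (-1 : ℝ) 0))] with v h1 h2 h3 h4
  rw [negL, h1, extPos, h2, indicator_of_notMem (fun h => h.1.not_gt h3.2), h4, Pi.zero_apply]

/-- A property which holds for almost all positive and for almost all negative velocities holds
almost everywhere. -/
theorem ae_velocity {P : ℝ → Prop} (hp : ∀ᵐ v ∂(volume.restrict (Ioo (0 : ℝ) 1)), P v)
    (hn : ∀ᵐ v ∂(volume.restrict (Ioo (-1 : ℝ) 0)), P v) :
    ∀ᵐ v ∂(volume.restrict (Ioo (-1 : ℝ) 1)), P v := by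
  have h0 : ∀ᵐ v : ℝ, v ≠ 0 := by simp [ae_iff]
  rw [ae_restrict_iff' measurableSet_Ioo] at hp hn ⊢
  filter_upwards [hp, hn, h0] with v h1 h2 h3 h4
  rcases lt_or_gt_of_ne h3 with h | h
  · exact h2 ⟨h4.1, h⟩
  · exact h1 ⟨h, h4.2⟩

theorem L1V_ext {f g : L1V} (hp : posL f = posL g) (hn : negL f = negL g) : f = g := by
  refine Lp.ext (ae_velocity ?_ ?_)
  · filter_upwards [coe_restrL pos_subset f, coe_restrL pos_subset g] with v h1 h2
    rw [← h1, ← h2]; exact congrArg (fun u : L1Pos => u v) hp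
  · filter_upwards [coe_restrL neg_subset f, coe_restrL neg_subset g] with v h1 h2
    rw [← h1, ← h2]; exact congrArg (fun u : L1Neg => u v) hn

/-- The operator which acts as `A` on negative and as `B` on positive velocities, and exchanges
them. -/
def exchangeL (A : L1Neg →L[ℂ] L1Pos) (B : L1Pos →L[ℂ] L1Neg) : L1V →L[ℂ] L1V :=
  extPos ∘L A ∘L negL + extNeg ∘L B ∘L posL

section Exchange

variable (A : L1Neg →L[ℂ] L1Pos) (B : L1Pos →L[ℂ] L1Neg)

theorem posL_exchangeL (f : L1V) : posL (exchangeL A B f) = A (negL f) := by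
  change posL (extPos (A (negL f)) + extNeg (B (posL f))) = _
  rw [map_add, posL_extPos, posL_extNeg, add_zero]

theorem negL_exchangeL (f : L1V) : negL (exchangeL A B f) = B (posL f) := by
  change negL (extPos (A (negL f)) + extNeg (B (posL f))) = _
  rw [map_add, negL_extPos, negL_extNeg, zero_add]

end Exchange

variable {a : ℝ}

theorem isTimeWeight_V (ha : 0 < a) : IsTimeWeight (volume.restrict (Ioo (-1 : ℝ) 1))
    (fun v : ℝ => |v|) (fun _ => 2 * a) (2 * a) := isTimeWeight_abs measurableSet_Ioo subset_rfl ha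

theorem isTimeWeight_pos (ha : 0 < a) : IsTimeWeight (volume.restrict (Ioo (0 : ℝ) 1))
    (fun v : ℝ => |v|) (fun _ => 2 * a) (2 * a) := isTimeWeight_abs measurableSet_Ioo pos_subset ha

theorem isTimeWeight_neg (ha : 0 < a) : IsTimeWeight (volume.restrict (Ioo (-1 : ℝ) 0))
    (fun v : ℝ => |v|) (fun _ => 2 * a) (2 * a) := isTimeWeight_abs measurableSet_Ioo neg_subset ha

theorem posL_velL (f : L1V) : posL (velL _ f) = velL _ (posL f) :=
  restrL_mulL _ (isTimeWeight_V one_pos).memLp_weight f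

theorem negL_velL (f : L1V) : negL (velL _ f) = velL _ (negL f) :=
  restrL_mulL _ (isTimeWeight_V one_pos).memLp_weight f

theorem posL_crossL (ha : 0 < a) (l : ℂ) (f : L1V) :
    posL (crossL a _ l f) = crossL a _ l (posL f) :=
  restrL_mulL _ ((isTimeWeight_V ha).memLp_expSym l) f

theorem negL_crossL (ha : 0 < a) (l : ℂ) (f : L1V) :
    negL (crossL a _ l f) = crossL a _ l (negL f) :=
  restrL_mulL _ ((isTimeWeight_V ha).memLp_expSym l) f

theorem posL_pow_velL (n : ℕ) (f : L1V) : posL ((velL _ ^ n) f) = (velL _ ^ n) (posL f) := by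
  induction n with
  | zero => rfl
  | succ n ih => rw [pow_succ', mul_apply_eq_comp, posL_velL, ih, pow_succ', mul_apply_eq_comp]

theorem negL_pow_velL (n : ℕ) (f : L1V) : negL ((velL _ ^ n) f) = (velL _ ^ n) (negL f) := by
  induction n with
  | zero => rfl
  | succ n ih => rw [pow_succ', mul_apply_eq_comp, negL_velL, ih, pow_succ', mul_apply_eq_comp]

/-! ### The boundary operators in the scale of weighted spaces -/

section Boundary

variable {I J : Set ℝ} {a : ℝ}

/-- Speeds are below `1`, so a crossing of the slab takes time at least `2 a`. -/
theorem norm_crossL_le_exp (hI : MeasurableSet I) (hI1 : I ⊆ Ioo (-1 : ℝ) 1) (ha : 0 < a) {l : ℂ}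
    (hl : 0 ≤ l.re) : ‖crossL a I l‖ ≤ Real.exp (-(l.re * (2 * a))) := by
  have hw := isTimeWeight_abs hI hI1 ha
  refine norm_mulL_le (hw.memLp_expSym l) (Real.exp_nonneg _) ?_
  filter_upwards [hw.ae] with v hv
  rw [expSym, projRe_of_nonneg hl, Complex.norm_exp, Complex.neg_re, Complex.re_mul_ofReal]
  refine Real.exp_le_exp.2 (neg_le_neg (mul_le_mul_of_nonneg_left ?_ hl))
  rw [le_div_iff₀ hv.1]
  exact mul_le_of_le_one_right (by positivity) hv.2.1

/-- The operator `O₁ e^{-2λa/|v|} O₂ e^{-2λa/|v|}`. -/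
def returnL (a : ℝ) (O₁ : L1Neg →L[ℂ] L1Pos) (O₂ : L1Pos →L[ℂ] L1Neg) (l : ℂ) :
    L1Pos →L[ℂ] L1Pos :=
  O₁ ∘L crossL a (Ioo (-1) 0) l ∘L O₂ ∘L crossL a (Ioo 0 1) l

variable {O₁ : L1Neg →L[ℂ] L1Pos} {O₂ : L1Pos →L[ℂ] L1Neg}

theorem returnL_mul_I (s : ℝ) : returnL a O₁ O₂ (s * Complex.I) = G a O₁ O₂ s := by
  rw [G, phaseMul_eq_crossL, phaseMul_eq_crossL, returnL]

/-- On the axis this is the invertibility of `1 - G`. For `Re λ > 0` each crossing is damped by a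
factor less than `1`, and a Neumann series applies. -/
theorem isUnit_one_sub_returnL (ha : 0 < a) (h₁ : ‖O₁‖ ≤ 1) (h₂ : ‖O₂‖ ≤ 1)
    (hG : ∀ s : ℝ, s ≠ 0 → IsUnit (1 - G a O₁ O₂ s)) {l : ℂ} (hl : 0 ≤ l.re) (hl0 : l ≠ 0) :
    IsUnit (1 - returnL a O₁ O₂ l) := by
  rcases hl.eq_or_lt with h | h
  · have e : l = (l.im : ℂ) * Complex.I := Complex.ext (by simp [← h]) (by simp)
    have him : l.im ≠ 0 := fun h0 => hl0 (by rw [e, h0]; simp)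
    rw [e, returnL_mul_I]
    exact hG _ him
  · refine isUnit_one_sub_of_norm_lt_one ?_
    have hn := norm_crossL_le_exp measurableSet_Ioo neg_subset ha hl
    have hp := norm_crossL_le_exp measurableSet_Ioo pos_subset ha hl
    have hlt : Real.exp (-(l.re * (2 * a))) < 1 := Real.exp_lt_one_iff.2 (by
      have : 0 < l.re * (2 * a) := by positivity
      linarith)
    have hp1 : ‖crossL a (Ioo 0 1) l‖ ≤ Real.exp (-(l.re * (2 * a))) := hp
    have hn1 := hn.trans hlt.le
    calc ‖returnL a O₁ O₂ l‖
        ≤ ‖O₁‖ * (‖crossL a (Ioo (-1) 0) l‖ * (‖O₂‖ * ‖crossL a (Ioo 0 1) l‖)) := by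
          refine (ContinuousLinearMap.opNorm_comp_le _ _).trans ?_
          gcongr
          refine (ContinuousLinearMap.opNorm_comp_le _ _).trans ?_
          gcongr
          exact ContinuousLinearMap.opNorm_comp_le _ _
      _ ≤ 1 * (1 * (1 * Real.exp (-(l.re * (2 * a))))) := by gcongr
      _ < 1 := by linarith

/-- The inverse of `1 - O e^{-2λa/|v|}` on `L¹(-1,1)`. -/
def boundaryInv (a : ℝ) (O₁ : L1Neg →L[ℂ] L1Pos) (O₂ : L1Pos →L[ℂ] L1Neg) (l : ℂ) :
    L1V →L[ℂ] L1V :=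
  extPos ∘L Ring.inverse (1 - returnL a O₁ O₂ l) ∘L (posL + O₁ ∘L crossL a _ l ∘L negL) +
    extNeg ∘L (negL + O₂ ∘L crossL a _ l ∘L Ring.inverse (1 - returnL a O₁ O₂ l) ∘L
      (posL + O₁ ∘L crossL a _ l ∘L negL))

/-- The inverse comes from block elimination in `y - O E y = f`: substituting the negative component
into the positive one leaves an equation for `1 - returnL` alone, after which the negative component
is recovered from the positive one. -/
theorem posL_boundaryInv (l : ℂ) (f : L1V) : posL (boundaryInv a O₁ O₂ l f)
    = Ring.inverse (1 - returnL a O₁ O₂ l) (posL f + O₁ (crossL a _ l (negL f))) := by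
  change posL (extPos _ + extNeg _) = _
  rw [map_add, posL_extPos, posL_extNeg, add_zero]
  rfl

theorem negL_boundaryInv (l : ℂ) (f : L1V) : negL (boundaryInv a O₁ O₂ l f)
    = negL f + O₂ (crossL a _ l (posL (boundaryInv a O₁ O₂ l f))) := by
  rw [posL_boundaryInv]
  change negL (extPos _ + extNeg _) = _
  rw [map_add, negL_extNeg, negL_extPos, zero_add]
  rfl

theorem boundaryInv_left (ha : 0 < a) {l : ℂ} (hu : IsUnit (1 - returnL a O₁ O₂ l)) (f : L1V) :
    boundaryInv a O₁ O₂ l (f - exchangeL O₁ O₂ (crossL a _ l f)) = f := by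
  have h1 : ∀ x, Ring.inverse (1 - returnL a O₁ O₂ l) (x - returnL a O₁ O₂ l x) = x := fun x =>
    DFunLike.congr_fun (Ring.inverse_mul_cancel _ hu) x
  have hp : posL (boundaryInv a O₁ O₂ l (f - exchangeL O₁ O₂ (crossL a _ l f))) = posL f := by
    rw [posL_boundaryInv, map_sub, map_sub, posL_exchangeL, negL_exchangeL, posL_crossL ha,
      negL_crossL ha, map_sub, map_sub, sub_add_sub_cancel]
    exact h1 _
  refine L1V_ext hp ?_
  rw [negL_boundaryInv, hp, map_sub, negL_exchangeL, posL_crossL ha, sub_add_cancel]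

theorem boundaryInv_right (ha : 0 < a) {l : ℂ} (hu : IsUnit (1 - returnL a O₁ O₂ l)) (f : L1V) :
    boundaryInv a O₁ O₂ l f - exchangeL O₁ O₂ (crossL a _ l (boundaryInv a O₁ O₂ l f)) = f := by
  have h1 : ∀ x, Ring.inverse (1 - returnL a O₁ O₂ l) x
      - returnL a O₁ O₂ l (Ring.inverse (1 - returnL a O₁ O₂ l) x) = x := fun x =>
    DFunLike.congr_fun (Ring.mul_inverse_cancel _ hu) x
  refine L1V_ext ?_ ?_
  · rw [map_sub, posL_exchangeL, negL_crossL ha, negL_boundaryInv, map_add, map_add,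
      posL_boundaryInv, ← sub_sub, sub_right_comm]
    exact sub_eq_of_eq_add (h1 _)
  · rw [map_sub, negL_exchangeL, posL_crossL ha, negL_boundaryInv, add_sub_cancel_right]

theorem norm_boundaryInv_le (ha : 0 < a) (h₁ : ‖O₁‖ ≤ 1) (h₂ : ‖O₂‖ ≤ 1) (l : ℂ) :
    ‖boundaryInv a O₁ O₂ l‖ ≤ 4 * (1 + ‖Ring.inverse (1 - returnL a O₁ O₂ l)‖) := by
  set W := Ring.inverse (1 - returnL a O₁ O₂ l) with hW
  refine ContinuousLinearMap.opNorm_le_bound _ (by positivity) fun f => ?_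
  have b1 : ∀ x, ‖O₁ (crossL a _ l x)‖ ≤ ‖x‖ := fun x =>
    (O₁.le_opNorm _).trans ((mul_le_of_le_one_left (norm_nonneg _) h₁).trans
      (((crossL a _ l).le_opNorm _).trans (mul_le_of_le_one_left (norm_nonneg _)
        ((isTimeWeight_neg ha).norm_expL_le l))))
  have b2 : ∀ x, ‖O₂ (crossL a _ l x)‖ ≤ ‖x‖ := fun x =>
    (O₂.le_opNorm _).trans ((mul_le_of_le_one_left (norm_nonneg _) h₂).trans
      (((crossL a _ l).le_opNorm _).trans (mul_le_of_le_one_left (norm_nonneg _)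
        ((isTimeWeight_pos ha).norm_expL_le l))))
  set y := W (posL f + O₁ (crossL a _ l (negL f))) with hy
  have n1 : ‖y‖ ≤ ‖W‖ * (‖f‖ + ‖f‖) := (W.le_opNorm _).trans (mul_le_mul_of_nonneg_left
    ((norm_add_le _ _).trans (add_le_add (norm_posL_apply_le f)
      ((b1 _).trans (norm_negL_apply_le f)))) (norm_nonneg _))
  have e : boundaryInv a O₁ O₂ l f = extPos y + extNeg (negL f + O₂ (crossL a _ l y)) := rfl
  rw [e]
  have n2 : ‖extNeg (negL f + O₂ (crossL a _ l y))‖ ≤ ‖f‖ + ‖y‖ :=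
    (norm_extNeg_apply_le _).trans ((norm_add_le _ _).trans (add_le_add (norm_negL_apply_le f)
      (b2 y)))
  have n3 := norm_add_le (extPos y) (extNeg (negL f + O₂ (crossL a _ l y)))
  have n4 := norm_extPos_apply_le y
  have n5 := norm_nonneg f
  have n6 : 0 ≤ ‖W‖ * ‖f‖ := by positivity
  nlinarith

/-- The operator `O₁ e^{-2λa/|v|} O₂ e^{-2λa/|v|}` inherits the smoothing property of `O₁ O₂`. -/
theorem exists_returnL_lift (ha : 0 < a) (h₁ : IsStochastic O₁) (h₂ : IsStochastic O₂) {m : ℕ}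
    {Z : L1Pos →L[ℂ] L1Pos} (hZ : ∀ f, (velL _ ^ m) (Z f) = O₁ (O₂ f)) (l : ℂ) :
    ∃ P : L1Pos →L[ℂ] L1Pos, (∀ f, (velL _ ^ m) (P f) = returnL a O₁ O₂ l f) ∧
      ∀ f, ‖P f‖ ≤ ‖Z‖ * ‖f‖ := by
  refine exists_lift (pow_injective (isTimeWeight_pos ha).weightL_injective m) fun f => ?_
  have hp := isTimeWeight_pos ha
  have hn := isTimeWeight_neg ha
  -- The exponentials have modulus at most `1`, so two dominations give `|returnL f| ≤ O₁ O₂ |f| =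
  -- |v|^m Z |f|`; such a function can be divided by `|v|^m`.
  have d1 : ∀ᵐ v ∂(volume.restrict (Ioo (0 : ℝ) 1)), ‖crossL a _ l f v‖ ≤ (absL f v).re := by
    filter_upwards [hp.coe_expL l f, hp.norm_expSym_le l, coe_absL f] with v e1 e2 e3
    rw [e1, e3, norm_mul, Complex.ofReal_re]
    exact mul_le_of_le_one_left (norm_nonneg _) e2
  have d2 := h₂.domination (isNonneg_absL f) d1
  have d3 : ∀ᵐ v ∂(volume.restrict (Ioo (-1 : ℝ) 0)),
      ‖crossL a _ l (O₂ (crossL a _ l f)) v‖ ≤ (O₂ (absL f) v).re := by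
    filter_upwards [hn.coe_expL l (O₂ (crossL a _ l f)), hn.norm_expSym_le l, d2] with v e1 e2 e3
    rw [e1, norm_mul]
    exact (mul_le_of_le_one_left (norm_nonneg _) e2).trans e3
  have d4 := h₁.domination (h₂ _ (isNonneg_absL f)).1 d3
  obtain ⟨u, hu, hun⟩ := hp.exists_of_norm_le m (g := returnL a O₁ O₂ l f) (y := Z (absL f)) (by
    rw [hZ]
    filter_upwards [d4] with v hv
    exact hv.trans (Complex.re_le_norm _))
  exact ⟨u, hu, hun.trans ((Z.le_opNorm _).trans (by rw [norm_absL]))⟩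

/-- The closed right half plane without the origin. -/
def punctured : Set ℂ := {l : ℂ | 0 ≤ l.re ∧ l ≠ 0}

/-- The boundary operators give rise to a scale family. -/
theorem exists_isScaleFamily (ha : 0 < a) (h₁ : IsStochastic O₁) (h₂ : IsStochastic O₂)
    (hG : ∀ s : ℝ, s ≠ 0 → IsUnit (1 - G a O₁ O₂ s)) {m : ℕ}
    (hw : WeightBounded m (O₁ ∘L O₂)) (hc₁ : ConjBounded m O₁) (hc₂ : ConjBounded m O₂) :
    ∃ (O : ℕ → L1V →L[ℂ] L1V) (Γ : ℂ → L1V →L[ℂ] L1V) (c : ℝ), O 0 = exchangeL O₁ O₂ ∧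
      IsScaleFamily (velL _) (crossL a _) O m punctured (boundaryInv a O₁ O₂) Γ c := by
  obtain ⟨Z, hZ⟩ := hw.exists_lift measurableSet_Ioo pos_subset
  obtain ⟨S₁, hS₁⟩ := hc₁.exists_lift measurableSet_Ioo neg_subset measurableSet_Ioo pos_subset
  obtain ⟨S₂, hS₂⟩ := hc₂.exists_lift measurableSet_Ioo pos_subset measurableSet_Ioo neg_subset
  have hV := isTimeWeight_V ha
  obtain ⟨Q₁, hQ₁0, hQ₁⟩ := exists_chain (isTimeWeight_neg ha) (isTimeWeight_pos ha) hS₁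
  obtain ⟨Q₂, hQ₂0, hQ₂⟩ := exists_chain (isTimeWeight_pos ha) (isTimeWeight_neg ha) hS₂
  choose P hP hPn using exists_returnL_lift ha h₁ h₂ hZ
  set O : ℕ → L1V →L[ℂ] L1V := fun n => exchangeL (Q₁ n) (Q₂ n) with hO
  -- Each component of `(O E)³` contains a full return. For positive velocities it acts last, after
  -- `O₁ E`. For negative ones it acts first, and the factor `|v|^m` gained is carried through `O₂`
  -- by `S₂`.
  set Γ : ℂ → L1V →L[ℂ] L1V := fun l =>
    extPos ∘L P l ∘L O₁ ∘L crossL a _ l ∘L negL + extNeg ∘L S₂ ∘L crossL a _ l ∘L P l ∘L posL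
    with hΓ
  have hO0 : O 0 = exchangeL O₁ O₂ := by rw [hO]; simp only [hQ₁0, hQ₂0]
  obtain ⟨c, hc⟩ : ∃ c : ℝ, c = ∑ n ∈ Finset.range (m + 1), ‖O n‖ + 2 * a + (‖Z‖ + ‖S₂‖ * ‖Z‖) :=
    ⟨_, rfl⟩
  have hsum : 0 ≤ ∑ n ∈ Finset.range (m + 1), ‖O n‖ := Finset.sum_nonneg fun _ _ => norm_nonneg _
  have hZ0 : 0 ≤ ‖Z‖ + ‖S₂‖ * ‖Z‖ := by positivity
  refine ⟨O, Γ, c, hO0, hV.weightL_injective, hV.norm_weightL_le, hV.norm_expL_le,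
    hV.continuous_expL, hV.weightL_expL, fun l l' x => ?_, fun n hn => ?_, fun n hn x => ?_,
    fun l hl x => ?_, fun l hl x => ?_, fun l hl => ?_, fun l hl x => ?_⟩
  · refine (hV.norm_expL_sub_le l l' x).trans ?_
    gcongr
    linarith
  · have : ‖O n‖ ≤ ∑ n ∈ Finset.range (m + 1), ‖O n‖ :=
      Finset.single_le_sum (f := fun n => ‖O n‖) (fun _ _ => norm_nonneg _)
        (Finset.mem_range.2 (Nat.lt_succ_of_le hn))
    linarith
  · refine L1V_ext ?_ ?_
    · rw [posL_velL, posL_exchangeL, posL_exchangeL, hQ₁ n hn, negL_velL]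
    · rw [negL_velL, negL_exchangeL, negL_exchangeL, hQ₂ n hn, posL_velL]
  · rw [hO0]
    exact boundaryInv_left ha (isUnit_one_sub_returnL ha h₁.norm_le h₂.norm_le hG hl.1 hl.2) x
  · rw [hO0]
    exact boundaryInv_right ha (isUnit_one_sub_returnL ha h₁.norm_le h₂.norm_le hG hl.1 hl.2) x
  · have hΓl : ‖Γ l‖ ≤ ‖Z‖ + ‖S₂‖ * ‖Z‖ := by
      refine ContinuousLinearMap.opNorm_le_bound _ hZ0 fun x => ?_
      have n1 : ‖O₁ (crossL a _ l (negL x))‖ ≤ ‖x‖ :=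
        (h₁.norm_apply_le _).trans (((crossL a _ l).le_opNorm _).trans
          ((mul_le_of_le_one_left (norm_nonneg _)
            ((isTimeWeight_neg ha).norm_expL_le l)).trans (norm_negL_apply_le x)))
      have n2 : ‖extPos (P l (O₁ (crossL a _ l (negL x))))‖ ≤ ‖Z‖ * ‖x‖ :=
        (norm_extPos_apply_le _).trans ((hPn l _).trans
          (mul_le_mul_of_nonneg_left n1 (norm_nonneg _)))
      have n3 : ‖crossL a _ l (P l (posL x))‖ ≤ ‖Z‖ * ‖x‖ :=
        ((crossL a _ l).le_opNorm _).trans ((mul_le_of_le_one_left (norm_nonneg _)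
          ((isTimeWeight_pos ha).norm_expL_le l)).trans ((hPn l _).trans
            (mul_le_mul_of_nonneg_left (norm_posL_apply_le x) (norm_nonneg _))))
      have n4 : ‖extNeg (S₂ (crossL a _ l (P l (posL x))))‖ ≤ ‖S₂‖ * (‖Z‖ * ‖x‖) :=
        (norm_extNeg_apply_le _).trans ((S₂.le_opNorm _).trans
          (mul_le_mul_of_nonneg_left n3 (norm_nonneg _)))
      change ‖extPos (P l (O₁ (crossL a _ l (negL x))))
        + extNeg (S₂ (crossL a _ l (P l (posL x))))‖ ≤ _
      refine (norm_add_le _ _).trans ((add_le_add n2 n4).trans (le_of_eq ?_))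
      ring
    linarith
  · have e : Γ l x = extPos (P l (O₁ (crossL a _ l (negL x))))
        + extNeg (S₂ (crossL a _ l (P l (posL x)))) := rfl
    refine L1V_ext ?_ ?_
    · rw [posL_pow_velL, e, map_add, posL_extPos, posL_extNeg, add_zero, hP, hO0, posL_exchangeL,
        negL_crossL ha, negL_exchangeL, posL_crossL ha, posL_exchangeL, negL_crossL ha]
      rfl
    · rw [negL_pow_velL, e, map_add, negL_extPos, negL_extNeg, zero_add, hS₂,
        pow_comm_apply ((isTimeWeight_pos ha).weightL_expL l), hP, hO0, negL_exchangeL,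
        posL_crossL ha, posL_exchangeL, negL_crossL ha, negL_exchangeL, posL_crossL ha]
      rfl

end Boundary

/-! ### Integral operators on product spaces -/

section Maps

variable {α β : Type*} [MeasurableSpace α] [MeasurableSpace β] {μ : Measure α} {ν : Measure β}

theorem IsL1Map.comp_measurePreserving {γ : Type*} [MeasurableSpace γ] {ρ' : Measure γ}
    {Φ : (α → ℂ) → β → ℂ} {C : ℝ} (h : IsL1Map μ ν Φ C) {e : α → γ}
    (he : MeasurePreserving e μ ρ') : IsL1Map ρ' ν (fun F => Φ (F ∘ e)) C where
  nonneg := h.nonneg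
  congr f g hfg := h.congr _ _ (he.quasiMeasurePreserving.ae hfg)
  add f g hf hg := h.add _ _ (he.integrable_comp_of_integrable hf)
    (he.integrable_comp_of_integrable hg)
  smul c f hf := h.smul c _ (he.integrable_comp_of_integrable hf)
  integrable f hf := h.integrable _ (he.integrable_comp_of_integrable hf)
  bound f hf := by
    refine (h.bound _ (he.integrable_comp_of_integrable hf)).trans (le_of_eq ?_)
    have := integral_map (μ := μ) (φ := e) he.measurable.aemeasurable (f := fun z => ‖f z‖)
      (by rw [he.map_eq]; exact hf.norm.aestronglyMeasurable)
    rw [he.map_eq] at this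
    rw [this]
    rfl

theorem IsL1Map.mulL_comm {Φ : (α → ℂ) → β → ℂ} {C : ℝ} (h : IsL1Map μ ν Φ C) {m : α → ℂ}
    {m' : β → ℂ} (hm : MemLp m ∞ μ) (hm' : MemLp m' ∞ ν)
    (hΦ : ∀ f : α → ℂ, Φ (fun x => m x * f x) =ᵐ[ν] fun z => m' z * Φ f z) (f : Lp ℂ 1 μ) :
    mulL ν m' (h.clm f) = h.clm (mulL μ m f) := by
  refine Lp.ext ?_
  filter_upwards [coe_mulL hm' (h.clm f), h.coe_clm f, h.coe_clm (mulL μ m f),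
    h.congr _ _ (coe_mulL hm f), hΦ f] with z h1 h2 h3 h4 h5
  rw [h1, h2, h3, h4, h5]

end Maps

section Product

variable {α β : Type*} [MeasurableSpace α] [MeasurableSpace β] {μ : Measure α} {ν : Measure β}
  [SFinite μ] [SFinite ν] {ρ : Measure (α × β)}

/-- Pull-back along the second projection, followed by multiplication with a function whose
integrals in the first variable are bounded. -/
theorem isL1Map_pull (hρ : ρ = μ.prod ν) {m : α × β → ℂ} (hm : Measurable m) {C : ℝ} (hC : 0 ≤ C)
    (hb : ∀ᵐ z ∂ν, Integrable (fun x => m (x, z)) μ ∧ ∫ x, ‖m (x, z)‖ ∂μ ≤ C) :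
    IsL1Map ν ρ (fun f p => m p * f p.2) C := by
  subst hρ
  have hmeas : ∀ f : β → ℂ, Integrable f ν →
      AEStronglyMeasurable (fun p : α × β => m p * f p.2) (μ.prod ν) := fun f hf =>
    hm.aestronglyMeasurable.mul hf.aestronglyMeasurable.comp_snd
  have hnorm : ∀ (f : β → ℂ) z, ∫ x, ‖m (x, z) * f z‖ ∂μ = (∫ x, ‖m (x, z)‖ ∂μ) * ‖f z‖ := by
    intro f z
    simp_rw [norm_mul]
    exact integral_mul_const _ _
  have hint : ∀ f : β → ℂ, Integrable f ν →
      Integrable (fun p : α × β => m p * f p.2) (μ.prod ν) := by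
    intro f hf
    refine (integrable_prod_iff' (hmeas f hf)).2 ⟨?_, ?_⟩
    · filter_upwards [hb] with z hz
      exact hz.1.mul_const _
    · refine (hf.norm.const_mul C).mono (hmeas f hf).norm.prod_swap.integral_prod_right' ?_
      filter_upwards [hb] with z hz
      simp only [hnorm]
      rw [Real.norm_of_nonneg (by positivity), Real.norm_of_nonneg (by positivity)]
      exact mul_le_mul_of_nonneg_right hz.2 (norm_nonneg _)
  refine ⟨hC, fun f g hfg => ?_, fun f g _ _ => ?_, fun c f _ => ?_, hint, fun f hf => ?_⟩
  · filter_upwards [Measure.quasiMeasurePreserving_snd.ae hfg] with p hp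
    rw [hp]
  · exact Eventually.of_forall fun p => mul_add _ _ _
  · exact Eventually.of_forall fun p => mul_left_comm _ _ _
  · rw [integral_prod_symm _ (hint f hf).norm, ← integral_const_mul]
    refine integral_mono_ae (hint f hf).norm.swap.integral_prod_left (hf.norm.const_mul C) ?_
    filter_upwards [hb] with z hz
    simp only [hnorm]
    exact mul_le_mul_of_nonneg_right hz.2 (norm_nonneg _)

/-- Integration in the first variable. -/
theorem isL1Map_integ (hρ : ρ = μ.prod ν) : IsL1Map ρ ν (fun F z => ∫ x, F (x, z) ∂μ) 1 := by
  subst hρ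
  refine ⟨zero_le_one, fun f g hfg => ?_, fun f g hf hg => ?_, fun c f _ => ?_, fun f hf => ?_,
    fun f hf => ?_⟩
  · have h1 : ∀ᵐ q ∂(ν.prod μ), f q.swap = g q.swap :=
      (Measure.measurePreserving_swap (μ := ν) (ν := μ)).quasiMeasurePreserving.ae hfg
    filter_upwards [Measure.ae_ae_of_ae_prod h1] with z hz
    exact integral_congr_ae hz
  · filter_upwards [hf.prod_left_ae, hg.prod_left_ae] with z h1 h2
    exact integral_add h1 h2
  · exact Eventually.of_forall fun z => integral_const_mul _ _
  · exact hf.swap.integral_prod_left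
  · rw [one_mul, integral_prod_symm _ hf.norm]
    exact integral_mono hf.swap.integral_prod_left.norm hf.norm.swap.integral_prod_left
      fun z => norm_integral_le_integral_norm _

theorem measurePreserving_exchange :
    MeasurePreserving (fun p : α × α × β => (p.2.1, p.1, p.2.2)) (μ.prod (μ.prod ν))
      (μ.prod (μ.prod ν)) := by
  have h1 := measurePreserving_prodAssoc μ μ ν
  have h2 := (Measure.measurePreserving_swap (μ := μ) (ν := μ)).prod (MeasurePreserving.id ν)
  exact h1.comp (h2.comp (h1.symm MeasurableEquiv.prodAssoc))

/-- Integration in the middle variable. -/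
theorem isL1Map_integ_middle (hρ : ρ = μ.prod ν) :
    IsL1Map (μ.prod ρ) ρ (fun F z => ∫ y, F (z.1, y, z.2) ∂μ) 1 := by
  subst hρ
  exact (isL1Map_integ (μ := μ) (ν := μ.prod ν) rfl).comp_measurePreserving
    measurePreserving_exchange

end Product

/-! ### Integrals of exponentials -/

/-- It will be used with `K = 1 / |v|` and `c = Re λ / |v|`, for which `K / c` no longer depends on
`v`. -/
theorem integrable_exp_Ioi {c K : ℝ} (hc : 0 < c) (y : ℝ) :
    Integrable ((Ioi y).indicator fun x => K * Real.exp (-(c * (x - y)))) ∧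
      ∫ x, (Ioi y).indicator (fun x => K * Real.exp (-(c * (x - y)))) x = K / c := by
  have e : ∀ x, K * Real.exp (-(c * (x - y))) = K * Real.exp (c * y) * Real.exp (-c * x) := by
    intro x; rw [mul_assoc, ← Real.exp_add]; congr 2; ring
  simp_rw [e]
  refine ⟨(integrable_indicator_iff measurableSet_Ioi).2
    ((integrableOn_exp_mul_Ioi (neg_lt_zero.2 hc) y).const_mul _), ?_⟩
  rw [integral_indicator measurableSet_Ioi, integral_const_mul,
    integral_exp_mul_Ioi (neg_lt_zero.2 hc), mul_assoc, mul_div_assoc', mul_neg, ← Real.exp_add,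
    show c * y + -c * y = 0 by ring, Real.exp_zero, neg_div_neg_eq, mul_one_div]

theorem integrable_exp_Iio {c K : ℝ} (hc : 0 < c) (y : ℝ) :
    Integrable ((Iio y).indicator fun x => K * Real.exp (-(c * (y - x)))) ∧
      ∫ x, (Iio y).indicator (fun x => K * Real.exp (-(c * (y - x)))) x = K / c := by
  have h := integrable_exp_Ioi (K := K) hc (-y)
  have e : ∀ x, (Iio y).indicator (fun x => K * Real.exp (-(c * (y - x)))) x
      = (Ioi (-y)).indicator (fun x => K * Real.exp (-(c * (x - -y)))) (-x) := by
    intro x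
    have hx : x ∈ Iio y ↔ -x ∈ Ioi (-y) := by simp
    by_cases h1 : x ∈ Iio y
    · rw [indicator_of_mem h1, indicator_of_mem (hx.1 h1)]
      congr 3; ring
    · rw [indicator_of_notMem h1, indicator_of_notMem (fun h2 => h1 (hx.2 h2))]
  refine ⟨(h.1.comp_neg).congr (Eventually.of_forall fun x => (e x).symm), ?_⟩
  simp_rw [e]
  rw [integral_neg_eq_self (fun x => (Ioi (-y)).indicator
    (fun x => K * Real.exp (-(c * (x - -y)))) x) volume]
  exact h.2

theorem integrable_of_norm_le_of_integral_eq {m : ℝ → ℂ} (hm : Measurable m) {g : ℝ → ℝ} {C : ℝ}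
    (hg : Integrable g ∧ ∫ x, g x = C) {s : Set ℝ} (hs : MeasurableSet s)
    (hg0 : ∀ x, 0 ≤ g x) (h : ∀ x ∈ s, ‖m x‖ ≤ g x) :
    Integrable m (volume.restrict s) ∧ ∫ x in s, ‖m x‖ ≤ C := by
  have hgs := hg.1.integrableOn (s := s)
  have hi : Integrable m (volume.restrict s) := by
    refine Integrable.mono (g := g) hgs hm.aestronglyMeasurable ?_
    filter_upwards [ae_restrict_mem hs] with x hx
    exact (h x hx).trans (le_abs_self _)
  refine ⟨hi, ?_⟩
  rw [← hg.2]
  refine (setIntegral_mono_on hi.norm hgs hs h).trans ?_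
  exact setIntegral_le_integral hg.1 (Eventually.of_forall hg0)

/-! ### The solution operators in the slab -/

section Slab

variable {a : ℝ}

theorem restrict_slab (a : ℝ) : (volume.restrict (slab a) : Measure (ℝ × ℝ))
    = (volume.restrict (Ioo (-a) a)).prod (volume.restrict (Ioo (-1 : ℝ) 1)) := by
  rw [Measure.prod_restrict, slab, Measure.volume_eq_prod]

theorem ae_slab (a : ℝ) : ∀ᵐ z ∂(volume.restrict (slab a)), z ∈ slab a ∧ z.2 ≠ 0 := by
  have h0 : ∀ᵐ v ∂(volume.restrict (Ioo (-1 : ℝ) 1)), v ≠ 0 := ae_restrict_of_ae (by simp [ae_iff])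
  have h1 : ∀ᵐ z ∂(volume.restrict (slab a)), z.2 ≠ 0 := by
    rw [restrict_slab]
    exact Measure.quasiMeasurePreserving_snd.ae h0
  filter_upwards [h1, ae_restrict_mem (measurableSet_slab a)] with z h2 h3
  exact ⟨h3, h2⟩

/-- The measure on triples of a position `x`, a position `y` and a velocity `v`. -/
abbrev pathMeasure (a : ℝ) : Measure (ℝ × ℝ × ℝ) :=
  (volume.restrict (Ioo (-a) a)).prod (volume.restrict (slab a))

/-- Integrable functions of two positions and a velocity. -/
abbrev L1Path (a : ℝ) : Type := Lp ℂ 1 (pathMeasure a)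

/-- The distance of the position `x` from the face at which particles of velocity `v` enter. -/
def entryDist (a v x : ℝ) : ℝ := if 0 < v then a + x else a - x

theorem measurable_entryDist (a : ℝ) : Measurable fun z : ℝ × ℝ => entryDist a z.2 z.1 :=
  Measurable.ite (measurableSet_lt measurable_const measurable_snd)
    (measurable_const.add measurable_fst) (measurable_const.sub measurable_fst)

/-- The distance from `x` to the exit face is the entry distance of `-x`. -/
theorem measurable_exitDist (a : ℝ) : Measurable fun z : ℝ × ℝ => entryDist a z.2 (-z.1) :=
  Measurable.ite (measurableSet_lt measurable_const measurable_snd)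
    (measurable_const.add measurable_fst.neg) (measurable_const.sub measurable_fst.neg)

theorem entryDist_mem {v x : ℝ} (hx : x ∈ Ioo (-a) a) :
    0 ≤ entryDist a v x ∧ entryDist a v x ≤ 2 * a := by
  unfold entryDist
  split_ifs <;> constructor <;> linarith [hx.1, hx.2]

theorem isTimeWeight_entry (ha : 0 < a) : IsTimeWeight (volume.restrict (slab a))
    (fun z => |z.2|) (fun z => entryDist a z.2 z.1) (2 * a) where
  measurable_w := measurable_norm.comp measurable_snd
  measurable_τ := measurable_entryDist a
  nonneg := by positivity
  ae := by
    filter_upwards [ae_slab a] with z hz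
    obtain ⟨h1, h2⟩ := entryDist_mem (v := z.2) hz.1.1
    exact ⟨abs_pos.2 hz.2, (abs_lt.2 hz.1.2).le, h1, h2⟩

theorem isTimeWeight_exit (ha : 0 < a) : IsTimeWeight (volume.restrict (slab a))
    (fun z => |z.2|) (fun z => entryDist a z.2 (-z.1)) (2 * a) where
  measurable_w := measurable_norm.comp measurable_snd
  measurable_τ := measurable_exitDist a
  nonneg := by positivity
  ae := by
    filter_upwards [ae_slab a] with z hz
    obtain ⟨h1, h2⟩ := entryDist_mem (a := a) (v := z.2) (x := -z.1)
      ⟨by linarith [hz.1.1.2], by linarith [hz.1.1.1]⟩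
    exact ⟨abs_pos.2 hz.2, (abs_lt.2 hz.1.2).le, h1, h2⟩

theorem isTimeWeight_path (ha : 0 < a) : IsTimeWeight (pathMeasure a)
    (fun θ => |θ.2.2|) (fun θ => |θ.1 - θ.2.1|) (2 * a) where
  measurable_w := measurable_norm.comp (measurable_snd.comp measurable_snd)
  measurable_τ := measurable_norm.comp (measurable_fst.sub (measurable_fst.comp measurable_snd))
  nonneg := by positivity
  ae := by
    have h1 : ∀ᵐ θ ∂(pathMeasure a), θ.2 ∈ slab a ∧ θ.2.2 ≠ 0 :=
      Measure.quasiMeasurePreserving_snd.ae (ae_slab a)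
    have h2 : ∀ᵐ θ ∂(pathMeasure a), θ.1 ∈ Ioo (-a) a :=
      Measure.quasiMeasurePreserving_fst.ae (ae_restrict_mem measurableSet_Ioo)
    filter_upwards [h1, h2] with θ h3 h4
    refine ⟨abs_pos.2 h3.2, (abs_lt.2 h3.1.2).le, abs_nonneg _, abs_le.2 ⟨?_, ?_⟩⟩ <;>
      linarith [h3.1.1.1, h3.1.1.2, h4.1, h4.2]

/-- Multiplication by `|v|` on `L¹(Ω)`. -/
abbrev velSlab (a : ℝ) : L1Slab a →L[ℂ] L1Slab a := weightL _ fun z => |z.2|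

/-- Multiplication by `|v|` on functions of two positions and a velocity. -/
abbrev velPath (a : ℝ) : L1Path a →L[ℂ] L1Path a := weightL _ fun θ => |θ.2.2|

theorem isL1Map_liftV (a : ℝ) : IsL1Map (volume.restrict (Ioo (-1 : ℝ) 1))
    (volume.restrict (slab a)) (fun f p => 1 * f p.2) (volume.real (Ioo (-a) a)) :=
  isL1Map_pull (restrict_slab a) (m := fun _ => 1) measurable_const measureReal_nonneg
    (Eventually.of_forall fun z => ⟨integrable_const _, by simp⟩)

theorem isL1Map_integV (a : ℝ) : IsL1Map (volume.restrict (slab a))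
    (volume.restrict (Ioo (-1 : ℝ) 1)) (fun F v => ∫ x in Ioo (-a) a, F (x, v)) 1 :=
  isL1Map_integ (restrict_slab a)

theorem measurableSet_behind : MeasurableSet {θ : ℝ × ℝ × ℝ | 0 < (θ.1 - θ.2.1) * θ.2.2} :=
  measurableSet_lt measurable_const (by fun_prop)

theorem isL1Map_path (a : ℝ) : IsL1Map (volume.restrict (slab a)) (pathMeasure a)
    (fun f p => {θ : ℝ × ℝ × ℝ | 0 < (θ.1 - θ.2.1) * θ.2.2}.indicator (fun _ => 1) p * f p.2)
    (volume.real (Ioo (-a) a)) := by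
  refine isL1Map_pull rfl (measurable_const.indicator measurableSet_behind) measureReal_nonneg
    (Eventually.of_forall fun z => ?_)
  have hm : Measurable fun x : ℝ =>
      {θ : ℝ × ℝ × ℝ | 0 < (θ.1 - θ.2.1) * θ.2.2}.indicator (fun _ => (1 : ℂ)) (x, z) :=
    (measurable_const.indicator measurableSet_behind).comp (by fun_prop)
  have hb : ∀ x : ℝ, ‖{θ : ℝ × ℝ × ℝ | 0 < (θ.1 - θ.2.1) * θ.2.2}.indicator
      (fun _ => (1 : ℂ)) (x, z)‖ ≤ 1 := fun x => by
    refine (norm_indicator_le_norm_self _ _).trans ?_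
    simp
  have hi := (integrable_const (μ := volume.restrict (Ioo (-a) a)) (1 : ℝ)).mono'
    hm.aestronglyMeasurable (Eventually.of_forall hb)
  refine ⟨hi, (integral_mono hi.norm (integrable_const 1) hb).trans ?_⟩
  simp

theorem isL1Map_integPath (a : ℝ) : IsL1Map (pathMeasure a) (volume.restrict (slab a))
    (fun F z => ∫ y in Ioo (-a) a, F (z.1, y, z.2)) 1 :=
  isL1Map_integ_middle (restrict_slab a)

/-- Functions of the velocity as functions on the slab. -/
def liftV (a : ℝ) : L1V →L[ℂ] L1Slab a := (isL1Map_liftV a).clm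

/-- Integration in the position. -/
def integV (a : ℝ) : L1Slab a →L[ℂ] L1V := (isL1Map_integV a).clm

/-- Functions on the slab as functions of two positions and a velocity, which are cut off to the
pairs of positions in the order of the motion. -/
def pathL (a : ℝ) : L1Slab a →L[ℂ] L1Path a := (isL1Map_path a).clm

/-- Integration in the second position. -/
def integPath (a : ℝ) : L1Path a →L[ℂ] L1Slab a := (isL1Map_integPath a).clm

theorem velSlab_liftV (f : L1V) : velSlab a (liftV a f) = liftV a (velL _ f) :=
  (isL1Map_liftV a).mulL_comm (isTimeWeight_V one_pos).memLp_weight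
    (memLp_top_of_bound (by fun_prop) 1 (by
      filter_upwards [ae_slab a] with z hz
      simpa using (abs_lt.2 hz.1.2).le))
    (fun f => Eventually.of_forall fun z => by simp only [one_mul]) f

theorem velL_integV (ha : 0 < a) (f : L1Slab a) : velL _ (integV a f) = integV a (velSlab a f) :=
  (isL1Map_integV a).mulL_comm (isTimeWeight_entry ha).memLp_weight
    (isTimeWeight_V ha).memLp_weight
    (fun f => Eventually.of_forall fun v => integral_const_mul ((|v| : ℝ) : ℂ) fun x => f (x, v)) f

theorem velPath_pathL (ha : 0 < a) (f : L1Slab a) :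
    velPath a (pathL a f) = pathL a (velSlab a f) :=
  (isL1Map_path a).mulL_comm (isTimeWeight_entry ha).memLp_weight
    (isTimeWeight_path ha).memLp_weight
    (fun _ => Eventually.of_forall fun _ => mul_left_comm _ _ _) f

theorem velSlab_integPath (ha : 0 < a) (f : L1Path a) :
    velSlab a (integPath a f) = integPath a (velPath a f) :=
  (isL1Map_integPath a).mulL_comm (isTimeWeight_path ha).memLp_weight
    (isTimeWeight_entry ha).memLp_weight
    (fun f => Eventually.of_forall fun z =>
      integral_const_mul ((|z.2| : ℝ) : ℂ) fun y => f (z.1, y, z.2)) f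

/-- The flow of the incoming flux through the slab, multiplied by `|v|`. -/
def inflowL (a : ℝ) (l : ℂ) : L1V →L[ℂ] L1Slab a :=
  expL _ (fun z => |z.2|) (fun z => entryDist a z.2 z.1) l ∘L liftV a

/-- The flux which a source contributes to the outgoing flux. -/
def outflowL (a : ℝ) (l : ℂ) : L1Slab a →L[ℂ] L1V :=
  integV a ∘L expL _ (fun z => |z.2|) (fun z => entryDist a z.2 (-z.1)) l

/-- The flow of a source through the slab, multiplied by `|v|`. -/
def sourceL (a : ℝ) (l : ℂ) : L1Slab a →L[ℂ] L1Slab a :=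
  integPath a ∘L expL _ (fun θ => |θ.2.2|) (fun θ => |θ.1 - θ.2.1|) l ∘L pathL a

theorem velSlab_inflowL (ha : 0 < a) (l : ℂ) (f : L1V) :
    velSlab a (inflowL a l f) = inflowL a l (velL _ f) := by
  change velSlab a (expL _ _ _ l (liftV a f)) = expL _ _ _ l (liftV a (velL _ f))
  rw [(isTimeWeight_entry ha).weightL_expL, velSlab_liftV]

theorem velL_outflowL (ha : 0 < a) (l : ℂ) (f : L1Slab a) :
    velL _ (outflowL a l f) = outflowL a l (velSlab a f) := by
  change velL _ (integV a (expL _ _ _ l f)) = integV a (expL _ _ _ l (velSlab a f))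
  rw [velL_integV ha, (isTimeWeight_exit ha).weightL_expL]

theorem velSlab_sourceL (ha : 0 < a) (l : ℂ) (f : L1Slab a) :
    velSlab a (sourceL a l f) = sourceL a l (velSlab a f) := by
  change velSlab a (integPath a (expL _ _ _ l (pathL a f)))
    = integPath a (expL _ _ _ l (pathL a (velSlab a f)))
  rw [velSlab_integPath ha, (isTimeWeight_path ha).weightL_expL, velPath_pathL ha]

theorem norm_inflowL_le (ha : 0 < a) (l : ℂ) : ‖inflowL a l‖ ≤ volume.real (Ioo (-a) a) := by
  refine (ContinuousLinearMap.opNorm_comp_le _ _).trans ?_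
  exact (mul_le_of_le_one_left (norm_nonneg _) ((isTimeWeight_entry ha).norm_expL_le l)).trans
    (isL1Map_liftV a).norm_clm_le

theorem continuous_inflowL (ha : 0 < a) (f : L1V) : Continuous fun l => inflowL a l f :=
  (isTimeWeight_entry ha).continuous_expL (liftV a f)

theorem continuous_outflowL (ha : 0 < a) (f : L1Slab a) : Continuous fun l => outflowL a l f :=
  (integV a).continuous.comp ((isTimeWeight_exit ha).continuous_expL f)

theorem continuous_sourceL (ha : 0 < a) (f : L1Slab a) : Continuous fun l => sourceL a l f :=
  (integPath a).continuous.comp ((isTimeWeight_path ha).continuous_expL (pathL a f))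

end Slab

/-! ### The scaled solution up to the imaginary axis -/

section Extension

variable {a : ℝ} {O₁ : L1Neg →L[ℂ] L1Pos} {O₂ : L1Pos →L[ℂ] L1Neg} {O : ℕ → L1V →L[ℂ] L1V}
  {Γ : ℂ → L1V →L[ℂ] L1V} {c : ℝ} {k : ℕ}

/-- The incoming flux for the source `|v|^{k+1} g`, divided by `|v|^{k+1}`. -/
def scaledInflux (a : ℝ) (O₁ : L1Neg →L[ℂ] L1Pos) (O₂ : L1Pos →L[ℂ] L1Neg)
    (O : ℕ → L1V →L[ℂ] L1V) (Γ : ℂ → L1V →L[ℂ] L1V) (k : ℕ) (g : L1Slab a) (l : ℂ) : L1V :=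
  scaleInv (velL _) (crossL a _) O (k + 1) (boundaryInv a O₁ O₂) Γ (k + 1) l
    (O (k + 1) (outflowL a l g))

/-- The solution of the resolvent equation for the source `|v|^{k+1} g`, divided by `|v|^k`. -/
def scaledSolution (a : ℝ) (O₁ : L1Neg →L[ℂ] L1Pos) (O₂ : L1Pos →L[ℂ] L1Neg)
    (O : ℕ → L1V →L[ℂ] L1V) (Γ : ℂ → L1V →L[ℂ] L1V) (k : ℕ) (g : L1Slab a) (l : ℂ) : L1Slab a :=
  inflowL a l (scaledInflux a O₁ O₂ O Γ k g l) + sourceL a l g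

theorem continuousOn_scaledSolution (ha : 0 < a)
    (h : IsScaleFamily (velL _) (crossL a _) O (k + 1) punctured (boundaryInv a O₁ O₂) Γ c)
    (g : L1Slab a) : ContinuousOn (scaledSolution a O₁ O₂ O Γ k g) punctured := by
  have h1 : ContinuousOn (scaledInflux a O₁ O₂ O Γ k g) punctured :=
    h.continuousOn_scaleInv_apply (Nat.succ_pos k) le_rfl
      ((O (k + 1)).continuous.comp (continuous_outflowL ha g)).continuousOn
  refine ContinuousOn.add (fun s hs => ?_) (continuous_sourceL ha g).continuousOn
  exact tendsto_clm_apply_of_strong (Eventually.of_forall (norm_inflowL_le ha))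
    (fun x => (continuous_inflowL ha x).continuousWithinAt) (h1 s hs)

theorem mul_I_mem_punctured {s : ℝ} (hs : s ≠ 0) : (s : ℂ) * Complex.I ∈ punctured :=
  ⟨by simp, mul_ne_zero (by exact_mod_cast hs) Complex.I_ne_zero⟩

theorem tendsto_mul_I {s : ℝ} (hs : s ≠ 0) :
    Tendsto (fun t : ℝ => (t : ℂ) * Complex.I) (𝓝 s) (𝓝[punctured] ((s : ℂ) * Complex.I)) := by
  refine tendsto_nhdsWithin_iff.2 ⟨Continuous.tendsto (by fun_prop) s, ?_⟩
  filter_upwards [isOpen_compl_singleton.mem_nhds hs] with t ht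
  exact mul_I_mem_punctured ht

/-- Outflow, boundary operator, inverse and inflow all act compatibly with the scale. Of these only
the inverse raises the exponent of `κ`, by one beyond the one per derivative, which explains the
starting exponent `1`. -/
theorem exists_scaleDiff_scaledSolution (ha : 0 < a) (h₁ : ‖O₁‖ ≤ 1) (h₂ : ‖O₂‖ ≤ 1)
    (h : IsScaleFamily (velL _) (crossL a _) O (k + 1) punctured (boundaryInv a O₁ O₂) Γ c) :
    ∃ C : ℝ, 0 ≤ C ∧ ∀ g : L1Slab a, ScaleDiff (velSlab a)
      (fun s => 1 + ‖Ring.inverse (1 - G a O₁ O₂ s)‖) k 1 (C * ‖g‖)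
      (fun s => scaledSolution a O₁ O₂ O Γ k g (s * Complex.I)) := by
  obtain ⟨κ, hκe⟩ : ∃ κ : ℝ → ℝ, κ = fun s => 1 + ‖Ring.inverse (1 - G a O₁ O₂ s)‖ := ⟨_, rfl⟩
  rw [← hκe]
  have hκ : ∀ s, 1 ≤ κ s := fun s => by
    rw [hκe]; exact le_add_of_nonneg_right (norm_nonneg _)
  have hc := h.nonneg
  -- Since `‖N₀‖ ≤ 4 κ` and `κ ≥ 1`, the inverses are bounded by `1 + c + c² + 4 c κ ≤ (1 + 5 c +
  -- c²) κ`.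
  obtain ⟨c', hc'⟩ : ∃ c', c' = 1 + 5 * c + c ^ 2 := ⟨_, rfl⟩
  have hcc' : c ≤ c' := by nlinarith
  have hc0 : 0 ≤ c' := hc.trans hcc'
  have hV := (isTimeWeight_V ha).isPhaseFamily
  obtain ⟨cm, hcm, hN⟩ := scaleDiff_resolvent (L := k + 1) (c := c') hV hκ
    (O := O) (N := fun n s => scaleInv (velL _) (crossL a _) O (k + 1) (boundaryInv a O₁ O₂) Γ n
      (s * Complex.I))
    (fun n hn => (h.norm_O n hn).trans hcc') h.chain
    (fun n hn s hs x => h.scaleInv_left hn (mul_I_mem_punctured hs) x)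
    (fun n hn s hs x => h.scaleInv_right hn (mul_I_mem_punctured hs) x)
    (fun n hn s hs => by
      refine (h.norm_scaleInv_le hn (mul_I_mem_punctured hs)).trans ?_
      have h3 := norm_boundaryInv_le ha h₁ h₂ (s * Complex.I)
      rw [returnL_mul_I] at h3
      have h4 : ‖boundaryInv a O₁ O₂ (s * Complex.I)‖ ≤ 4 * κ s := by rw [hκe]; exact h3
      have h5 := hκ s
      rw [hc']
      nlinarith [mul_le_mul_of_nonneg_left h4 hc, sq_nonneg c, mul_nonneg hc (sub_nonneg.2 h5),
        mul_nonneg (sq_nonneg c) (sub_nonneg.2 h5)])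
    (fun n hn s hs => by
      obtain ⟨K, hK⟩ := h.eventually_norm_scaleInv_le (Nat.succ_pos k) hn (mul_I_mem_punctured hs)
      exact ⟨K, (tendsto_mul_I hs).eventually hK⟩)
    (fun n hn s hs x => (h.continuousOn_scaleInv (Nat.succ_pos k) hn x _
      (mul_I_mem_punctured hs)).tendsto.comp (tendsto_mul_I hs)) k
  obtain ⟨b, hb⟩ : ∃ b, b = volume.real (Ioo (-a) a) := ⟨_, rfl⟩
  have hb0 : 0 ≤ b := by rw [hb]; exact measureReal_nonneg
  obtain ⟨e, he⟩ : ∃ e, e = (1 + 2 * a) ^ k := ⟨_, rfl⟩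
  have he0 : 0 ≤ e := by rw [he]; positivity
  refine ⟨e * (b * (cm * (c' * (1 * e)))) + 1 * (e * b), by positivity, fun g => ?_⟩
  have hg : ScaleDiff (velSlab a) κ k 0 ‖g‖ fun _ => g := ScaleDiff.const hκ le_rfl
  have s1 := (isTimeWeight_exit ha).isPhaseFamily.scaleDiff hκ
    (isTimeWeight_exit ha).norm_timeL_le (norm_nonneg g) hg
  have s2 := s1.map_const (T := integV a) (M' := velL _) (velL_integV ha)
    (isL1Map_integV a).norm_clm_le
  have s3 := ScaleDiff.map (M' := velL _) (T := fun n => O (n + 1)) (c := c')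
    (fun n hn x => h.chain (n + 1) (Nat.succ_lt_succ hn) x)
    (fun n hn => (h.norm_O _ (Nat.succ_le_succ hn)).trans hcc') s2
  -- The top level is `k + 1 = b + k` with `b = 1`. After `k` derivatives level `1` is reached; the
  -- last power of `|v|` is reserved for passing from `|v| f` to `f`.
  have s4 := hN 1 (by omega) (by positivity) s3
  have s5 := s4.map_const (T := liftV a) (M' := velSlab a) velSlab_liftV
    (isL1Map_liftV a).norm_clm_le
  have s6 := (isTimeWeight_entry ha).isPhaseFamily.scaleDiff hκ
    (isTimeWeight_entry ha).norm_timeL_le (by positivity) s5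
  have t1 := hg.map_const (T := pathL a) (M' := velPath a) (velPath_pathL ha)
    (isL1Map_path a).norm_clm_le
  have t2 := (isTimeWeight_path ha).isPhaseFamily.scaleDiff hκ
    (isTimeWeight_path ha).norm_timeL_le (by positivity) t1
  have t3 := (t2.map_const (T := integPath a) (M' := velSlab a) (velSlab_integPath ha)
    (isL1Map_integPath a).norm_clm_le).mono hκ (by positivity) zero_le_one le_rfl
  have h6 := s6.add t3
  rw [← hb, ← he] at h6
  have e1 : e * (b * (cm * (c' * (1 * (e * ‖g‖))))) + 1 * (e * (b * ‖g‖))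
      = (e * (b * (cm * (c' * (1 * e)))) + 1 * (e * b)) * ‖g‖ := by ring
  rw [e1, Nat.add_comm 1 k] at h6
  exact h6

end Extension

/-! ### The resolvent in the open right half plane -/

section Resolvent

variable {a : ℝ} {l : ℂ}

theorem pow_comm_apply_of {X Y : Type*} [NormedAddCommGroup X] [NormedSpace ℂ X]
    [NormedAddCommGroup Y] [NormedSpace ℂ Y] {M : X →L[ℂ] X} {M' : Y →L[ℂ] Y} {T : X →L[ℂ] Y}
    (h : ∀ x, M' (T x) = T (M x)) (n : ℕ) (x : X) : (M' ^ n) (T x) = T ((M ^ n) x) := by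
  induction n generalizing x with
  | zero => rfl
  | succ n ih => rw [pow_succ, mul_apply_eq_comp, h, ih, pow_succ, mul_apply_eq_comp]

theorem norm_inv_mul_expSym {α : Type*} {w τ : α → ℝ} (hl : 0 < l.re) {z : α} (hz : 0 < w z) :
    ‖((w z : ℝ) : ℂ)⁻¹ * expSym w τ l z‖ = (w z)⁻¹ * Real.exp (-(l.re / w z * τ z)) := by
  rw [norm_mul, norm_inv, Complex.norm_real, Real.norm_of_nonneg hz.le, expSym,
    projRe_of_nonneg hl.le, Complex.norm_exp, Complex.neg_re, Complex.re_mul_ofReal]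
  congr 3
  ring

/-- The integral over `x` of `|v|⁻¹ e^{-Re λ d / |v|}`, with `d` the distance from the entry face,
is at most `1 / Re λ` for every `v`: damping pays for the division by `|v|`. -/
theorem isL1Map_inflow (ha : 0 < a) (hl : 0 < l.re) :
    IsL1Map (volume.restrict (Ioo (-1 : ℝ) 1)) (volume.restrict (slab a))
      (fun f p => ((|p.2| : ℝ) : ℂ)⁻¹ * expSym (fun z => |z.2|) (fun z => entryDist a z.2 z.1) l p
        * f p.2) (1 / l.re) := by
  have hw := isTimeWeight_entry ha
  have hm : Measurable fun p : ℝ × ℝ => ((|p.2| : ℝ) : ℂ)⁻¹ *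
      expSym (fun z => |z.2|) (fun z => entryDist a z.2 z.1) l p :=
    (Complex.measurable_ofReal.comp hw.measurable_w).inv.mul
      (measurable_expSym hw.measurable_w hw.measurable_τ l)
  refine isL1Map_pull (restrict_slab a) hm (by positivity) ?_
  have h0 : ∀ᵐ v ∂(volume.restrict (Ioo (-1 : ℝ) 1)), v ≠ 0 := ae_restrict_of_ae (by simp [ae_iff])
  filter_upwards [h0] with v hv
  have hv' : 0 < |v| := abs_pos.2 hv
  have hc : 0 < l.re / |v| := by positivity
  have hK : |v|⁻¹ / (l.re / |v|) = 1 / l.re := by field_simp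
  have hn : ∀ x : ℝ, ‖((|(x, v).2| : ℝ) : ℂ)⁻¹ *
      expSym (fun z => |z.2|) (fun z => entryDist a z.2 z.1) l (x, v)‖
      = |v|⁻¹ * Real.exp (-(l.re / |v| * entryDist a v x)) := fun x =>
    norm_inv_mul_expSym (w := fun z : ℝ × ℝ => |z.2|) hl hv'
  have hmv := hm.comp (measurable_prodMk_right (y := v))
  rcases lt_or_gt_of_ne hv with h | h
  · have hI := integrable_exp_Iio (K := |v|⁻¹) hc a
    rw [hK] at hI
    refine integrable_of_norm_le_of_integral_eq hmv hI measurableSet_Ioo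
      (fun x => indicator_nonneg (fun x _ => by positivity) x) fun x hx => ?_
    rw [indicator_of_mem (s := Iio a) hx.2]
    exact (hn x).le.trans_eq (by rw [entryDist, if_neg h.not_gt])
  · have hI := integrable_exp_Ioi (K := |v|⁻¹) hc (-a)
    rw [hK] at hI
    refine integrable_of_norm_le_of_integral_eq hmv hI measurableSet_Ioo
      (fun x => indicator_nonneg (fun x _ => by positivity) x) fun x hx => ?_
    rw [indicator_of_mem (s := Ioi (-a)) hx.1]
    exact (hn x).le.trans_eq (by rw [entryDist, if_pos h]; congr 3; ring)

/-- The same estimate as for the inflow, with the starting point `y` in place of the entry face and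
integration over the positions downstream of `y`. -/
theorem isL1Map_source (ha : 0 < a) (hl : 0 < l.re) :
    IsL1Map (volume.restrict (slab a)) (pathMeasure a)
      (fun f p => {θ : ℝ × ℝ × ℝ | 0 < (θ.1 - θ.2.1) * θ.2.2}.indicator (fun θ =>
        ((|θ.2.2| : ℝ) : ℂ)⁻¹ * expSym (fun θ => |θ.2.2|) (fun θ => |θ.1 - θ.2.1|) l θ) p
        * f p.2) (1 / l.re) := by
  have hw := isTimeWeight_path ha
  have hm : Measurable ({θ : ℝ × ℝ × ℝ | 0 < (θ.1 - θ.2.1) * θ.2.2}.indicator fun θ =>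
      ((|θ.2.2| : ℝ) : ℂ)⁻¹ * expSym (fun θ => |θ.2.2|) (fun θ => |θ.1 - θ.2.1|) l θ) :=
    ((Complex.measurable_ofReal.comp hw.measurable_w).inv.mul
      (measurable_expSym hw.measurable_w hw.measurable_τ l)).indicator measurableSet_behind
  refine isL1Map_pull rfl hm (by positivity) ?_
  filter_upwards [ae_slab a] with z hz
  obtain ⟨y, v⟩ := z
  have hv : v ≠ 0 := hz.2
  have hv' : 0 < |v| := abs_pos.2 hv
  have hc : 0 < l.re / |v| := by positivity
  have hK : |v|⁻¹ / (l.re / |v|) = 1 / l.re := by field_simp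
  have hn : ∀ x : ℝ, ‖((|(x, y, v).2.2| : ℝ) : ℂ)⁻¹ *
      expSym (fun θ => |θ.2.2|) (fun θ => |θ.1 - θ.2.1|) l (x, y, v)‖
      = |v|⁻¹ * Real.exp (-(l.re / |v| * |x - y|)) := fun x =>
    norm_inv_mul_expSym (w := fun θ : ℝ × ℝ × ℝ => |θ.2.2|) hl hv'
  have hmv := hm.comp (measurable_prodMk_right (y := (y, v)))
  have hmem : ∀ x, (x, y, v) ∈ {θ : ℝ × ℝ × ℝ | 0 < (θ.1 - θ.2.1) * θ.2.2} ↔ 0 < (x - y) * v :=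
    fun x => Iff.rfl
  rcases lt_or_gt_of_ne hv with h | h
  · have hI := integrable_exp_Iio (K := |v|⁻¹) hc y
    rw [hK] at hI
    refine integrable_of_norm_le_of_integral_eq hmv hI measurableSet_Ioo
      (fun x => indicator_nonneg (fun x _ => by positivity) x) fun x hx => ?_
    rw [Function.comp_apply]
    by_cases hxy : x < y
    · rw [indicator_of_mem (s := Iio y) hxy, indicator_of_mem ((hmem x).2 (by nlinarith))]
      exact (hn x).le.trans_eq (by rw [abs_of_neg (sub_neg.2 hxy), neg_sub])
    · rw [indicator_of_notMem (s := Iio y) hxy,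
        indicator_of_notMem (fun h2 => hxy (by have := (hmem x).1 h2; nlinarith)), norm_zero]
  · have hI := integrable_exp_Ioi (K := |v|⁻¹) hc y
    rw [hK] at hI
    refine integrable_of_norm_le_of_integral_eq hmv hI measurableSet_Ioo
      (fun x => indicator_nonneg (fun x _ => by positivity) x) fun x hx => ?_
    rw [Function.comp_apply]
    by_cases hxy : y < x
    · rw [indicator_of_mem (s := Ioi y) hxy, indicator_of_mem ((hmem x).2 (by nlinarith))]
      exact (hn x).le.trans_eq (by rw [abs_of_pos (sub_pos.2 hxy)])
    · rw [indicator_of_notMem (s := Ioi y) hxy,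
        indicator_of_notMem (fun h2 => hxy (by have := (hmem x).1 h2; nlinarith)), norm_zero]

/-- For `Re λ > 0` the solution operators stay bounded after division by `|v|`. -/
theorem exists_div_velSlab (ha : 0 < a) (hl : 0 < l.re) :
    ∃ (B : L1V →L[ℂ] L1Slab a) (A : L1Slab a →L[ℂ] L1Slab a),
      (∀ f, velSlab a (B f) = inflowL a l f) ∧ ∀ g, velSlab a (A g) = sourceL a l g := by
  have hw := isTimeWeight_entry ha
  have hp := isTimeWeight_path ha
  refine ⟨(isL1Map_inflow ha hl).clm, integPath a ∘L (isL1Map_source ha hl).clm, fun f => ?_,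
    fun g => ?_⟩
  · refine Lp.ext ?_
    filter_upwards [hw.coe_weightL ((isL1Map_inflow ha hl).clm f),
      (isL1Map_inflow ha hl).coe_clm f, hw.coe_expL l (liftV a f), (isL1Map_liftV a).coe_clm f,
      ae_slab a] with z h1 h2 h3 h4 h5
    have h6 : ((|z.2| : ℝ) : ℂ) ≠ 0 := by exact_mod_cast abs_ne_zero.2 h5.2
    rw [h1, h2, mul_assoc, mul_inv_cancel_left₀ h6]
    change _ = expL _ _ _ l (liftV a f) z
    rw [h3, liftV, h4, one_mul]
  · change velSlab a (integPath a ((isL1Map_source ha hl).clm g))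
      = integPath a (expL _ _ _ l (pathL a g))
    rw [velSlab_integPath ha]
    congr 1
    refine Lp.ext ?_
    have h5 : ∀ᵐ θ ∂(pathMeasure a), θ.2.2 ≠ 0 := by
      filter_upwards [hp.ae] with θ hθ
      exact abs_pos.1 hθ.1
    filter_upwards [hp.coe_weightL ((isL1Map_source ha hl).clm g),
      (isL1Map_source ha hl).coe_clm g, hp.coe_expL l (pathL a g), (isL1Map_path a).coe_clm g,
      h5] with θ h1 h2 h3 h4 h5
    have h6 : ((|θ.2.2| : ℝ) : ℂ) ≠ 0 := by exact_mod_cast abs_ne_zero.2 h5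
    rw [h1, h2, h3, pathL, h4]
    by_cases hθ : θ ∈ {θ : ℝ × ℝ × ℝ | 0 < (θ.1 - θ.2.1) * θ.2.2}
    · rw [indicator_of_mem hθ, indicator_of_mem hθ, mul_assoc, mul_inv_cancel_left₀ h6, one_mul]
    · rw [indicator_of_notMem hθ, indicator_of_notMem hθ]; simp

variable {O₁ : L1Neg →L[ℂ] L1Pos} {O₂ : L1Pos →L[ℂ] L1Neg}

/-- The incoming flux of the solution of the resolvent equation with source `g`. -/
def influx (a : ℝ) (O₁ : L1Neg →L[ℂ] L1Pos) (O₂ : L1Pos →L[ℂ] L1Neg) (l : ℂ) (g : L1Slab a) :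
    L1V := boundaryInv a O₁ O₂ l (exchangeL O₁ O₂ (outflowL a l g))

theorem exists_resolvent (ha : 0 < a) (O₁ : L1Neg →L[ℂ] L1Pos) (O₂ : L1Pos →L[ℂ] L1Neg)
    (hl : 0 < l.re) : ∃ R : L1Slab a →L[ℂ] L1Slab a,
      ∀ g, velSlab a (R g) = inflowL a l (influx a O₁ O₂ l g) + sourceL a l g := by
  obtain ⟨B, A, hB, hA⟩ := exists_div_velSlab ha hl
  refine ⟨B ∘L boundaryInv a O₁ O₂ l ∘L exchangeL O₁ O₂ ∘L outflowL a l + A, fun g => ?_⟩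
  change velSlab a (B (influx a O₁ O₂ l g) + A g) = _
  rw [map_add, hB, hA]

/-- The flow operators commute with multiplication by `|v|`, and the inverse at level `k + 1` is
intertwined with that at level `0`. So `|v|^{k+1}` can be pulled out of the formula for `|v| f`, and
one factor `|v|` cancelled. -/
theorem eq_pow_scaledSolution {O : ℕ → L1V →L[ℂ] L1V} {Γ : ℂ → L1V →L[ℂ] L1V} {c : ℝ} {k : ℕ}
    (ha : 0 < a) (hO : O 0 = exchangeL O₁ O₂)
    (h : IsScaleFamily (velL _) (crossL a _) O (k + 1) punctured (boundaryInv a O₁ O₂) Γ c)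
    (hl : l ∈ punctured) {f g : L1Slab a}
    (hf : velSlab a f = inflowL a l (influx a O₁ O₂ l ((velSlab a ^ (k + 1)) g))
      + sourceL a l ((velSlab a ^ (k + 1)) g)) :
    f = (velSlab a ^ k) (scaledSolution a O₁ O₂ O Γ k g l) := by
  apply (isTimeWeight_entry ha).weightL_injective
  rw [← mul_apply_eq_comp, ← pow_succ', scaledSolution, map_add,
    pow_comm_apply_of (velSlab_inflowL ha l), pow_comm_apply_of (velSlab_sourceL ha l),
    scaledInflux, h.pow_scaleInv le_rfl hl, pow_chain_apply h.chain le_rfl,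
    pow_comm_apply_of (velL_outflowL ha l), hO]
  exact hf

end Resolvent

/-! ### The transport equation on a line -/

section Line

/-- Integration by parts for a primitive of a merely integrable function: Fubini on the triangle `y
< x`, then the fundamental theorem of calculus for the smooth factor, which vanishes at the right
endpoint. -/
theorem integral_deriv_mul_primitive {b c : ℝ} {χ χ' h : ℝ → ℂ}
    (hχ : ∀ x, HasDerivAt χ (χ' x) x) (hχ' : Continuous χ') (hc : χ c = 0)
    (hh : IntegrableOn h (Ioo b c)) :
    ∫ x in Ioo b c, χ' x * ∫ y in Ioo b x, h y = -∫ x in Ioo b c, χ x * h x := by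
  set μ := volume.restrict (Ioo b c) with hμ
  have hi : Integrable ({p : ℝ × ℝ | p.2 < p.1}.indicator fun p => χ' p.1 * h p.2) (μ.prod μ) := by
    refine Integrable.indicator (Integrable.mul_prod ?_ hh) (measurableSet_lt measurable_snd
      measurable_fst)
    exact (hχ'.integrableOn_Icc (a := b) (b := c)).mono_set Ioo_subset_Icc_self
  have hsw := integral_integral_swap (μ := μ) (ν := μ)
    (f := fun x y => {p : ℝ × ℝ | p.2 < p.1}.indicator (fun p => χ' p.1 * h p.2) (x, y)) hi
  have e1 : ∀ x ∈ Ioo b c, ∫ y, {p : ℝ × ℝ | p.2 < p.1}.indicator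
      (fun p => χ' p.1 * h p.2) (x, y) ∂μ = χ' x * ∫ y in Ioo b x, h y := by
    intro x hx
    have : ∀ y, {p : ℝ × ℝ | p.2 < p.1}.indicator (fun p => χ' p.1 * h p.2) (x, y)
        = χ' x * (Iio x).indicator h y := by
      intro y
      by_cases hy : y < x
      · rw [indicator_of_mem (s := {p : ℝ × ℝ | p.2 < p.1}) hy, indicator_of_mem (s := Iio x) hy]
      · rw [indicator_of_notMem (s := {p : ℝ × ℝ | p.2 < p.1}) hy,
          indicator_of_notMem (s := Iio x) hy, mul_zero]
    simp_rw [this]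
    rw [integral_const_mul, hμ, setIntegral_indicator measurableSet_Iio, Ioo_inter_Iio,
      min_eq_right hx.2.le]
  have e2 : ∀ y ∈ Ioo b c, ∫ x, {p : ℝ × ℝ | p.2 < p.1}.indicator
      (fun p => χ' p.1 * h p.2) (x, y) ∂μ = -(χ y * h y) := by
    intro y hy
    have : ∀ x, {p : ℝ × ℝ | p.2 < p.1}.indicator (fun p => χ' p.1 * h p.2) (x, y)
        = (Ioi y).indicator χ' x * h y := by
      intro x
      by_cases hx : y < x
      · rw [indicator_of_mem (s := {p : ℝ × ℝ | p.2 < p.1}) hx, indicator_of_mem (s := Ioi y) hx]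
      · rw [indicator_of_notMem (s := {p : ℝ × ℝ | p.2 < p.1}) hx,
          indicator_of_notMem (s := Ioi y) hx, zero_mul]
    simp_rw [this]
    rw [integral_mul_const, hμ, setIntegral_indicator measurableSet_Ioi, inter_comm,
      Ioi_inter_Ioo, max_eq_left hy.1.le, ← integral_Ioc_eq_integral_Ioo,
      ← intervalIntegral.integral_of_le hy.2.le,
      intervalIntegral.integral_eq_sub_of_hasDerivAt (fun x _ => hχ x)
        (hχ'.intervalIntegrable _ _), hc, zero_sub, neg_mul]
  rw [setIntegral_congr_fun measurableSet_Ioo e1] at hsw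
  rw [hsw, setIntegral_congr_fun measurableSet_Ioo e2, integral_neg]

/-- The solution of `v F' + λ F = g` on `(-a, a)`. -/
def lineSol (a : ℝ) (l : ℂ) (v : ℝ) (C : ℂ) (g : ℝ → ℂ) (x : ℝ) : ℂ :=
  Complex.exp (-(l / v * x)) * (C + (v : ℂ)⁻¹ * ∫ y in Ioo (-a) x, Complex.exp (l / v * y) * g y)

variable {a : ℝ} {l : ℂ} {v : ℝ} {C : ℂ} {g : ℝ → ℂ}

theorem integrableOn_exp_mul (hg : IntegrableOn g (Ioo (-a) a)) (ν : ℂ) :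
    IntegrableOn (fun y : ℝ => Complex.exp (ν * y) * g y) (Ioo (-a) a) := by
  rw [← integrableOn_Icc_iff_integrableOn_Ioo] at hg ⊢
  exact hg.continuousOn_mul (Continuous.continuousOn (by fun_prop)) isCompact_Icc

theorem continuousOn_primitive_Ioo {h : ℝ → ℂ} (ha : 0 < a) (hh : IntegrableOn h (Ioo (-a) a)) :
    ContinuousOn (fun x => ∫ y in Ioo (-a) x, h y) (Icc (-a) a) := by
  have hle : -a ≤ a := by linarith
  have h1 := intervalIntegral.continuousOn_primitive_interval (f := h) (a := -a) (b := a)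
    (μ := volume) (by rw [uIcc_of_le hle, integrableOn_Icc_iff_integrableOn_Ioo]; exact hh)
  rw [uIcc_of_le hle] at h1
  refine h1.congr fun x hx => ?_
  simp only
  rw [intervalIntegral.integral_of_le hx.1, integral_Ioc_eq_integral_Ioo]

theorem continuousOn_lineSol (ha : 0 < a) (hg : IntegrableOn g (Ioo (-a) a)) :
    ContinuousOn (lineSol a l v C g) (Icc (-a) a) := by
  have h1 := continuousOn_primitive_Ioo ha (integrableOn_exp_mul hg (l / v))
  exact (Continuous.continuousOn (by fun_prop)).mul
    (continuousOn_const.add (continuousOn_const.mul h1))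

theorem integrableOn_Ioo_of_continuousOn {h : ℝ → ℂ} (hh : ContinuousOn h (Icc (-a) a)) :
    IntegrableOn h (Ioo (-a) a) := hh.integrableOn_Icc.mono_set Ioo_subset_Icc_self

/-- Absorb the exponential of the solution into the test function, `χ = φ e^{-λx/v}`. The constant
part integrates to `0` because `χ` vanishes at both ends, and the primitive is integrated by parts.
-/
theorem integral_deriv_mul_lineSol (ha : 0 < a) (hv : v ≠ 0) (hg : IntegrableOn g (Ioo (-a) a))
    {φ φ' : ℝ → ℝ} (hφ : ∀ x, HasDerivAt φ (φ' x) x) (hφ' : Continuous φ') (h1 : φ (-a) = 0)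
    (h2 : φ a = 0) :
    ∫ x in Ioo (-a) a, (v * φ' x) • lineSol a l v C g x
      = -∫ x in Ioo (-a) a, φ x • (g x - l * lineSol a l v C g x) := by
  have hv' : (v : ℂ) ≠ 0 := by exact_mod_cast hv
  have hφc : Continuous φ := continuous_iff_continuousAt.2 fun x => (hφ x).continuousAt
  set F := lineSol a l v C g with hF
  set P : ℝ → ℂ := fun x => ∫ y in Ioo (-a) x, Complex.exp (l / v * y) * g y with hP
  set χ : ℝ → ℂ := fun x => (φ x : ℂ) * Complex.exp (-(l / v * x)) with hχ
  set χ' : ℝ → ℂ := fun x => (φ' x : ℂ) * Complex.exp (-(l / v * x))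
    + (φ x : ℂ) * (Complex.exp (-(l / v * x)) * -(l / v * 1)) with hχ'
  have hFc : ContinuousOn F (Icc (-a) a) := continuousOn_lineSol ha hg
  have hPc : ContinuousOn P (Icc (-a) a) :=
    continuousOn_primitive_Ioo ha (integrableOn_exp_mul hg (l / v))
  have hd : ∀ x, HasDerivAt χ (χ' x) x := fun x =>
    (hφ x).ofReal_comp.mul (((Complex.ofRealCLM.hasDerivAt (x := x)).const_mul (l / v)).neg.cexp)
  have hχ'c : Continuous χ' := by rw [hχ']; fun_prop
  have hχa : χ a = 0 := by rw [hχ]; simp [h2]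
  have hχa' : χ (-a) = 0 := by rw [hχ]; simp only [h1]; simp
  have k1 := integral_deriv_mul_primitive hd hχ'c hχa (integrableOn_exp_mul hg (l / v))
  have k2 : ∫ x in Ioo (-a) a, χ' x = 0 := by
    rw [← integral_Ioc_eq_integral_Ioo, ← intervalIntegral.integral_of_le (by linarith),
      intervalIntegral.integral_eq_sub_of_hasDerivAt (fun x _ => hd x)
        (hχ'c.intervalIntegrable _ _), hχa, hχa', sub_self]
  have e1 : ∀ x, (v * φ' x) • F x
      = v * C * χ' x + χ' x * P x + (φ x : ℂ) * (l * F x) := by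
    intro x
    have hFx : F x = Complex.exp (-(l / v * x)) * (C + (v : ℂ)⁻¹ * P x) := rfl
    rw [hFx, hχ', Complex.real_smul]
    push_cast
    field_simp
    ring
  have e2 : ∀ x, φ x • (g x - l * F x) = χ x * (Complex.exp (l / v * x) * g x)
      - (φ x : ℂ) * (l * F x) := by
    intro x
    have : Complex.exp (-(l / v * x)) * Complex.exp (l / v * x) = 1 := by
      rw [← Complex.exp_add, neg_add_cancel, Complex.exp_zero]
    rw [hχ, Complex.real_smul]
    linear_combination (φ x : ℂ) * g x * -this
  have i1 : IntegrableOn (fun x => v * C * χ' x) (Ioo (-a) a) :=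
    integrableOn_Ioo_of_continuousOn (continuousOn_const.mul hχ'c.continuousOn)
  have i2 : IntegrableOn (fun x => χ' x * P x) (Ioo (-a) a) :=
    integrableOn_Ioo_of_continuousOn (hχ'c.continuousOn.mul hPc)
  have i3 : IntegrableOn (fun x => (φ x : ℂ) * (l * F x)) (Ioo (-a) a) :=
    integrableOn_Ioo_of_continuousOn ((Continuous.continuousOn (by fun_prop)).mul
      (continuousOn_const.mul hFc))
  have i4 : IntegrableOn (fun x => χ x * (Complex.exp (l / v * x) * g x)) (Ioo (-a) a) := by
    have := integrableOn_exp_mul hg (l / v)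
    rw [← integrableOn_Icc_iff_integrableOn_Ioo] at this ⊢
    exact this.continuousOn_mul (Continuous.continuousOn (by rw [hχ]; fun_prop)) isCompact_Icc
  simp_rw [e1, e2]
  have i12 : IntegrableOn (fun x => v * C * χ' x + χ' x * P x) (Ioo (-a) a) := i1.add i2
  rw [integral_add i12 i3, integral_add i1 i2, integral_sub i4 i3, integral_const_mul, k2, k1]
  ring

end Line

/-! ### The resolvent on lines -/

section LineValues

variable {a : ℝ} {l : ℂ} {v : ℝ} {g : ℝ → ℂ}

/-- The constant in the solution of `v F' + λ F = g` with incoming flux `p`. -/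
def lineConst (a : ℝ) (l : ℂ) (v : ℝ) (p : ℂ) (g : ℝ → ℂ) : ℂ :=
  if 0 < v then (v : ℂ)⁻¹ * (Complex.exp (-(l / v * a)) * p)
  else -((v : ℂ)⁻¹ * (Complex.exp (l / v * a) * p + ∫ y in Ioo (-a) a, Complex.exp (l / v * y) * g y))

theorem lineSol_eq_of_pos (hv : 0 < v) (p : ℂ) {x : ℝ} (hx : x ∈ Ioo (-a) a) :
    |v| • lineSol a l v (lineConst a l v p g) g x
      = Complex.exp (-(l * ((entryDist a v x / |v| : ℝ) : ℂ))) * p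
        + ∫ y in Ioo (-a) a, {y | 0 < (x - y) * v}.indicator
          (fun y => Complex.exp (-(l * ((|x - y| / |v| : ℝ) : ℂ))) * g y) y := by
  have hv' : (v : ℂ) ≠ 0 := by exact_mod_cast hv.ne'
  have hset : {y : ℝ | 0 < (x - y) * v} = Iio x := by
    ext y
    simp only [mem_ofPred_eq, mem_Iio]
    rw [mul_pos_iff_of_pos_right hv, sub_pos]
  have e1 : ∫ y in Ioo (-a) a, {y | 0 < (x - y) * v}.indicator
      (fun y => Complex.exp (-(l * ((|x - y| / |v| : ℝ) : ℂ))) * g y) y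
      = Complex.exp (-(l / v * x)) * ∫ y in Ioo (-a) x, Complex.exp (l / v * y) * g y := by
    rw [hset, setIntegral_indicator measurableSet_Iio, Ioo_inter_Iio, min_eq_right hx.2.le,
      ← integral_const_mul]
    refine setIntegral_congr_fun measurableSet_Ioo fun y hy => ?_
    rw [← mul_assoc, ← Complex.exp_add, abs_of_pos (sub_pos.2 hy.2), abs_of_pos hv]
    congr 2
    push_cast
    field_simp
    ring
  have e2 : Complex.exp (-(l * ((entryDist a v x / |v| : ℝ) : ℂ)))
      = Complex.exp (-(l / v * x)) * Complex.exp (-(l / v * a)) := by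
    rw [← Complex.exp_add, entryDist, if_pos hv, abs_of_pos hv]
    congr 1
    push_cast
    field_simp
    ring
  rw [e1, e2, lineSol, lineConst, if_pos hv, abs_of_pos hv, Complex.real_smul]
  field_simp

theorem lineSol_eq_of_neg (ha : 0 < a) (hv : v < 0) (hg : IntegrableOn g (Ioo (-a) a)) (p : ℂ)
    {x : ℝ} (hx : x ∈ Ioo (-a) a) :
    |v| • lineSol a l v (lineConst a l v p g) g x
      = Complex.exp (-(l * ((entryDist a v x / |v| : ℝ) : ℂ))) * p
        + ∫ y in Ioo (-a) a, {y | 0 < (x - y) * v}.indicator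
          (fun y => Complex.exp (-(l * ((|x - y| / |v| : ℝ) : ℂ))) * g y) y := by
  have hv' : (v : ℂ) ≠ 0 := by exact_mod_cast hv.ne
  have hset : {y : ℝ | 0 < (x - y) * v} = Ioi x := by
    ext y
    simp only [mem_ofPred_eq, mem_Ioi]
    constructor <;> intro h <;> nlinarith
  have hi := integrableOn_exp_mul hg (l / v)
  -- For `v < 0` particles come from the right. The full integral in `lineConst` turns the primitive
  -- from `-a` into minus the integral from `x` to `a`.
  have e0 : ∫ y in Ioo (-a) a, Complex.exp (l / v * y) * g y
      = (∫ y in Ioo (-a) x, Complex.exp (l / v * y) * g y)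
        + ∫ y in Ioo x a, Complex.exp (l / v * y) * g y := by
    have h := intervalIntegral.integral_add_adjacent_intervals (μ := volume)
      (f := fun y : ℝ => Complex.exp (l / v * y) * g y) (a := -a) (b := x) (c := a)
      (by rw [intervalIntegrable_iff_integrableOn_Ioo_of_le hx.1.le]
          exact hi.mono_set (Ioo_subset_Ioo le_rfl hx.2.le))
      (by rw [intervalIntegrable_iff_integrableOn_Ioo_of_le hx.2.le]
          exact hi.mono_set (Ioo_subset_Ioo hx.1.le le_rfl))
    rw [intervalIntegral.integral_of_le hx.1.le, intervalIntegral.integral_of_le hx.2.le,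
      intervalIntegral.integral_of_le (by linarith), integral_Ioc_eq_integral_Ioo,
      integral_Ioc_eq_integral_Ioo, integral_Ioc_eq_integral_Ioo] at h
    exact h.symm
  have e1 : ∫ y in Ioo (-a) a, {y | 0 < (x - y) * v}.indicator
      (fun y => Complex.exp (-(l * ((|x - y| / |v| : ℝ) : ℂ))) * g y) y
      = Complex.exp (-(l / v * x)) * ∫ y in Ioo x a, Complex.exp (l / v * y) * g y := by
    rw [hset, setIntegral_indicator measurableSet_Ioi, inter_comm, Ioi_inter_Ioo,
      max_eq_left hx.1.le, ← integral_const_mul]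
    refine setIntegral_congr_fun measurableSet_Ioo fun y hy => ?_
    rw [← mul_assoc, ← Complex.exp_add, abs_of_neg (sub_neg.2 hy.1), abs_of_neg hv]
    congr 2
    push_cast
    field_simp
    ring
  have e2 : Complex.exp (-(l * ((entryDist a v x / |v| : ℝ) : ℂ)))
      = Complex.exp (-(l / v * x)) * Complex.exp (l / v * a) := by
    rw [← Complex.exp_add, entryDist, if_neg hv.not_gt, abs_of_neg hv]
    congr 1
    push_cast
    field_simp
    ring
  rw [e1, e2, lineSol, lineConst, if_neg hv.not_gt, abs_of_neg hv, Complex.real_smul, e0]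
  push_cast
  field_simp
  ring

theorem lineSol_left (a : ℝ) (l : ℂ) (v : ℝ) (C : ℂ) (g : ℝ → ℂ) :
    lineSol a l v C g (-a) = Complex.exp (l / v * a) * C := by
  rw [lineSol, Ioo_self, setIntegral_empty]
  push_cast
  ring_nf

theorem lineSol_entry_of_pos (hv : 0 < v) (p : ℂ) :
    |v| • lineSol a l v (lineConst a l v p g) g (-a) = p := by
  have hv' : (v : ℂ) ≠ 0 := by exact_mod_cast hv.ne'
  have : Complex.exp (l / v * a) * Complex.exp (-(l / v * a)) = 1 := by
    rw [← Complex.exp_add, add_neg_cancel, Complex.exp_zero]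
  rw [lineSol_left, lineConst, if_pos hv, abs_of_pos hv, Complex.real_smul]
  linear_combination (Complex.exp (l / v * a) * Complex.exp (-(l / v * a)) * p) *
    mul_inv_cancel₀ hv' + p * this

theorem lineSol_entry_of_neg (hv : v < 0) (p : ℂ) :
    |v| • lineSol a l v (lineConst a l v p g) g a = p := by
  have hv' : (v : ℂ) ≠ 0 := by exact_mod_cast hv.ne
  have : Complex.exp (-(l / v * a)) * Complex.exp (l / v * a) = 1 := by
    rw [← Complex.exp_add, neg_add_cancel, Complex.exp_zero]
  rw [lineSol, lineConst, if_neg hv.not_gt, abs_of_neg hv, Complex.real_smul]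
  push_cast
  linear_combination (Complex.exp (-(l / v * a)) * Complex.exp (l / v * a) * p) *
    mul_inv_cancel₀ hv' + p * this

theorem lineSol_exit_of_pos (hv : 0 < v) (p : ℂ) :
    |v| • lineSol a l v (lineConst a l v p g) g a
      = Complex.exp (-(l * ((2 * a / |v| : ℝ) : ℂ))) * p
        + ∫ y in Ioo (-a) a, Complex.exp (-(l * ((entryDist a v (-y) / |v| : ℝ) : ℂ))) * g y := by
  have hv' : (v : ℂ) ≠ 0 := by exact_mod_cast hv.ne'
  have e1 : ∫ y in Ioo (-a) a, Complex.exp (-(l * ((entryDist a v (-y) / |v| : ℝ) : ℂ))) * g y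
      = Complex.exp (-(l / v * a)) * ∫ y in Ioo (-a) a, Complex.exp (l / v * y) * g y := by
    rw [← integral_const_mul]
    refine setIntegral_congr_fun measurableSet_Ioo fun y hy => ?_
    rw [← mul_assoc, ← Complex.exp_add, entryDist, if_pos hv, abs_of_pos hv]
    congr 2
    push_cast
    field_simp
    ring
  have e2 : Complex.exp (-(l * ((2 * a / |v| : ℝ) : ℂ)))
      = Complex.exp (-(l / v * a)) * Complex.exp (-(l / v * a)) := by
    rw [← Complex.exp_add, abs_of_pos hv]
    congr 1
    push_cast
    field_simp
    ring
  rw [e1, e2, lineSol, lineConst, if_pos hv, abs_of_pos hv, Complex.real_smul]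
  field_simp

theorem lineSol_exit_of_neg (hv : v < 0) (p : ℂ) :
    |v| • lineSol a l v (lineConst a l v p g) g (-a)
      = Complex.exp (-(l * ((2 * a / |v| : ℝ) : ℂ))) * p
        + ∫ y in Ioo (-a) a, Complex.exp (-(l * ((entryDist a v (-y) / |v| : ℝ) : ℂ))) * g y := by
  have hv' : (v : ℂ) ≠ 0 := by exact_mod_cast hv.ne
  have e1 : ∫ y in Ioo (-a) a, Complex.exp (-(l * ((entryDist a v (-y) / |v| : ℝ) : ℂ))) * g y
      = Complex.exp (l / v * a) * ∫ y in Ioo (-a) a, Complex.exp (l / v * y) * g y := by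
    rw [← integral_const_mul]
    refine setIntegral_congr_fun measurableSet_Ioo fun y hy => ?_
    rw [← mul_assoc, ← Complex.exp_add, entryDist, if_neg hv.not_gt, abs_of_neg hv]
    congr 2
    push_cast
    field_simp
    ring
  have e2 : Complex.exp (-(l * ((2 * a / |v| : ℝ) : ℂ)))
      = Complex.exp (l / v * a) * Complex.exp (l / v * a) := by
    rw [← Complex.exp_add, abs_of_neg hv]
    congr 1
    push_cast
    field_simp
    ring
  rw [e1, e2, lineSol_left, lineConst, if_neg hv.not_gt, abs_of_neg hv, Complex.real_smul]
  push_cast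
  field_simp

end LineValues

section Slices

variable {a : ℝ} {l : ℂ}

theorem integrable_prod_of_slab {E : Type*} [NormedAddCommGroup E] {f : ℝ × ℝ → E}
    (hf : Integrable f (volume.restrict (slab a))) :
    Integrable f ((volume.restrict (Ioo (-a) a)).prod (volume.restrict (Ioo (-1 : ℝ) 1))) := by
  rwa [restrict_slab] at hf

theorem ae_integrableOn_slice (g : L1Slab a) :
    ∀ᵐ v ∂(volume.restrict (Ioo (-1 : ℝ) 1)), IntegrableOn (fun x => g (x, v)) (Ioo (-a) a) :=
  (integrable_prod_of_slab (integrable_Lp g)).prod_left_ae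

theorem coe_inflowL (ha : 0 < a) (hl : 0 ≤ l.re) (p : L1V) :
    inflowL a l p =ᵐ[volume.restrict (slab a)] fun z =>
      Complex.exp (-(l * ((entryDist a z.2 z.1 / |z.2| : ℝ) : ℂ))) * p z.2 := by
  filter_upwards [(isTimeWeight_entry ha).coe_expL l (liftV a p), (isL1Map_liftV a).coe_clm p]
    with z h1 h2
  change expL _ _ _ l (liftV a p) z = _
  rw [h1, liftV, h2, one_mul, expSym, projRe_of_nonneg hl]

theorem coe_outflowL (ha : 0 < a) (hl : 0 ≤ l.re) (g : L1Slab a) :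
    outflowL a l g =ᵐ[volume.restrict (Ioo (-1 : ℝ) 1)] fun v => ∫ y in Ioo (-a) a,
      Complex.exp (-(l * ((entryDist a v (-y) / |v| : ℝ) : ℂ))) * g (y, v) := by
  have hw := isTimeWeight_exit ha
  refine ((isL1Map_integV a).coe_clm _).trans ?_
  refine ((isL1Map_integV a).congr _ _ (hw.coe_expL l g)).trans ?_
  refine Eventually.of_forall fun v => ?_
  simp only [expSym, projRe_of_nonneg hl]

theorem coe_sourceL (ha : 0 < a) (hl : 0 ≤ l.re) (g : L1Slab a) :
    sourceL a l g =ᵐ[volume.restrict (slab a)] fun z => ∫ y in Ioo (-a) a,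
      {y | 0 < (z.1 - y) * z.2}.indicator
        (fun y => Complex.exp (-(l * ((|z.1 - y| / |z.2| : ℝ) : ℂ))) * g (y, z.2)) y := by
  have hw := isTimeWeight_path ha
  refine ((isL1Map_integPath a).coe_clm _).trans ?_
  have h1 : expL (pathMeasure a) (fun θ => |θ.2.2|) (fun θ => |θ.1 - θ.2.1|) l (pathL a g)
      =ᵐ[pathMeasure a] fun θ => {θ : ℝ × ℝ × ℝ | 0 < (θ.1 - θ.2.1) * θ.2.2}.indicator
        (fun θ => Complex.exp (-(l * ((|θ.1 - θ.2.1| / |θ.2.2| : ℝ) : ℂ))) * g θ.2) θ := by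
    filter_upwards [hw.coe_expL l (pathL a g), (isL1Map_path a).coe_clm g] with θ h2 h3
    rw [h2, pathL, h3]
    by_cases hθ : θ ∈ {θ : ℝ × ℝ × ℝ | 0 < (θ.1 - θ.2.1) * θ.2.2}
    · rw [indicator_of_mem hθ, indicator_of_mem hθ, one_mul, expSym, projRe_of_nonneg hl]
    · rw [indicator_of_notMem hθ, indicator_of_notMem hθ, zero_mul, mul_zero]
  refine ((isL1Map_integPath a).congr _ _ h1).trans ?_
  exact Eventually.of_forall fun z => rfl

/-- On almost every line the solution of the resolvent equation is given by `lineSol`. -/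
theorem ae_slice_eq_lineSol (ha : 0 < a) (hl : 0 < l.re) {f g : L1Slab a} {p : L1V}
    (hf : velSlab a f = inflowL a l p + sourceL a l g) :
    ∀ᵐ v ∂(volume.restrict (Ioo (-1 : ℝ) 1)), v ≠ 0 ∧ IntegrableOn (fun x => g (x, v)) (Ioo (-a) a) ∧
      ∀ᵐ x ∂(volume.restrict (Ioo (-a) a)),
        lineSol a l v (lineConst a l v (p v) fun x => g (x, v)) (fun x => g (x, v)) x = f (x, v) := by
  have h0 : ∀ᵐ v ∂(volume.restrict (Ioo (-1 : ℝ) 1)), v ≠ 0 := ae_restrict_of_ae (by simp [ae_iff])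
  have h1 : ∀ᵐ z ∂(volume.restrict (slab a)), ((|z.2| : ℝ) : ℂ) * f z
      = Complex.exp (-(l * ((entryDist a z.2 z.1 / |z.2| : ℝ) : ℂ))) * p z.2
        + ∫ y in Ioo (-a) a, {y | 0 < (z.1 - y) * z.2}.indicator
        (fun y => Complex.exp (-(l * ((|z.1 - y| / |z.2| : ℝ) : ℂ))) * g (y, z.2)) y := by
    filter_upwards [(isTimeWeight_entry ha).coe_weightL f, coe_inflowL ha hl.le p,
      coe_sourceL ha hl.le g, Lp.coeFn_add (inflowL a l p) (sourceL a l g)] with z k1 k2 k3 k4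
    rw [← k1, ← k2, ← k3]
    change velSlab a f z = _
    rw [hf, k4, Pi.add_apply]
  filter_upwards [h0, ae_integrableOn_slice g, ae_slices h1 subset_rfl] with v hv hg hs
  refine ⟨hv, hg, ?_⟩
  filter_upwards [hs, ae_restrict_mem measurableSet_Ioo] with x hx hxm
  have hv' : ((|v| : ℝ) : ℂ) ≠ 0 := by exact_mod_cast abs_ne_zero.2 hv
  refine mul_left_cancel₀ hv' ?_
  rw [hx, ← Complex.real_smul]
  rcases lt_or_gt_of_ne hv with h | h
  · exact lineSol_eq_of_neg ha h hg _ hxm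
  · exact lineSol_eq_of_pos h _ hxm

end Slices

/-! ### Solvability of the resolvent equation -/

section Solve

variable {a : ℝ} {l : ℂ}

theorem integral_slab {E : Type*} [NormedAddCommGroup E] [NormedSpace ℝ E] {f : ℝ × ℝ → E}
    (hf : Integrable f (volume.restrict (slab a))) :
    ∫ z in slab a, f z = ∫ v in Ioo (-1 : ℝ) 1, ∫ x in Ioo (-a) a, f (x, v) := by
  rw [restrict_slab]
  exact integral_prod_symm _ (integrable_prod_of_slab hf)

theorem hasDerivAt_slice {φ : ℝ × ℝ → ℝ} (hφ : ContDiff ℝ ∞ φ) (v x : ℝ) :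
    HasDerivAt (fun x => φ (x, v)) (fderiv ℝ φ (x, v) (1, 0)) x :=
  ((hφ.differentiable (by simp)) (x, v)).hasFDerivAt.comp_hasDerivAt x
    ((hasDerivAt_id x).prodMk (hasDerivAt_const x v))

theorem continuous_slice_deriv {φ : ℝ × ℝ → ℝ} (hφ : ContDiff ℝ ∞ φ) (v : ℝ) :
    Continuous fun x => fderiv ℝ φ (x, v) (1, 0) :=
  ((hφ.continuous_fderiv (by simp)).clm_apply continuous_const).comp
    (continuous_id.prodMk continuous_const)

/-- By Fubini the distributional identity reduces to almost every line, where the restricted test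
function vanishes at both ends. -/
theorem isStreamDeriv_of_lineSol (ha : 0 < a) (hl : 0 < l.re) {f g : L1Slab a} {p : L1V}
    (hf : velSlab a f = inflowL a l p + sourceL a l g) : IsStreamDeriv a f (g - l • f) := by
  intro φ h1 h2 h3
  rw [integral_slab (f := fun z => (z.2 * fderiv ℝ φ z (1, 0)) • f z) (integrable_testDeriv f h1 h2),
    integral_slab (f := fun z => φ z • (g - l • f : L1Slab a) z) (integrable_test _ h1 h2),
    ← integral_neg]
  refine integral_congr_ae ?_
  have hw : ∀ᵐ z ∂(volume.restrict (slab a)), (g - l • f : L1Slab a) z = g z - l * f z := by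
    filter_upwards [Lp.coeFn_sub g (l • f), Lp.coeFn_smul l f] with z e1 e2
    rw [e1, Pi.sub_apply, e2, Pi.smul_apply, smul_eq_mul]
  filter_upwards [ae_slice_eq_lineSol ha hl hf, ae_slices hw subset_rfl] with v ⟨hv, hg, hx⟩ hwv
  have hφ0 : ∀ x, x = a ∨ x = -a → φ (x, v) = 0 := by
    intro x hx
    refine image_eq_zero_of_notMem_tsupport fun hm => ?_
    have := (h3 hm).1
    rcases hx with rfl | rfl
    · exact lt_irrefl _ this.2
    · exact lt_irrefl _ this.1
  have key := integral_deriv_mul_lineSol (l := l)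
    (C := lineConst a l v (p v) fun x => g (x, v)) ha hv hg
    (hasDerivAt_slice h1 v) (continuous_slice_deriv h1 v) (hφ0 _ (Or.inr rfl)) (hφ0 _ (Or.inl rfl))
  refine Eq.trans ?_ (key.trans ?_)
  · refine integral_congr_ae ?_
    filter_upwards [hx] with x h4
    rw [h4]
  · congr 1
    refine integral_congr_ae ?_
    filter_upwards [hx, hwv] with x h4 h5
    rw [h4, h5]

theorem coe_crossL (ha : 0 < a) (hl : 0 ≤ l.re) (p : L1V) :
    crossL a _ l p =ᵐ[volume.restrict (Ioo (-1 : ℝ) 1)] fun v =>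
      Complex.exp (-(l * ((2 * a / |v| : ℝ) : ℂ))) * p v := by
  filter_upwards [(isTimeWeight_V ha).coe_expL l p] with v hv
  rw [hv, expSym, projRe_of_nonneg hl]

theorem isTransportPair_of_lineSol (ha : 0 < a) (hl : 0 < l.re) {O₁ : L1Neg →L[ℂ] L1Pos}
    {O₂ : L1Pos →L[ℂ] L1Neg} {f g : L1Slab a} {p : L1V}
    (hf : velSlab a f = inflowL a l p + sourceL a l g)
    (hp : p = exchangeL O₁ O₂ (crossL a _ l p + outflowL a l g)) :
    IsTransportPair a O₁ O₂ f (g - l • f) := by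
  -- `q` is the outgoing and `p` the incoming flux: the former is read off at the exit face of each
  -- line, the latter at its entry face. Both boundary conditions together are `p = O q`.
  obtain ⟨q, hq⟩ : ∃ q, q = crossL a _ l p + outflowL a l g := ⟨_, rfl⟩
  rw [← hq] at hp
  have hqv : ∀ᵐ v ∂(volume.restrict (Ioo (-1 : ℝ) 1)), q v
      = Complex.exp (-(l * ((2 * a / |v| : ℝ) : ℂ))) * p v + ∫ y in Ioo (-a) a,
        Complex.exp (-(l * ((entryDist a v (-y) / |v| : ℝ) : ℂ))) * g (y, v) := by
    filter_upwards [coe_crossL ha hl.le p, coe_outflowL ha hl.le g,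
      Lp.coeFn_add (crossL a _ l p) (outflowL a l g)] with v h1 h2 h3
    rw [hq, h3, Pi.add_apply, h1, h2]
  have hs := ae_slice_eq_lineSol ha hl hf
  have hneg : ∀ (x : ℝ) (u : L1V), (∀ᵐ v ∂(volume.restrict (Ioo (-1 : ℝ) 1)), v < 0 →
      u v = |v| • lineSol a l v (lineConst a l v (p v) fun x => g (x, v)) (fun x => g (x, v)) x) →
      IsFlux a f x (Ioo (-1) 0) (negL u) := by
    intro x u hu
    filter_upwards [ae_restrict_of_ae_restrict_of_subset neg_subset hs,
      ae_restrict_of_ae_restrict_of_subset neg_subset hu, coe_restrL neg_subset u,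
      ae_restrict_mem measurableSet_Ioo] with v ⟨hv, hg, hx⟩ h2 h3 h4
    exact ⟨_, continuousOn_lineSol ha hg, hx, h3.trans (h2 h4.2)⟩
  have hpos : ∀ (x : ℝ) (u : L1V), (∀ᵐ v ∂(volume.restrict (Ioo (-1 : ℝ) 1)), 0 < v →
      u v = |v| • lineSol a l v (lineConst a l v (p v) fun x => g (x, v)) (fun x => g (x, v)) x) →
      IsFlux a f x (Ioo 0 1) (posL u) := by
    intro x u hu
    filter_upwards [ae_restrict_of_ae_restrict_of_subset pos_subset hs,
      ae_restrict_of_ae_restrict_of_subset pos_subset hu, coe_restrL pos_subset u,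
      ae_restrict_mem measurableSet_Ioo] with v ⟨hv, hg, hx⟩ h2 h3 h4
    exact ⟨_, continuousOn_lineSol ha hg, hx, h3.trans (h2 h4.1)⟩
  refine ⟨isStreamDeriv_of_lineSol ha hl hf, negL q, posL q, hneg _ _ ?_, ?_, hpos _ _ ?_, ?_⟩
  · filter_upwards [hqv] with v h1 h2
    rw [h1, lineSol_exit_of_neg h2]
  · rw [← posL_exchangeL O₁ O₂, ← hp]
    exact hpos _ _ (Eventually.of_forall fun v h2 => (lineSol_entry_of_pos h2 _).symm)
  · filter_upwards [hqv] with v h1 h2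
    rw [h1, lineSol_exit_of_pos h2]
  · rw [← negL_exchangeL O₁ O₂, ← hp]
    exact hneg _ _ (Eventually.of_forall fun v h2 => (lineSol_entry_of_neg h2 _).symm)

theorem influx_eq {O₁ : L1Neg →L[ℂ] L1Pos} {O₂ : L1Pos →L[ℂ] L1Neg} (ha : 0 < a)
    (hu : IsUnit (1 - returnL a O₁ O₂ l)) (g : L1Slab a) :
    influx a O₁ O₂ l g
      = exchangeL O₁ O₂ (crossL a _ l (influx a O₁ O₂ l g) + outflowL a l g) := by
  rw [map_add]
  exact (sub_eq_iff_eq_add.1 (boundaryInv_right ha hu _)).trans (add_comm _ _)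

end Solve

/-! ### Uniqueness on lines -/

section LineUniqueness

/-- A smooth bump of mass `1` around `c`, supported in the ball of radius `1 / (n + 1)`. -/
def bump (n : ℕ) : ContDiffBump (0 : ℝ) where
  rIn := 1 / (2 * ((n : ℝ) + 1))
  rOut := 1 / ((n : ℝ) + 1)
  rIn_pos := by positivity
  rIn_lt_rOut := by
    refine one_div_lt_one_div_of_lt (by positivity) ?_
    have : (0 : ℝ) ≤ n := n.cast_nonneg
    linarith

/-- The bump centered at `c`. -/
def bumpAt (c : ℝ) (n : ℕ) (x : ℝ) : ℝ := (bump n).normed volume (c - x)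

theorem contDiff_bumpAt (c : ℝ) (n : ℕ) : ContDiff ℝ ∞ (bumpAt c n) :=
  ((bump n).contDiff_normed (μ := volume)).comp (contDiff_const.sub contDiff_id)

theorem bumpAt_eq_zero {c x : ℝ} {n : ℕ} (h : 1 / ((n : ℝ) + 1) ≤ |c - x|) : bumpAt c n x = 0 := by
  have hs : c - x ∉ Function.support ((bump n).normed volume) := by
    rw [ContDiffBump.support_normed_eq, mem_ball_zero_iff, not_lt]
    exact h
  exact Function.notMem_support.1 hs

theorem integral_bumpAt (c : ℝ) (n : ℕ) : ∫ x, bumpAt c n x = 1 := by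
  have := integral_sub_left_eq_self (fun x => (bump n).normed volume x) volume c
  exact this.trans (bump n).integral_normed

theorem tendsto_integral_bumpAt {H : ℝ → ℂ} (hH : Continuous H) (c : ℝ) :
    Tendsto (fun n => ∫ x, bumpAt c n x • H x) atTop (𝓝 (H c)) := by
  have h1 : Tendsto (fun n : ℕ => (bump n).rOut) atTop (𝓝 0) :=
    tendsto_one_div_add_atTop_nhds_zero_nat
  have := ContDiffBump.convolution_tendsto_right_of_continuous (μ := volume) h1 hH c
  refine this.congr fun n => ?_
  rw [convolution_eq_swap]
  rfl

variable {a : ℝ}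

/-- The ball of radius `1 / (n + 1)` around `c` is contained in `(-a, a)`. -/
def FitsIn (a c : ℝ) (n : ℕ) : Prop := -a < c - 1 / ((n : ℝ) + 1) ∧ c + 1 / ((n : ℝ) + 1) < a

theorem FitsIn.support_subset {c : ℝ} {n : ℕ} (h : FitsIn a c n) {x : ℝ}
    (hx : c + 1 / ((n : ℝ) + 1) ≤ x) : Function.support (bumpAt c n) ⊆ Ioc (-a) x := by
  intro y hy
  by_contra hcon
  refine hy (bumpAt_eq_zero ?_)
  by_contra hlt
  rw [not_le, abs_lt] at hlt
  exact hcon ⟨by linarith [h.1], by linarith⟩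

theorem eventually_fitsIn {c : ℝ} (hc : c ∈ Ioo (-a) a) : ∀ᶠ n : ℕ in atTop, FitsIn a c n := by
  have h1 : Tendsto (fun n : ℕ => 1 / ((n : ℝ) + 1)) atTop (𝓝 0) :=
    tendsto_one_div_add_atTop_nhds_zero_nat
  filter_upwards [h1.eventually (gt_mem_nhds (sub_pos.2 hc.1)),
    h1.eventually (gt_mem_nhds (sub_pos.2 hc.2))] with n h2 h3
  exact ⟨by linarith, by linarith⟩

theorem FitsIn.setIntegral_eq {c : ℝ} {n : ℕ} (h : FitsIn a c n) (H : ℝ → ℂ) :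
    ∫ x in Ioo (-a) a, bumpAt c n x • H x = ∫ x, bumpAt c n x • H x := by
  refine setIntegral_eq_integral_of_forall_compl_eq_zero fun x hx => ?_
  rw [bumpAt_eq_zero, zero_smul]
  by_contra hlt
  rw [not_le, abs_lt] at hlt
  exact hx ⟨by linarith [h.1], by linarith [h.2]⟩

/-- A primitive of the difference of two bumps. -/
def testFun (a c d : ℝ) (n : ℕ) (x : ℝ) : ℝ := ∫ y in (-a)..x, (bumpAt c n y - bumpAt d n y)

theorem hasDerivAt_testFun (a c d : ℝ) (n : ℕ) (x : ℝ) :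
    HasDerivAt (testFun a c d n) (bumpAt c n x - bumpAt d n x) x :=
  (((contDiff_bumpAt c n).continuous.sub
    (contDiff_bumpAt d n).continuous).integral_hasStrictDerivAt (-a) x).hasDerivAt

theorem deriv_testFun (a c d : ℝ) (n : ℕ) :
    deriv (testFun a c d n) = fun x => bumpAt c n x - bumpAt d n x :=
  funext fun x => (hasDerivAt_testFun a c d n x).deriv

theorem contDiff_testFun (a c d : ℝ) (n : ℕ) : ContDiff ℝ ∞ (testFun a c d n) := by
  rw [contDiff_infty_iff_deriv, deriv_testFun]
  exact ⟨fun x => (hasDerivAt_testFun a c d n x).differentiableAt,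
    (contDiff_bumpAt c n).sub (contDiff_bumpAt d n)⟩

/-- To the left of both bumps the integrand vanishes; to the right the two unit masses cancel. Thus
this primitive is an admissible test function. -/
theorem testFun_eq_zero {c d : ℝ} {n : ℕ} (hc : FitsIn a c n) (hd : FitsIn a d n) {x : ℝ}
    (hx : x ∉ Icc (min c d - 1 / ((n : ℝ) + 1)) (max c d + 1 / ((n : ℝ) + 1))) :
    testFun a c d n x = 0 := by
  rw [mem_Icc, not_and_or, not_le, not_le] at hx
  have i1 : ∀ c, IntervalIntegrable (bumpAt c n) volume (-a) x := fun c =>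
    (contDiff_bumpAt c n).continuous.intervalIntegrable _ _
  rcases hx with hx | hx
  · refine intervalIntegral.integral_zero_ae (Eventually.of_forall fun y hy => ?_)
    have hy2 : y < min c d - 1 / ((n : ℝ) + 1) := by
      refine hy.2.trans_lt (max_lt ?_ hx)
      rcases min_choice c d with h | h <;> rw [h]
      · exact hc.1
      · exact hd.1
    rw [bumpAt_eq_zero, bumpAt_eq_zero, sub_zero]
    · refine le_trans ?_ (le_abs_self _)
      linarith [min_le_right c d]
    · refine le_trans ?_ (le_abs_self _)
      linarith [min_le_left c d]
  · rw [testFun, intervalIntegral.integral_sub (i1 c) (i1 d),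
      intervalIntegral.integral_eq_integral_of_support_subset (hc.support_subset (by
        linarith [le_max_left c d])),
      intervalIntegral.integral_eq_integral_of_support_subset (hd.support_subset (by
        linarith [le_max_right c d])), integral_bumpAt, integral_bumpAt, sub_self]

theorem hasCompactSupport_testFun {c d : ℝ} {n : ℕ} (hc : FitsIn a c n) (hd : FitsIn a d n) :
    HasCompactSupport (testFun a c d n) :=
  HasCompactSupport.intro isCompact_Icc fun _ hx => testFun_eq_zero hc hd hx

theorem tsupport_testFun {c d : ℝ} {n : ℕ} (hc : FitsIn a c n) (hd : FitsIn a d n) :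
    tsupport (testFun a c d n) ⊆ Ioo (-a) a := by
  refine (closure_minimal (t := Icc (min c d - 1 / ((n : ℝ) + 1)) (max c d + 1 / ((n : ℝ) + 1)))
    (fun x hx => ?_) isClosed_Icc).trans fun x hx => ?_
  · by_contra h
    exact hx (testFun_eq_zero hc hd h)
  · constructor
    · refine lt_of_lt_of_le ?_ hx.1
      rcases min_choice c d with h | h <;> rw [h]
      · exact hc.1
      · exact hd.1
    · refine hx.2.trans_lt ?_
      rcases max_choice c d with h | h <;> rw [h]
      · exact hc.2
      · exact hd.2

/-- A continuous weak solution of `v F' + λ F = 0` is an exponential function. -/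
theorem eq_exp_of_weak_solution (ha : 0 < a) {l : ℂ} {v : ℝ} (hv : v ≠ 0) {F : ℝ → ℂ}
    (hF : Continuous F)
    (h : ∀ (c d : ℚ) (n : ℕ), FitsIn a c n → FitsIn a d n →
      ∫ x in Ioo (-a) a, (v * deriv (testFun a c d n) x) • F x
        = l * ∫ x in Ioo (-a) a, testFun a c d n x • F x) :
    ∀ x ∈ Icc (-a) a, F x = Complex.exp (-(l / v * (x + a))) * F (-a) := by
  have hv' : (v : ℂ) ≠ 0 := by exact_mod_cast hv
  set P : ℝ → ℂ := fun x => ∫ y in (-a)..x, F y with hP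
  have hPd : ∀ x, HasDerivAt P (F x) x := fun x => (hF.integral_hasStrictDerivAt (-a) x).hasDerivAt
  have hPc : Continuous P := continuous_iff_continuousAt.2 fun x => (hPd x).continuousAt
  -- The argument of du Bois-Reymond: the weak equation says that `v F + λ ∫ F` is constant.
  set H : ℝ → ℂ := fun x => v * F x + l * P x with hH
  have hHc : Continuous H := by rw [hH]; fun_prop
  have hFi : IntegrableOn F (Ioo (-a) a) := integrableOn_Ioo_of_continuousOn hF.continuousOn
  -- Testing with the primitive of a difference of bumps shows that the averages of `H` around `c`
  -- and `d` agree.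
  have key : ∀ (c d : ℚ) (n : ℕ), FitsIn a c n → FitsIn a d n →
      ∫ x, bumpAt c n x • H x = ∫ x, bumpAt d n x • H x := by
    intro c d n hc hd
    have e1 := h c d n hc hd
    have hend : ∀ x, x = a ∨ x = -a → testFun a c d n x = 0 := by
      intro x hx
      refine image_eq_zero_of_notMem_tsupport fun hm => ?_
      have := tsupport_testFun hc hd hm
      rcases hx with rfl | rfl
      · exact lt_irrefl _ this.2
      · exact lt_irrefl _ this.1
    have e2 := integral_deriv_mul_primitive (b := -a) (c := a) (h := F)
      (χ := fun x => (testFun a c d n x : ℂ)) (fun x => (hasDerivAt_testFun a c d n x).ofReal_comp)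
      (Complex.continuous_ofReal.comp ((contDiff_bumpAt c n).continuous.sub
        (contDiff_bumpAt d n).continuous)) (by simp [hend a (Or.inl rfl)]) hFi
    have e3 : ∫ x in Ioo (-a) a, (bumpAt c n x - bumpAt d n x) • H x = 0 := by
      have e4 : ∀ x ∈ Ioo (-a) a, (bumpAt c n x - bumpAt d n x) • H x
          = (v * deriv (testFun a c d n) x) • F x
            + l * (((bumpAt c n x - bumpAt d n x : ℝ) : ℂ) * ∫ y in Ioo (-a) x, F y) := by
        intro x hx
        have : P x = ∫ y in Ioo (-a) x, F y := by
          rw [hP]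
          simp only
          rw [intervalIntegral.integral_of_le hx.1.le, integral_Ioc_eq_integral_Ioo]
        rw [← this, deriv_testFun, hH, Complex.real_smul, Complex.real_smul]
        push_cast
        ring
      have cb : Continuous fun x => bumpAt c n x - bumpAt d n x :=
        (contDiff_bumpAt c n).continuous.sub (contDiff_bumpAt d n).continuous
      rw [setIntegral_congr_fun measurableSet_Ioo e4, integral_add, integral_const_mul, e1, e2]
      · simp_rw [Complex.real_smul]
        ring
      · refine integrableOn_Ioo_of_continuousOn (Continuous.continuousOn ?_)
        rw [deriv_testFun]
        exact (continuous_const.mul cb).smul hF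
      · refine integrableOn_Ioo_of_continuousOn (continuousOn_const.mul ?_)
        exact (Complex.continuous_ofReal.comp cb).continuousOn.mul
          (continuousOn_primitive_Ioo ha hFi)
    have i1 : ∀ c, IntegrableOn (fun x => bumpAt c n x • H x) (Ioo (-a) a) := fun c =>
      integrableOn_Ioo_of_continuousOn ((contDiff_bumpAt c n).continuous.smul hHc).continuousOn
    simp_rw [sub_smul] at e3
    rw [integral_sub (i1 c) (i1 d), hc.setIntegral_eq, hd.setIntegral_eq] at e3
    exact sub_eq_zero.1 e3
  -- The bumps shrink to points. Rational centres are enough by density, and only countably many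
  -- test functions are involved.
  have hrat : ∀ c d : ℚ, (c : ℝ) ∈ Ioo (-a) a → (d : ℝ) ∈ Ioo (-a) a → H c = H d := by
    intro c d hc hd
    refine tendsto_nhds_unique_of_eventuallyEq (tendsto_integral_bumpAt hHc c)
      (tendsto_integral_bumpAt hHc d) ?_
    filter_upwards [eventually_fitsIn hc, eventually_fitsIn hd] with n h1 h2
    exact key c d n h1 h2
  have hconst : ∀ x ∈ Icc (-a) a, H x = H (-a) := by
    have h0 : (((0 : ℚ) : ℝ)) ∈ Ioo (-a) a := by simpa using ha
    have hcl : ∀ x ∈ Icc (-a) a, H x = H ((0 : ℚ) : ℝ) := by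
      have hd : Icc (-a) a ⊆ closure (Ioo (-a) a ∩ range ((↑) : ℚ → ℝ)) := by
        rw [← closure_Ioo (by linarith : -a ≠ a)]
        exact closure_minimal (Dense.open_subset_closure_inter Rat.denseRange_cast isOpen_Ioo) isClosed_closure
      intro x hx
      have hc : IsClosed {x | H x = H ((0 : ℚ) : ℝ)} := isClosed_eq hHc continuous_const
      refine closure_minimal ?_ hc (hd hx)
      rintro _ ⟨hy, q, rfl⟩
      exact hrat q 0 hy h0
    intro x hx
    rw [hcl x hx, hcl (-a) ⟨le_rfl, by linarith⟩]
  have hFx : ∀ x ∈ Icc (-a) a, F x = F (-a) - l / v * P x := by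
    intro x hx
    have h1 := hconst x hx
    have h2 : P (-a) = 0 := intervalIntegral.integral_same
    simp only [hH, h2, mul_zero, add_zero] at h1
    field_simp
    linear_combination h1
  -- The integrated equation `F = F(-a) - (λ/v) P` with `P' = F` is now solved by the integrating
  -- factor `e^{λx/v}`.
  have hy : ∀ x ∈ Icc (-a) a, Complex.exp (l / v * x) * (F (-a) - l / v * P x)
      = Complex.exp (l / v * (-a : ℝ)) * (F (-a) - l / v * P (-a)) := by
    have hd : ∀ x : ℝ, HasDerivAt (fun x : ℝ => Complex.exp (l / v * x) * (F (-a) - l / v * P x))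
        (Complex.exp (l / v * x) * (l / v * 1) * (F (-a) - l / v * P x)
          + Complex.exp (l / v * x) * -(l / v * F x)) x := fun x =>
      (((Complex.ofRealCLM.hasDerivAt (x := x)).const_mul (l / v)).cexp).mul
        (((hPd x).const_mul (l / v)).const_sub _)
    refine constant_of_has_deriv_right_zero (fun x _ => (hd x).continuousAt.continuousWithinAt) ?_
    intro x hx
    refine (hd x).hasDerivWithinAt.congr_deriv ?_
    rw [hFx x ⟨hx.1, hx.2.le⟩]
    ring
  intro x hx
  have h1 := hy x hx
  rw [← hFx x hx, ← hFx (-a) ⟨le_rfl, by linarith⟩] at h1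
  have h2 : Complex.exp (-(l / v * x)) * Complex.exp (l / v * x) = 1 := by
    rw [← Complex.exp_add, neg_add_cancel, Complex.exp_zero]
  have h3 : Complex.exp (-(l / v * (x + a)))
      = Complex.exp (-(l / v * x)) * Complex.exp (l / v * (-a : ℝ)) := by
    rw [← Complex.exp_add]; congr 1; push_cast; ring
  rw [h3, mul_assoc, ← h1, ← mul_assoc, h2, one_mul]

end LineUniqueness

/-! ### Uniqueness for the resolvent equation -/

section Unique

variable {a : ℝ} {l : ℂ}

/-- Test with products `φ(x) χ(v)` and vary `χ`: the fundamental lemma of the calculus of variations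
in `v` removes the second variable. The exceptional null set depends on `φ`. -/
theorem ae_weak_slice {d : L1Slab a} (hd : IsStreamDeriv a d (-(l • d))) {φ : ℝ → ℝ}
    (hφ : ContDiff ℝ ∞ φ) (hc : HasCompactSupport φ) (hs : tsupport φ ⊆ Ioo (-a) a) :
    ∀ᵐ v ∂(volume.restrict (Ioo (-1 : ℝ) 1)),
      ∫ x in Ioo (-a) a, (v * deriv φ x) • d (x, v) = l * ∫ x in Ioo (-a) a, φ x • d (x, v) := by
  have hφc : Continuous fun z : ℝ × ℝ => φ z.1 := hφ.continuous.comp continuous_fst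
  obtain ⟨K, hK⟩ := hφ.continuous.bounded_above_of_compact_support hc
  have hdc : Continuous (deriv φ) := hφ.continuous_deriv (by simp)
  obtain ⟨K', hK'⟩ := hdc.bounded_above_of_compact_support hc.deriv
  have i1 : Integrable (fun z : ℝ × ℝ => φ z.1 • d z) (volume.restrict (slab a)) :=
    (integrable_Lp d).bdd_smul K hφc.aestronglyMeasurable (Eventually.of_forall fun z => hK _)
  have i2 : Integrable (fun z : ℝ × ℝ => (z.2 * deriv φ z.1) • d z) (volume.restrict (slab a)) := by
    have hmc : Continuous fun z : ℝ × ℝ => z.2 * deriv φ z.1 :=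
      continuous_snd.mul (hdc.comp continuous_fst)
    refine (integrable_Lp d).bdd_smul K' hmc.aestronglyMeasurable ?_
    filter_upwards [ae_slab a] with z hz
    rw [norm_mul]
    exact (mul_le_of_le_one_left (norm_nonneg _) (abs_lt.2 hz.1.2).le).trans (hK' _)
  have i3 : Integrable (fun z : ℝ × ℝ => (z.2 * deriv φ z.1) • d z - l * (φ z.1 • d z))
      (volume.restrict (slab a)) := i2.sub (i1.const_mul l)
  set m : ℝ → ℂ := fun v => ∫ x in Ioo (-a) a,
    ((v * deriv φ x) • d (x, v) - l * (φ x • d (x, v))) with hm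
  have hmi : IntegrableOn m (Ioo (-1 : ℝ) 1) :=
    (integrable_prod_of_slab i3).swap.integral_prod_left
  have key : ∀ᵐ v, v ∈ Ioo (-1 : ℝ) 1 → m v = 0 := by
    refine isOpen_Ioo.ae_eq_zero_of_integral_contDiff_smul_eq_zero
      hmi.locallyIntegrableOn fun χ h1 h2 h3 => ?_
    have hprod : ContDiff ℝ ∞ fun z : ℝ × ℝ => φ z.1 * χ z.2 :=
      (hφ.comp contDiff_fst).mul (h1.comp contDiff_snd)
    have hzero : ∀ z : ℝ × ℝ, z ∉ tsupport φ ×ˢ tsupport χ → φ z.1 * χ z.2 = 0 := by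
      intro z hz
      rw [mem_prod, not_and_or] at hz
      rcases hz with hz | hz
      · rw [image_eq_zero_of_notMem_tsupport hz, zero_mul]
      · rw [image_eq_zero_of_notMem_tsupport hz, mul_zero]
    have hcs : HasCompactSupport fun z : ℝ × ℝ => φ z.1 * χ z.2 :=
      HasCompactSupport.intro (hc.isCompact.prod h2.isCompact) hzero
    have hts : tsupport (fun z : ℝ × ℝ => φ z.1 * χ z.2) ⊆ slab a := by
      refine (closure_minimal (t := tsupport φ ×ˢ tsupport χ) (fun z hz => ?_)
        ((isClosed_tsupport φ).prod (isClosed_tsupport χ))).trans (prod_mono hs h3)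
      by_contra h
      exact hz (hzero z h)
    have h4 := hd _ hprod hcs hts
    have hfd : ∀ z : ℝ × ℝ, fderiv ℝ (fun z : ℝ × ℝ => φ z.1 * χ z.2) z (1, 0)
        = deriv φ z.1 * χ z.2 := fun z =>
      (hasDerivAt_slice hprod z.2 z.1).unique
        (((hφ.differentiable (by simp)) z.1).hasDerivAt.mul_const (χ z.2))
    have h5 : ∫ z in slab a, χ z.2 • ((z.2 * deriv φ z.1) • d z - l * (φ z.1 • d z)) = 0 := by
      have e1 : ∫ z in slab a, (φ z.1 * χ z.2) • (-(l • d) : L1Slab a) z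
          = -∫ z in slab a, χ z.2 • (l * (φ z.1 • d z)) := by
        rw [← integral_neg]
        refine integral_congr_ae ?_
        filter_upwards [Lp.coeFn_neg (l • d), Lp.coeFn_smul l d] with z k1 k2
        rw [k1, Pi.neg_apply, k2, Pi.smul_apply]
        simp only [Complex.real_smul, smul_eq_mul]
        push_cast
        ring
      rw [e1, neg_neg] at h4
      simp_rw [hfd] at h4
      have e2 : ∀ z : ℝ × ℝ, (z.2 * (deriv φ z.1 * χ z.2)) • d z
          = χ z.2 • ((z.2 * deriv φ z.1) • d z) := fun z => by
        rw [smul_smul]; congr 1; ring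
      simp_rw [e2] at h4
      obtain ⟨K₂, hK₂⟩ := h1.continuous.bounded_above_of_compact_support h2
      have hχm : AEStronglyMeasurable (fun z : ℝ × ℝ => χ z.2) (volume.restrict (slab a)) :=
        (h1.continuous.comp continuous_snd).aestronglyMeasurable
      have j1 : Integrable (fun z : ℝ × ℝ => χ z.2 • ((z.2 * deriv φ z.1) • d z))
          (volume.restrict (slab a)) :=
        i2.bdd_smul K₂ hχm (Eventually.of_forall fun z => hK₂ _)
      have j2 : Integrable (fun z : ℝ × ℝ => χ z.2 • (l * (φ z.1 • d z)))
          (volume.restrict (slab a)) :=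
        (i1.const_mul l).bdd_smul K₂ hχm (Eventually.of_forall fun z => hK₂ _)
      simp_rw [smul_sub]
      rw [integral_sub j1 j2, h4, sub_self]
    obtain ⟨K₂, hK₂⟩ := h1.continuous.bounded_above_of_compact_support h2
    rw [integral_slab (f := fun z : ℝ × ℝ => χ z.2 • ((z.2 * deriv φ z.1) • d z
      - l * (φ z.1 • d z))) (i3.bdd_smul K₂
        (h1.continuous.comp continuous_snd).aestronglyMeasurable
        (Eventually.of_forall fun z => hK₂ _))] at h5
    rw [← setIntegral_eq_integral_of_forall_compl_eq_zero (s := Ioo (-1 : ℝ) 1) fun v hv => by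
      rw [image_eq_zero_of_notMem_tsupport (fun h => hv (h3 h)), zero_smul]]
    rw [← h5]
    refine integral_congr_ae (Eventually.of_forall fun v => ?_)
    exact (integral_smul (χ v) _).symm
  have key' : ∀ᵐ v ∂(volume.restrict (Ioo (-1 : ℝ) 1)), m v = 0 :=
    (ae_restrict_iff' measurableSet_Ioo).2 key
  filter_upwards [key', (integrable_prod_of_slab i1).prod_left_ae,
    (integrable_prod_of_slab i2).prod_left_ae] with v h1 h2 h3
  rw [hm] at h1
  simp only at h1
  rw [integral_sub h3 (h2.const_mul l), integral_const_mul] at h1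
  exact sub_eq_zero.1 h1

/-- On almost every line a continuous representative of a solution of the homogeneous equation is
an exponential function. -/
theorem ae_slice_eq_exp (ha : 0 < a) {d : L1Slab a} (hd : IsStreamDeriv a d (-(l • d))) :
    ∀ᵐ v ∂(volume.restrict (Ioo (-1 : ℝ) 1)), ∀ F : ℝ → ℂ, ContinuousOn F (Icc (-a) a) →
      (∀ᵐ x ∂(volume.restrict (Ioo (-a) a)), F x = d (x, v)) →
      ∀ x ∈ Icc (-a) a, F x = Complex.exp (-(l / v * (x + a))) * F (-a) := by
  have h0 : ∀ᵐ v ∂(volume.restrict (Ioo (-1 : ℝ) 1)), v ≠ 0 := ae_restrict_of_ae (by simp [ae_iff])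
  -- Only countably many test functions occur, so a single null set of velocities serves for all of
  -- them.
  have h1 : ∀ᵐ v ∂(volume.restrict (Ioo (-1 : ℝ) 1)), ∀ (b c : ℚ) (n : ℕ),
      FitsIn a b n → FitsIn a c n →
      ∫ x in Ioo (-a) a, (v * deriv (testFun a b c n) x) • d (x, v)
        = l * ∫ x in Ioo (-a) a, testFun a b c n x • d (x, v) := by
    simp_rw [ae_all_iff]
    intro b c n hb hc
    exact ae_weak_slice hd (contDiff_testFun a b c n) (hasCompactSupport_testFun hb hc)
      (tsupport_testFun hb hc)
  have hle : -a ≤ a := by linarith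
  filter_upwards [h0, h1] with v hv hw F hF hFd
  -- The representative is continuous on the closed interval only; it is extended by its end values
  -- to the whole line.
  set F' : ℝ → ℂ := IccExtend hle ((Icc (-a) a).domRestrict F) with hF'
  have hF'c : Continuous F' := (continuousOn_iff_continuous_domRestrict.1 hF).Icc_extend'
  have hFF' : ∀ x ∈ Icc (-a) a, F' x = F x := fun x hx => IccExtend_of_mem hle _ hx
  have hF'd : ∀ᵐ x ∂(volume.restrict (Ioo (-a) a)), F' x = d (x, v) := by
    filter_upwards [hFd, ae_restrict_mem measurableSet_Ioo] with x h2 h3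
    rw [hFF' x (Ioo_subset_Icc_self h3), h2]
  have key := eq_exp_of_weak_solution ha (l := l) hv hF'c fun b c n hb hc => by
    have e := hw b c n hb hc
    refine Eq.trans (integral_congr_ae ?_) (e.trans (congrArg _ (integral_congr_ae ?_)))
    · filter_upwards [hF'd] with x hx
      rw [hx]
    · filter_upwards [hF'd] with x hx
      rw [hx]
  intro x hx
  rw [← hFF' x hx, ← hFF' (-a) ⟨le_rfl, hle⟩]
  exact key x hx

theorem eqOn_of_ae_eq (ha : 0 < a) {F F' : ℝ → ℂ} {h : ℝ → ℂ} (hF : ContinuousOn F (Icc (-a) a))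
    (hF' : ContinuousOn F' (Icc (-a) a))
    (h1 : ∀ᵐ x ∂(volume.restrict (Ioo (-a) a)), F x = h x)
    (h2 : ∀ᵐ x ∂(volume.restrict (Ioo (-a) a)), F' x = h x) : EqOn F F' (Icc (-a) a) := by
  refine Measure.eqOn_Icc_of_ae_eq volume (by linarith) ?_ hF hF'
  rw [← Measure.restrict_congr_set Ioo_ae_eq_Icc]
  filter_upwards [h1, h2] with x e1 e2
  rw [e1, e2]

theorem eq_zero_of_ae_slices {d : L1Slab a} (h : ∀ᵐ v ∂(volume.restrict (Ioo (-1 : ℝ) 1)),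
    ∀ᵐ x ∂(volume.restrict (Ioo (-a) a)), d (x, v) = 0) : d = 0 := by
  rw [← norm_eq_zero, norm_eq_integral, integral_slab (integrable_Lp d).norm]
  refine integral_eq_zero_of_ae ?_
  filter_upwards [h] with v hv
  refine integral_eq_zero_of_ae ?_
  filter_upwards [hv] with x hx
  rw [hx, norm_zero, Pi.zero_apply]

/-- The exponential form on lines gives `hR = E O₁ hL` and `hL = E O₂ hR`. Hence `O₁ hL` is fixed by
the return operator and vanishes, then so does `O₂ hR`. With zero incoming flux every exponential is
zero. -/
theorem eq_zero_of_isTransportPair (ha : 0 < a) (hl : 0 ≤ l.re) {O₁ : L1Neg →L[ℂ] L1Pos}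
    {O₂ : L1Pos →L[ℂ] L1Neg} (hu : IsUnit (1 - returnL a O₁ O₂ l)) {d : L1Slab a}
    (hd : IsTransportPair a O₁ O₂ d (-(l • d))) : d = 0 := by
  obtain ⟨hs, hL, hR, f1, f2, f3, f4⟩ := hd
  have hE := ae_slice_eq_exp ha hs
  have hma : -a ∈ Icc (-a) a := ⟨le_rfl, by linarith⟩
  have hpa : a ∈ Icc (-a) a := ⟨by linarith, le_rfl⟩
  have hR' : hR = crossL a _ l (O₁ hL) := by
    refine Lp.ext ?_
    filter_upwards [f2, f3, ae_restrict_of_ae_restrict_of_subset pos_subset hE,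
      (isTimeWeight_pos ha).coe_expL l (O₁ hL), ae_restrict_mem measurableSet_Ioo]
      with v ⟨F, hF, hFd, hFv⟩ ⟨F', hF', hF'd, hF'v⟩ hexp hcr hv
    have hv0 : (v : ℂ) ≠ 0 := by exact_mod_cast hv.1.ne'
    rw [hcr, hFv, hF'v, ← eqOn_of_ae_eq ha hF hF' hFd hF'd hpa, hexp F hF hFd a hpa, expSym,
      projRe_of_nonneg hl, abs_of_pos hv.1]
    have : Complex.exp (-(l / v * (a + a))) = Complex.exp (-(l * ((2 * a / v : ℝ) : ℂ))) := by
      congr 2; push_cast; field_simp; ring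
    rw [this, mul_smul_comm]
  have hL' : hL = crossL a _ l (O₂ hR) := by
    refine Lp.ext ?_
    filter_upwards [f1, f4, ae_restrict_of_ae_restrict_of_subset neg_subset hE,
      (isTimeWeight_neg ha).coe_expL l (O₂ hR), ae_restrict_mem measurableSet_Ioo]
      with v ⟨F, hF, hFd, hFv⟩ ⟨F', hF', hF'd, hF'v⟩ hexp hcr hv
    have hv0 : (v : ℂ) ≠ 0 := by exact_mod_cast hv.2.ne
    rw [hcr, hFv, hF'v, ← eqOn_of_ae_eq ha hF hF' hFd hF'd hpa, hexp F hF hFd a hpa, expSym,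
      projRe_of_nonneg hl, abs_of_neg hv.2]
    have : Complex.exp (-(l * ((2 * a / -v : ℝ) : ℂ))) * Complex.exp (-(l / v * (a + a))) = 1 := by
      rw [← Complex.exp_add, Complex.exp_eq_one_iff]
      refine ⟨0, ?_⟩
      push_cast
      field_simp
      ring
    rw [mul_smul_comm, ← mul_assoc, this, one_mul]
  have h1 : O₁ hL = 0 := by
    have e : (1 - returnL a O₁ O₂ l) (O₁ hL) = 0 := by
      change O₁ hL - O₁ (crossL a _ l (O₂ (crossL a _ l (O₁ hL)))) = 0
      rw [← hR', ← hL', sub_self]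
    have := DFunLike.congr_fun (Ring.inverse_mul_cancel _ hu) (O₁ hL)
    rw [mul_apply_eq_comp, e, map_zero] at this
    exact this.symm
  have h2 : O₂ hR = 0 := by rw [hR', h1, map_zero, map_zero]
  have hzero : ∀ {v : ℝ} {F : ℝ → ℂ}, (∀ x ∈ Icc (-a) a,
      F x = Complex.exp (-(l / v * (x + a))) * F (-a)) → F (-a) = 0 →
      (∀ᵐ x ∂(volume.restrict (Ioo (-a) a)), F x = d (x, v)) →
      ∀ᵐ x ∂(volume.restrict (Ioo (-a) a)), d (x, v) = 0 := by
    intro v F h3 h4 h5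
    filter_upwards [h5, ae_restrict_mem measurableSet_Ioo] with x h6 h7
    rw [← h6, h3 x (Ioo_subset_Icc_self h7), h4, mul_zero]
  refine eq_zero_of_ae_slices (ae_velocity ?_ ?_)
  · rw [h1] at f2
    filter_upwards [f2, ae_restrict_of_ae_restrict_of_subset pos_subset hE,
      ae_restrict_mem measurableSet_Ioo, Lp.coeFn_zero ℂ 1 (volume.restrict (Ioo (0 : ℝ) 1))]
      with v ⟨F, hF, hFd, hFv⟩ hexp hv h0
    rw [h0, Pi.zero_apply, eq_comm, smul_eq_zero] at hFv
    exact hzero (hexp F hF hFd) (hFv.resolve_left (abs_pos.2 hv.1.ne').ne') hFd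
  · rw [h2] at f4
    filter_upwards [f4, ae_restrict_of_ae_restrict_of_subset neg_subset hE,
      ae_restrict_mem measurableSet_Ioo, Lp.coeFn_zero ℂ 1 (volume.restrict (Ioo (-1 : ℝ) 0))]
      with v ⟨F, hF, hFd, hFv⟩ hexp hv h0
    rw [h0, Pi.zero_apply, eq_comm, smul_eq_zero] at hFv
    -- For negative velocities the flux vanishes at `x = a`; the exponential factor is nonzero, so
    -- the value at `-a` vanishes as well.
    have h3 := hFv.resolve_left (abs_pos.2 hv.2.ne).ne'
    rw [hexp F hF hFd a hpa] at h3
    exact hzero (hexp F hF hFd) ((mul_eq_zero.1 h3).resolve_left (Complex.exp_ne_zero _)) hFd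

end Unique

/-! ### The resolvent of the transport operator -/

section Final

variable {a : ℝ}

theorem IsTransportPair.mem_domain {O₁ : L1Neg →L[ℂ] L1Pos} {O₂ : L1Pos →L[ℂ] L1Neg}
    {f w : L1Slab a} (h : IsTransportPair a O₁ O₂ f w) : f ∈ (transportOp a O₁ O₂).domain :=
  ⟨w, h⟩

theorem IsTransportPair.transportOp_eq {O₁ : L1Neg →L[ℂ] L1Pos} {O₂ : L1Pos →L[ℂ] L1Neg}
    {f w : L1Slab a} (h : IsTransportPair a O₁ O₂ f w)
    (hf : f ∈ (transportOp a O₁ O₂).domain) : transportOp a O₁ O₂ ⟨f, hf⟩ = -w := by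
  have hf' : ∃ w, IsTransportPair a O₁ O₂ f w := hf
  change -(Classical.choose hf') = -w
  rw [(Classical.choose_spec hf').1.unique h.1]

/-- The explicit formula solves the equation, so `R` is a right inverse. It is also a left inverse,
because `f` and `R (λ f - T f)` differ by a solution of the homogeneous problem. -/
theorem isResolventAt_transportOp (ha : 0 < a) {l : ℂ} (hl : 0 < l.re)
    {O₁ : L1Neg →L[ℂ] L1Pos} {O₂ : L1Pos →L[ℂ] L1Neg} (hu : IsUnit (1 - returnL a O₁ O₂ l))
    {R : L1Slab a →L[ℂ] L1Slab a}
    (hR : ∀ g, velSlab a (R g) = inflowL a l (influx a O₁ O₂ l g) + sourceL a l g) :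
    IsResolventAt (transportOp a O₁ O₂) l R := by
  have hp : ∀ g, IsTransportPair a O₁ O₂ (R g) (g - l • R g) := fun g =>
    isTransportPair_of_lineSol ha hl (hR g) (influx_eq ha hu g)
  refine ⟨fun g => ⟨(hp g).mem_domain, ?_⟩, ?_⟩
  · rw [(hp g).transportOp_eq]
    abel
  · rintro ⟨f, hf⟩
    obtain ⟨w, hw⟩ : ∃ w, IsTransportPair a O₁ O₂ f w := hf
    rw [hw.transportOp_eq hw.mem_domain]
    change R (l • f - -w) = f
    set g := l • f - -w with hg
    have hd := hw.add ((hp g).smul (-1))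
    have e : w + (-1 : ℂ) • (g - l • R g) = -(l • (f + (-1 : ℂ) • R g)) := by
      rw [hg]; module
    rw [e] at hd
    have h0 := eq_zero_of_isTransportPair ha hl.le hu hd
    rw [neg_one_smul, ← sub_eq_add_neg, sub_eq_zero] at h0
    exact h0.symm

/-- Division of an element of `L¹(Ω)` by a power of the speed. -/
theorem exists_velSlab_pow_eq (ha : 0 < a) (n : ℕ) {g : L1Slab a}
    (hg : Integrable (fun z : ℝ × ℝ => ‖g z‖ / |z.2| ^ n) (volume.restrict (slab a))) :
    ∃ u : L1Slab a, (velSlab a ^ n) u = g ∧ ‖u‖ = ∫ z in slab a, ‖g z‖ / |z.2| ^ n := by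
  have hm : AEStronglyMeasurable (fun z : ℝ × ℝ => (((|z.2| : ℝ) : ℂ) ^ n)⁻¹ * g z)
      (volume.restrict (slab a)) :=
    (((Complex.measurable_ofReal.comp (measurable_norm.comp measurable_snd)).pow_const
      n).inv.aestronglyMeasurable).mul (Lp.aestronglyMeasurable g)
  have hn : ∀ z : ℝ × ℝ, ‖(((|z.2| : ℝ) : ℂ) ^ n)⁻¹ * g z‖ = ‖g z‖ / |z.2| ^ n := fun z => by
    rw [norm_mul, norm_inv, norm_pow, Complex.norm_real, Real.norm_eq_abs, abs_abs, div_eq_inv_mul]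
  have hi : Integrable (fun z : ℝ × ℝ => (((|z.2| : ℝ) : ℂ) ^ n)⁻¹ * g z)
      (volume.restrict (slab a)) :=
    hg.mono' hm (Eventually.of_forall fun z => (hn z).le)
  refine ⟨hi.toL1 _, Lp.ext ?_, ?_⟩
  · filter_upwards [(isTimeWeight_entry ha).coe_weightL_pow n (hi.toL1 _), hi.coeFn_toL1,
      ae_slab a] with z h1 h2 h3
    have h4 : ((|z.2| : ℝ) : ℂ) ≠ 0 := by exact_mod_cast (abs_pos.2 h3.2).ne'
    rw [velSlab, h1, h2, mul_inv_cancel_left₀ (pow_ne_zero _ h4)]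
  · rw [norm_eq_integral]
    refine integral_congr_ae ?_
    filter_upwards [hi.coeFn_toL1] with z h1
    rw [h1, hn]

/-- Each binomial coefficient is at most `2 ^ n`. It converts powers of `1 + ‖(1 - G)⁻¹‖` into the
sum of powers required in the final estimate. -/
theorem one_add_pow_le_sum {x : ℝ} (hx : 0 ≤ x) (n : ℕ) :
    (1 + x) ^ n ≤ 2 ^ n * ∑ i ∈ Finset.range (n + 1), x ^ i := by
  rw [add_comm, add_pow, Finset.mul_sum]
  refine Finset.sum_le_sum fun i hi => ?_
  rw [one_pow, mul_one, mul_comm]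
  refine mul_le_mul_of_nonneg_right ?_ (pow_nonneg hx i)
  exact_mod_cast Nat.choose_le_two_pow n i

end Final

end SlabTransport
end

open SlabTransport

theorem mainTheorem4
    (a : ℝ) (ha : 0 < a)
    (α₁ β₁ α₂ β₂ : ℝ)
    (hα₁ : 0 ≤ α₁) (hβ₁ : 0 ≤ β₁) (h₁ : α₁ + β₁ = 1)
    (hα₂ : 0 ≤ α₂) (hβ₂ : 0 ≤ β₂) (h₂ : α₂ + β₂ = 1)
    (hβ : 0 < β₁ + β₂)
    (K₁ : SlabTransport.L1Neg →L[ℂ] SlabTransport.L1Pos)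
    (K₂ : SlabTransport.L1Pos →L[ℂ] SlabTransport.L1Neg)
    (hK₁ : SlabTransport.IsStochastic K₁) (hK₁' : SlabTransport.IsWeaklyCompact K₁)
    (hK₂ : SlabTransport.IsStochastic K₂) (hK₂' : SlabTransport.IsWeaklyCompact K₂)
    (O₁ : SlabTransport.L1Neg →L[ℂ] SlabTransport.L1Pos)
    (O₂ : SlabTransport.L1Pos →L[ℂ] SlabTransport.L1Neg)
    (hO₁ : O₁ = SlabTransport.leftBoundaryOp α₁ β₁ K₁)
    (hO₂ : O₂ = SlabTransport.rightBoundaryOp α₂ β₂ K₂)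
    (k : ℕ)
    (hO₁O₂ : SlabTransport.WeightBounded (k + 1) (O₁ ∘L O₂))
    (hO₁conj : SlabTransport.ConjBounded (k + 1) O₁)
    (hO₂conj : ∀ p : ℕ, p ≤ k → SlabTransport.ConjBounded (k + 1 - p) O₂) :
    (∀ s : ℝ, s ≠ 0 → IsUnit (1 - SlabTransport.G a O₁ O₂ s)) ∧
    ∃ R : ℂ → (SlabTransport.L1Slab a →L[ℂ] SlabTransport.L1Slab a),
      (∀ μ : ℂ, 0 < μ.re →
        SlabTransport.IsResolventAt (SlabTransport.transportOp a O₁ O₂) μ (R μ)) ∧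
      ∃ C : ℝ, 0 < C ∧ ∀ g : SlabTransport.L1Slab a,
        Integrable (fun z : ℝ × ℝ => ‖g z‖ / |z.2| ^ (k + 1))
          (volume.restrict (SlabTransport.slab a)) →
        ∃ F : ℂ → SlabTransport.L1Slab a,
          (∀ μ : ℂ, 0 < μ.re → F μ = R μ g) ∧
          ContinuousOn F {μ : ℂ | 0 ≤ μ.re ∧ μ ≠ 0} ∧
          ContDiffOn ℝ k (fun s : ℝ => F (s * Complex.I)) {s : ℝ | s ≠ 0} ∧
          ∀ j : ℕ, j ≤ k → ∀ s : ℝ, s ≠ 0 →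
            ‖iteratedDeriv j (fun t : ℝ => F (t * Complex.I)) s‖ ≤
              C * (∑ l ∈ Finset.range (j + 2),
                  ‖Ring.inverse (1 - SlabTransport.G a O₁ O₂ s)‖ ^ l) *
                ∫ z in SlabTransport.slab a, ‖g z‖ / |z.2| ^ (k + 1) := by
  have hs₁ : IsStochastic O₁ := hO₁ ▸ isStochastic_leftBoundaryOp hα₁ hβ₁ h₁ hK₁
  have hs₂ : IsStochastic O₂ := hO₂ ▸ isStochastic_rightBoundaryOp hα₂ hβ₂ h₂ hK₂
  have hG : ∀ s : ℝ, s ≠ 0 → IsUnit (1 - G a O₁ O₂ s) := by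
    intro s hs
    rw [hO₁, hO₂]
    exact isUnit_one_sub_G ha hα₁ hβ₁ h₁ hα₂ hβ₂ h₂ hβ hK₁ hK₁' hK₂ hK₂' hs
  have hn₁ : ‖O₁‖ ≤ 1 := hs₁.norm_le
  have hn₂ : ‖O₂‖ ≤ 1 := hs₂.norm_le
  have hunit : ∀ l : ℂ, 0 < l.re → IsUnit (1 - returnL a O₁ O₂ l) := fun l hl =>
    isUnit_one_sub_returnL ha hn₁ hn₂ hG hl.le fun h => by simp [h] at hl
  refine ⟨hG, ?_⟩
  -- Outside the open half plane `R` has the default value `0`, which is never used.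
  have hex : ∀ l : ℂ, ∃ R : L1Slab a →L[ℂ] L1Slab a, 0 < l.re →
      ∀ g, velSlab a (R g) = inflowL a l (influx a O₁ O₂ l g) + sourceL a l g := by
    intro l
    by_cases hl : 0 < l.re
    · obtain ⟨R, hR⟩ := exists_resolvent ha O₁ O₂ hl
      exact ⟨R, fun _ => hR⟩
    · exact ⟨0, fun h => absurd h hl⟩
  choose R hR using hex
  refine ⟨R, fun μ hμ => isResolventAt_transportOp ha hμ (hunit μ hμ) (hR μ hμ), ?_⟩
  obtain ⟨O, Γ, c, hO, hfam⟩ := exists_isScaleFamily ha hs₁ hs₂ hG hO₁O₂ hO₁conj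
    (hO₂conj 0 (Nat.zero_le k))
  obtain ⟨C, hC, hdiff⟩ := exists_scaleDiff_scaledSolution ha hn₁ hn₂ hfam
  -- The factor `2 ^ (k + 1)` comes from the binomial estimate. Since `C` is only known to be
  -- nonnegative, `1` is added for positivity.
  refine ⟨C * 2 ^ (k + 1) + 1, by positivity, fun g hg => ?_⟩
  obtain ⟨u, hu, hun⟩ := exists_velSlab_pow_eq ha (k + 1) hg
  obtain ⟨hcd, hb⟩ := (hdiff u).contDiffOn (isTimeWeight_entry ha).norm_weightL_le
  -- With `g = |v|^{k+1} u`, the solution is `|v|^k` times the scaled solution for `u`: these `k`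
  -- factors are what the `k` derivatives consume.
  refine ⟨fun l => (velSlab a ^ k) (scaledSolution a O₁ O₂ O Γ k u l), fun μ hμ => ?_,
    (velSlab a ^ k).continuous.comp_continuousOn (continuousOn_scaledSolution ha hfam u), hcd,
    fun j hj s hs => (hb j hj s hs).trans ?_⟩
  · have hμ' : μ ∈ punctured := ⟨hμ.le, fun h => by simp [h] at hμ⟩
    refine (eq_pow_scaledSolution ha hO hfam hμ' ?_).symm
    rw [hu]
    exact hR μ hμ g
  · rw [← hun, add_comm 1 j]
    set x := ‖Ring.inverse (1 - G a O₁ O₂ s)‖ with hx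
    have hx0 : 0 ≤ x := norm_nonneg _
    have hS : 0 ≤ ∑ i ∈ Finset.range (j + 2), x ^ i :=
      Finset.sum_nonneg fun i _ => pow_nonneg hx0 i
    have h2 : (2 : ℝ) ^ (j + 1) ≤ 2 ^ (k + 1) := pow_le_pow_right₀ one_le_two (by omega)
    have h3 := (one_add_pow_le_sum hx0 (j + 1)).trans (mul_le_mul_of_nonneg_right h2 hS)
    calc C * ‖u‖ * (1 + x) ^ (j + 1)
        ≤ C * ‖u‖ * (2 ^ (k + 1) * ∑ i ∈ Finset.range (j + 2), x ^ i) :=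
          mul_le_mul_of_nonneg_left h3 (by positivity)
      _ = C * 2 ^ (k + 1) * (∑ i ∈ Finset.range (j + 2), x ^ i) * ‖u‖ := by ring
      _ ≤ (C * 2 ^ (k + 1) + 1) * (∑ i ∈ Finset.range (j + 2), x ^ i) * ‖u‖ := by
          gcongr
          linarith
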